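/- Let $X$ be a connected complex manifold with base point $x$ (for example, a compact connected Kähler manifold), let $B$ be a unital real $C^*$-algebra (a real Banach algebra with a linear involution $*$, $(ab)^*=b^*a^*$, such that $\|a^*a\|=\|a\|^2$ and $1+a^*a$ is invertible for all $a$), and let $U(B)$ be its unitary group. Let $J$ act on complex $1$-forms on $X$ by $i$ on $(1,0)$-forms and by $-i$ on $(0,1)$-forms, and put $d^c=i\partial-i\bar\partial$, so that $d^cf=J\,df$ for functions $f$. Write $\tau(u:v)=(\bar u:\bar v)$ for complex conjugation on $\mathbb P^1=\mathbb P^1(\mathbb C)$ and on $B\otimes_{\mathbb R}\mathbb C$. (a) Let $R^J_{X,x}(B)$ be the set of isomorphism classes of triples $(U(\mathcal P),D,f)$, where $U(\mathcal P)$ is a right torsor on $X$ under the sheaf of smooth $U(B)$-valued functions, $f\in x^*U(\mathcal P)$, and $D\colon U(\mathcal P)\to \mathcal A^1_X\otimes\mathrm{ad}\,\mathcal P$ (with $\mathrm{ad}\,\mathcal P$ the associated bundle of algebras with fibre $B$) is a $d$-connection, $D(pg)=g^{-1}D(p)g+g^{-1}dg$, which is flat and pluriharmonic: $DD^c+D^cD=0$.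 Here $D=d^++\vartheta$ is the decomposition into anti-self-adjoint and self-adjoint parts, and $D^c=Jd^+-J\vartheta$. (b) Let $\mathcal O(B)$ be the sheaf of holomorphic $B\otimes\mathbb C$-valued functions on $\mathbb P^1$, with the involution $g(z)\mapsto\overline{g(\bar z)}$. Let $R^{\mathbb T}_{X,x}(\mathcal O(B))$ be the set of isomorphism classes of quadruples $(\mathcal T,\tilde D,\tau^\sharp,f)$, where $\mathcal T$ is a right torsor on $X\times\mathbb P^1$ under the sheaf of $(B\otimes\mathbb C)^\times$-valued functions that are smooth along $X$ and holomorphic along $\mathbb P^1$, such that for every $y\in X$ the pullback of $\mathcal T$ to $\{y\}\times\mathbb P^1$ is trivial as an $\mathcal O(B)^\times$-torsor; $\tilde D\colon\mathcal T\to\mathcal A^1_X\otimes\mathrm{ad}\,\mathcal T(1)$ is a flat $(ud+vd^c)$-connection along $X$, $\tilde D(pg)=g^{-1}\tilde D(p)g+g^{-1}(u\,dg+v\,d^cg)$, with $u,v$ the standard sections of $\mathcal O(1)$; $\tau^\sharp$ is a real structure on $(\mathcal T,\tilde D)$, i.e. an involution of $\mathcal T$ over $\mathrm{id}_X\times\tau$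 which is semilinear with respect to the involution of $\mathcal O(B)$ and compatible with $\tilde D$; and $f$ is a $\tau^\sharp$-invariant section of $x^*\mathcal T$ over $\mathbb P^1$. (c) Let $\theta(u:v)=(v:-u)$ on $\mathbb P^1$, with lift $(u,v)\mapsto(v,-u)$ to $\mathcal O(1)$; it is the composite of complex conjugation and the antipodal map $(u:v)\mapsto(\bar v:-\bar u)$. Let $C\tau(g)=(\bar g^{-1})^*$ on $(B\otimes\mathbb C)^\times$, with differential $\mathrm{ad}\,C\tau(b)=-\bar b^{\,*}$. The involution $\sigma$ of $R^{\mathbb T}_{X,x}(\mathcal O(B))$ sends $(\mathcal T,\tilde D,\tau^\sharp,f)$ to the pullback of $\mathcal T$ along $\mathrm{id}_X\times\theta$ with structure group changed along $C\tau$, with connection $J\,(\mathrm{ad}\,C\tau)\,\theta^{-1}\tilde D$ and with the induced real structure and framing. Then extension of the structure group from $U(B)$ to $(B\otimes\mathbb C)^\times$, pulled back to $X\times\mathbb P^1$, with the connection $uD+vD^c$, the natural real structure and the framing given by $f$, defines a bijection $$R^J_{X,x}(B)\;\cong\;R^{\mathbb T}_{X,x}(\mathcal O(B))^{\sigma}$$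 from $R^J_{X,x}(B)$ onto the set of $\sigma$-invariant elements. In other words, the $\sigma$-invariant elements of the framed twistor functor are exactly the framed pluriharmonic torsors. -/

import Mathlib

open Topology
open scoped Manifold ContDiff LinearAlgebra.Projectivization

noncomputable section

set_option linter.unusedSectionVars false

namespace Twistor

universe uE uX uB

/-! ### Complexification of a real algebra -/

/-- The complexification `B ⊗_ℝ ℂ`, whose elements are written `re + i im`. -/
@[ext]
structure Cx (B : Type uB) where
  re : B
  im : B

namespace Cx

section Algebra

variable {B : Type uB} [Ring B]

instance : Zero (Cx B) := ⟨⟨0, 0⟩⟩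
instance : One (Cx B) := ⟨⟨1, 0⟩⟩
instance : Add (Cx B) := ⟨fun z w => ⟨z.re + w.re, z.im + w.im⟩⟩
instance : Neg (Cx B) := ⟨fun z => ⟨-z.re, -z.im⟩⟩
instance : Mul (Cx B) := ⟨fun z w => ⟨z.re * w.re - z.im * w.im, z.re * w.im + z.im * w.re⟩⟩

@[simp] theorem zero_re : (0 : Cx B).re = 0 := rfl
@[simp] theorem zero_im : (0 : Cx B).im = 0 := rfl
@[simp] theorem one_re : (1 : Cx B).re = 1 := rfl
@[simp] theorem one_im : (1 : Cx B).im = 0 := rfl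
@[simp] theorem add_re (z w : Cx B) : (z + w).re = z.re + w.re := rfl
@[simp] theorem add_im (z w : Cx B) : (z + w).im = z.im + w.im := rfl
@[simp] theorem neg_re (z : Cx B) : (-z).re = -z.re := rfl
@[simp] theorem neg_im (z : Cx B) : (-z).im = -z.im := rfl
@[simp] theorem mul_re (z w : Cx B) : (z * w).re = z.re * w.re - z.im * w.im := rfl
@[simp] theorem mul_im (z w : Cx B) : (z * w).im = z.re * w.im + z.im * w.re := rfl

instance : Ring (Cx B) where
  add_assoc _ _ _ := by ext <;> simp [add_assoc]
  zero_add _ := by ext <;> simp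
  add_zero _ := by ext <;> simp
  add_comm _ _ := by ext <;> simp [add_comm]
  neg_add_cancel _ := by ext <;> simp
  left_distrib _ _ _ := by ext <;> simp <;> noncomm_ring
  right_distrib _ _ _ := by ext <;> simp <;> noncomm_ring
  zero_mul _ := by ext <;> simp
  mul_zero _ := by ext <;> simp
  mul_assoc _ _ _ := by ext <;> simp <;> noncomm_ring
  one_mul _ := by ext <;> simp
  mul_one _ := by ext <;> simp
  nsmul := nsmulRec
  zsmul := zsmulRec

@[simp] theorem sub_re (z w : Cx B) : (z - w).re = z.re - w.re := by
  simp [sub_eq_add_neg]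
@[simp] theorem sub_im (z w : Cx B) : (z - w).im = z.im - w.im := by
  simp [sub_eq_add_neg]

/-- The inclusion of `B` in its complexification. -/
def ofBase (b : B) : Cx B := ⟨b, 0⟩

@[simp] theorem ofBase_re (b : B) : (ofBase b).re = b := rfl
@[simp] theorem ofBase_im (b : B) : (ofBase b).im = 0 := rfl

/-- The inclusion `B → B ⊗ ℂ` as a map of monoids. -/
def ofBaseHom : B →* Cx B where
  toFun := ofBase
  map_one' := rfl
  map_mul' _ _ := by ext <;> simp

/-- Complex conjugation `τ` on `B ⊗ ℂ`. -/
def conj : Cx B ≃+* Cx B where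
  toFun z := ⟨z.re, -z.im⟩
  invFun z := ⟨z.re, -z.im⟩
  left_inv _ := by ext <;> simp
  right_inv _ := by ext <;> simp
  map_add' _ _ := by ext <;> simp [add_comm]
  map_mul' _ _ := by ext <;> simp [add_comm]

@[simp] theorem conj_re (z : Cx B) : (conj z).re = z.re := rfl
@[simp] theorem conj_im (z : Cx B) : (conj z).im = -z.im := rfl

section Smul

variable [Algebra ℝ B]

instance : SMul ℂ (Cx B) :=
  ⟨fun c z => ⟨c.re • z.re - c.im • z.im, c.re • z.im + c.im • z.re⟩⟩

@[simp] theorem smul_re (c : ℂ) (z : Cx B) : (c • z).re = c.re • z.re - c.im • z.im := rfl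
@[simp] theorem smul_im (c : ℂ) (z : Cx B) : (c • z).im = c.re • z.im + c.im • z.re := rfl

instance : Module ℂ (Cx B) where
  one_smul _ := by ext <;> simp
  mul_smul _ _ _ := by ext <;> simp <;> module
  smul_zero _ := by ext <;> simp
  smul_add _ _ _ := by ext <;> simp <;> module
  add_smul _ _ _ := by ext <;> simp <;> module
  zero_smul _ := by ext <;> simp

instance : Algebra ℂ (Cx B) :=
  Algebra.ofModule
    (fun _ _ _ => by ext <;> simp [sub_mul, add_mul, smul_sub, smul_add] <;> abel)
    (fun _ _ _ => by ext <;> simp [mul_sub, mul_add, smul_sub, smul_add] <;> abel)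

end Smul

section StarPart

variable [StarRing B]

/-- The antilinear involution `(b ⊗ λ)^* = b^* ⊗ conj λ`. -/
instance : StarRing (Cx B) where
  star z := ⟨star z.re, -star z.im⟩
  star_involutive _ := by ext <;> simp
  star_mul _ _ := by ext <;> simp [add_comm, sub_eq_add_neg]
  star_add _ _ := by ext <;> simp [add_comm]

@[simp] theorem star_re (z : Cx B) : (star z).re = star z.re := rfl
@[simp] theorem star_im (z : Cx B) : (star z).im = -star z.im := rfl

/-- The involution `Cτ(g) = ((conj g)⁻¹)^*` of the group `(B ⊗ ℂ)ˣ`. -/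
def cartan (g : (Cx B)ˣ) : (Cx B)ˣ where
  val := star (conj (g⁻¹ : (Cx B)ˣ).val)
  inv := star (conj g.val)
  val_inv := by rw [← star_mul, ← map_mul]; simp
  inv_val := by rw [← star_mul, ← map_mul]; simp

theorem cartan_val (g : (Cx B)ˣ) : (cartan g).val = star (conj (g⁻¹ : (Cx B)ˣ).val) := rfl
theorem cartan_inv (g : (Cx B)ˣ) : ((cartan g)⁻¹ : (Cx B)ˣ).val = star (conj g.val) := rfl

theorem star_conj_mul (z w : Cx B) : star (conj (z * w)) = star (conj w) * star (conj z) := by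
  rw [map_mul, star_mul]

theorem star_conj_invol (z : Cx B) : star (conj (star (conj z))) = z := by ext <;> simp

theorem cartan_mul (g h : (Cx B)ˣ) : cartan (g * h) = cartan g * cartan h := by
  ext1
  simp [cartan_val, mul_inv_rev]

theorem cartan_one : cartan (1 : (Cx B)ˣ) = 1 := by
  ext1
  simp [cartan_val]

theorem cartan_cartan (g : (Cx B)ˣ) : cartan (cartan g) = g := by
  ext1
  rw [cartan_val, cartan_inv, star_conj_invol]

theorem cartan_conj (g : (Cx B)ˣ) :
    cartan (Units.map (conj (B := B)).toMonoidHom g)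
      = Units.map (conj (B := B)).toMonoidHom (cartan g) := by
  ext1
  change star (conj (conj (g⁻¹ : (Cx B)ˣ).val)) = conj (star (conj (g⁻¹ : (Cx B)ˣ).val))
  ext <;> simp

end StarPart

end Algebra

section Norm

variable {B : Type uB} [NormedRing B] [NormedAlgebra ℝ B]

/-- An auxiliary norm on `B ⊗ ℂ`, which is real-homogeneous only. -/
def auxNorm (z : Cx B) : ℝ := ‖z.re‖ + ‖z.im‖

theorem auxNorm_nonneg (z : Cx B) : 0 ≤ auxNorm z := by unfold auxNorm; positivity

theorem auxNorm_add (z w : Cx B) : auxNorm (z + w) ≤ auxNorm z + auxNorm w := by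
  simp only [auxNorm, add_re, add_im]
  linarith [norm_add_le z.re w.re, norm_add_le z.im w.im]

theorem auxNorm_mul (z w : Cx B) : auxNorm (z * w) ≤ auxNorm z * auxNorm w := by
  simp only [auxNorm, mul_re, mul_im]
  have h1 := norm_sub_le (z.re * w.re) (z.im * w.im)
  have h2 := norm_add_le (z.re * w.im) (z.im * w.re)
  nlinarith [norm_mul_le z.re w.re, norm_mul_le z.im w.im, norm_mul_le z.re w.im,
    norm_mul_le z.im w.re]

theorem auxNorm_smul (c : ℂ) (z : Cx B) : auxNorm (c • z) ≤ 2 * ‖c‖ * auxNorm z := by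
  simp only [auxNorm, smul_re, smul_im]
  have h1 := norm_sub_le (c.re • z.re) (c.im • z.im)
  have h2 := norm_add_le (c.re • z.im) (c.im • z.re)
  have hr : |c.re| ≤ ‖c‖ := Complex.abs_re_le_norm c
  have hi : |c.im| ≤ ‖c‖ := Complex.abs_im_le_norm c
  simp only [norm_smul, Real.norm_eq_abs] at h1 h2
  nlinarith [mul_le_mul_of_nonneg_right hr (norm_nonneg z.re),
    mul_le_mul_of_nonneg_right hr (norm_nonneg z.im),
    mul_le_mul_of_nonneg_right hi (norm_nonneg z.re),
    mul_le_mul_of_nonneg_right hi (norm_nonneg z.im)]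

/-- A complex Banach algebra norm on `B ⊗ ℂ`. It induces the product topology of `B × B`, and only
this topology is of any importance. -/
def cxNorm (z : Cx B) : ℝ := ⨆ c : Circle, auxNorm ((c : ℂ) • z)

theorem cxNorm_bdd (z : Cx B) : BddAbove (Set.range fun c : Circle => auxNorm ((c : ℂ) • z)) :=
  ⟨2 * auxNorm z, by
    rintro _ ⟨c, rfl⟩
    have h := auxNorm_smul (c : ℂ) z
    rwa [Circle.norm_coe, mul_one] at h⟩

theorem auxNorm_le_cxNorm_smul (c : Circle) (z : Cx B) : auxNorm ((c : ℂ) • z) ≤ cxNorm z :=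
  le_ciSup (cxNorm_bdd z) c

theorem auxNorm_le_cxNorm (z : Cx B) : auxNorm z ≤ cxNorm z := by
  simpa using auxNorm_le_cxNorm_smul 1 z

theorem cxNorm_le (z : Cx B) : cxNorm z ≤ 2 * auxNorm z :=
  ciSup_le fun c => by simpa [Circle.norm_coe] using auxNorm_smul (c : ℂ) z

theorem cxNorm_smul_le (c : ℂ) (z : Cx B) : cxNorm (c • z) ≤ ‖c‖ * cxNorm z := by
  refine ciSup_le fun d => ?_
  have key : ∀ (r : ℝ) (w : Cx B), 0 ≤ r → auxNorm ((r : ℂ) • w) = r * auxNorm w := by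
    intro r w hr
    simp only [auxNorm, smul_re, smul_im, Complex.ofReal_re, Complex.ofReal_im, zero_smul,
      sub_zero, add_zero, norm_smul, Real.norm_eq_abs, abs_of_nonneg hr, mul_add]
  have hc : (c : ℂ) = (‖c‖ : ℂ) * Circle.exp (Complex.arg c) := by
    simp [Complex.norm_mul_exp_arg_mul_I]
  have : (d : ℂ) • c • z = ((‖c‖ : ℝ) : ℂ) • (((d * Circle.exp (Complex.arg c) : Circle) : ℂ) • z) := by
    conv_lhs => rw [hc]
    simp only [smul_smul, Circle.coe_mul]
    congr 1
    ring
  rw [this, key _ _ (norm_nonneg _)]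
  exact mul_le_mul_of_nonneg_left (auxNorm_le_cxNorm_smul _ _) (norm_nonneg _)

/-- `cxNorm` as a ring norm. -/
def ringNorm (B : Type uB) [NormedRing B] [NormedAlgebra ℝ B] : RingNorm (Cx B) where
  toFun := cxNorm
  map_zero' := le_antisymm (by simpa [auxNorm] using cxNorm_le (0 : Cx B))
    ((auxNorm_nonneg _).trans (auxNorm_le_cxNorm _))
  add_le' z w := ciSup_le fun c => by
    rw [smul_add]
    exact (auxNorm_add _ _).trans
      (add_le_add (auxNorm_le_cxNorm_smul c z) (auxNorm_le_cxNorm_smul c w))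
  neg' z := by
    simp only [cxNorm, auxNorm, smul_neg, neg_re, neg_im, norm_neg]
  mul_le' z w := ciSup_le fun c => by
    rw [← smul_mul_assoc]
    exact (auxNorm_mul _ _).trans (mul_le_mul (auxNorm_le_cxNorm_smul c z) (auxNorm_le_cxNorm w)
      (auxNorm_nonneg _) ((auxNorm_nonneg _).trans (auxNorm_le_cxNorm z)))
  eq_zero_of_map_eq_zero' z hz := by
    have h := auxNorm_le_cxNorm z
    rw [hz] at h
    have h1 : ‖z.re‖ + ‖z.im‖ ≤ 0 := h
    have h2 := norm_nonneg z.re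
    have h3 := norm_nonneg z.im
    ext
    · exact norm_eq_zero.1 (by linarith)
    · exact norm_eq_zero.1 (by linarith)

instance : NormedRing (Cx B) := (ringNorm B).toNormedRing

theorem norm_def (z : Cx B) : ‖z‖ = cxNorm z := rfl

instance : NormedAlgebra ℂ (Cx B) where
  norm_smul_le := cxNorm_smul_le

/-- The real linear homeomorphism `B ⊗ ℂ ≃ B × B`. -/
def toProd : Cx B ≃L[ℝ] B × B :=
  LinearEquiv.toContinuousLinearEquivOfBounds
    { toFun := fun z => (z.re, z.im)
      invFun := fun p => ⟨p.1, p.2⟩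
      left_inv := fun _ => rfl
      right_inv := fun _ => rfl
      map_add' := fun _ _ => rfl
      map_smul' := fun r z => by
        ext
        · change ((r : ℂ) • z).re = r • z.re
          simp only [smul_re, Complex.ofReal_re, Complex.ofReal_im, zero_smul, sub_zero]
        · change ((r : ℂ) • z).im = r • z.im
          simp only [smul_im, Complex.ofReal_re, Complex.ofReal_im, zero_smul, add_zero] } 1 4
    (fun z => by
      rw [one_mul]
      refine le_trans ?_ (auxNorm_le_cxNorm z)
      exact max_le (le_add_of_nonneg_right (norm_nonneg _)) (le_add_of_nonneg_left (norm_nonneg _)))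
    (fun p => by
      refine (cxNorm_le _).trans ?_
      have h1 : ‖p.1‖ ≤ ‖p‖ := norm_fst_le p
      have h2 : ‖p.2‖ ≤ ‖p‖ := norm_snd_le p
      change 2 * (‖p.1‖ + ‖p.2‖) ≤ _
      linarith)

instance [CompleteSpace B] : CompleteSpace (Cx B) :=
  (completeSpace_congr (e := (toProd (B := B)).toEquiv) (toProd (B := B)).isUniformEmbedding).2
    inferInstance

/-- The map `z ↦ (conj z)^*`, the complex-linear extension of the involution `*` of `B`. -/
def transpose [StarRing B] [CStarRing B] [StarModule ℝ B] : Cx B →L[ℂ] Cx B :=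
  LinearMap.mkContinuous
    { toFun := fun z => star (conj z)
      map_add' := fun z w => by simp
      map_smul' := fun c z => by ext <;> simp } 2
    (fun z => by
      refine (cxNorm_le _).trans ?_
      refine mul_le_mul_of_nonneg_left (le_trans (le_of_eq ?_) (auxNorm_le_cxNorm z)) zero_le_two
      simp [auxNorm])

theorem transpose_apply [StarRing B] [CStarRing B] [StarModule ℝ B] (z : Cx B) :
    transpose z = star (conj z) := rfl

end Norm

end Cx

/-! ### The projective line -/

/-- The projective line `ℙ¹(ℂ)`, with homogeneous co-ordinates `(u : v)`. -/
abbrev P1 : Type := ℙ ℂ (ℂ × ℂ)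

/-- The quotient topology on `ℙ¹(ℂ)`. -/
instance : TopologicalSpace P1 :=
  TopologicalSpace.coinduced (fun c : {c : ℂ × ℂ // c ≠ 0} => Projectivization.mk ℂ c.1 c.2)
    inferInstance

/-- The quotient map `q : ℂ² ∖ {0} → ℙ¹(ℂ)`, extended by an irrelevant value at the origin. -/
def pt (c : ℂ × ℂ) : P1 :=
  if h : c ≠ 0 then Projectivization.mk ℂ c h else Projectivization.mk ℂ (1, 0) (by simp)

theorem pt_of_ne {c : ℂ × ℂ} (h : c ≠ 0) : pt c = Projectivization.mk ℂ c h := dif_pos h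

theorem exists_pt (z : P1) : ∃ c : ℂ × ℂ, c ≠ 0 ∧ pt c = z :=
  ⟨z.rep, z.rep_nonzero, by rw [pt_of_ne z.rep_nonzero, Projectivization.mk_rep]⟩

theorem continuous_mk : Continuous
    (fun c : {c : ℂ × ℂ // c ≠ 0} => Projectivization.mk ℂ c.1 c.2) :=
  continuous_coinduced_rng

/-- The lift `(u, v) ↦ (v, -u)` of `τσ_ℙ` to `ℂ²`. -/
def rotL : (ℂ × ℂ) ≃L[ℂ] (ℂ × ℂ) :=
  (ContinuousLinearEquiv.prodComm ℂ ℂ ℂ).trans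
    ((ContinuousLinearEquiv.refl ℂ ℂ).prodCongr (ContinuousLinearEquiv.neg ℂ))

theorem rotL_apply (c : ℂ × ℂ) : rotL c = (c.2, -c.1) := rfl

theorem rotL_ne {c : ℂ × ℂ} (h : c ≠ 0) : rotL c ≠ 0 :=
  (map_ne_zero_iff rotL rotL.injective).2 h

/-- The involution `τσ_ℙ : (u : v) ↦ (v : -u)` of `ℙ¹`, the composite of complex conjugation and
the antipodal map `σ_ℙ : (u : v) ↦ (conj v : - conj u)`. -/
def rot : P1 → P1 := Projectivization.map rotL.toLinearEquiv.toLinearMap rotL.injective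

/-- The lift `(u, v) ↦ (conj u, conj v)` of complex conjugation to `ℂ²`. -/
def cc (c : ℂ × ℂ) : ℂ × ℂ := (starRingEnd ℂ c.1, starRingEnd ℂ c.2)

theorem cc_ne {c : ℂ × ℂ} (h : c ≠ 0) : cc c ≠ 0 := by
  intro h0
  apply h
  have h1 := congrArg Prod.fst h0
  have h2 := congrArg Prod.snd h0
  ext1
  · simpa [cc] using h1
  · simpa [cc] using h2

/-- The involution `τ : (u : v) ↦ (conj u : conj v)` of `ℙ¹(ℂ)`. -/
def bar : P1 → P1 :=
  Projectivization.lift (fun c => pt (cc c.1)) (by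
    rintro ⟨a, ha⟩ ⟨b, hb⟩ t (rfl : a = t • b)
    have ht : t ≠ 0 := by rintro rfl; simp at ha
    simp only
    rw [pt_of_ne (cc_ne ha), pt_of_ne (cc_ne hb), Projectivization.mk_eq_mk_iff']
    exact ⟨starRingEnd ℂ t, by ext1 <;> simp [cc]⟩)

theorem rot_pt {c : ℂ × ℂ} (h : c ≠ 0) : rot (pt c) = pt (rotL c) := by
  rw [pt_of_ne h, pt_of_ne (rotL_ne h)]
  rfl

theorem bar_pt {c : ℂ × ℂ} (h : c ≠ 0) : bar (pt c) = pt (cc c) := by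
  rw [pt_of_ne h]
  rfl

theorem rot_rot (z : P1) : rot (rot z) = z := by
  obtain ⟨c, hc, rfl⟩ := exists_pt z
  rw [rot_pt hc, rot_pt (rotL_ne hc), pt_of_ne (rotL_ne (rotL_ne hc)), pt_of_ne hc,
    Projectivization.mk_eq_mk_iff']
  exact ⟨-1, by ext1 <;> simp [rotL_apply]⟩

theorem rot_bar (z : P1) : rot (bar z) = bar (rot z) := by
  obtain ⟨c, hc, rfl⟩ := exists_pt z
  rw [bar_pt hc, rot_pt (cc_ne hc), rot_pt hc, bar_pt (rotL_ne hc)]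
  simp [cc, rotL_apply]

theorem continuous_rot : Continuous rot := by
  refine continuous_coinduced_dom.2 ?_
  exact continuous_mk.comp (Continuous.subtype_mk (rotL.continuous.comp continuous_subtype_val)
    fun c => rotL_ne c.2)

/-! ### Forms on a complex manifold

`X` is a complex manifold modelled on the complex vector space `E`. The tangent space of `X` at
any point is identified with `E` through the preferred chart, so that a `V`-valued `1`-form on `X`
is a function `X → (E →L[ℝ] V)`, and the complex structure of the tangent spaces is multiplication
by `i` in `E`. -/

section Forms

variable {E : Type uE} [NormedAddCommGroup E] [NormedSpace ℂ E]

/-- The complex structure `ξ ↦ i ξ` of a tangent space, as a real linear map. -/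
def jmul : E →L[ℝ] E := (Complex.I • ContinuousLinearMap.id ℂ E).restrictScalars ℝ

@[simp] theorem jmul_apply (ξ : E) : jmul ξ = Complex.I • ξ := rfl

theorem jmul_jmul (ξ : E) : jmul (jmul ξ) = -ξ := by
  simp [smul_smul]

variable {X : Type uX} [TopologicalSpace X] [ChartedSpace E X]
variable {V : Type*} [NormedAddCommGroup V] [NormedSpace ℝ V]

/-- The differential at `e` of the inverse of the preferred chart at `y`. -/
def chartD (y : X) (e : E) : E →L[ℝ] E := mfderiv 𝓘(ℝ, E) 𝓘(ℝ, E) (chartAt E y).symm e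

/-- The pullback of a `1`-form along the inverse of the preferred chart at `y`. -/
def localForm (y : X) (α : X → E →L[ℝ] V) (e : E) : E →L[ℝ] V :=
  (α ((chartAt E y).symm e)).comp (chartD y e)

/-- The `1`-form `J α = i ⋄ α`: multiplication by `i` on `(1,0)`-forms and by `-i` on
`(0,1)`-forms. -/
def Jform (α : X → E →L[ℝ] V) (y : X) : E →L[ℝ] V := (α y).comp jmul

/-- The exterior derivative of a `1`-form, as a function of a point and two tangent vectors. -/
def dForm (α : X → E →L[ℝ] V) (y : X) (ξ η : E) : V :=
  fderiv ℝ (localForm y α) (chartAt E y y) ξ η - fderiv ℝ (localForm y α) (chartAt E y y) η ξ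

/-- The operator `dᶜ = J d J⁻¹ = i∂ - i∂̄` on `1`-forms, where `J⁻¹ = -J` on `1`-forms and
`(J Ω)(ξ, η) = Ω(i ξ, i η)` on `2`-forms. -/
def dcForm (α : X → E →L[ℝ] V) (y : X) (ξ η : E) : V :=
  dForm (fun y' => -Jform α y') y (jmul ξ) (jmul η)

/-- The differential of a function with values in a vector space. -/
def dFun (f : X → V) (y : X) : E →L[ℝ] V := mfderiv 𝓘(ℝ, E) 𝓘(ℝ, V) f y

/-- The wedge product `α ∧ β` of `1`-forms at one point, for an associative product. -/
def wedge {A : Type*} [NormedRing A] [NormedAlgebra ℝ A] (α β : E →L[ℝ] A) (ξ η : E) : A :=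
  α ξ * β η - α η * β ξ

variable (E) in
/-- A function is smooth (for the underlying real manifold) near `y`. -/
def SmoothNear (f : X → V) (y : X) : Prop :=
  ∀ᶠ y' in 𝓝 y, ContMDiffAt 𝓘(ℝ, E) 𝓘(ℝ, V) ∞ f y'

variable (E) in
/-- A function on `X × ℂ²` is smooth near `(y, c)`, and holomorphic in the second variable. -/
def SmoothHolNear {W : Type*} [NormedAddCommGroup W] [NormedSpace ℂ W] (f : X → ℂ × ℂ → W)
    (y : X) (c : ℂ × ℂ) : Prop :=
  ∀ᶠ p : X × (ℂ × ℂ) in 𝓝 (y, c),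
    ContMDiffAt (𝓘(ℝ, E).prod 𝓘(ℝ, ℂ × ℂ)) 𝓘(ℝ, W) ∞ (fun p' : X × (ℂ × ℂ) => f p'.1 p'.2) p ∧
      DifferentiableAt ℂ (f p.1) p.2

end Forms

/-! ### Torsors -/

/-- A right torsor under a sheaf of groups on `Y`. The sheaf of groups consists of those local
functions `g` from `Y` to the group `G` such that `R g y` holds at all points `y` of the domain. The
torsor is given by its `G`-bundle `proj : Tot → Y` together with the sheaf of its sections: `IsReg s
y` means that the restriction of `s` to a neighbourhood of `y` is a section of the torsor. -/
structure Torsor (Y : Type uX) [TopologicalSpace Y] (G : Type uB) [Group G]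
    (R : (Y → G) → Y → Prop) where
  Tot : Type (max uX uB)
  proj : Tot → Y
  act : Tot → G → Tot
  act_one : ∀ p, act p 1 = p
  act_mul : ∀ p g h, act p (g * h) = act (act p g) h
  proj_act : ∀ p g, proj (act p g) = proj p
  existsUnique_act : ∀ p q, proj p = proj q → ∃! g, act p g = q
  IsReg : (Y → Tot) → Y → Prop
  reg_exists : ∀ y, ∃ s, IsReg s y
  reg_proj : ∀ s y, IsReg s y → proj (s y) = y
  reg_nhds : ∀ s y, IsReg s y → ∀ᶠ y' in 𝓝 y, IsReg s y'
  reg_congr : ∀ s s' y, s =ᶠ[𝓝 y] s' → IsReg s y → IsReg s' y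
  reg_act : ∀ s y, IsReg s y → ∀ g : Y → G, IsReg (fun y' => act (s y') (g y')) y ↔ R g y


/-- For a torsor on `X × ℙ¹(ℂ)`, the sections over `ℙ¹(ℂ)` of its pullback to `{y} × ℙ¹(ℂ)`: they
are locally the restrictions of sections of the torsor. -/
def Torsor.IsFibreSection {X : Type uX} [TopologicalSpace X] {G : Type uB} [Group G]
    {R : (X × P1 → G) → X × P1 → Prop} (T : Torsor (X × P1) G R) (y : X) (f : P1 → T.Tot) : Prop :=
  ∀ z₀, ∃ s, T.IsReg s (y, z₀) ∧ f z₀ = s (y, z₀) ∧ ∀ᶠ z in 𝓝 z₀, f z = s (y, z)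

section Functors

variable (E : Type uE) [NormedAddCommGroup E] [NormedSpace ℂ E]
variable {X : Type uX} [TopologicalSpace X] [ChartedSpace E X]
variable (B : Type uB) [NormedRing B] [NormedAlgebra ℝ B] [StarRing B] [CStarRing B]
  [StarModule ℝ B]

variable {B} in
/-- Smooth functions with values in the unitary group `U(B)`. -/
def SmoothUnitary (g : X → unitary B) (y : X) : Prop :=
  SmoothNear E (fun y' => (g y' : B)) y

variable {B} in
/-- Functions on open subsets of `X × ℙ¹(ℂ)` with values in `(B ⊗ ℂ)ˣ`, smooth in the first variable
with values in holomorphic functions of the second. As usual, functions on `ℙ¹(ℂ)` are regarded as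
homogeneous functions on `ℂ² ∖ {0}`. -/
def SmoothHolUnits (g : X × P1 → (Cx B)ˣ) (w : X × P1) : Prop :=
  ∀ c, c ≠ 0 → pt c = w.2 → SmoothHolNear E (fun y' c' => (g (y', pt c')).val) w.1 c

variable {E B} in
/-- If `a` describes `D` in terms of a section of `U(𝒫)`, this describes
`Dᶜ = i ⋄ d⁺ - i ⋄ ϑ`, where `d⁺` and `ϑ` come from the anti-self-adjoint and self-adjoint parts
of `a`. -/
def connC (a : X → E →L[ℝ] B) : X → E →L[ℝ] B :=
  let adj : X → E →L[ℝ] B := fun y => ((starL' ℝ : B ≃L[ℝ] B) : B →L[ℝ] B).comp (a y)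
  Jform (fun y => (1 / 2 : ℝ) • (a y - adj y)) - Jform (fun y => (1 / 2 : ℝ) • (a y + adj y))

/-- A triple `(U(𝒫), D, f)`, consisting of a right torsor `U(𝒫)` on `X` under the sheaf of smooth
`U(B)`-valued functions, a pluriharmonic connection `D` and a framing `f ∈ x^* U(𝒫)`. Since a local
section `s` of `U(𝒫)` trivialises `ad 𝒫`, the form `D s` is given by a `B`-valued form `conn s`,
with `D s = [s, conn s]`. -/
structure FramedPluriharmonic (x : X) extends Torsor X (unitary B) (SmoothUnitary E) where
  conn : (X → Tot) → X → E →L[ℝ] B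
  conn_congr : ∀ s s' y, s =ᶠ[𝓝 y] s' → conn s y = conn s' y
  conn_smooth : ∀ s y, IsReg s y → ContDiffAt ℝ ∞ (localForm y (conn s)) (chartAt E y y)
  conn_act : ∀ s y, IsReg s y → ∀ u : X → unitary B, SmoothUnitary E u y → ∀ ξ,
    conn (fun y' => act (s y') (u y')) y ξ =
      star (u y : B) * conn s y ξ * (u y : B) + star (u y : B) * dFun (fun y' => (u y' : B)) y ξ
  flat : ∀ s y, IsReg s y → ∀ ξ η,
    dForm (conn s) y ξ η + wedge (conn s y) (conn s y) ξ η = 0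
  pluriharmonic : ∀ s y, IsReg s y → ∀ ξ η,
    dForm (connC (conn s)) y ξ η + wedge (conn s y) (connC (conn s) y) ξ η +
      (dcForm (conn s) y ξ η + wedge (connC (conn s) y) (conn s y) ξ η) = 0
  frame : Tot
  proj_frame : proj frame = x

/-- A quadruple `(𝒯, D, τ, f)`, consisting of a right torsor `𝒯` on `X × ℙ¹(ℂ)` under the sheaf of
`(B ⊗ ℂ)ˣ`-valued functions which are smooth along `X` and holomorphic along `ℙ¹(ℂ)`, trivial on
each `{y} × ℙ¹(ℂ)`, a flat `(u d + v dᶜ)`-connection `D` with values in `𝒜¹ ⊗ ad 𝒯(1)`, a real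
structure `τ` over complex conjugation of `ℙ¹(ℂ)`, and a `τ`-invariant framing `f` of `x^* 𝒯`. For a
local section `s` of `𝒯`, the form `D s = [s, conn s]` is a form along `X` with coefficients in
`𝒪(1)`; sections of `𝒪(1)` are homogeneous functions of degree `1` of `c = (u, v) ∈ ℂ² ∖ {0}`. -/
structure FramedTwistor (x : X) extends Torsor (X × P1) (Cx B)ˣ (SmoothHolUnits E) where
  fibre_trivial : ∀ y, ∃ f, toTorsor.IsFibreSection y f
  conn : (X × P1 → Tot) → X → ℂ × ℂ → E →L[ℝ] Cx B
  conn_congr : ∀ s s' y c, c ≠ 0 → s =ᶠ[𝓝 (y, pt c)] s' → conn s y c = conn s' y c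
  conn_smul : ∀ s y c, c ≠ 0 → IsReg s (y, pt c) → ∀ l : ℂ, l ≠ 0 →
    conn s y (l • c) = l • conn s y c
  conn_smooth : ∀ s y c, c ≠ 0 → IsReg s (y, pt c) →
    ContDiffAt ℝ ∞ (fun p : E × (ℂ × ℂ) => localForm y (fun y' => conn s y' p.2) p.1)
      (chartAt E y y, c)
  conn_hol : ∀ s y c, c ≠ 0 → IsReg s (y, pt c) → DifferentiableAt ℂ (conn s y) c
  conn_act : ∀ s y c, c ≠ 0 → IsReg s (y, pt c) →
    ∀ g : X × P1 → (Cx B)ˣ, SmoothHolUnits E g (y, pt c) → ∀ ξ,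
    conn (fun w => act (s w) (g w)) y c ξ =
      ((g (y, pt c))⁻¹ : (Cx B)ˣ).val * conn s y c ξ * (g (y, pt c)).val +
      ((g (y, pt c))⁻¹ : (Cx B)ˣ).val *
        (c.1 • dFun (fun y' => (g (y', pt c)).val) y ξ +
          c.2 • dFun (fun y' => (g (y', pt c)).val) y (jmul ξ))
  flat : ∀ s y c, c ≠ 0 → IsReg s (y, pt c) → ∀ ξ η,
    c.1 • dForm (fun y' => conn s y' c) y ξ η + c.2 • dcForm (fun y' => conn s y' c) y ξ η +
      wedge (conn s y c) (conn s y c) ξ η = 0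
  tau : Tot → Tot
  proj_tau : ∀ p, proj (tau p) = ((proj p).1, bar (proj p).2)
  tau_act : ∀ p g, tau (act p g) = act (tau p) (Units.map (Cx.conj (B := B)).toMonoidHom g)
  tau_tau : ∀ p, tau (tau p) = p
  tau_reg : ∀ s w, IsReg s w → IsReg (fun w' => tau (s (w'.1, bar w'.2))) (w.1, bar w.2)
  tau_conn : ∀ s y c, c ≠ 0 → IsReg s (y, pt c) → ∀ ξ,
    conn (fun w' => tau (s (w'.1, bar w'.2))) y (cc c) ξ = Cx.conj (conn s y c ξ)
  frame : P1 → Tot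
  frame_section : toTorsor.IsFibreSection x frame
  tau_frame : ∀ z, tau (frame z) = frame (bar z)

variable {E B} {x : X}

/-- Isomorphism of framed pluriharmonic torsors. -/
def FramedPluriharmonic.Iso (P Q : FramedPluriharmonic E B x) : Prop :=
  ∃ φ : P.Tot ≃ Q.Tot, (∀ p, Q.proj (φ p) = P.proj p) ∧
    (∀ p u, φ (P.act p u) = Q.act (φ p) u) ∧
    (∀ s y, P.IsReg s y ↔ Q.IsReg (φ ∘ s) y) ∧
    (∀ s y, P.IsReg s y → Q.conn (φ ∘ s) y = P.conn s y) ∧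
    φ P.frame = Q.frame

/-- Isomorphism of framed twistor torsors. -/
def FramedTwistor.Iso (S T : FramedTwistor E B x) : Prop :=
  ∃ φ : S.Tot ≃ T.Tot, (∀ p, T.proj (φ p) = S.proj p) ∧
    (∀ p g, φ (S.act p g) = T.act (φ p) g) ∧
    (∀ s w, S.IsReg s w ↔ T.IsReg (φ ∘ s) w) ∧
    (∀ s y c, c ≠ 0 → S.IsReg s (y, pt c) → T.conn (φ ∘ s) y c = S.conn s y c) ∧
    (∀ p, φ (S.tau p) = T.tau (φ p)) ∧
    ∀ z, φ (S.frame z) = T.frame z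

variable (E B x)

instance FramedPluriharmonic.setoid : Setoid (FramedPluriharmonic E B x) where
  r := FramedPluriharmonic.Iso
  iseqv :=
    { refl := fun P => ⟨Equiv.refl _, by simp, by simp, by simp, by simp, by simp⟩
      symm := by
        rintro P Q ⟨φ, h1, h2, h3, h4, h5⟩
        have hc : ∀ s : X → Q.Tot, φ ∘ (φ.symm ∘ s) = s := fun s => by ext; simp
        refine ⟨φ.symm, fun p => ?_, fun p u => ?_, fun s y => ?_, fun s y hs => ?_, ?_⟩
        · rw [← h1, φ.apply_symm_apply]
        · rw [φ.symm_apply_eq, h2, φ.apply_symm_apply]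
        · rw [h3, hc]
        · rw [← h4 _ y ((h3 _ y).2 (by rwa [hc])), hc]
        · rw [φ.symm_apply_eq, h5]
      trans := by
        rintro P Q S ⟨φ, h1, h2, h3, h4, h5⟩ ⟨ψ, k1, k2, k3, k4, k5⟩
        refine ⟨φ.trans ψ, fun p => ?_, fun p u => ?_, fun s y => ?_, fun s y hs => ?_, ?_⟩
        · simp [h1, k1]
        · simp [h2, k2]
        · rw [h3, k3]; rfl
        · rw [← h4 s y hs, ← k4 _ y ((h3 s y).1 hs)]; rfl
        · simp [h5, k5] }

instance FramedTwistor.setoid : Setoid (FramedTwistor E B x) where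
  r := FramedTwistor.Iso
  iseqv :=
    { refl := fun P =>
        ⟨Equiv.refl _, by simp, by simp, by simp, by simp, by simp, by simp⟩
      symm := by
        rintro P Q ⟨φ, h1, h2, h3, h4, h5, h6⟩
        have hc : ∀ s : X × P1 → Q.Tot, φ ∘ (φ.symm ∘ s) = s := fun s => by ext; simp
        refine ⟨φ.symm, fun p => ?_, fun p u => ?_, fun s y => ?_, fun s y c h0 hs => ?_,
          fun p => ?_, fun z => ?_⟩
        · rw [← h1, φ.apply_symm_apply]
        · rw [φ.symm_apply_eq, h2, φ.apply_symm_apply]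
        · rw [h3, hc]
        · rw [← h4 _ y c h0 ((h3 _ _).2 (by rwa [hc])), hc]
        · rw [φ.symm_apply_eq, h5, φ.apply_symm_apply]
        · rw [φ.symm_apply_eq, h6]
      trans := by
        rintro P Q S ⟨φ, h1, h2, h3, h4, h5, h6⟩ ⟨ψ, k1, k2, k3, k4, k5, k6⟩
        refine ⟨φ.trans ψ, fun p => ?_, fun p u => ?_, fun s y => ?_, fun s y c h0 hs => ?_,
          fun p => ?_, fun z => ?_⟩
        · simp [h1, k1]
        · simp [h2, k2]
        · rw [h3, k3]; rfl
        · rw [← h4 s y c h0 hs, ← k4 _ y c h0 ((h3 _ _).1 hs)]; rfl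
        · simp [h5, k5]
        · simp [h6, k6] }

/-- The set `R^J_{X,x}(B)` of isomorphism classes of framed pluriharmonic torsors. -/
def RJ : Type _ := Quotient (FramedPluriharmonic.setoid E B x)

/-- The set `R^T_{X,x}(𝒪(B))` of isomorphism classes of framed twistor torsors with coefficients in
the sheaf `𝒪(B) = B ⊗ 𝒪` of holomorphic functions on `ℙ¹(ℂ)`. -/
def RT : Type _ := Quotient (FramedTwistor.setoid E B x)

end Functors

/-! ### The involution `σ` -/

section Sigma

variable {E : Type uE} [NormedAddCommGroup E] [NormedSpace ℂ E]
variable {X : Type uX} [TopologicalSpace X] [ChartedSpace E X]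
variable {V : Type*} [NormedAddCommGroup V] [NormedSpace ℝ V]

theorem chartD_jmul [IsManifold 𝓘(ℂ, E) 1 X] (y : X) {e : E}
    (he : e ∈ (chartAt E y).target) :
    (chartD y e).comp jmul = jmul.comp (chartD y e) := by
  have h : MDifferentiableAt 𝓘(ℂ, E) 𝓘(ℂ, E) (chartAt E y).symm e :=
    mdifferentiableAt_atlas_symm (chart_mem_atlas E y) he
  have h1 := h.hasMFDerivAt
  have h2 : HasFDerivWithinAt (𝕜 := ℂ) (writtenInExtChartAt 𝓘(ℂ, E) 𝓘(ℂ, E) e (chartAt E y).symm)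
      (mfderiv 𝓘(ℂ, E) 𝓘(ℂ, E) (chartAt E y).symm e : E →L[ℂ] E) (Set.range 𝓘(ℂ, E))
      (extChartAt 𝓘(ℂ, E) e e) := h1.2
  have h3 : HasMFDerivAt 𝓘(ℝ, E) 𝓘(ℝ, E) (chartAt E y).symm e
      ((mfderiv 𝓘(ℂ, E) 𝓘(ℂ, E) (chartAt E y).symm e : E →L[ℂ] E).restrictScalars ℝ) :=
    ⟨h1.1, h2.restrictScalars ℝ⟩
  have h4 : chartD y e =
      (mfderiv 𝓘(ℂ, E) 𝓘(ℂ, E) (chartAt E y).symm e : E →L[ℂ] E).restrictScalars ℝ := h3.mfderiv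
  rw [h4]
  ext ξ
  exact map_smul (mfderiv 𝓘(ℂ, E) 𝓘(ℂ, E) (chartAt E y).symm e : E →L[ℂ] E) Complex.I ξ

theorem localForm_J [IsManifold 𝓘(ℂ, E) 1 X] (α : X → E →L[ℝ] V) (y : X) {e : E}
    (he : e ∈ (chartAt E y).target) :
    localForm y (Jform α) e = (localForm y α e).comp jmul := by
  unfold localForm Jform
  rw [ContinuousLinearMap.comp_assoc, ContinuousLinearMap.comp_assoc,
    chartD_jmul y he]

theorem localForm_comp {W : Type*} [NormedAddCommGroup W] [NormedSpace ℝ W] (A : V →L[ℝ] W)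
    (α : X → E →L[ℝ] V) (y : X) (e : E) :
    localForm y (fun y' => A.comp (α y')) e = A.comp (localForm y α e) := rfl

theorem dForm_comp {W : Type*} [NormedAddCommGroup W] [NormedSpace ℝ W] (A : V →L[ℝ] W)
    (α : X → E →L[ℝ] V) (y : X) (h : DifferentiableAt ℝ (localForm y α) (chartAt E y y)) (ξ η : E) :
    dForm (fun y' => A.comp (α y')) y ξ η = A (dForm α y ξ η) := by
  have h1 : localForm y (fun y' => A.comp (α y')) = fun e => A.comp (localForm y α e) := rfl
  have h2 := ((ContinuousLinearMap.compL ℝ E V W A).hasFDerivAt.comp _ h.hasFDerivAt).fderiv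
  have h3 : (fun e => A.comp (localForm y α e)) =
    (ContinuousLinearMap.compL ℝ E V W A) ∘ localForm y α := rfl
  unfold dForm
  rw [h1, h3, h2]
  simp

theorem dForm_neg (α : X → E →L[ℝ] V) (y : X) (ξ η : E) :
    dForm (fun y' => -α y') y ξ η = -dForm α y ξ η := by
  have h1 : localForm y (fun y' => -α y') = fun e => -localForm y α e := by
    funext e
    exact ContinuousLinearMap.neg_comp _ _
  unfold dForm
  rw [h1, fderiv_fun_neg]
  simp
  abel

theorem differentiableAt_localForm_J [IsManifold 𝓘(ℂ, E) 1 X] (α : X → E →L[ℝ] V) (y : X)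
    (h : DifferentiableAt ℝ (localForm y α) (chartAt E y y)) :
    DifferentiableAt ℝ (localForm y (Jform α)) (chartAt E y y) := by
  have h1 : localForm y (Jform α) =ᶠ[𝓝 (chartAt E y y)]
      fun e => (localForm y α e).comp jmul := by
    filter_upwards [(chartAt E y).open_target.mem_nhds (mem_chart_target E y)] with e he
    exact localForm_J α y he
  exact (h.clm_comp (differentiableAt_const _)).congr_of_eventuallyEq h1

variable {B : Type uB} [NormedRing B] [NormedAlgebra ℝ B] [StarRing B] [CStarRing B]
  [StarModule ℝ B]

/-- The map `J ∘ ad(Cτ)` on forms at one point, where `ad(Cτ)(b) = -(conj b)^*`. -/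
def sigmaForm : (E →L[ℝ] Cx B) →L[ℂ] (E →L[ℝ] Cx B) :=
  LinearMap.mkContinuous
    { toFun := fun a => -((Cx.transpose (B := B)).restrictScalars ℝ).comp (a.comp jmul)
      map_add' := fun a b => by ext1 ξ; simp [add_comm]
      map_smul' := fun c a => by ext1 ξ; simp }
    (‖(Cx.transpose (B := B)).restrictScalars ℝ‖ * ‖(jmul : E →L[ℝ] E)‖)
    (fun a => by
      change ‖-_‖ ≤ _
      rw [norm_neg, mul_assoc, mul_comm ‖jmul‖]
      exact (ContinuousLinearMap.opNorm_comp_le _ _).trans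
        (mul_le_mul_of_nonneg_left (ContinuousLinearMap.opNorm_comp_le _ _) (norm_nonneg _)))

theorem sigmaForm_apply (a : E →L[ℝ] Cx B) (ξ : E) :
    sigmaForm a ξ = -star (Cx.conj (a (jmul ξ))) := rfl

/-- The map `(y, z) ↦ (y, τσ_ℙ z)` of `X × ℙ¹(ℂ)`. -/
def rotY (w : X × P1) : X × P1 := (w.1, rot w.2)

theorem rotY_rotY (w : X × P1) : rotY (rotY w) = w := by simp [rotY, rot_rot]

theorem comp_rotY_rotY {S : Type*} (s : X × P1 → S) : (s ∘ rotY) ∘ rotY = s := by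
  funext w
  simp [rotY_rotY]

theorem continuous_rotY : Continuous (rotY : X × P1 → X × P1) :=
  continuous_fst.prodMk (continuous_rot.comp continuous_snd)

theorem rotY_pt (y : X) {c : ℂ × ℂ} (hc : c ≠ 0) : rotY (y, pt c) = (y, pt (rotL c)) := by
  simp [rotY, rot_pt hc]

theorem tendsto_rotY (w : X × P1) : Filter.Tendsto rotY (𝓝 (rotY w)) (𝓝 w) := by
  have := (continuous_rotY (X := X)).tendsto (rotY w)
  rwa [rotY_rotY] at this

theorem tendsto_rotY' (w : X × P1) : Filter.Tendsto rotY (𝓝 w) (𝓝 (rotY w)) :=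
  (continuous_rotY (X := X)).tendsto w

variable [CompleteSpace B]

theorem cartan_val_eq (g : (Cx B)ˣ) :
    (Cx.cartan g).val = Cx.transpose (Ring.inverse g.val) := by
  rw [Ring.inverse_unit]
  rfl

theorem SmoothHolUnits.cartan {g : X × P1 → (Cx B)ˣ} {w : X × P1}
    (h : SmoothHolUnits E g w) :
    SmoothHolUnits E (fun w' => Cx.cartan (g (rotY w'))) (rotY w) := by
  intro c hc hcw
  have hw : pt (rotL c) = w.2 := by
    rw [← rot_pt hc, hcw]
    exact rot_rot _
  have h1 := h (rotL c) (rotL_ne hc) hw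
  have ht : Filter.Tendsto (fun p : X × (ℂ × ℂ) => (p.1, rotL p.2)) (𝓝 (w.1, c))
      (𝓝 (w.1, rotL c)) :=
    (continuous_fst.prodMk (rotL.continuous.comp continuous_snd)).tendsto _
  have h0 : ∀ᶠ p : X × (ℂ × ℂ) in 𝓝 (w.1, c), p.2 ≠ 0 :=
    continuous_snd.continuousAt.eventually_ne hc
  change ∀ᶠ p in 𝓝 (w.1, c), _
  filter_upwards [ht.eventually h1, h0] with p hp hp0
  have hq : ∀ᶠ q : X × (ℂ × ℂ) in 𝓝 p, q.2 ≠ 0 := continuous_snd.continuousAt.eventually_ne hp0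
  have hq2 : ∀ᶠ q : ℂ × ℂ in 𝓝 p.2, q ≠ 0 := continuousAt_id.eventually_ne hp0
  constructor
  · have e1 : ContMDiffAt (𝓘(ℝ, E).prod 𝓘(ℝ, ℂ × ℂ)) (𝓘(ℝ, E).prod 𝓘(ℝ, ℂ × ℂ)) ∞
        (fun q : X × (ℂ × ℂ) => (q.1, rotL q.2)) p :=
      contMDiffAt_fst.prodMk
        (((rotL.toContinuousLinearMap.restrictScalars ℝ).contMDiff.contMDiffAt).comp p
          contMDiffAt_snd)
    have e2 := hp.1.comp p e1
    have e3 : ContDiffAt ℝ ∞ (fun b : Cx B => Cx.transpose (Ring.inverse b))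
        (g (p.1, pt (rotL p.2))).val :=
      ((Cx.transpose (B := B)).restrictScalars ℝ).contDiff.contDiffAt.comp _
        (contDiffAt_ringInverse ℝ _)
    refine (e3.comp_contMDiffAt (f := fun q : X × (ℂ × ℂ) => (g (q.1, pt (rotL q.2))).val)
      e2).congr_of_eventuallyEq ?_
    filter_upwards [hq] with q hq0
    simp only [Function.comp, cartan_val_eq, rotY_pt _ hq0]
  · have e2 := hp.2.comp p.2 rotL.differentiableAt
    have e3 : DifferentiableAt ℂ (fun b : Cx B => Cx.transpose (Ring.inverse b))
        (g (p.1, pt (rotL p.2))).val :=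
      (Cx.transpose (B := B)).differentiableAt.comp _ (differentiableAt_inverse (Units.isUnit _))
    refine (e3.comp p.2 e2).congr_of_eventuallyEq ?_
    filter_upwards [hq2] with q hq0
    simp only [Function.comp, cartan_val_eq, rotY_pt _ hq0]

theorem smoothHolUnits_cartan_iff {g : X × P1 → (Cx B)ˣ} {w : X × P1} :
    SmoothHolUnits E (fun w' => Cx.cartan (g (rotY w'))) (rotY w) ↔ SmoothHolUnits E g w := by
  refine ⟨fun h => ?_, fun h => h.cartan⟩
  have := h.cartan
  simpa only [rotY_rotY, Cx.cartan_cartan] using this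

theorem dFun_cartan (g : X × P1 → (Cx B)ˣ) (y : X) {c : ℂ × ℂ} (hc : c ≠ 0)
    (h : SmoothHolUnits E g (y, pt c)) (ξ : E) :
    dFun (fun y' => (Cx.cartan (g (rotY (y', pt (rotL c))))).val) y ξ =
      -star (Cx.conj (((g (y, pt c))⁻¹ : (Cx B)ˣ).val * dFun (fun y' => (g (y', pt c)).val) y ξ *
        ((g (y, pt c))⁻¹ : (Cx B)ˣ).val)) := by
  have hr : ∀ y' : X, rotY (y', pt (rotL c)) = (y', pt c) := fun y' => by
    rw [← rotY_pt y' hc, rotY_rotY]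
  simp only [hr, cartan_val_eq]
  have h1 := (h c hc rfl).self_of_nhds.1
  have h2 : ContMDiffAt 𝓘(ℝ, E) (𝓘(ℝ, E).prod 𝓘(ℝ, ℂ × ℂ)) ∞ (fun y' : X => (y', c)) y :=
    contMDiffAt_id.prodMk contMDiffAt_const
  have h3 : ContMDiffAt 𝓘(ℝ, E) 𝓘(ℝ, Cx B) ∞ (fun y' => (g (y', pt c)).val) y :=
    ContMDiffAt.comp (f := fun y' : X => (y', c))
      (g := fun p' : X × (ℂ × ℂ) => (g (p'.1, pt p'.2)).val) y h1 h2
  have h4 : MDifferentiableAt 𝓘(ℝ, E) 𝓘(ℝ, Cx B) (fun y' => (g (y', pt c)).val) y :=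
    h3.mdifferentiableAt (by simp)
  have h5 : HasFDerivAt (fun b : Cx B => Cx.transpose (Ring.inverse b)) _ (g (y, pt c)).val :=
    ((Cx.transpose (B := B)).restrictScalars ℝ).hasFDerivAt.comp _
      (hasFDerivAt_ringInverse (𝕜 := ℝ) (g (y, pt c)))
  have h6 := (h5.hasMFDerivAt.comp y h4.hasMFDerivAt).mfderiv
  have h7 : dFun (fun y' => Cx.transpose (Ring.inverse (g (y', pt c)).val)) y ξ =
      Cx.transpose (-(((g (y, pt c))⁻¹ : (Cx B)ˣ).val * dFun (fun y' => (g (y', pt c)).val) y ξ *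
        ((g (y, pt c))⁻¹ : (Cx B)ˣ).val)) :=
    congrArg (fun L : E →L[ℝ] Cx B => L ξ) h6
  rw [h7, map_neg, Cx.transpose_apply]

variable [IsManifold 𝓘(ℂ, E) 1 X]

theorem contDiffAt_sigma {α : X → ℂ × ℂ → E →L[ℝ] Cx B} {y : X} {c : ℂ × ℂ}
    (h : ContDiffAt ℝ ∞ (fun p : E × (ℂ × ℂ) => localForm y (fun y' => α y' p.2) p.1)
      (chartAt E y y, rotL c)) :
    ContDiffAt ℝ ∞
      (fun p : E × (ℂ × ℂ) => localForm y (fun y' => sigmaForm (α y' (rotL p.2))) p.1)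
      (chartAt E y y, c) := by
  have h1 : ContDiffAt ℝ ∞ (fun p : E × (ℂ × ℂ) => (p.1, rotL p.2)) (chartAt E y y, c) :=
    contDiffAt_fst.prodMk
      ((rotL.toContinuousLinearMap.restrictScalars ℝ).contDiff.contDiffAt.comp _ contDiffAt_snd)
  have h2 := ((sigmaForm (E := E) (B := B)).restrictScalars ℝ).contDiff.contDiffAt.comp _
    (h.comp (chartAt E y y, c) h1)
  refine h2.congr_of_eventuallyEq ?_
  have h3 : ∀ᶠ p : E × (ℂ × ℂ) in 𝓝 (chartAt E y y, c), p.1 ∈ (chartAt E y).target :=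
    continuous_fst.continuousAt.eventually
      ((chartAt E y).open_target.mem_nhds (mem_chart_target E y))
  filter_upwards [h3] with p hp
  ext1 ξ
  have h4 := congrArg (fun L : E →L[ℝ] E => L ξ) (chartD_jmul y hp)
  have h5 : chartD y p.1 (jmul ξ) = jmul (chartD y p.1 ξ) := h4
  simp only [localForm, Function.comp, ContinuousLinearMap.comp_apply, sigmaForm_apply,
    ContinuousLinearMap.coe_restrictScalars']
  rw [h5]

theorem flat_sigma {α : X → E →L[ℝ] Cx B} {y : X} {c : ℂ × ℂ}
    (hd : DifferentiableAt ℝ (localForm y α) (chartAt E y y))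
    (h : ∀ ξ η, (rotL c).1 • dForm α y ξ η + (rotL c).2 • dcForm α y ξ η +
      wedge (α y) (α y) ξ η = 0) (ξ η : E) :
    c.1 • dForm (fun y' => sigmaForm (α y')) y ξ η +
      c.2 • dcForm (fun y' => sigmaForm (α y')) y ξ η +
      wedge (sigmaForm (α y)) (sigmaForm (α y)) ξ η = 0 := by
  set A : Cx B →L[ℝ] Cx B := -(Cx.transpose (B := B)).restrictScalars ℝ with hA
  have hAa : ∀ b, A b = -star (Cx.conj b) := fun b => rfl
  have hAs : ∀ (l : ℂ) b, A (l • b) = l • A b := fun l b => by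
    simp [hA]
  have e1 : (fun y' => sigmaForm (α y')) = fun y' => A.comp (Jform α y') := by
    funext y'
    ext1 ξ
    rfl
  have e2 : dForm (fun y' => sigmaForm (α y')) y ξ η = A (dForm (Jform α) y ξ η) := by
    rw [e1, dForm_comp A _ y (differentiableAt_localForm_J α y hd)]
  have e3 : dcForm α y (jmul ξ) (jmul η) = -dForm (Jform α) y ξ η := by
    unfold dcForm
    rw [dForm_neg, jmul_jmul, jmul_jmul]
    simp [dForm]
  have e4 : dcForm (fun y' => sigmaForm (α y')) y ξ η = A (dForm α y (jmul ξ) (jmul η)) := by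
    unfold dcForm
    rw [← dForm_comp A α y hd]
    congr 1
    funext y'
    ext1 ζ
    change -(-star (Cx.conj (α y' (jmul (jmul ζ))))) = -star (Cx.conj (α y' ζ))
    rw [jmul_jmul]
    simp
  have e5 : wedge (sigmaForm (α y)) (sigmaForm (α y)) ξ η =
      A (wedge (α y) (α y) (jmul ξ) (jmul η)) := by
    simp only [wedge, sigmaForm_apply, hAa, map_sub, star_sub, Cx.star_conj_mul]
    noncomm_ring
  have e6 := congrArg A (h (jmul ξ) (jmul η))
  rw [map_add, map_add, hAs, hAs, map_zero, e3, map_neg, rotL_apply] at e6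
  rw [e2, e4, e5, ← e6]
  simp only [smul_neg, neg_smul, neg_neg]
  abel

variable {x : X}

/-- The action of `σ = (Cτ)(τσ')` on framed twistor torsors. The bundle of `σ 𝒯` is the pullback of
that of `𝒯` along `τσ_ℙ`, with structure group changed along `Cτ`, so that `σ 𝒯` has the same total
space with `g` acting as `(Cτ)⁻¹(g) = Cτ(g)`. The connection is `J ad(Cτ) (τσ_ℙ)⁻¹ D`. -/
def FramedTwistor.sigma (T : FramedTwistor E B x) : FramedTwistor E B x where
  Tot := T.Tot
  proj p := rotY (T.proj p)
  act p g := T.act p (Cx.cartan g)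
  act_one p := by rw [Cx.cartan_one, T.act_one]
  act_mul p g h := by rw [Cx.cartan_mul, T.act_mul]
  proj_act p g := by rw [T.proj_act]
  existsUnique_act p q h := by
    have h' : T.proj p = T.proj q := by
      have := congrArg rotY h
      rwa [rotY_rotY, rotY_rotY] at this
    obtain ⟨g, hg, hu⟩ := T.existsUnique_act p q h'
    refine ⟨Cx.cartan g, ?_, fun k hk => ?_⟩
    · simp only [Cx.cartan_cartan, hg]
    · rw [← hu _ hk, Cx.cartan_cartan]
  IsReg s w := T.IsReg (s ∘ rotY) (rotY w)
  reg_exists w := by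
    obtain ⟨s, hs⟩ := T.reg_exists (rotY w)
    refine ⟨s ∘ rotY, ?_⟩
    rwa [comp_rotY_rotY]
  reg_proj s w h := by
    have := T.reg_proj _ _ h
    simp only [Function.comp, rotY_rotY] at this
    rw [this, rotY_rotY]
  reg_nhds s w h := (tendsto_rotY' w).eventually (T.reg_nhds _ _ h)
  reg_congr s s' w h hs := T.reg_congr _ _ _ ((tendsto_rotY w).eventually h) hs
  reg_act s w h g := by
    refine Iff.trans ?_ (smoothHolUnits_cartan_iff (E := E) (g := g) (w := w))
    exact T.reg_act _ _ h (fun w' => Cx.cartan (g (rotY w')))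
  fibre_trivial y := by
    obtain ⟨f, hf⟩ := T.fibre_trivial y
    refine ⟨f ∘ rot, fun z₀ => ?_⟩
    obtain ⟨s, h1, h2, h3⟩ := hf (rot z₀)
    exact ⟨s ∘ rotY, by
      change T.IsReg ((s ∘ rotY) ∘ rotY) _
      rwa [comp_rotY_rotY], h2, (continuous_rot.tendsto z₀).eventually h3⟩
  conn s y c := sigmaForm (T.conn (s ∘ rotY) y (rotL c))
  conn_congr s s' y c hc h := by
    rw [T.conn_congr (s ∘ rotY) (s' ∘ rotY) y (rotL c) (rotL_ne hc)]
    rw [← rotY_pt y hc]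
    exact (tendsto_rotY _).eventually h
  conn_smul s y c hc h l hl := by
    rw [rotY_pt y hc] at h
    rw [map_smul, T.conn_smul _ _ _ (rotL_ne hc) h l hl, map_smul]
  conn_smooth s y c hc h := by
    rw [rotY_pt y hc] at h
    exact contDiffAt_sigma (T.conn_smooth _ _ _ (rotL_ne hc) h)
  conn_hol s y c hc h := by
    rw [rotY_pt y hc] at h
    exact (sigmaForm (E := E) (B := B)).differentiableAt.comp c
      ((T.conn_hol _ _ _ (rotL_ne hc) h).comp c rotL.differentiableAt)
  conn_act s y c hc h g hg ξ := by
    rw [rotY_pt y hc] at h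
    have hg' := hg.cartan
    rw [rotY_pt y hc] at hg'
    have e := T.conn_act _ _ _ (rotL_ne hc) h _ hg' (jmul ξ)
    have hr : rotY (y, pt (rotL c)) = (y, pt c) := by rw [← rotY_pt y hc, rotY_rotY]
    rw [dFun_cartan g y hc hg, dFun_cartan g y hc hg, hr, jmul_jmul, map_neg] at e
    rw [sigmaForm_apply, sigmaForm_apply]
    refine (congrArg (fun b : Cx B => -star (Cx.conj b)) e).trans ?_
    rw [Cx.cartan_val, Cx.cartan_inv]
    generalize dFun (fun y' => (g (y', pt c)).val) y ξ = D1
    generalize dFun (fun y' => (g (y', pt c)).val) y (jmul ξ) = D2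
    generalize T.conn (s ∘ rotY) y (rotL c) (jmul ξ) = K
    have hsm : ∀ (l : ℂ) (b : Cx B), star (Cx.conj (l • b)) = l • star (Cx.conj b) :=
      fun l b => (Cx.transpose (B := B)).map_smul l b
    simp only [map_add, star_add, Cx.star_conj_mul, Cx.star_conj_invol, hsm, map_neg, star_neg,
      rotL_apply]
    generalize g (y, pt c) = k
    simp only [neg_add_rev, add_mul, mul_add, smul_neg, neg_smul, neg_mul, mul_neg, neg_neg,
      smul_mul_assoc, mul_smul_comm, mul_assoc, Units.inv_mul, mul_one]
    abel
  flat s y c hc h ξ η := by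
    rw [rotY_pt y hc] at h
    refine flat_sigma ?_ (T.flat _ _ _ (rotL_ne hc) h) ξ η
    have h1 := T.conn_smooth _ _ _ (rotL_ne hc) h
    have h2 : ContDiffAt ℝ ∞ (fun e : E => (e, rotL c)) (chartAt E y y) :=
      contDiffAt_id.prodMk contDiffAt_const
    exact (h1.comp (chartAt E y y) h2).differentiableAt (by simp)
  tau := T.tau
  proj_tau p := by
    rw [T.proj_tau]
    simp [rotY, rot_bar]
  tau_act p g := by
    rw [T.tau_act, Cx.cartan_conj]
  tau_tau := T.tau_tau
  tau_reg s w h := by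
    have := T.tau_reg _ _ h
    have e : ((fun w' : X × P1 => T.tau (s (w'.1, bar w'.2))) ∘ rotY) =
        fun w' => T.tau ((s ∘ rotY) (w'.1, bar w'.2)) := by
      funext w'
      simp [rotY, rot_bar]
    rw [e]
    simpa [rotY, rot_bar] using this
  tau_conn s y c hc h ξ := by
    rw [rotY_pt y hc] at h
    have := T.tau_conn _ _ _ (rotL_ne hc) h (jmul ξ)
    have e : ((fun w' : X × P1 => T.tau (s (w'.1, bar w'.2))) ∘ rotY) =
        fun w' => T.tau ((s ∘ rotY) (w'.1, bar w'.2)) := by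
      funext w'
      simp [rotY, rot_bar]
    have e2 : rotL (cc c) = cc (rotL c) := by
      simp [cc, rotL_apply]
    rw [sigmaForm_apply, sigmaForm_apply, e, e2, this]
    ext <;> simp
  frame := T.frame ∘ rot
  frame_section z₀ := by
    obtain ⟨s, h1, h2, h3⟩ := T.frame_section (rot z₀)
    exact ⟨s ∘ rotY, by
      change T.IsReg ((s ∘ rotY) ∘ rotY) _
      rwa [comp_rotY_rotY], h2, (continuous_rot.tendsto z₀).eventually h3⟩
  tau_frame z := by
    simp only [Function.comp, T.tau_frame, rot_bar]

/-- The involution `σ` of `R^T_{X,x}(𝒪(B))`. -/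
def sigma : RT E B x → RT E B x :=
  Quotient.map FramedTwistor.sigma (by
    rintro S T ⟨φ, h1, h2, h3, h4, h5, h6⟩
    refine ⟨φ, fun p => ?_, fun p g => h2 _ _, fun s w => h3 _ _, fun s y c hc hs => ?_, h5,
      fun z => h6 _⟩
    · exact congrArg rotY (h1 p)
    · refine congrArg sigmaForm (h4 _ _ _ (rotL_ne hc) ?_)
      rw [← rotY_pt y hc]
      exact hs)

end Sigma

/-! ### The twistor torsor of a pluriharmonic torsor -/

section Extension

variable {E : Type uE} [NormedAddCommGroup E] [NormedSpace ℂ E]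
variable {X : Type uX} [TopologicalSpace X] [ChartedSpace E X]
variable {B : Type uB} [NormedRing B] [NormedAlgebra ℝ B] [StarRing B] [CStarRing B]
  [StarModule ℝ B] {x : X}

/-- The inclusion of `U(B)` in `(B ⊗ ℂ)ˣ`. -/
def unitaryToCx : unitary B →* (Cx B)ˣ :=
  (Units.map (Cx.ofBaseHom (B := B))).comp Unitary.toUnits

/-- `T` is the framed twistor torsor of `P = (U(𝒫), D, f)`, that is, the torsor obtained from the
pullback of `U(𝒫)` to `X × ℙ¹(ℂ)` by extending the structure group from `U(B)` to `(B ⊗ ℂ)ˣ`, with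
its natural real structure, the connection `u D + v Dᶜ`, and the framing given by `f`. As for any
extension of structure group of a torsor, this means that there is an equivariant map `ι` from the
pullback of `U(𝒫)` to `T` which is compatible with all these structures. -/
def IsTwistorOf (P : FramedPluriharmonic E B x) (T : FramedTwistor E B x) : Prop :=
  ∃ ι : P.Tot → P1 → T.Tot,
    (∀ p z, T.proj (ι p z) = (P.proj p, z)) ∧
    (∀ p u z, ι (P.act p u) z = T.act (ι p z) (unitaryToCx u)) ∧
    (∀ s y, P.IsReg s y → ∀ z, T.IsReg (fun w => ι (s w.1) w.2) (y, z)) ∧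
    (∀ p z, T.tau (ι p z) = ι p (bar z)) ∧
    (∀ s y, P.IsReg s y → ∀ c, c ≠ 0 → ∀ ξ,
      T.conn (fun w => ι (s w.1) w.2) y c ξ =
        c.1 • Cx.ofBase (P.conn s y ξ) + c.2 • Cx.ofBase (connC (P.conn s) y ξ)) ∧
    ∀ z, T.frame z = ι P.frame z

end Extension

end Twistor

end

open Topology
open scoped Manifold ContDiff LinearAlgebra.Projectivization

noncomputable section

set_option linter.unusedSectionVars false

namespace Twistor

universe uE uX uB


/-! ### The topology of the projective line -/

/-! A point of `U(𝒫)` over `y` gives a section of its twistor torsor `𝒯` over `{y} × ℙ¹`. This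
section is fixed by the real structure `τ` and by the isomorphism `φ : 𝒯 → σ𝒯`, regarded as a
self-map of `𝒯` over `(u : v) ↦ (v : -u)`. Conversely, `U(𝒫)` can be recovered as the set of
sections over projective lines fixed by `τ` and `φ`. Indeed two sections over the same projective
line differ by a constant (Liouville), and the constants fixed by conjugation and by `Cτ` are the
unitary elements of `B` (`exists_unitary_of_fixed`).

Invariance. The form of `D^c` is `a^c = -(J a)^*`, so `J ad(Cτ)` takes `a` to `a^c` and `a^c` to
`-a`, and the substitution `(u, v) ↦ (v, -u)` restores `u a + v a^c`. Hence `σ` fixes the twistor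
torsors of pluriharmonic torsors (`IsExt.sigma`). The curvature of `u a + v a^c` has coefficients
`D²`, `D D^c + D^c D` and `(D^c)²`, the last being the negative adjoint of the first up to `J`; so
flatness over `ℙ¹` is equivalent to flatness and pluriharmonicity of `D`.

Rigidity. Morphisms of framed twistor torsors are unique (`FramedTwistor.IsHom.eq`): agreement at
one point spreads along `ℙ¹` by Liouville, and over the connected `X` because the difference of two
morphisms solves a linear differential equation. This gives injectivity, and `φ² = 1` for an
isomorphism `φ : 𝒯 → σ𝒯`.

Surjectivity. The analytic core is `FramedTwistor.exists_extends`: a section over `{y₀} × ℙ¹`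
extends to neighbouring lines. Away from the two points with `u² + v² = 0` the operator `u d + v
d^c` is an invertible transform of `d`, and radial parallel transport extends the section. Across a
degenerate point, the transported section and a local section differ by a family of functions on an
annulus that is `1` at `y₀`; a Birkhoff factorization near `1`, obtained from a Toeplitz operator on
a Wiener algebra, makes them match (`exists_factorization`).

On such a family of sections `τ` and `φ` act through functions `a(y)`, `b(y)`, which form a cocycle
of `ℤ/2 × ℤ/2`. Nearby cocycles are cohomologous, so the family can be modified to make `a` and `b`
constant (`exists_isNormal`). Whether fixed sections exist over `y` then depends only on these
constants, hence is locally constant in `y`; the frame provides one over `x`. The fixed sections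
form a `U(B)`-torsor. Its connection form is the value of the twistor connection at `(1, 0)`: a form
with coefficients in `𝒪(1)` is linear in `(u, v)`, `τ` makes the coefficient of `u` real, and `φ`
identifies the coefficient of `v` with its `D^c`. -/

theorem pt_smul {c : ℂ × ℂ} (hc : c ≠ 0) {l : ℂ} (hl : l ≠ 0) : pt (l • c) = pt c := by
  rw [pt_of_ne hc, pt_of_ne (smul_ne_zero hl hc), Projectivization.mk_eq_mk_iff']
  exact ⟨l, rfl⟩

theorem exists_smul_of_pt_eq {c c' : ℂ × ℂ} (hc : c ≠ 0) (hc' : c' ≠ 0) (h : pt c = pt c') :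
    ∃ l : ℂ, l ≠ 0 ∧ c = l • c' := by
  rw [pt_of_ne hc, pt_of_ne hc', Projectivization.mk_eq_mk_iff'] at h
  obtain ⟨l, rfl⟩ := h
  exact ⟨l, by rintro rfl; simp at hc, rfl⟩

theorem continuousAt_pt {c : ℂ × ℂ} (hc : c ≠ 0) : ContinuousAt pt c := by
  have h : ContinuousOn pt {c : ℂ × ℂ | c ≠ 0} := by
    rw [continuousOn_iff_continuous_domRestrict]
    refine continuous_mk.congr fun c => ?_
    exact (pt_of_ne c.2).symm
  exact h.continuousAt (isOpen_ne.mem_nhds hc)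

/-- The saturation of `U` under scaling is the union of its preimages under multiplication by
nonzero scalars, and each of these is open. -/
theorem isOpen_image_pt {U : Set (ℂ × ℂ)} (hU : IsOpen U) (h0 : ∀ c ∈ U, c ≠ 0) :
    IsOpen (pt '' U) := by
  rw [isOpen_coinduced]
  have h : (fun c : {c : ℂ × ℂ // c ≠ 0} => Projectivization.mk ℂ c.1 c.2) ⁻¹' (pt '' U) =
      ⋃ l : {l : ℂ // l ≠ 0}, (fun c : {c : ℂ × ℂ // c ≠ 0} => l.1 • c.1) ⁻¹' U := by
    ext c
    simp only [Set.mem_preimage, Set.mem_image, Set.mem_iUnion]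
    constructor
    · rintro ⟨d, hd, e⟩
      rw [← pt_of_ne c.2] at e
      obtain ⟨l, hl, e'⟩ := exists_smul_of_pt_eq (h0 d hd) c.2 e
      exact ⟨⟨l, hl⟩, e' ▸ hd⟩
    · rintro ⟨l, hl⟩
      exact ⟨_, hl, by rw [pt_smul c.2 l.2, pt_of_ne c.2]⟩
  rw [h]
  exact isOpen_iUnion fun l => hU.preimage (continuous_subtype_val.const_smul l.1)

/-- Continuity and openness of the quotient map combine to an equality of filters, so that germs on
`ℙ¹` can be tested on `ℂ² ∖ {0}`. -/
theorem map_pt_nhds {c : ℂ × ℂ} (hc : c ≠ 0) : Filter.map pt (𝓝 c) = 𝓝 (pt c) := by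
  refine le_antisymm (continuousAt_pt hc) fun S hS => ?_
  rw [Filter.mem_map] at hS
  obtain ⟨U, hU, hUo, hcU⟩ := mem_nhds_iff.1 (Filter.inter_mem hS (isOpen_ne.mem_nhds hc))
  have h1 := isOpen_image_pt hUo fun d hd => (hU hd).2
  refine Filter.mem_of_superset (h1.mem_nhds ⟨c, hcU, rfl⟩) ?_
  rintro _ ⟨d, hd, rfl⟩
  exact (hU hd).1

theorem eventually_nhds_pt {c : ℂ × ℂ} (hc : c ≠ 0) {P : P1 → Prop} :
    (∀ᶠ z in 𝓝 (pt c), P z) ↔ ∀ᶠ c' in 𝓝 c, P (pt c') := by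
  rw [← map_pt_nhds hc, Filter.eventually_map]

theorem eventually_nhds_prod_pt {X : Type*} [TopologicalSpace X] {y : X} {c : ℂ × ℂ} (hc : c ≠ 0)
    {P : X × P1 → Prop} :
    (∀ᶠ w in 𝓝 (y, pt c), P w) ↔ ∀ᶠ p : X × (ℂ × ℂ) in 𝓝 (y, c), P (p.1, pt p.2) := by
  rw [nhds_prod_eq, nhds_prod_eq, ← map_pt_nhds hc, ← Filter.map_id (f := 𝓝 y),
    Filter.prod_map_map_eq, Filter.eventually_map]
  simp

theorem eventually_ne_zero {X : Type*} [TopologicalSpace X] {y : X} {c : ℂ × ℂ} (hc : c ≠ 0) :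
    ∀ᶠ p : X × (ℂ × ℂ) in 𝓝 (y, c), p.2 ≠ 0 :=
  continuous_snd.continuousAt.eventually_ne hc

instance : CompactSpace P1 := by
  have h : Set.univ = pt '' Metric.sphere (0 : ℂ × ℂ) 1 := by
    symm
    rw [Set.eq_univ_iff_forall]
    intro z
    obtain ⟨c, hc, rfl⟩ := exists_pt z
    refine ⟨(‖c‖⁻¹ : ℂ) • c, ?_, pt_smul hc ?_⟩
    · simp [norm_smul, hc]
    · simpa using hc
  refine ⟨?_⟩
  rw [h]
  refine (isCompact_sphere _ _).image_of_continuousOn fun c hc => ?_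
  exact (continuousAt_pt (by rintro rfl; simp at hc)).continuousWithinAt

theorem continuous_bar : Continuous bar := by
  refine continuous_coinduced_dom.2 ?_
  have : (bar ∘ fun c : {c : ℂ × ℂ // c ≠ 0} => Projectivization.mk ℂ c.1 c.2) =
      fun c : {c : ℂ × ℂ // c ≠ 0} => Projectivization.mk ℂ (cc c.1) (cc_ne c.2) := by
    funext c
    simp only [Function.comp]
    rw [← pt_of_ne c.2, bar_pt c.2, pt_of_ne (cc_ne c.2)]
  rw [this]
  have h2 : Continuous fun c : {c : ℂ × ℂ // c ≠ 0} => cc c.1 := by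
    unfold cc
    fun_prop
  exact continuous_mk.comp (h2.subtype_mk fun c => cc_ne c.2)

theorem cc_cc (c : ℂ × ℂ) : cc (cc c) = c := by simp [cc]

theorem bar_bar (z : P1) : bar (bar z) = z := by
  obtain ⟨c, hc, rfl⟩ := exists_pt z
  rw [bar_pt hc, bar_pt (cc_ne hc), cc_cc]

/-- A condition on neighbourhoods of the points `(y, z)` for all `z ∈ ℙ¹` holds near `y`,
uniformly in `z`. -/
theorem eventually_forall_P1 {X : Type*} [TopologicalSpace X] {y : X} {P : X × P1 → Prop}
    (h : ∀ z, ∀ᶠ w in 𝓝 (y, z), P w) : ∀ᶠ y' in 𝓝 y, ∀ z, P (y', z) := by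
  have := isCompact_univ.eventually_forall_of_forall_eventually (x₀ := y) (K := (Set.univ : Set P1))
    (P := fun y' z => P (y', z)) fun z _ => h z
  simpa using this

/-! ### Homogeneous holomorphic functions -/

section Liouville

variable {W : Type*} [NormedAddCommGroup W] [NormedSpace ℂ W] {G : ℂ × ℂ → W}

theorem differentiable_affine_chart (hd : ∀ c, c ≠ 0 → DifferentiableAt ℂ G c) :
    Differentiable ℂ fun z : ℂ => G (1, z) := fun z =>
  (hd (1, z) (by simp)).comp z ((differentiableAt_const _).prodMk differentiableAt_id)

theorem tendsto_inv_chart (hd : ∀ c, c ≠ 0 → DifferentiableAt ℂ G c) :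
    Filter.Tendsto (fun z : ℂ => G (z⁻¹, 1)) (Filter.cocompact ℂ) (𝓝 (G (0, 1))) := by
  have h1 : Filter.Tendsto (fun z : ℂ => (z⁻¹, (1 : ℂ))) (Filter.cocompact ℂ) (𝓝 (0, 1)) :=
    (Filter.tendsto_inv₀_cobounded.mono_left (by rw [Metric.cobounded_eq_cocompact])).prodMk_nhds
      tendsto_const_nhds
  exact (hd (0, 1) (by simp)).continuousAt.tendsto.comp h1

theorem eventually_ne_cocompact : ∀ᶠ z : ℂ in Filter.cocompact ℂ, z ≠ 0 := by
  filter_upwards [(isCompact_singleton (x := (0 : ℂ))).compl_mem_cocompact] with z hz using hz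

/-- A holomorphic function on `ℂ² ∖ {0}` which is homogeneous of degree `0` is constant. -/
theorem homogeneous_zero_const [CompleteSpace W] (hd : ∀ c, c ≠ 0 → DifferentiableAt ℂ G c)
    (hh : ∀ c, c ≠ 0 → ∀ l : ℂ, l ≠ 0 → G (l • c) = G c) {c c' : ℂ × ℂ} (hc : c ≠ 0)
    (hc' : c' ≠ 0) : G c = G c' := by
  -- In the affine chart, `G (1, z) = G (1/z, 1)` tends to `G (0, 1)` at infinity, so Liouville's
  -- theorem applies.
  have key : ∀ z : ℂ, G (1, z) = G (0, 1) := fun z => by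
    refine (differentiable_affine_chart hd).apply_eq_of_tendsto_cocompact z ?_
    refine (tendsto_inv_chart hd).congr' ?_
    filter_upwards [eventually_ne_cocompact] with z hz
    rw [← hh (z⁻¹, 1) (by simp) z hz]
    simp [hz]
  have key2 : ∀ c, c ≠ 0 → G c = G (0, 1) := by
    rintro ⟨u, v⟩ hc
    by_cases hu : u = 0
    · subst hu
      have hv : v ≠ 0 := by rintro rfl; simp at hc
      rw [← hh (0, 1) (by simp) v hv]
      simp
    · rw [← key (v / u), ← hh (1, v / u) (by simp) u hu]
      simp [mul_div_cancel₀ _ hu]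
  rw [key2 c hc, key2 c' hc']

/-- A holomorphic function on `ℂ² ∖ {0}` which is homogeneous of degree `1` is linear. -/
theorem homogeneous_one_linear [CompleteSpace W] (hd : ∀ c, c ≠ 0 → DifferentiableAt ℂ G c)
    (hh : ∀ c, c ≠ 0 → ∀ l : ℂ, l ≠ 0 → G (l • c) = l • G c) {c : ℂ × ℂ} (hc : c ≠ 0) :
    G c = c.1 • G (1, 0) + c.2 • G (0, 1) := by
  -- The divided difference `(G (1, z) - G (1, 0)) / z` is entire, and for `z ≠ 0` it equals `G
  -- (1/z, 1) - z⁻¹ G (1, 0)`, which tends to `G (0, 1)` at infinity.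
  have key : ∀ z : ℂ, dslope (fun z : ℂ => G (1, z)) 0 z = G (0, 1) := fun z => by
    have h1 : Differentiable ℂ (dslope (fun z : ℂ => G (1, z)) 0) := by
      rw [← differentiableOn_univ, Complex.differentiableOn_dslope Filter.univ_mem,
        differentiableOn_univ]
      exact differentiable_affine_chart hd
    refine h1.apply_eq_of_tendsto_cocompact z ?_
    have h2 : Filter.Tendsto (fun z : ℂ => G (z⁻¹, 1) - z⁻¹ • G (1, 0)) (Filter.cocompact ℂ)
        (𝓝 (G (0, 1) - (0 : ℂ) • G (1, 0))) :=
      (tendsto_inv_chart hd).sub ((Filter.tendsto_inv₀_cobounded.mono_left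
        (by rw [Metric.cobounded_eq_cocompact])).smul_const _)
    rw [zero_smul, sub_zero] at h2
    refine h2.congr' ?_
    filter_upwards [eventually_ne_cocompact] with z hz
    rw [dslope_of_ne _ hz, slope_def_module, sub_zero, smul_sub]
    congr 1
    rw [← hh _ (by simp) _ (inv_ne_zero hz)]
    simp [hz]
  have key1 : ∀ z : ℂ, G (1, z) = G (1, 0) + z • G (0, 1) := fun z => by
    have := sub_smul_dslope (fun z : ℂ => G (1, z)) 0 z
    rw [key, sub_zero] at this
    rw [this]
    abel
  obtain ⟨u, v⟩ := c
  by_cases hu : u = 0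
  · subst hu
    have hv : v ≠ 0 := by rintro rfl; simp at hc
    have := hh (0, 1) (by simp) v hv
    simp only [Prod.smul_mk, smul_eq_mul, mul_zero, mul_one] at this
    simp [this]
  · have := hh (1, v / u) (by simp) u hu
    rw [key1] at this
    simp only [Prod.smul_mk, smul_eq_mul, mul_one, mul_div_cancel₀ _ hu, smul_add, smul_smul]
      at this
    exact this

end Liouville


/-! ### Division in torsors -/

namespace Torsor

variable {Y : Type uX} [TopologicalSpace Y] {G : Type uB} [Group G] {R : (Y → G) → Y → Prop}
  (T : Torsor Y G R)

open Classical in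
/-- The element `g` with `q = p g`, for two points `p` and `q` of the same fibre. -/
def div (p q : T.Tot) : G :=
  if h : T.proj p = T.proj q then (T.existsUnique_act p q h).choose else 1

variable {T}

theorem act_div {p q : T.Tot} (h : T.proj p = T.proj q) : T.act p (T.div p q) = q := by
  rw [div, dif_pos h]
  exact (T.existsUnique_act p q h).choose_spec.1

theorem act_left_inj {p : T.Tot} {g h : G} : T.act p g = T.act p h ↔ g = h :=
  ⟨fun e => (T.existsUnique_act p (T.act p h) (T.proj_act p h).symm).unique e rfl, fun e => e ▸ rfl⟩

theorem div_act (p : T.Tot) (g : G) : T.div p (T.act p g) = g :=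
  act_left_inj.1 (act_div (T.proj_act p g).symm)

theorem div_eq_of_act_eq {p q : T.Tot} {g : G} (h : T.act p g = q) : T.div p q = g := by
  rw [← h, div_act]

theorem div_self (p : T.Tot) : T.div p p = 1 := div_eq_of_act_eq (T.act_one p)

theorem eventually_proj {s : Y → T.Tot} {y : Y} (h : T.IsReg s y) :
    ∀ᶠ y' in 𝓝 y, T.proj (s y') = y' := by
  filter_upwards [T.reg_nhds s y h] with y' hy' using T.reg_proj s y' hy'

theorem eventually_act_div {s s' : Y → T.Tot} {y : Y} (h : T.IsReg s y)
    (h' : ∀ᶠ y' in 𝓝 y, T.proj (s' y') = y') :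
    s' =ᶠ[𝓝 y] fun y' => T.act (s y') (T.div (s y') (s' y')) := by
  filter_upwards [eventually_proj h, h'] with y' h1 h2
  rw [act_div (h1.trans h2.symm)]

/-- Regularity of a section becomes smoothness of a group-valued function; this is how sections of
all torsors below are tested. -/
theorem isReg_iff_div {s s' : Y → T.Tot} {y : Y} (h : T.IsReg s y)
    (h' : ∀ᶠ y' in 𝓝 y, T.proj (s' y') = y') :
    T.IsReg s' y ↔ R (fun y' => T.div (s y') (s' y')) y := by
  rw [← T.reg_act s y h]
  have := eventually_act_div h h'
  exact ⟨T.reg_congr _ _ _ this, T.reg_congr _ _ _ this.symm⟩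

theorem reg_div {s s' : Y → T.Tot} {y : Y} (h : T.IsReg s y) (h' : T.IsReg s' y) :
    R (fun y' => T.div (s y') (s' y')) y :=
  (isReg_iff_div h (eventually_proj h')).1 h'

end Torsor

/-! ### Smooth functions which are holomorphic in the second variable -/

section SmoothHol

variable {E : Type*} [NormedAddCommGroup E] [NormedSpace ℝ E]
  {C : Type*} [NormedAddCommGroup C] [NormedSpace ℂ C]
  {C' : Type*} [NormedAddCommGroup C'] [NormedSpace ℂ C']
  {W : Type*} [NormedAddCommGroup W] [NormedSpace ℂ W]
  {W' : Type*} [NormedAddCommGroup W'] [NormedSpace ℂ W']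

/-- A function is smooth near a point, and holomorphic in the second variable. -/
def SmoothHolAt (f : E × C → W) (p : E × C) : Prop :=
  ∀ᶠ q in 𝓝 p, ContDiffAt ℝ ∞ f q ∧ DifferentiableAt ℂ (fun c => f (q.1, c)) q.2

namespace SmoothHolAt

variable {f f' : E × C → W} {p : E × C}

theorem eventually (h : SmoothHolAt f p) : ∀ᶠ q in 𝓝 p, SmoothHolAt f q :=
  eventually_eventually_nhds.2 h

theorem contDiffAt (h : SmoothHolAt f p) : ContDiffAt ℝ ∞ f p := h.self_of_nhds.1

theorem continuousAt (h : SmoothHolAt f p) : ContinuousAt f p := h.contDiffAt.continuousAt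

theorem differentiableAt (h : SmoothHolAt f p) :
    DifferentiableAt ℂ (fun c => f (p.1, c)) p.2 := h.self_of_nhds.2

theorem eventually_snd {P : E × C → Prop} (h : ∀ᶠ q in 𝓝 p, P q) :
    ∀ᶠ c in 𝓝 p.2, P (p.1, c) :=
  (continuous_const.prodMk continuous_id).continuousAt.eventually h

theorem eventually_fst {P : E × C → Prop} (h : ∀ᶠ q in 𝓝 p, P q) :
    ∀ᶠ e in 𝓝 p.1, P (e, p.2) :=
  (continuous_id.prodMk continuous_const).continuousAt.eventually h

theorem congr (h : SmoothHolAt f p) (e : f' =ᶠ[𝓝 p] f) : SmoothHolAt f' p := by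
  filter_upwards [h, e.eventuallyEq_nhds] with q hq hq'
  exact ⟨hq.1.congr_of_eventuallyEq hq', hq.2.congr_of_eventuallyEq (eventually_snd hq')⟩

theorem comp_of_eventually {Φ : W → W'} (hΦ : ∀ᶠ w in 𝓝 (f p), ContDiffAt ℂ ∞ Φ w)
    (h : SmoothHolAt f p) : SmoothHolAt (fun q => Φ (f q)) p := by
  filter_upwards [h, h.continuousAt.eventually hΦ] with q hq hq'
  exact ⟨(hq'.restrict_scalars ℝ).comp q hq.1, (hq'.differentiableAt (by simp)).comp q.2 hq.2⟩

theorem of_fst {u : E → W} (h : ∀ᶠ e in 𝓝 p.1, ContDiffAt ℝ ∞ u e) :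
    SmoothHolAt (fun q : E × C => u q.1) p := by
  filter_upwards [continuous_fst.continuousAt.eventually h] with q hq
  exact ⟨hq.comp q contDiffAt_fst, differentiableAt_const _⟩

theorem of_snd {t : C → W} (h : ∀ᶠ c in 𝓝 p.2, ContDiffAt ℂ ∞ t c) :
    SmoothHolAt (fun q : E × C => t q.2) p := by
  filter_upwards [continuous_snd.continuousAt.eventually h] with q hq
  exact ⟨(hq.restrict_scalars ℝ).comp q contDiffAt_snd, hq.differentiableAt (by simp)⟩

theorem comp_snd {t : C' → C} {e : E} {c : C'} (h : SmoothHolAt f (e, t c))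
    (ht : ∀ᶠ c in 𝓝 c, ContDiffAt ℂ ∞ t c) :
    SmoothHolAt (fun q : E × C' => f (q.1, t q.2)) (e, c) := by
  have hc : ContinuousAt (fun q : E × C' => (q.1, t q.2)) (e, c) :=
    continuousAt_fst.prodMk
      (ContinuousAt.comp (f := Prod.snd) ht.self_of_nhds.continuousAt continuousAt_snd)
  filter_upwards [hc.eventually h, continuous_snd.continuousAt.eventually ht] with q hq hq'
  constructor
  · exact ContDiffAt.comp (f := fun q : E × C' => (q.1, t q.2)) q hq.1
      (contDiffAt_fst.prodMk ((hq'.restrict_scalars ℝ).comp q contDiffAt_snd))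
  · exact DifferentiableAt.comp (g := fun c => f (q.1, c)) q.2 hq.2
      (hq'.differentiableAt (by simp))

theorem smul {l : E × C → ℂ} (hl : SmoothHolAt l p) (h : SmoothHolAt f p) :
    SmoothHolAt (fun q => l q • f q) p := by
  filter_upwards [hl, h] with q hq hq'
  exact ⟨hq.1.smul hq'.1, hq.2.smul hq'.2⟩

theorem sub (h : SmoothHolAt f p) (h' : SmoothHolAt f' p) :
    SmoothHolAt (fun q => f q - f' q) p := by
  filter_upwards [h, h'] with q hq hq'
  exact ⟨hq.1.sub hq'.1, hq.2.sub hq'.2⟩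

section Ring

variable {A : Type*} [NormedRing A] [NormedAlgebra ℂ A] {f f' : E × C → A}

theorem mul (h : SmoothHolAt f p) (h' : SmoothHolAt f' p) :
    SmoothHolAt (fun q => f q * f' q) p := by
  filter_upwards [h, h'] with q hq hq'
  exact ⟨hq.1.mul hq'.1, hq.2.mul hq'.2⟩

theorem ringInverse [CompleteSpace A] (h : SmoothHolAt f p) (hu : IsUnit (f p)) :
    SmoothHolAt (fun q => Ring.inverse (f q)) p := by
  refine h.comp_of_eventually ?_
  filter_upwards [Units.isOpen.mem_nhds hu] with w hw
  obtain ⟨u, rfl⟩ := hw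
  exact contDiffAt_ringInverse ℂ u

end Ring

end SmoothHolAt

end SmoothHol

/-! ### Expressions in charts -/

section Charts

variable {E : Type uE} [NormedAddCommGroup E] [NormedSpace ℂ E]
variable {X : Type uX} [TopologicalSpace X] [ChartedSpace E X]

/-- All calculus takes place over `ℝ`, and the complex analytic changes of charts are real smooth by
restriction of scalars. -/
theorem isManifold_real [IsManifold 𝓘(ℂ, E) ω X] : IsManifold 𝓘(ℝ, E) ∞ X := by
  refine isManifold_of_contDiffOn 𝓘(ℝ, E) ∞ X fun e e' he he' => ?_
  have h : e.symm.trans e' ∈ contDiffGroupoid ω 𝓘(ℂ, E) :=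
    HasGroupoid.compatible he he'
  rw [contDiffGroupoid, mem_groupoid_of_pregroupoid] at h
  have h1 := h.1
  simp only [contDiffPregroupoid] at h1
  have h2 := (h1.restrict_scalars ℝ).of_le (m := ∞) (by exact mod_cast le_top)
  simpa using h2

variable [IsManifold 𝓘(ℝ, E) ∞ X]

section

variable {V : Type*} [NormedAddCommGroup V] [NormedSpace ℝ V]

theorem contMDiffAt_chart_symm' {y₀ : X} {e : E} (he : e ∈ (chartAt E y₀).target) :
    ContMDiffAt 𝓘(ℝ, E) 𝓘(ℝ, E) ∞ (chartAt E y₀).symm e :=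
  (contMDiffOn_chart_symm (x := y₀)).contMDiffAt ((chartAt E y₀).open_target.mem_nhds he)

theorem contMDiffAt_chart' {y₀ y : X} (hy : y ∈ (chartAt E y₀).source) :
    ContMDiffAt 𝓘(ℝ, E) 𝓘(ℝ, E) ∞ (chartAt E y₀) y :=
  (contMDiffOn_chart (x := y₀)).contMDiffAt ((chartAt E y₀).open_source.mem_nhds hy)

/-- The chart is that of a fixed `y₀` and not of the moving point `y`, as is needed for statements
about all `y` near `y₀`. -/
theorem contMDiffAt_iff_chart {f : X → V} {y₀ y : X} (hy : y ∈ (chartAt E y₀).source) :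
    ContMDiffAt 𝓘(ℝ, E) 𝓘(ℝ, V) ∞ f y ↔
      ContDiffAt ℝ ∞ (fun e => f ((chartAt E y₀).symm e)) (chartAt E y₀ y) := by
  rw [← contMDiffAt_iff_contDiffAt]
  constructor
  · intro h
    refine ContMDiffAt.comp (g := f) _ ?_
      (contMDiffAt_chart_symm' ((chartAt E y₀).map_source hy))
    rwa [(chartAt E y₀).left_inv hy]
  · intro h
    refine (h.comp y (contMDiffAt_chart' hy)).congr_of_eventuallyEq ?_
    filter_upwards [(chartAt E y₀).open_source.mem_nhds hy] with y' hy'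
    simp [(chartAt E y₀).left_inv hy']

theorem eventually_chart_iff {y₀ y : X} (hy : y ∈ (chartAt E y₀).source) {P : E → Prop} :
    (∀ᶠ e in 𝓝 (chartAt E y₀ y), P e) ↔ ∀ᶠ y' in 𝓝 y, P (chartAt E y₀ y') := by
  rw [← (chartAt E y₀).map_nhds_eq hy, Filter.eventually_map]

theorem smoothNear_iff_chart {f : X → V} {y₀ y : X} (hy : y ∈ (chartAt E y₀).source) :
    SmoothNear E f y ↔
      ∀ᶠ e in 𝓝 (chartAt E y₀ y), ContDiffAt ℝ ∞ (fun e => f ((chartAt E y₀).symm e)) e := by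
  rw [eventually_chart_iff hy]
  refine Filter.eventually_congr ?_
  filter_upwards [(chartAt E y₀).open_source.mem_nhds hy] with y' hy'
  exact contMDiffAt_iff_chart hy'

end

variable {C : Type*} [NormedAddCommGroup C] [NormedSpace ℝ C]
variable {W : Type*} [NormedAddCommGroup W] [NormedSpace ℝ W]

theorem contMDiffAt_prod_iff_chart {f : X × C → W} {y₀ y : X} {c : C}
    (hy : y ∈ (chartAt E y₀).source) :
    ContMDiffAt (𝓘(ℝ, E).prod 𝓘(ℝ, C)) 𝓘(ℝ, W) ∞ f (y, c) ↔
      ContDiffAt ℝ ∞ (fun q : E × C => f ((chartAt E y₀).symm q.1, q.2)) (chartAt E y₀ y, c) := by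
  have key : ∀ (F : E × C → W) (q : E × C),
      ContMDiffAt (𝓘(ℝ, E).prod 𝓘(ℝ, C)) 𝓘(ℝ, W) ∞ F q ↔ ContDiffAt ℝ ∞ F q := fun F q => by
    rw [← contMDiffAt_iff_contDiffAt, modelWithCornersSelf_prod, ← chartedSpaceSelf_prod]
  rw [← key]
  constructor
  · intro h
    refine ContMDiffAt.comp (g := f) (f := fun q : E × C => ((chartAt E y₀).symm q.1, q.2))
      (chartAt E y₀ y, c) ?_ (ContMDiffAt.prodMk
        (ContMDiffAt.comp (g := (chartAt E y₀).symm) (f := Prod.fst) _ (contMDiffAt_chart_symm'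
          ((chartAt E y₀).map_source hy)) contMDiffAt_fst) contMDiffAt_snd)
    simpa only [(chartAt E y₀).left_inv hy] using h
  · intro h
    refine (ContMDiffAt.comp (f := fun q : X × C => (chartAt E y₀ q.1, q.2)) (y, c) h
      ((ContMDiffAt.comp (g := chartAt E y₀) (f := Prod.fst) (y, c) (contMDiffAt_chart' hy)
        contMDiffAt_fst).prodMk contMDiffAt_snd)).congr_of_eventuallyEq ?_
    filter_upwards [continuous_fst.continuousAt.eventually
      ((chartAt E y₀).open_source.mem_nhds hy)] with y' hy'
    simp [(chartAt E y₀).left_inv hy']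

theorem eventually_chart_prod_iff {C : Type*} [TopologicalSpace C] {y₀ y : X} {c : C}
    (hy : y ∈ (chartAt E y₀).source)
    {P : E × C → Prop} :
    (∀ᶠ q in 𝓝 (chartAt E y₀ y, c), P q) ↔
      ∀ᶠ q : X × C in 𝓝 (y, c), P (chartAt E y₀ q.1, q.2) := by
  rw [nhds_prod_eq, nhds_prod_eq, ← (chartAt E y₀).map_nhds_eq hy, ← Filter.map_id (f := 𝓝 c),
    Filter.prod_map_map_eq, Filter.eventually_map]
  simp

end Charts

/-! ### Smooth holomorphic functions in charts -/

section ChartsHol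

variable {E : Type uE} [NormedAddCommGroup E] [NormedSpace ℂ E]
variable {X : Type uX} [TopologicalSpace X] [ChartedSpace E X] [IsManifold 𝓘(ℝ, E) ∞ X]
variable {W : Type*} [NormedAddCommGroup W] [NormedSpace ℂ W]

theorem smoothHolNear_iff_chart {f : X → ℂ × ℂ → W} {y₀ y : X} {c : ℂ × ℂ}
    (hy : y ∈ (chartAt E y₀).source) :
    SmoothHolNear E f y c ↔
      SmoothHolAt (fun q : E × (ℂ × ℂ) => f ((chartAt E y₀).symm q.1) q.2)
        (chartAt E y₀ y, c) := by
  unfold SmoothHolAt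
  rw [eventually_chart_prod_iff hy]
  refine Filter.eventually_congr ?_
  filter_upwards [continuous_fst.continuousAt.eventually
    ((chartAt E y₀).open_source.mem_nhds hy)] with p hp
  rw [← contMDiffAt_prod_iff_chart (f := fun p' : X × (ℂ × ℂ) => f p'.1 p'.2) hp]
  simp [(chartAt E y₀).left_inv hp]

variable {B : Type uB} [NormedRing B] [NormedAlgebra ℝ B]

/-- The definition of `SmoothHolUnits` quantifies over all representatives of a point of `ℙ¹`. One
is enough, since any two differ by a scalar and scaling is holomorphic. -/
theorem smoothHolUnits_iff_chart {g : X × P1 → (Cx B)ˣ} {y₀ y : X} {c : ℂ × ℂ} (hc : c ≠ 0)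
    (hy : y ∈ (chartAt E y₀).source) :
    SmoothHolUnits E g (y, pt c) ↔
      SmoothHolAt (fun q : E × (ℂ × ℂ) => (g ((chartAt E y₀).symm q.1, pt q.2)).val)
        (chartAt E y₀ y, c) := by
  constructor
  · intro h
    exact (smoothHolNear_iff_chart (f := fun y c => (g (y, pt c)).val) hy).1 (h c hc rfl)
  · intro h c' hc' e
    obtain ⟨l, hl, rfl⟩ := exists_smul_of_pt_eq hc hc' (Eq.symm e)
    refine (smoothHolNear_iff_chart (f := fun y c => (g (y, pt c)).val) hy).2 ?_
    have h1 := SmoothHolAt.comp_snd (C' := ℂ × ℂ) (t := fun c => l • c) h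
      (.of_forall fun _ => contDiffAt_id.const_smul l)
    refine h1.congr ?_
    filter_upwards [continuous_snd.continuousAt.eventually_ne (y := (0 : ℂ × ℂ)) hc'] with q hq
    simp only [pt_smul hq hl]

theorem smoothHolUnits_iff {g : X × P1 → (Cx B)ˣ} {y : X} {c : ℂ × ℂ} (hc : c ≠ 0) :
    SmoothHolUnits E g (y, pt c) ↔
      SmoothHolAt (fun q : E × (ℂ × ℂ) => (g ((chartAt E y).symm q.1, pt q.2)).val)
        (chartAt E y y, c) :=
  smoothHolUnits_iff_chart hc (mem_chart_source E y)

namespace SmoothHolUnits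

variable [CompleteSpace B] {g h : X × P1 → (Cx B)ˣ} {w : X × P1}

theorem mul' (hg : SmoothHolUnits E g w) (hh : SmoothHolUnits E h w) :
    SmoothHolUnits E (fun w => g w * h w) w := by
  obtain ⟨y, z⟩ := w
  obtain ⟨c, hc, rfl⟩ := exists_pt z
  rw [smoothHolUnits_iff hc] at *
  exact hg.mul hh

theorem inv' (hg : SmoothHolUnits E g w) : SmoothHolUnits E (fun w => (g w)⁻¹) w := by
  obtain ⟨y, z⟩ := w
  obtain ⟨c, hc, rfl⟩ := exists_pt z
  rw [smoothHolUnits_iff hc] at *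
  simpa only [Ring.inverse_unit] using hg.ringInverse (Units.isUnit _)

end SmoothHolUnits

end ChartsHol


/-! ### Real structure of the complexification -/

namespace Cx

variable {B : Type uB} [NormedRing B] [NormedAlgebra ℝ B]

/-- The real part, as a continuous real linear map. -/
def reL : Cx B →L[ℝ] B := (ContinuousLinearMap.fst ℝ B B).comp (toProd (B := B)).toContinuousLinearMap

/-- The inclusion of `B`, as a continuous real linear map. -/
def ofBaseL : B →L[ℝ] Cx B :=
  (toProd (B := B)).symm.toContinuousLinearMap.comp (ContinuousLinearMap.inl ℝ B B)

/-- Complex conjugation, as a continuous real linear map. -/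
def conjL : Cx B →L[ℝ] Cx B :=
  (toProd (B := B)).symm.toContinuousLinearMap.comp
    (((ContinuousLinearMap.id ℝ B).prodMap (-ContinuousLinearMap.id ℝ B)).comp
      (toProd (B := B)).toContinuousLinearMap)

@[simp] theorem reL_apply (z : Cx B) : reL z = z.re := rfl
@[simp] theorem ofBaseL_apply (b : B) : ofBaseL b = ofBase b := rfl
@[simp] theorem conjL_apply (z : Cx B) : conjL z = conj z := rfl

theorem conj_smul (l : ℂ) (z : Cx B) : conj (l • z) = (starRingEnd ℂ l) • conj z := by
  ext <;> simp; abel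

theorem conj_conj (z : Cx B) : conj (conj z) = z := by ext <;> simp

theorem conj_ofBase (b : B) : conj (ofBase b) = ofBase b := by ext <;> simp

theorem conj_eq_iff {z : Cx B} : conj z = z ↔ z = ofBase z.re := by
  constructor
  · intro h
    have h2 : -z.im = z.im := congrArg Cx.im h
    have h3 : z.im = 0 := by
      have h4 : (2 : ℝ) • z.im = 0 := by
        rw [two_smul]
        nth_rewrite 1 [← h2]
        simp
      simpa using h4
    ext <;> simp [h3]
  · intro h
    rw [h, conj_ofBase]

theorem ofBase_injective : Function.Injective (ofBase : B → Cx B) := fun _ _ h =>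
  congrArg Cx.re h

theorem ofBase_mul (a b : B) : ofBase (a * b) = ofBase a * ofBase b := map_mul ofBaseHom a b

theorem ofBase_add (a b : B) : ofBase (a + b) = ofBase a + ofBase b := map_add (ofBaseL (B := B)) a b

theorem ofBase_zero : ofBase (0 : B) = 0 := rfl

/-- Complex conjugation on the group `(B ⊗ ℂ)ˣ`. -/
abbrev conjU : (Cx B)ˣ →* (Cx B)ˣ := Units.map (conj (B := B)).toMonoidHom

theorem conjU_val (g : (Cx B)ˣ) : (conjU g).val = conj g.val := rfl

theorem conjU_conjU (g : (Cx B)ˣ) : conjU (conjU g) = g := by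
  ext1
  exact conj_conj _

end Cx

section Unitary

variable {B : Type uB} [NormedRing B] [NormedAlgebra ℝ B] [StarRing B]

theorem unitaryToCx_val (u : unitary B) : (unitaryToCx u).val = Cx.ofBase (u : B) := rfl

theorem unitaryToCx_inv_val (u : unitary B) :
    ((unitaryToCx u)⁻¹ : (Cx B)ˣ).val = Cx.ofBase (star (u : B)) := rfl

theorem unitaryToCx_injective : Function.Injective (unitaryToCx : unitary B → (Cx B)ˣ) :=
  fun u v h => Subtype.ext (Cx.ofBase_injective (congrArg Units.val h))

theorem conjU_unitaryToCx (u : unitary B) : Cx.conjU (unitaryToCx u) = unitaryToCx u := by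
  ext1
  exact Cx.conj_ofBase _

theorem cartan_unitaryToCx (u : unitary B) : Cx.cartan (unitaryToCx u) = unitaryToCx u := by
  ext1
  rw [Cx.cartan_val, unitaryToCx_inv_val, Cx.conj_ofBase, unitaryToCx_val]
  ext <;> simp

/-- The fixed points of complex conjugation and of `Cτ` on `(B ⊗ ℂ)ˣ` are the unitary elements
of `B`. -/
theorem exists_unitary_of_fixed {g : (Cx B)ˣ} (h1 : Cx.conjU g = g) (h2 : Cx.cartan g = g) :
    ∃ u : unitary B, unitaryToCx u = g := by
  -- Invariance under conjugation puts `g` in `B`; then `Cτ(g) = g` reads `g⁻¹ = g^*`.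
  have e1 : g.val = Cx.ofBase g.val.re := Cx.conj_eq_iff.1 (congrArg Units.val h1)
  have e3 : (g⁻¹ : (Cx B)ˣ).val = star g.val := by
    have : (Cx.cartan g)⁻¹ = g⁻¹ := by rw [h2]
    rw [← this, Cx.cartan_inv]
    exact congrArg star (congrArg Units.val h1)
  refine ⟨⟨g.val.re, ?_⟩, Units.ext e1.symm⟩
  rw [Unitary.mem_iff]
  have e4 : star (Cx.ofBase g.val.re) = Cx.ofBase (star g.val.re) := by ext <;> simp
  have e5 : (g⁻¹ : (Cx B)ˣ).val = Cx.ofBase (star g.val.re) := by rw [e3, ← e4, ← e1]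
  constructor
  · apply Cx.ofBase_injective
    rw [Cx.ofBase_mul, ← e5, ← e1, g.inv_mul]
    rfl
  · apply Cx.ofBase_injective
    rw [Cx.ofBase_mul, ← e5, ← e1, g.mul_inv]
    rfl

end Unitary

/-! ### More smooth holomorphic functions -/

/-- A real differentiable map whose derivative is complex linear is complex differentiable. -/
theorem differentiableAt_complex_of_fderiv {F G : Type*} [NormedAddCommGroup F] [NormedSpace ℂ F]
    [NormedAddCommGroup G] [NormedSpace ℂ G] {f : F → G} {x : F} {L : F →L[ℝ] G}
    (h : HasFDerivAt f L x) (hL : ∀ v, L (Complex.I • v) = Complex.I • L v) :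
    DifferentiableAt ℂ f x := by
  have hsm : ∀ (c : ℂ) v, L (c • v) = c • L v := fun c v => by
    have : ∀ (r : ℝ) (w : F), L ((r : ℂ) • w) = (r : ℂ) • L w := fun r w => by
      rw [Complex.coe_smul, Complex.coe_smul, map_smul]
    rw [← Complex.re_add_im c, add_smul, map_add, mul_smul, this, this, hL, add_smul, mul_smul]
  let L' : F →L[ℂ] G := { toFun := L, map_add' := map_add L, map_smul' := hsm, cont := L.cont }
  exact (hasFDerivAt_of_restrictScalars ℝ (f' := L') h (by ext; rfl)).differentiableAt

/-- Schwarz reflection: the complex linear derivative of `f` is composed with an antilinear map on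
each side, and the result is complex linear again. -/
theorem DifferentiableAt.conj_cc {B : Type uB} [NormedRing B] [NormedAlgebra ℝ B]
    {f : ℂ × ℂ → Cx B} {c : ℂ × ℂ} (h : DifferentiableAt ℂ f (cc c)) :
    DifferentiableAt ℂ (fun c => Cx.conj (f (cc c))) c := by
  let ccL : (ℂ × ℂ) →L[ℝ] (ℂ × ℂ) :=
    (Complex.conjCLE : ℂ →L[ℝ] ℂ).prodMap (Complex.conjCLE : ℂ →L[ℝ] ℂ)
  have h1 : HasFDerivAt (fun c => Cx.conj (f (cc c)))
      (Cx.conjL.comp (((fderiv ℂ f (cc c)).restrictScalars ℝ).comp ccL)) c :=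
    (Cx.conjL (B := B)).hasFDerivAt.comp c
      ((h.hasFDerivAt.restrictScalars ℝ).comp c ccL.hasFDerivAt)
  refine differentiableAt_complex_of_fderiv h1 fun v => ?_
  have e : ccL (Complex.I • v) = (-Complex.I) • ccL v := by
    ext1 <;> simp [ccL]
  simp only [ContinuousLinearMap.comp_apply, ContinuousLinearMap.coe_restrictScalars', e,
    map_smul, Cx.conjL_apply, Cx.conj_smul]
  simp

section Closure

variable {E : Type uE} [NormedAddCommGroup E] [NormedSpace ℂ E]
variable {X : Type uX} [TopologicalSpace X] [ChartedSpace E X] [IsManifold 𝓘(ℝ, E) ∞ X]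
variable {B : Type uB} [NormedRing B] [NormedAlgebra ℝ B]

theorem contDiff_cc : ContDiff ℝ ∞ cc := by
  have : cc = ((Complex.conjCLE : ℂ →L[ℝ] ℂ).prodMap (Complex.conjCLE : ℂ →L[ℝ] ℂ)) := by
    ext <;> rfl
  rw [this]
  exact ContinuousLinearMap.contDiff _

theorem SmoothHolAt.conj_cc {f : E × (ℂ × ℂ) → Cx B} {e : E} {c : ℂ × ℂ}
    (h : SmoothHolAt f (e, cc c)) :
    SmoothHolAt (fun q : E × (ℂ × ℂ) => Cx.conj (f (q.1, cc q.2))) (e, c) := by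
  have hc : ContinuousAt (fun q : E × (ℂ × ℂ) => (q.1, cc q.2)) (e, c) :=
    continuousAt_fst.prodMk (contDiff_cc.continuous.continuousAt.comp continuousAt_snd)
  filter_upwards [hc.eventually h] with q hq
  constructor
  · exact (Cx.conjL (B := B)).contDiff.contDiffAt.comp q
      (ContDiffAt.comp (f := fun q : E × (ℂ × ℂ) => (q.1, cc q.2)) q hq.1
        (contDiffAt_fst.prodMk (contDiff_cc.contDiffAt.comp q contDiffAt_snd)))
  · exact DifferentiableAt.conj_cc (f := fun c => f (q.1, c)) hq.2

theorem SmoothHolUnits.conj_bar {g : X × P1 → (Cx B)ˣ} {w : X × P1}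
    (h : SmoothHolUnits E g w) :
    SmoothHolUnits E (fun w' => Cx.conjU (g (w'.1, bar w'.2))) (w.1, bar w.2) := by
  obtain ⟨y, z⟩ := w
  obtain ⟨c, hc, rfl⟩ := exists_pt z
  rw [smoothHolUnits_iff hc] at h
  simp only [bar_pt hc]
  rw [smoothHolUnits_iff (cc_ne hc)]
  rw [← cc_cc c] at h
  refine h.conj_cc.congr ?_
  filter_upwards [eventually_ne_zero (cc_ne hc)] with q hq
  simp [bar_pt hq, Cx.conjU_val]

/-- A function of the point of `X` alone. -/
theorem smoothHolUnits_fst_iff {k : X → (Cx B)ˣ} {y : X} {z : P1} :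
    SmoothHolUnits E (fun w => k w.1) (y, z) ↔ SmoothNear E (fun y' => (k y').val) y := by
  obtain ⟨c, hc, rfl⟩ := exists_pt z
  rw [smoothHolUnits_iff hc, smoothNear_iff_chart (mem_chart_source E y)]
  constructor
  · intro h
    filter_upwards [SmoothHolAt.eventually_fst h] with e he
    exact ContDiffAt.comp (f := fun e : E => (e, c)) e he.1 (contDiffAt_id.prodMk contDiffAt_const)
  · intro h
    exact SmoothHolAt.of_fst (p := (chartAt E y y, c)) h

theorem smoothHolUnits_const (k : (Cx B)ˣ) (w : X × P1) :
    SmoothHolUnits E (fun _ => k) w :=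
  smoothHolUnits_fst_iff (k := fun _ => k).2 (.of_forall fun _ => contMDiffAt_const)

variable [StarRing B]

/-- The inclusion of `B` and the real part are continuous real linear maps, which transport
smoothness between `U(B)` and `(B ⊗ ℂ)ˣ` in both directions. -/
theorem smoothHolUnits_unitary_iff {u : X → unitary B} {y : X} {z : P1} :
    SmoothHolUnits E (fun w => unitaryToCx (u w.1)) (y, z) ↔ SmoothUnitary E u y := by
  rw [smoothHolUnits_fst_iff (k := fun y => unitaryToCx (u y))]
  constructor
  · intro h
    filter_upwards [h] with y' hy'
    exact (Cx.reL (B := B)).contMDiff.contMDiffAt.comp y' hy'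
  · intro h
    filter_upwards [h] with y' hy'
    exact (Cx.ofBaseL (B := B)).contMDiff.contMDiffAt.comp y' hy'

end Closure

/-! ### Sections over a projective line -/

section Fibre

variable {E : Type uE} [NormedAddCommGroup E] [NormedSpace ℂ E]
variable {X : Type uX} [TopologicalSpace X] [ChartedSpace E X] [IsManifold 𝓘(ℝ, E) ∞ X]
variable {B : Type uB} [NormedRing B] [NormedAlgebra ℝ B]

theorem SmoothHolUnits.differentiableAt {g : X × P1 → (Cx B)ˣ} {y : X} {c : ℂ × ℂ} (hc : c ≠ 0)
    (h : SmoothHolUnits E g (y, pt c)) :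
    DifferentiableAt ℂ (fun c => (g (y, pt c)).val) c :=
  (h c hc rfl).self_of_nhds.2

variable {T : Torsor (X × P1) (Cx B)ˣ (SmoothHolUnits E)}

theorem isFibreSection_of_reg {S : X × P1 → T.Tot} {y : X} (h : ∀ z, T.IsReg S (y, z)) :
    T.IsFibreSection y fun z => S (y, z) :=
  fun z => ⟨S, h z, rfl, .of_forall fun _ => rfl⟩

theorem Torsor.IsFibreSection.proj {y : X} {f : P1 → T.Tot} (h : T.IsFibreSection y f) (z : P1) :
    T.proj (f z) = (y, z) := by
  obtain ⟨s, h1, h2, -⟩ := h z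
  rw [h2, T.reg_proj _ _ h1]

theorem Torsor.IsFibreSection.act {y : X} {f : P1 → T.Tot} (h : T.IsFibreSection y f)
    (k : (Cx B)ˣ) : T.IsFibreSection y fun z => T.act (f z) k := by
  intro z
  obtain ⟨s, h1, h2, h3⟩ := h z
  refine ⟨fun w => T.act (s w) k, (T.reg_act s _ h1 _).2 (smoothHolUnits_const k _),
    congrArg (fun p => T.act p k) h2, ?_⟩
  filter_upwards [h3] with z' hz'
  rw [hz']

/-- Liouville on `ℙ¹`: pulled back to `ℂ² ∖ {0}`, `g` is homogeneous of degree `0`. This is why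
sections of a fibre form a torsor under constants. -/
theorem eq_of_fibre_hol [CompleteSpace B] {g : P1 → (Cx B)ˣ}
    (h : ∀ c, c ≠ 0 → DifferentiableAt ℂ (fun c => (g (pt c)).val) c) (z z' : P1) :
    g z = g z' := by
  obtain ⟨c, hc, rfl⟩ := exists_pt z
  obtain ⟨c', hc', rfl⟩ := exists_pt z'
  ext1
  exact homogeneous_zero_const (G := fun c => (g (pt c)).val) h
    (fun c hc l hl => by rw [pt_smul hc hl]) hc hc'

/-- Two sections over the same projective line differ by a constant. -/
theorem Torsor.IsFibreSection.exists_act [CompleteSpace B] {y : X} {f f' : P1 → T.Tot}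
    (h : T.IsFibreSection y f) (h' : T.IsFibreSection y f') :
    ∃ k : (Cx B)ˣ, ∀ z, f' z = T.act (f z) k := by
  have hp : ∀ z, T.proj (f z) = T.proj (f' z) := fun z => by rw [h.proj, h'.proj]
  refine ⟨T.div (f (pt (1, 0))) (f' (pt (1, 0))), fun z => ?_⟩
  rw [← eq_of_fibre_hol (g := fun z => T.div (f z) (f' z)) (fun c hc => ?_) z]
  · exact (act_div (hp z)).symm
  · obtain ⟨s, h1, h2, h3⟩ := h (pt c)
    obtain ⟨s', h1', h2', h3'⟩ := h' (pt c)
    have := (reg_div h1 h1').differentiableAt hc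
    refine this.congr_of_eventuallyEq ?_
    filter_upwards [(eventually_nhds_pt hc).1 h3, (eventually_nhds_pt hc).1 h3'] with c' e e'
    rw [e, e']

end Fibre


/-! ### Forms in charts, gauge transformations and curvature -/

section FormsInCharts

variable {E : Type uE} [NormedAddCommGroup E] [NormedSpace ℂ E]
variable {X : Type uX} [TopologicalSpace X] [ChartedSpace E X] [IsManifold 𝓘(ℝ, E) ∞ X]
variable {V : Type*} [NormedAddCommGroup V] [NormedSpace ℝ V]

theorem mem_target_self (y : X) : chartAt E y y ∈ (chartAt E y).target := mem_chart_target E y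

theorem symm_self (y : X) : (chartAt E y).symm (chartAt E y y) = y :=
  (chartAt E y).left_inv (mem_chart_source E y)

theorem eventually_mem_target (y : X) :
    ∀ᶠ e in 𝓝 (chartAt E y y), e ∈ (chartAt E y).target :=
  (chartAt E y).open_target.mem_nhds (mem_target_self y)

theorem eventually_symm {y : X} {P : X → Prop} (h : ∀ᶠ y' in 𝓝 y, P y') :
    ∀ᶠ e in 𝓝 (chartAt E y y), P ((chartAt E y).symm e) := by
  have := (chartAt E y).continuousAt_symm (mem_target_self y)
  rw [ContinuousAt, symm_self] at this
  exact this.eventually h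

theorem mdifferentiableAt_chart_symm {y : X} {e : E} (he : e ∈ (chartAt E y).target) :
    MDifferentiableAt 𝓘(ℝ, E) 𝓘(ℝ, E) (chartAt E y).symm e :=
  (contMDiffAt_chart_symm' he).mdifferentiableAt (by simp)

/-- Tangent vectors at `y` are read in the chart at `y`, whose inverse therefore has the identity as
its derivative at the centre. At other points of the chart domain `chartD` compares two different
charts. -/
theorem chartD_self (y : X) : chartD y (chartAt E y y) = ContinuousLinearMap.id ℝ E := by
  have h1 : (chartAt E y ∘ (chartAt E y).symm) =ᶠ[𝓝 (chartAt E y y)] id := by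
    filter_upwards [eventually_mem_target y] with e he
    simp [(chartAt E y).right_inv he]
  have h : HasMFDerivAt 𝓘(ℝ, E) 𝓘(ℝ, E) (chartAt E y).symm (chartAt E y y)
      (ContinuousLinearMap.id ℝ E) := by
    refine ⟨(chartAt E y).continuousAt_symm (mem_target_self y), ?_⟩
    simp only [writtenInExtChartAt, extChartAt, mfld_simps, symm_self]
    exact ((hasFDerivAt_id _).congr_of_eventuallyEq h1).hasFDerivWithinAt
  exact h.mfderiv

theorem localForm_self (α : X → E →L[ℝ] V) (y : X) :
    localForm y α (chartAt E y y) = α y := by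
  unfold localForm
  rw [chartD_self, symm_self]
  rfl

theorem localForm_congr {α β : X → E →L[ℝ] V} {y : X} (h : α =ᶠ[𝓝 y] β) :
    localForm y α =ᶠ[𝓝 (chartAt E y y)] localForm y β := by
  filter_upwards [eventually_symm h] with e he
  unfold localForm
  rw [he]

theorem localForm_dFun {f : X → V} {y : X} {e : E} (he : e ∈ (chartAt E y).target)
    (hf : ContMDiffAt 𝓘(ℝ, E) 𝓘(ℝ, V) ∞ f ((chartAt E y).symm e)) :
    localForm y (dFun f) e = fderiv ℝ (fun e => f ((chartAt E y).symm e)) e := by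
  have h := mfderiv_comp e (hf.mdifferentiableAt (by simp)) (mdifferentiableAt_chart_symm he)
  rw [mfderiv_eq_fderiv] at h
  exact h.symm

theorem dFun_eq {f : X → V} {y : X} (hf : ContMDiffAt 𝓘(ℝ, E) 𝓘(ℝ, V) ∞ f y) :
    dFun f y = fderiv ℝ (fun e => f ((chartAt E y).symm e)) (chartAt E y y) := by
  rw [← localForm_self (dFun f) y]
  exact localForm_dFun (mem_target_self y) (by rwa [symm_self])

theorem dForm_congr {α β : X → E →L[ℝ] V} {y : X} (h : α =ᶠ[𝓝 y] β) (ξ η : E) :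
    dForm α y ξ η = dForm β y ξ η := by
  unfold dForm
  rw [(localForm_congr h).fderiv_eq]

theorem dcForm_congr {α β : X → E →L[ℝ] V} {y : X} (h : α =ᶠ[𝓝 y] β) (ξ η : E) :
    dcForm α y ξ η = dcForm β y ξ η := by
  refine dForm_congr ?_ _ _
  filter_upwards [h] with y' hy'
  simp only [Jform, hy']

theorem dForm_add {α β : X → E →L[ℝ] V} {y : X}
    (hα : DifferentiableAt ℝ (localForm y α) (chartAt E y y))
    (hβ : DifferentiableAt ℝ (localForm y β) (chartAt E y y)) (ξ η : E) :
    dForm (fun y' => α y' + β y') y ξ η = dForm α y ξ η + dForm β y ξ η := by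
  have : localForm y (fun y' => α y' + β y') = fun e => localForm y α e + localForm y β e := by
    funext e
    exact ContinuousLinearMap.add_comp _ _ _
  unfold dForm
  rw [this, fderiv_fun_add hα hβ]
  simp only [ContinuousLinearMap.add_apply]
  abel

theorem dForm_const_smul {W : Type*} [NormedAddCommGroup W] [NormedSpace ℂ W]
    {α : X → E →L[ℝ] W} {y : X} (c : ℂ)
    (hα : DifferentiableAt ℝ (localForm y α) (chartAt E y y)) (ξ η : E) :
    dForm (fun y' => c • α y') y ξ η = c • dForm α y ξ η := by
  have : localForm y (fun y' => c • α y') = fun e => c • localForm y α e := by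
    funext e
    exact ContinuousLinearMap.smul_comp _ _ _
  unfold dForm
  rw [this, fderiv_fun_const_smul hα, smul_sub]
  rfl

theorem dcForm_const_smul {W : Type*} [NormedAddCommGroup W] [NormedSpace ℂ W]
    [IsManifold 𝓘(ℂ, E) 1 X]
    {α : X → E →L[ℝ] W} {y : X} (c : ℂ)
    (hα : DifferentiableAt ℝ (localForm y α) (chartAt E y y)) (ξ η : E) :
    dcForm (fun y' => c • α y') y ξ η = c • dcForm α y ξ η := by
  unfold dcForm
  rw [dForm_neg, dForm_neg, smul_neg, ← dForm_const_smul c (differentiableAt_localForm_J α y hα)]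
  rfl

theorem dcForm_add [IsManifold 𝓘(ℂ, E) 1 X] {α β : X → E →L[ℝ] V} {y : X}
    (hα : DifferentiableAt ℝ (localForm y α) (chartAt E y y))
    (hβ : DifferentiableAt ℝ (localForm y β) (chartAt E y y)) (ξ η : E) :
    dcForm (fun y' => α y' + β y') y ξ η = dcForm α y ξ η + dcForm β y ξ η := by
  unfold dcForm
  rw [dForm_neg, dForm_neg, dForm_neg, ← neg_add, ← dForm_add
    (differentiableAt_localForm_J α y hα) (differentiableAt_localForm_J β y hβ)]
  rfl

/-- Holomorphic charts commute with `J`, so `J` can be moved past the derivative, and `J² = -1`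
removes it from the second argument. -/
theorem dcForm_eq [IsManifold 𝓘(ℂ, E) 1 X] {α : X → E →L[ℝ] V} {y : X}
    (hα : DifferentiableAt ℝ (localForm y α) (chartAt E y y)) (ξ η : E) :
    dcForm α y ξ η = fderiv ℝ (localForm y α) (chartAt E y y) (jmul ξ) η -
      fderiv ℝ (localForm y α) (chartAt E y y) (jmul η) ξ := by
  have h1 : localForm y (Jform α) =ᶠ[𝓝 (chartAt E y y)]
      fun e => (localForm y α e).comp jmul := by
    filter_upwards [eventually_mem_target y] with e he using localForm_J α y he
  have h2 : HasFDerivAt (fun e => (localForm y α e).comp (jmul (E := E))) _ (chartAt E y y) :=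
    hα.hasFDerivAt.clm_comp (hasFDerivAt_const (jmul (E := E)) (chartAt E y y))
  unfold dcForm
  rw [dForm_neg]
  unfold dForm
  rw [h1.fderiv_eq, h2.fderiv]
  simp only [ContinuousLinearMap.add_apply, ContinuousLinearMap.comp_apply,
    ContinuousLinearMap.zero_apply, map_zero, ContinuousLinearMap.compL_apply,
    ContinuousLinearMap.flip_apply, ContinuousLinearMap.comp_zero, zero_add, jmul_jmul, map_neg]
  abel

end FormsInCharts

/-! ### Gauge transformations and curvature on a vector space -/

section Gauge

variable {E : Type*} [NormedAddCommGroup E] [NormedSpace ℂ E]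
variable {A : Type*} [NormedRing A] [NormedAlgebra ℂ A]

/-- The operation `u d + v dᶜ` on differentials of functions, for `c = (u, v)`. -/
def twist (c : ℂ × ℂ) (L : E →L[ℝ] A) : E →L[ℝ] A := c.1 • L + c.2 • L.comp jmul

theorem twist_apply (c : ℂ × ℂ) (L : E →L[ℝ] A) (ξ : E) :
    twist c L ξ = c.1 • L ξ + c.2 • L (jmul ξ) := rfl

/-- The form `h⁻¹ a h + h⁻¹ b`, where `hi` is the inverse of `h`. -/
def gauge (h hi : A) (a b : E →L[ℝ] A) : E →L[ℝ] A :=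
  (ContinuousLinearMap.mulLeftRight ℝ A hi h).comp a + (ContinuousLinearMap.mul ℝ A hi).comp b

theorem gauge_apply (h hi : A) (a b : E →L[ℝ] A) (ξ : E) :
    gauge h hi a b ξ = hi * a ξ * h + hi * b ξ := rfl

/-- The curvature of the `(u d + v dᶜ)`-connection with connection form `a`. -/
def curv (c : ℂ × ℂ) (a : E → E →L[ℝ] A) (e ξ η : E) : A :=
  c.1 • (fderiv ℝ a e ξ η - fderiv ℝ a e η ξ) +
    c.2 • (fderiv ℝ a e (jmul ξ) η - fderiv ℝ a e (jmul η) ξ) + wedge (a e) (a e) ξ η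

/-- The curvature is conjugated because `(u d + v dᶜ)² = 0` on functions, which comes down to the
symmetry of the second derivative of `G`. The rest is the product rule with `d(G⁻¹) = -G⁻¹ dG G⁻¹`.
-/
theorem curv_gauge [CompleteSpace A] {c : ℂ × ℂ} {a : E → E →L[ℝ] A} {G Gi : E → A} {e : E}
    (hr : ∀ e, G e * Gi e = 1) (hl : ∀ e, Gi e * G e = 1)
    (ha : DifferentiableAt ℝ a e) (hg : ContDiffAt ℝ ∞ G e) (ξ η : E) :
    curv c (fun e => gauge (G e) (Gi e) (a e) (twist c (fderiv ℝ G e))) e ξ η =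
      Gi e * curv c a e ξ η * G e := by
  have hGd : HasFDerivAt G (fderiv ℝ G e) e := (hg.differentiableAt (by simp)).hasFDerivAt
  have hGi : HasFDerivAt Gi
      (-(ContinuousLinearMap.mulLeftRight ℝ A (Gi e) (Gi e)).comp (fderiv ℝ G e)) e := by
    have := (hasFDerivAt_ringInverse (𝕜 := ℝ) (⟨G e, Gi e, hr e, hl e⟩ : Aˣ)).comp e hGd
    have hi : Ring.inverse ∘ G = Gi := by
      funext e
      exact Ring.inverse_unit (⟨G e, Gi e, hr e, hl e⟩ : Aˣ)
    rw [hi, ContinuousLinearMap.neg_comp] at this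
    exact this
  have h2 : HasFDerivAt (fderiv ℝ G) (fderiv ℝ (fderiv ℝ G) e) e :=
    ((hg.fderiv_right (m := ∞) (by simp)).differentiableAt (by simp)).hasFDerivAt
  have hsymm : ∀ v w, fderiv ℝ (fderiv ℝ G) e v w = fderiv ℝ (fderiv ℝ G) e w v := fun v w =>
    second_derivative_symmetric_of_eventually
      (by
        filter_upwards [(hg.of_le (m := 1) (by exact mod_cast le_top)).eventually (by simp)]
          with e' he'
        exact (he'.differentiableAt (by simp)).hasFDerivAt) h2 v w
  have hdiff : ∀ v w, fderiv ℝ (fun e => gauge (G e) (Gi e) (a e)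
      (twist c (fderiv ℝ G e))) e v w =
      -(Gi e * fderiv ℝ G e v * Gi e) * a e w * G e +
      Gi e * fderiv ℝ a e v w * G e + Gi e * a e w * fderiv ℝ G e v +
      (-(Gi e * fderiv ℝ G e v * Gi e) * twist c (fderiv ℝ G e) w +
      Gi e * twist c (fderiv ℝ (fderiv ℝ G) e v) w) := by
    intro v w
    have hd : DifferentiableAt ℝ (fun e => gauge (G e) (Gi e) (a e)
        (twist c (fderiv ℝ G e))) e := by
      unfold gauge twist
      have h2' := h2.differentiableAt
      have hGi' := hGi.differentiableAt
      have hGd' := hGd.differentiableAt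
      have e1 : DifferentiableAt ℝ (fun e => ContinuousLinearMap.mulLeftRight ℝ A
          (Gi e) (G e)) e :=
        (((ContinuousLinearMap.mulLeftRight ℝ A).differentiableAt.comp e hGi').clm_apply hGd')
      have e2 : DifferentiableAt ℝ (fun e => ContinuousLinearMap.mul ℝ A (Gi e)) e :=
        (ContinuousLinearMap.mul ℝ A).differentiableAt.comp e hGi'
      exact (e1.clm_comp ha).add (e2.clm_comp ((h2'.const_smul c.1).add
        ((h2'.clm_comp (differentiableAt_const _)).const_smul c.2)))
    -- Evaluating at a fixed vector before differentiating turns compositions of operators into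
    -- products in `A`.
    have e0 := (hd.hasFDerivAt.clm_apply (hasFDerivAt_const w e)).fderiv
    have e1 : HasFDerivAt (fun e => Gi e * a e w * G e + Gi e *
        (c.1 • fderiv ℝ G e w + c.2 • fderiv ℝ G e (jmul w))) _ e :=
      ((hGi.fun_mul' (ha.hasFDerivAt.clm_apply (hasFDerivAt_const w e))).fun_mul' hGd).fun_add
        (hGi.fun_mul' (((h2.clm_apply (hasFDerivAt_const w e)).fun_const_smul c.1).fun_add
          ((h2.clm_apply (hasFDerivAt_const (jmul w) e)).fun_const_smul c.2)))
    have e2 := congrArg (fun L : E →L[ℝ] A => L v) (e0.symm.trans e1.fderiv)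
    simp only [_root_.add_apply, ContinuousLinearMap.comp_apply,
      ContinuousLinearMap.flip_apply,
      ContinuousLinearMap.comp_zero, zero_add, _root_.smul_apply,
      _root_.neg_apply, ContinuousLinearMap.mulLeftRight_apply, smul_eq_mul,
      MulOpposite.smul_eq_mul_unop, MulOpposite.unop_op] at e2
    rw [e2]
    simp only [twist_apply]
    noncomm_ring
  have hgG : ∀ x : A, G e * (Gi e * x) = x := fun x => by
    rw [← mul_assoc, hr, one_mul]
  unfold curv wedge
  simp only [hdiff, gauge_apply]
  simp only [twist_apply, hsymm (jmul ξ) η, hsymm (jmul η) ξ, hsymm η ξ,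
    hsymm (jmul η) (jmul ξ)]
  simp only [mul_add, add_mul, mul_sub, sub_mul, mul_assoc, hgG, smul_add, smul_sub, neg_mul,
    mul_smul_comm, smul_mul_assoc, smul_neg, smul_comm c.2 c.1]
  abel

end Gauge


/-! ### Smooth families of continuous functions on an interval -/

section Slice

open scoped BoundedContinuousFunction

universe u v

variable {P : Type u} [NormedAddCommGroup P] [NormedSpace ℝ P] {L : ℝ}

open Classical in
/-- The continuous function `t ↦ G (p, t)` on `[0, L]`. -/
def slice {A : Type*} [NormedAddCommGroup A] (L : ℝ) (G : P × ℝ → A) (p : P) :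
    (Set.Icc (0 : ℝ) L →ᵇ A) :=
  if h : Continuous fun t : Set.Icc (0 : ℝ) L => G (p, t) then BoundedContinuousFunction.mkOfCompact ⟨_, h⟩ else 0

theorem slice_apply {A : Type*} [NormedAddCommGroup A] {G : P × ℝ → A} {p : P}
    (h : ∀ t ∈ Set.Icc (0 : ℝ) L, ContinuousAt G (p, t)) (t : Set.Icc (0 : ℝ) L) :
    slice L G p t = G (p, t) := by
  have : Continuous fun t : Set.Icc (0 : ℝ) L => G (p, t) := continuous_iff_continuousAt.2
    fun t => ContinuousAt.comp (f := fun t : Set.Icc (0 : ℝ) L => (p, (t : ℝ))) (h t t.2)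
      (by fun_prop)
  rw [slice, dif_pos this]
  rfl

theorem eventually_forall_Icc {p : P} {Q : P × ℝ → Prop}
    (h : ∀ t ∈ Set.Icc (0 : ℝ) L, ∀ᶠ q in 𝓝 (p, t), Q q) :
    ∀ᶠ p' in 𝓝 p, ∀ t ∈ Set.Icc (0 : ℝ) L, Q (p', t) :=
  isCompact_Icc.eventually_forall_of_forall_eventually (P := fun p' t => Q (p', t)) h

section

variable {A : Type v} [NormedAddCommGroup A]

/-- Compactness of `[0, L]` makes the pointwise estimate uniform in `t`, as convergence in the sup
norm requires. -/
theorem continuousAt_slice {G : P × ℝ → A} {p : P}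
    (h : ∀ t ∈ Set.Icc (0 : ℝ) L, ∀ᶠ q in 𝓝 (p, t), ContinuousAt G q) :
    ContinuousAt (slice L G) p := by
  rw [Metric.continuousAt_iff']
  intro ε hε
  have h1 : ∀ t ∈ Set.Icc (0 : ℝ) L, ∀ᶠ q in 𝓝 (p, t), dist (G q) (G (p, q.2)) ≤ ε / 2 := by
    intro t ht
    have h2 : ContinuousAt (fun q : P × ℝ => dist (G q) (G (p, q.2))) (p, t) := by
      refine (h t ht).self_of_nhds.dist ?_
      exact ContinuousAt.comp (f := fun q : P × ℝ => (p, q.2)) (h t ht).self_of_nhds (by fun_prop)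
    refine (h2.eventually_lt (continuousAt_const (y := ε / 2)) (by simpa using hε)).mono
      fun q hq => hq.le
  filter_upwards [eventually_forall_Icc h, eventually_forall_Icc h1] with p' h3 h4
  refine lt_of_le_of_lt ((BoundedContinuousFunction.dist_le (half_pos hε).le).2 fun t => ?_) (half_lt_self hε)
  rw [slice_apply h3, slice_apply fun t ht => (h t ht).self_of_nhds]
  exact h4 t t.2

variable [NormedSpace ℝ A]

variable (P L A) in
/-- Evaluation of a function with values in linear maps at a vector. -/
def sliceEval : (Set.Icc (0 : ℝ) L →ᵇ (P →L[ℝ] A)) →L[ℝ] P →L[ℝ] (Set.Icc (0 : ℝ) L →ᵇ A) :=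
  LinearMap.mkContinuous₂ (σ₁₃ := RingHom.id ℝ) (σ₂₃ := RingHom.id ℝ)
    (E := Set.Icc (0 : ℝ) L →ᵇ (P →L[ℝ] A)) (F := P) (G := Set.Icc (0 : ℝ) L →ᵇ A)
    (LinearMap.mk₂ ℝ (fun (φ : Set.Icc (0 : ℝ) L →ᵇ (P →L[ℝ] A)) (v : P) =>
      ((ContinuousLinearMap.apply ℝ A v).compLeftContinuousBounded _ φ : Set.Icc (0 : ℝ) L →ᵇ A))
      (fun φ ψ v => by ext; rfl) (fun r φ v => by ext; rfl)
      (fun φ v w => BoundedContinuousFunction.ext fun t => map_add (φ t) v w)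
      (fun r φ v => BoundedContinuousFunction.ext fun t => map_smul (φ t) r v)) 1
    (fun φ v => by
      rw [BoundedContinuousFunction.norm_le (by positivity), one_mul]
      intro t
      exact (φ t).le_of_opNorm_le (φ.norm_coe_le_norm t) v)

theorem sliceEval_apply (φ : (Set.Icc (0 : ℝ) L →ᵇ (P →L[ℝ] A))) (v : P) (t : Set.Icc (0 : ℝ) L) :
    sliceEval P L A φ v t = φ t v := rfl

/-- The partial derivative in the first variable. -/
def fderivFst {C : Type*} [NormedAddCommGroup C] [NormedSpace ℝ C] (G : P × C → A) (q : P × C) :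
    P →L[ℝ] A :=
  (fderiv ℝ G q).comp (ContinuousLinearMap.inl ℝ P C)

theorem contDiffAt_fderivFst {C : Type*} [NormedAddCommGroup C] [NormedSpace ℝ C] {n : ℕ}
    {G : P × C → A} {q : P × C}
    (h : ContDiffAt ℝ (n + 1 : ℕ) G q) : ContDiffAt ℝ n (fderivFst G) q :=
  (h.fderiv_right (m := n) (by exact_mod_cast le_rfl)).clm_comp contDiffAt_const

/-- On a small ball the partial derivative differs from its value at `p` by at most `ε`, uniformly
in `t` by compactness; the mean value inequality then bounds the remainder in the sup norm. -/
theorem hasFDerivAt_slice {G : P × ℝ → A} {p : P}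
    (h : ∀ t ∈ Set.Icc (0 : ℝ) L, ContDiffAt ℝ 1 G (p, t)) :
    HasFDerivAt (slice L G) (sliceEval P L A (slice L (fderivFst G) p)) p := by
  have hev : ∀ t ∈ Set.Icc (0 : ℝ) L, ∀ᶠ q in 𝓝 (p, t), ContDiffAt ℝ 1 G q := fun t ht =>
    (h t ht).eventually (by simp)
  have hD : ∀ t ∈ Set.Icc (0 : ℝ) L, ContinuousAt (fderivFst G) (p, t) := fun t ht =>
    (contDiffAt_fderivFst (n := 0) (h t ht)).continuousAt
  rw [hasFDerivAt_iff_isLittleO, Asymptotics.isLittleO_iff]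
  intro ε hε
  have h1 : ∀ t ∈ Set.Icc (0 : ℝ) L, ∀ᶠ q in 𝓝 (p, t),
      ‖fderivFst G q - fderivFst G (p, q.2)‖ ≤ ε := by
    intro t ht
    have h2 : ContinuousAt (fun q : P × ℝ => ‖fderivFst G q - fderivFst G (p, q.2)‖) (p, t) := by
      refine ((hD t ht).sub ?_).norm
      exact ContinuousAt.comp (f := fun q : P × ℝ => (p, q.2)) (x := (p, t)) (hD t ht) (by fun_prop)
    exact (h2.eventually_lt (continuousAt_const (y := ε)) (by simpa using hε)).mono
      fun q hq => hq.le
  obtain ⟨δ, hδ, hball⟩ := Metric.eventually_nhds_iff_ball.1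
    ((eventually_forall_Icc hev).and (eventually_forall_Icc h1))
  filter_upwards [Metric.ball_mem_nhds p hδ] with x hx
  rw [BoundedContinuousFunction.norm_le (by positivity)]
  intro t
  have hc : ∀ x ∈ Metric.ball p δ, slice L G x t = G (x, t) := fun x hx =>
    slice_apply (fun t ht => ((hball x hx).1 t ht).continuousAt) t
  simp only [BoundedContinuousFunction.sub_apply, sliceEval_apply]
  rw [hc x hx, hc p (Metric.mem_ball_self hδ), slice_apply hD]
  refine (convex_ball p δ).norm_image_sub_le_of_norm_hasFDerivWithin_le' (f := fun x => G (x, t))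
    (f' := fun x => fderivFst G (x, t)) (fun x hx => ?_) (fun x hx => (hball x hx).2 t t.2)
    (Metric.mem_ball_self hδ) hx
  have h3 := (((hball x hx).1 t t.2).differentiableAt (by simp)).hasFDerivAt
  exact (HasFDerivAt.comp (f := fun x : P => (x, (t : ℝ))) x h3
    (hasFDerivAt_prodMk_left x (t : ℝ))).hasFDerivWithinAt

end

/-- Induction on `n`: the derivative of a slice is, up to the linear map `sliceEval`, the slice of
the partial derivative. The target changes from `A` to `P →L[ℝ] A`, so the statement quantifies over
`A` in a universe that contains `P`. -/
theorem contDiffAt_slice_nat (n : ℕ) : ∀ {A : Type max u v} [NormedAddCommGroup A]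
    [NormedSpace ℝ A] {G : P × ℝ → A} {p : P},
    (∀ t ∈ Set.Icc (0 : ℝ) L, ContDiffAt ℝ n G (p, t)) → ContDiffAt ℝ n (slice L G) p := by
  induction n with
  | zero =>
    intro A _ _ G p h
    have h1 : ∀ t ∈ Set.Icc (0 : ℝ) L, ∀ᶠ q in 𝓝 (p, t), ∀ᶠ q' in 𝓝 q, ContinuousAt G q' :=
      fun t ht => eventually_eventually_nhds.2
        (((h t ht).eventually (by simp)).mono fun q hq => hq.continuousAt)
    refine contDiffAt_zero.2 ⟨_, eventually_forall_Icc h1, fun p' hp' => ?_⟩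
    exact (continuousAt_slice hp').continuousWithinAt
  | succ n ih =>
    intro A _ _ G p h
    have h1 : ∀ t ∈ Set.Icc (0 : ℝ) L, ∀ᶠ q in 𝓝 (p, t), ContDiffAt ℝ 1 G q := fun t ht =>
      ((h t ht).of_le (by exact_mod_cast Nat.le_add_left 1 n)).eventually (by simp)
    refine contDiffAt_succ_iff_hasFDerivAt.2
      ⟨fun p => sliceEval P L A (slice L (fderivFst G) p),
        ⟨_, eventually_forall_Icc h1, fun p' hp' => hasFDerivAt_slice hp'⟩, ?_⟩
    exact (sliceEval P L A).contDiff.contDiffAt.comp p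
      (ih fun t ht => contDiffAt_fderivFst (h t ht))

theorem contDiffAt_slice {A : Type v} [NormedAddCommGroup A] [NormedSpace ℝ A] {G : P × ℝ → A}
    {p : P} (h : ∀ t ∈ Set.Icc (0 : ℝ) L, ContDiffAt ℝ ∞ G (p, t)) :
    ContDiffAt ℝ ∞ (slice L G) p := by
  rw [contDiffAt_infty]
  intro n
  -- `ULift` moves `A` into the universe in which the induction runs.
  let e : ULift.{u} A ≃L[ℝ] A := ContinuousLinearEquiv.ulift
  have h1 : ContDiffAt ℝ n (slice L fun q => e.symm (G q)) p := by
    refine contDiffAt_slice_nat.{u, v} (A := ULift.{u} A) n fun t ht => ?_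
    exact e.symm.contDiff.contDiffAt.comp _ ((h t ht).of_le (by exact_mod_cast le_top))
  have h2 := ((e : ULift.{u} A →L[ℝ] A).compLeftContinuousBounded
    (Set.Icc (0 : ℝ) L)).contDiff.contDiffAt.comp p h1
  refine h2.congr_of_eventuallyEq ?_
  have h3 : ∀ t ∈ Set.Icc (0 : ℝ) L, ∀ᶠ q in 𝓝 (p, t), ContinuousAt G q := fun t ht =>
    (((h t ht).of_le (m := 1) (by exact_mod_cast le_top)).eventually (by simp)).mono
      fun q hq => hq.continuousAt
  filter_upwards [eventually_forall_Icc h3] with p' hp'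
  ext t
  rw [slice_apply hp']
  have h4 : slice L (fun q => e.symm (G q)) p' t = e.symm (G (p', t)) :=
    slice_apply (fun t ht => e.symm.continuous.continuousAt.comp (hp' t ht)) t
  exact ((congrArg e h4).trans (e.apply_symm_apply _)).symm

end Slice


/-! ### Holomorphic dependence of slices on parameters -/

section SliceHol

open scoped BoundedContinuousFunction

variable {E : Type*} [NormedAddCommGroup E] [NormedSpace ℝ E]
  {C : Type*} [NormedAddCommGroup C] [NormedSpace ℂ C]
  {A : Type*} [NormedAddCommGroup A] [NormedSpace ℂ A] {L : ℝ}

/-- Real smoothness is already known, so only complex linearity of the derivative is missing, and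
this can be tested after evaluation at each `t`. -/
theorem smoothHolAt_slice {a : (E × C) × ℝ → A} {p : E × C}
    (h : ∀ t ∈ Set.Icc (0 : ℝ) L, ∀ᶠ q in 𝓝 (p, t), ContDiffAt ℝ ∞ a q ∧
      DifferentiableAt ℂ (fun c => a ((q.1.1, c), q.2)) q.1.2) :
    SmoothHolAt (slice L a) p := by
  filter_upwards [eventually_forall_Icc h, (eventually_forall_Icc h).eventually_nhds] with q hq hq'
  have h1 : ContDiffAt ℝ ∞ (slice L a) q := contDiffAt_slice fun t ht => (hq t ht).1
  refine ⟨h1, ?_⟩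
  have h2 : HasFDerivAt (fun c => slice L a (q.1, c)) _ q.2 :=
    HasFDerivAt.comp (f := fun c : C => (q.1, c)) q.2
      (h1.differentiableAt (by simp)).hasFDerivAt (hasFDerivAt_prodMk_right (𝕜 := ℝ) q.1 q.2)
  refine differentiableAt_complex_of_fderiv h2 fun v => ?_
  ext t
  have h3 := (BoundedContinuousFunction.evalCLM ℝ (β := A) t).hasFDerivAt.comp q.2 h2
  have h4 := (hq t t.2).2.hasFDerivAt.restrictScalars ℝ
  have h5 := h3.unique (h4.congr_of_eventuallyEq (by
    filter_upwards [SmoothHolAt.eventually_snd (p := q) hq'] with c hc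
    exact slice_apply (fun t ht => (hc t ht).1.continuousAt) t))
  have h6 := fun v => congrArg (fun M : C →L[ℝ] A => M v) h5
  have h7 := h6 (Complex.I • v)
  have h8 := h6 v
  simp only [ContinuousLinearMap.comp_apply, BoundedContinuousFunction.evalCLM_apply,
    ContinuousLinearMap.coe_restrictScalars', map_smul (fderiv ℂ _ _)] at h7 h8
  rw [← h8] at h7
  exact h7

end SliceHol

/-! ### Neumann series -/

section Neumann

variable {F : Type*} [NormedAddCommGroup F] [NormedSpace ℂ F]
  {G : Type*} [NormedAddCommGroup G] [NormedSpace ℂ G]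

/-- The solution `h` of `h + V a h = x`, for small `V a`. -/
def neumann (V : G →L[ℂ] F →L[ℂ] F) (x : F) (a : G) : F := Ring.inverse (1 + V a) x

theorem neumann_zero (V : G →L[ℂ] F →L[ℂ] F) (x : F) : neumann V x 0 = x := by
  rw [neumann, map_zero, add_zero, Ring.inverse_one]
  rfl

variable [CompleteSpace F]

theorem isUnit_one_add_of_norm_lt_one {M : F →L[ℂ] F} (hM : ‖M‖ < 1) : IsUnit (1 + M) := by
  have h := isUnit_one_sub_of_norm_lt_one (x := -M) (by rwa [norm_neg])
  rwa [sub_neg_eq_add] at h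

theorem neumann_add {V : G →L[ℂ] F →L[ℂ] F} {a : G} (ha : ‖V a‖ < 1) (x : F) :
    neumann V x a + V a (neumann V x a) = x :=
  congrArg (fun M : F →L[ℂ] F => M x)
    (Ring.mul_inverse_cancel _ (isUnit_one_add_of_norm_lt_one ha))

/-- Smooth dependence on both arguments is inherited from inversion in the Banach algebra of
operators. This one fact serves the differential equation and the factorization alike. -/
theorem contDiffAt_neumann {x : F} {V : G →L[ℂ] F →L[ℂ] F} {a : G} (ha : ‖V a‖ < 1) :
    ContDiffAt ℂ ∞ (fun p : F × G => neumann V p.1 p.2) (x, a) := by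
  obtain ⟨u, hu⟩ := isUnit_one_add_of_norm_lt_one ha
  have h1 := contDiffAt_ringInverse ℂ (n := ∞) u
  rw [hu] at h1
  have h2 : ContDiffAt ℂ ∞ (fun p : F × G => 1 + V p.2) (x, a) :=
    contDiffAt_const.add (V.contDiff.contDiffAt.comp _ contDiffAt_snd)
  exact (ContDiffAt.comp (f := fun p : F × G => 1 + V p.2) (x, a) h1 h2).clm_apply contDiffAt_fst

end Neumann

/-! ### Linear differential equations -/

section Volterra

open scoped BoundedContinuousFunction

variable {A : Type*} [NormedRing A] [NormedAlgebra ℂ A]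

/-- The continuous extension of a function on `[0, 1]`. -/
def extendIcc (a : Set.Icc (0 : ℝ) 1 →ᵇ A) (t : ℝ) : A := a (Set.projIcc 0 1 zero_le_one t)

theorem continuous_extendIcc (a : Set.Icc (0 : ℝ) 1 →ᵇ A) : Continuous (extendIcc a) :=
  a.continuous.comp continuous_projIcc

theorem extendIcc_of_mem (a : Set.Icc (0 : ℝ) 1 →ᵇ A) {t : ℝ} (ht : t ∈ Set.Icc (0 : ℝ) 1) :
    extendIcc a t = a ⟨t, ht⟩ := by
  rw [extendIcc, Set.projIcc_of_mem _ ht]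

theorem norm_extendIcc_le (a : Set.Icc (0 : ℝ) 1 →ᵇ A) (t : ℝ) : ‖extendIcc a t‖ ≤ ‖a‖ :=
  a.norm_coe_le_norm _

/-- The Volterra operator `(a, h) ↦ ∫₀ᵗ a h`. -/
def volterraFun (a h : Set.Icc (0 : ℝ) 1 →ᵇ A) : Set.Icc (0 : ℝ) 1 →ᵇ A :=
  BoundedContinuousFunction.mkOfCompact
    ⟨fun t => ∫ s in (0 : ℝ)..t, extendIcc a s * extendIcc h s,
      (intervalIntegral.continuous_primitive (fun _ _ =>
        ((continuous_extendIcc a).mul (continuous_extendIcc h)).intervalIntegrable _ _) 0).comp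
          continuous_subtype_val⟩

theorem volterraFun_apply (a h : Set.Icc (0 : ℝ) 1 →ᵇ A) (t : Set.Icc (0 : ℝ) 1) :
    volterraFun a h t = ∫ s in (0 : ℝ)..t, extendIcc a s * extendIcc h s := rfl

theorem norm_volterraFun_le (a h : Set.Icc (0 : ℝ) 1 →ᵇ A) :
    ‖volterraFun a h‖ ≤ 1 * ‖a‖ * ‖h‖ := by
  rw [BoundedContinuousFunction.norm_le (by positivity)]
  intro t
  rw [volterraFun_apply]
  refine (intervalIntegral.norm_integral_le_of_norm_le_const (C := ‖a‖ * ‖h‖)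
    fun s _ => ?_).trans ?_
  · exact (norm_mul_le _ _).trans (mul_le_mul (norm_extendIcc_le _ _) (norm_extendIcc_le _ _)
      (norm_nonneg _) (norm_nonneg _))
  · rw [sub_zero, abs_of_nonneg t.2.1, one_mul]
    exact mul_le_of_le_one_right (by positivity) t.2.2

variable (A) in
/-- The Volterra operator as a bounded bilinear map. -/
def volterra : (Set.Icc (0 : ℝ) 1 →ᵇ A) →L[ℂ] (Set.Icc (0 : ℝ) 1 →ᵇ A) →L[ℂ]
    (Set.Icc (0 : ℝ) 1 →ᵇ A) :=
  LinearMap.mkContinuous₂ (σ₁₃ := RingHom.id ℂ) (σ₂₃ := RingHom.id ℂ)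
    (E := Set.Icc (0 : ℝ) 1 →ᵇ A) (F := Set.Icc (0 : ℝ) 1 →ᵇ A) (G := Set.Icc (0 : ℝ) 1 →ᵇ A)
    (LinearMap.mk₂ ℂ volterraFun
      (fun a a' h => by
        ext t
        simp only [volterraFun_apply, BoundedContinuousFunction.add_apply]
        rw [← intervalIntegral.integral_add]
        · simp only [← add_mul]
          rfl
        all_goals exact
          ((continuous_extendIcc _).mul (continuous_extendIcc h)).intervalIntegrable _ _)
      (fun c a h => by
        ext t
        simp only [volterraFun_apply, BoundedContinuousFunction.smul_apply]
        rw [← intervalIntegral.integral_smul]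
        simp only [← smul_mul_assoc]
        rfl)
      (fun a h h' => by
        ext t
        simp only [volterraFun_apply, BoundedContinuousFunction.add_apply]
        rw [← intervalIntegral.integral_add]
        · simp only [← mul_add]
          rfl
        all_goals exact
          ((continuous_extendIcc _).mul (continuous_extendIcc _)).intervalIntegrable _ _)
      (fun c a h => by
        ext t
        simp only [volterraFun_apply, BoundedContinuousFunction.smul_apply]
        rw [← intervalIntegral.integral_smul]
        simp only [← mul_smul_comm]
        rfl)) 1 norm_volterraFun_le

theorem volterra_apply (a h : Set.Icc (0 : ℝ) 1 →ᵇ A) : volterra A a h = volterraFun a h := rfl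

/-- The solution of `k' = -a k`, `k 0 = 1`, for small `a`. -/
def transport (a : Set.Icc (0 : ℝ) 1 →ᵇ A) : Set.Icc (0 : ℝ) 1 →ᵇ A :=
  neumann (volterra A) 1 a

theorem transport_zero : transport (0 : Set.Icc (0 : ℝ) 1 →ᵇ A) = 1 := neumann_zero _ _

/-- This crude bound suffices: the coefficient along a ray is proportional to the length of the ray,
hence small near the centre of a chart. -/
theorem norm_volterra_lt {a : Set.Icc (0 : ℝ) 1 →ᵇ A} (ha : ‖a‖ < 1) : ‖volterra A a‖ < 1 :=
  lt_of_le_of_lt (ContinuousLinearMap.opNorm_le_bound _ (norm_nonneg a) fun h => by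
    rw [volterra_apply, ← one_mul ‖a‖]
    exact norm_volterraFun_le a h) ha

variable [CompleteSpace A]

theorem contDiffAt_transport {a : Set.Icc (0 : ℝ) 1 →ᵇ A} (ha : ‖a‖ < 1) :
    ContDiffAt ℂ ∞ (transport (A := A)) a :=
  ContDiffAt.comp (f := fun a : Set.Icc (0 : ℝ) 1 →ᵇ A => ((1 : Set.Icc (0 : ℝ) 1 →ᵇ A), a)) a
    (contDiffAt_neumann (norm_volterra_lt ha)) (contDiffAt_const.prodMk contDiffAt_id)

theorem transport_eq {a : Set.Icc (0 : ℝ) 1 →ᵇ A} (ha : ‖a‖ < 1) (t : Set.Icc (0 : ℝ) 1) :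
    transport a t = 1 - ∫ s in (0 : ℝ)..t, extendIcc a s * extendIcc (transport a) s := by
  have h2 : transport a + volterra A a (transport a) = 1 :=
    neumann_add (F := Set.Icc (0 : ℝ) 1 →ᵇ A) (V := volterra A) (a := a)
      (norm_volterra_lt ha) 1
  rw [volterra_apply] at h2
  have h3 : transport a t + volterraFun a (transport a) t = 1 := by
    rw [← BoundedContinuousFunction.add_apply, h2]
    rfl
  rw [volterraFun_apply] at h3
  exact eq_sub_of_add_eq h3

theorem extendIcc_transport_zero {a : Set.Icc (0 : ℝ) 1 →ᵇ A} (ha : ‖a‖ < 1) :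
    extendIcc (transport a) 0 = 1 := by
  rw [extendIcc_of_mem _ (by simp), transport_eq ha]
  simp

theorem hasDerivWithinAt_transport {a : Set.Icc (0 : ℝ) 1 →ᵇ A} (ha : ‖a‖ < 1) {t : ℝ}
    (ht : t ∈ Set.Icc (0 : ℝ) 1) :
    HasDerivWithinAt (extendIcc (transport a)) (-(extendIcc a t * extendIcc (transport a) t))
      (Set.Icc 0 1) t := by
  have hc : Continuous fun s => extendIcc a s * extendIcc (transport a) s :=
    (continuous_extendIcc _).mul (continuous_extendIcc _)
  have h1 : HasDerivAt (fun t => 1 - ∫ s in (0 : ℝ)..t, extendIcc a s * extendIcc (transport a) s)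
      (-(extendIcc a t * extendIcc (transport a) t)) t := by
    simpa using (intervalIntegral.integral_hasDerivAt_right (hc.intervalIntegrable _ _)
      (hc.stronglyMeasurableAtFilter _ _) hc.continuousAt).const_sub (1 : A)
  refine h1.hasDerivWithinAt.congr (fun s hs => ?_) ?_
  · rw [extendIcc_of_mem _ hs, transport_eq ha]
  · rw [extendIcc_of_mem _ ht, transport_eq ha]

/-- Uniqueness of solutions of linear differential equations on `[0, 1]`. -/
theorem linear_ode_unique {M : ℝ → A →L[ℝ] A} (hM : ContinuousOn M (Set.Icc 0 1))
    {f g : ℝ → A}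
    (hf : ∀ t ∈ Set.Icc (0 : ℝ) 1, HasDerivWithinAt f (M t (f t)) (Set.Icc 0 1) t)
    (hg : ∀ t ∈ Set.Icc (0 : ℝ) 1, HasDerivWithinAt g (M t (g t)) (Set.Icc 0 1) t)
    (h0 : f 0 = g 0) : Set.EqOn f g (Set.Icc 0 1) := by
  obtain ⟨K, hK⟩ := isCompact_Icc.exists_bound_of_continuousOn hM
  have hmono : ∀ t ∈ Set.Ico (0 : ℝ) 1, Set.Icc (0 : ℝ) 1 ∈ 𝓝[Set.Ici t] t := fun t ht =>
    mem_nhdsWithin.2 ⟨Set.Iio 1, isOpen_Iio, ht.2, fun s hs => ⟨ht.1.trans hs.2, hs.1.le⟩⟩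
  refine ODE_solution_unique_of_mem_Icc_right (v := fun t x => M t x) (s := fun _ => Set.univ)
    (K := K.toNNReal) (fun t ht => ?_) (fun t ht => (hf t ht).continuousWithinAt)
    (fun t ht => ((hf t (Set.Ico_subset_Icc_self ht)).mono_of_mem_nhdsWithin (hmono t ht)))
    (fun _ _ => trivial)
    (fun t ht => (hg t ht).continuousWithinAt)
    (fun t ht => ((hg t (Set.Ico_subset_Icc_self ht)).mono_of_mem_nhdsWithin (hmono t ht)))
    (fun _ _ => trivial) h0
  refine (LipschitzWith.weaken (M t).lipschitz ?_).lipschitzOnWith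
  have := hK t (Set.Ico_subset_Icc_self ht)
  rw [← NNReal.coe_le_coe, coe_nnnorm]
  exact this.trans (Real.le_coe_toNNReal K)

end Volterra


/-! ### Laurent series with absolutely summable coefficients -/

section Wiener

open scoped ENNReal

variable {I : Type*} {A : Type*} [NormedAddCommGroup A] [NormedSpace ℂ A]
  {Y : Type*} [NormedAddCommGroup Y] [NormedSpace ℂ Y]

/-- Absolutely summable families. -/
def L1 (I : Type*) (A : Type*) [NormedAddCommGroup A] : Type _ := lp (fun _ : I => A) 1

instance : NormedAddCommGroup (L1 I A) := inferInstanceAs (NormedAddCommGroup (lp (fun _ : I => A) 1))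

instance : NormedSpace ℂ (L1 I A) := inferInstanceAs (NormedSpace ℂ (lp (fun _ : I => A) 1))

instance [CompleteSpace A] : CompleteSpace (L1 I A) :=
  inferInstanceAs (CompleteSpace (lp (fun _ : I => A) 1))

instance : CoeFun (L1 I A) fun _ => I → A := ⟨fun x => x.1⟩

theorem L1.hasSum_norm (x : L1 I A) : HasSum (fun i => ‖x i‖) ‖x‖ := by
  have h : HasSum (fun i => ‖x i‖ ^ (1 : ℝ≥0∞).toReal) (‖x‖ ^ (1 : ℝ≥0∞).toReal) :=
    lp.hasSum_norm (E := fun _ : I => A) (p := 1) (by simp) x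
  simpa only [ENNReal.toReal_one, Real.rpow_one] using h

variable (A) in
/-- The inclusion of the `i`-th summand. -/
def L1.single (i : I) : A →L[ℂ] L1 I A := by
  classical exact lp.singleContinuousLinearMap ℂ (fun _ : I => A) 1 i

theorem L1.norm_single (i : I) (a : A) : ‖L1.single A i a‖ = ‖a‖ := by
  classical exact lp.norm_single (E := fun _ : I => A) (p := 1) (by simp) i a

theorem L1.single_apply_self (i : I) (a : A) : (L1.single A i a) i = a := by
  classical exact lp.single_apply_self (E := fun _ : I => A) 1 i a

theorem L1.single_apply_ne {i j : I} (h : j ≠ i) (a : A) : (L1.single A i a) j = 0 := by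
  classical exact lp.single_apply_ne (E := fun _ : I => A) 1 i a h

theorem L1.hasSum_single (x : L1 I A) : HasSum (fun i => L1.single A i (x i)) x := by
  classical exact lp.hasSum_single (E := fun _ : I => A) (p := 1) (by simp) x

/-- Every element is the sum of its components, so continuous linear maps are determined on single
components. Identities for Laurent series are thus checked on monomials. -/
theorem L1.ext_single {φ ψ : L1 I A →L[ℂ] Y}
    (h : ∀ i a, φ (L1.single A i a) = ψ (L1.single A i a)) : φ = ψ := by
  ext1 x
  have h1 := (L1.hasSum_single x).mapL φ
  simp only [h] at h1
  exact h1.unique ((L1.hasSum_single x).mapL ψ)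

/-- The `i`-th coordinate. -/
def L1.coord (i : I) : L1 I A →L[ℂ] A :=
  LinearMap.mkContinuous
    { toFun := fun x => x i
      map_add' := fun _ _ => rfl
      map_smul' := fun _ _ => rfl } 1 (fun x => by
      rw [one_mul]
      exact lp.norm_apply_le_norm (E := fun _ : I => A) (p := 1) (by simp) x i)

theorem L1.coord_apply (i : I) (x : L1 I A) : L1.coord i x = x i := rfl

theorem L1.norm_coord_le (i : I) : ‖(L1.coord i : L1 I A →L[ℂ] A)‖ ≤ 1 :=
  LinearMap.mkContinuous_norm_le _ zero_le_one _

section Lsum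

variable [CompleteSpace Y] {φ : I → A →L[ℂ] Y} {C : ℝ}

theorem L1.summable_lsum (h : ∀ i, ‖φ i‖ ≤ C) (x : L1 I A) : Summable fun i => φ i (x i) := by
  refine Summable.of_norm_bounded ((L1.hasSum_norm x).summable.mul_left C) fun i => ?_
  exact (φ i).le_of_opNorm_le (h i) _

/-- The linear map out of `L1 I A` given by a bounded family of linear maps. -/
def L1.lsum (φ : I → A →L[ℂ] Y) (C : ℝ) (h : ∀ i, ‖φ i‖ ≤ C) : L1 I A →L[ℂ] Y :=
  LinearMap.mkContinuous
    { toFun := fun x => ∑' i, φ i (x i)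
      map_add' := fun x x' => by
        rw [← (L1.summable_lsum h x).tsum_add (L1.summable_lsum h x')]
        refine tsum_congr fun i => ?_
        rw [← map_add]
        rfl
      map_smul' := fun c x => by
        rw [RingHom.id_apply, ← (L1.summable_lsum h x).tsum_const_smul c]
        refine tsum_congr fun i => ?_
        rw [← map_smul]
        rfl } C fun x => by
      refine tsum_of_norm_bounded ((L1.hasSum_norm x).mul_left C) fun i => ?_
      exact (φ i).le_of_opNorm_le (h i) _

theorem L1.norm_lsum_le (h : ∀ i, ‖φ i‖ ≤ C) (hC : 0 ≤ C) : ‖L1.lsum φ C h‖ ≤ C :=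
  LinearMap.mkContinuous_norm_le _ hC _

theorem L1.lsum_single (h : ∀ i, ‖φ i‖ ≤ C) (i : I) (a : A) :
    L1.lsum φ C h (L1.single A i a) = φ i a := by
  have : L1.lsum φ C h (L1.single A i a) = ∑' j, φ j (L1.single A i a j) := rfl
  rw [this, tsum_eq_single i fun j hj => ?_, L1.single_apply_self]
  rw [L1.single_apply_ne hj, map_zero]

end Lsum

section Lsum₂

variable {J A' W : Type*} [NormedAddCommGroup A'] [NormedSpace ℂ A'] [NormedAddCommGroup W]
  [NormedSpace ℂ W] [CompleteSpace W] {C : ℝ}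

theorem L1.norm_flip_le {β : A →L[ℂ] A' →L[ℂ] W} (h : ‖β‖ ≤ C) : ‖β.flip‖ ≤ C := by
  rwa [ContinuousLinearMap.opNorm_flip]

/-- The bilinear map out of `L1 I A × L1 J A'` given by a bounded family of bilinear maps. -/
def L1.lsum₂ (β : I → J → A →L[ℂ] A' →L[ℂ] W) (hC : 0 ≤ C) (h : ∀ i j, ‖β i j‖ ≤ C) :
    L1 I A →L[ℂ] L1 J A' →L[ℂ] W :=
  L1.lsum (Y := L1 J A' →L[ℂ] W)
    (fun i => (L1.lsum (Y := A →L[ℂ] W) (fun j => (β i j).flip) C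
      fun j => L1.norm_flip_le (h i j)).flip) C
    fun _ => L1.norm_flip_le (L1.norm_lsum_le _ hC)

theorem L1.lsum₂_single {β : I → J → A →L[ℂ] A' →L[ℂ] W} (hC : 0 ≤ C) (h : ∀ i j, ‖β i j‖ ≤ C)
    (i : I) (j : J) (a : A) (a' : A') :
    L1.lsum₂ β hC h (L1.single A i a) (L1.single A' j a') = β i j a a' := by
  rw [L1.lsum₂, L1.lsum_single, ContinuousLinearMap.flip_apply, L1.lsum_single]
  rfl

end Lsum₂

section PowerSeries

variable {F : Type*} [NormedAddCommGroup F] [NormedSpace ℂ F] [CompleteSpace F]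

/-- A power series with bounded coefficients. -/
def powSeries (c : ℕ → F) (z : ℂ) : F := ∑' n, z ^ n • c n

variable {c : ℕ → F} {C : ℝ}

theorem summable_powSeries (h : ∀ n, ‖c n‖ ≤ C) {z : ℂ} (hz : ‖z‖ < 1) :
    Summable fun n => z ^ n • c n := by
  refine Summable.of_norm_bounded
    ((summable_geometric_of_lt_one (norm_nonneg z) hz).mul_right C) fun n => ?_
  rw [norm_smul, norm_pow]
  exact mul_le_mul_of_nonneg_left (h n) (by positivity)

/-- Bounded coefficients give normal convergence on smaller discs. It will be applied to operator
coefficients, so that evaluation of a Laurent series depends holomorphically on the point in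
operator norm. -/
theorem contDiffAt_powSeries (h : ∀ n, ‖c n‖ ≤ C) {z : ℂ} (hz : ‖z‖ < 1) :
    ContDiffAt ℂ ∞ (powSeries c) z := by
  obtain ⟨r, hr, hr1⟩ := exists_between hz
  have hr0 : 0 ≤ r := (norm_nonneg z).trans hr.le
  have h1 : DifferentiableOn ℂ (powSeries c) (Metric.ball 0 r) := by
    refine Complex.differentiableOn_tsum_of_summable_norm (u := fun n => r ^ n * C)
      ((summable_geometric_of_lt_one hr0 hr1).mul_right C) (fun n => ?_) Metric.isOpen_ball ?_
    · exact ((differentiable_id.pow n).smul_const (c n)).differentiableOn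
    · intro n w hw
      rw [norm_smul, norm_pow]
      have hw' : ‖w‖ ≤ r := by simpa using (Metric.mem_ball.1 hw).le
      exact mul_le_mul (pow_le_pow_left₀ (norm_nonneg _) hw' n) (h n) (norm_nonneg _)
        (by positivity)
  exact (h1.contDiffOn Metric.isOpen_ball).contDiffAt
    (Metric.isOpen_ball.mem_nhds (by simpa using hr))

theorem hasSum_powSeries_apply {c : ℕ → F →L[ℂ] Y} [CompleteSpace Y] (h : ∀ n, ‖c n‖ ≤ C) {z : ℂ}
    (hz : ‖z‖ < 1) (x : F) : HasSum (fun n => z ^ n • c n x) (powSeries c z x) :=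
  (summable_powSeries h hz).hasSum.mapL (ContinuousLinearMap.apply ℂ Y x)

end PowerSeries

variable [CompleteSpace A]

/-- The coefficients in degrees `n ≥ 0`. -/
def coordPos (n : ℕ) : L1 ℤ A →L[ℂ] A := L1.coord (n : ℤ)

/-- The coefficients in degrees `-1 - n < 0`. -/
def coordNeg (n : ℕ) : L1 ℤ A →L[ℂ] A := L1.coord (Int.negSucc n)

/-- The value at `w` of the non-negative part of a Laurent series. The `n`-th coordinate
represents `2 ^ n` times the coefficient. -/
def evPos (w : ℂ) : L1 ℤ A →L[ℂ] A := powSeries coordPos (w / 2)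

/-- The value at `t⁻¹` of the negative part of a Laurent series. -/
def evNeg (t : ℂ) : L1 ℤ A →L[ℂ] A := t • powSeries coordNeg t

theorem norm_half_lt {w : ℂ} (hw : ‖w‖ < 2) : ‖w / 2‖ < 1 := by
  rw [norm_div]
  simp only [RCLike.norm_ofNat]
  linarith

theorem contDiffAt_evPos {w : ℂ} (hw : ‖w‖ < 2) :
    ContDiffAt ℂ ∞ (evPos : ℂ → L1 ℤ A →L[ℂ] A) w :=
  (contDiffAt_powSeries (fun _ => L1.norm_coord_le _) (norm_half_lt hw)).comp w
    (contDiffAt_id.div_const 2)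

theorem contDiffAt_evNeg {t : ℂ} (ht : ‖t‖ < 1) :
    ContDiffAt ℂ ∞ (evNeg : ℂ → L1 ℤ A →L[ℂ] A) t :=
  contDiffAt_id.smul (contDiffAt_powSeries (fun _ => L1.norm_coord_le _) ht)

theorem hasSum_evPos {w : ℂ} (hw : ‖w‖ < 2) (x : L1 ℤ A) :
    HasSum (fun n : ℕ => (w / 2) ^ n • x n) (evPos w x) :=
  hasSum_powSeries_apply (c := coordPos) (fun _ => L1.norm_coord_le _) (norm_half_lt hw) x

theorem hasSum_evNeg {t : ℂ} (ht : ‖t‖ < 1) (x : L1 ℤ A) :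
    HasSum (fun n : ℕ => t ^ (n + 1) • x (Int.negSucc n)) (evNeg t x) := by
  have := (hasSum_powSeries_apply (c := coordNeg) (fun _ => L1.norm_coord_le _) ht x).const_smul t
  simp only [smul_smul, ← pow_succ'] at this
  exact this

theorem evPos_single_natCast {w : ℂ} (hw : ‖w‖ < 2) (n : ℕ) (a : A) :
    evPos w (L1.single A (n : ℤ) a) = (w / 2) ^ n • a := by
  refine (hasSum_evPos hw _).unique ?_
  convert hasSum_ite_eq n ((w / 2) ^ n • a) using 2 with m
  split_ifs with h
  · rw [h, L1.single_apply_self]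
  · rw [L1.single_apply_ne (by exact_mod_cast h), smul_zero]

theorem evPos_single_negSucc {w : ℂ} (hw : ‖w‖ < 2) (n : ℕ) (a : A) :
    evPos w (L1.single A (Int.negSucc n) a) = 0 := by
  refine (hasSum_evPos hw _).unique ?_
  convert hasSum_zero (α := A) (β := ℕ) using 2 with m
  rw [L1.single_apply_ne (by simp), smul_zero]

theorem evNeg_single_natCast {t : ℂ} (ht : ‖t‖ < 1) (n : ℕ) (a : A) :
    evNeg t (L1.single A (n : ℤ) a) = 0 := by
  refine (hasSum_evNeg ht _).unique ?_
  convert hasSum_zero (α := A) (β := ℕ) using 2 with m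
  rw [L1.single_apply_ne (by simp), smul_zero]

theorem evNeg_single_negSucc {t : ℂ} (ht : ‖t‖ < 1) (n : ℕ) (a : A) :
    evNeg t (L1.single A (Int.negSucc n) a) = t ^ (n + 1) • a := by
  refine (hasSum_evNeg ht _).unique ?_
  convert hasSum_ite_eq n (t ^ (n + 1) • a) using 2 with m
  split_ifs with h
  · rw [h, L1.single_apply_self]
  · rw [L1.single_apply_ne (by simpa using h), smul_zero]

/-- The value of a Laurent series at a point of the annulus `1 < |w| < 2`. -/
def evLaurent (w : ℂ) : L1 ℤ A →L[ℂ] A := evPos w + evNeg w⁻¹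

theorem norm_inv_lt {w : ℂ} (h1 : 1 < ‖w‖) : ‖w⁻¹‖ < 1 := by
  rw [norm_inv]
  exact inv_lt_one_of_one_lt₀ h1

/-- The weight of the `n`-th coordinate. -/
def lweight (n : ℤ) : ℂ := 2 ^ n.toNat

theorem lweight_ne_zero (n : ℤ) : lweight n ≠ 0 := by simp [lweight]

theorem evLaurent_single {w : ℂ} (h1 : 1 < ‖w‖) (h2 : ‖w‖ < 2) (n : ℤ) (a : A) :
    evLaurent w (L1.single A n a) = (w ^ n / lweight n) • a := by
  rw [evLaurent, _root_.add_apply]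
  cases n with
  | ofNat n =>
    rw [Int.ofNat_eq_natCast, evPos_single_natCast h2, evNeg_single_natCast (norm_inv_lt h1),
      add_zero, lweight, div_pow]
    simp
  | negSucc n =>
    rw [evPos_single_negSucc h2, evNeg_single_negSucc (norm_inv_lt h1), zero_add, lweight]
    simp [zpow_negSucc]

/-- The projection to the negative part. -/
def projNeg : L1 ℤ A →L[ℂ] L1 ℤ A :=
  L1.lsum (fun n => if n < 0 then L1.single A n else 0) 1 fun n => by
    split_ifs
    · exact ContinuousLinearMap.opNorm_le_bound _ zero_le_one fun a => by
        rw [L1.norm_single, one_mul]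
    · simp

theorem projNeg_single (n : ℤ) (a : A) :
    projNeg (L1.single A n a) = if n < 0 then L1.single A n a else 0 := by
  rw [projNeg, L1.lsum_single]
  split_ifs <;> rfl

/-- Idempotence, together with the two vanishing lemmas below, turns the equations for factors into
one-sided holomorphy. -/
theorem projNeg_projNeg (x : L1 ℤ A) : projNeg (projNeg x) = projNeg x := by
  have : (projNeg : L1 ℤ A →L[ℂ] L1 ℤ A).comp projNeg = projNeg := by
    refine L1.ext_single fun n a => ?_
    rw [ContinuousLinearMap.comp_apply, projNeg_single]
    split_ifs with h
    · rw [projNeg_single, if_pos h]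
    · rw [map_zero]
  exact congrArg (fun M : L1 ℤ A →L[ℂ] L1 ℤ A => M x) this

theorem evPos_of_projNeg_eq {w : ℂ} (hw : ‖w‖ < 2) {x : L1 ℤ A} (hx : projNeg x = x) :
    evPos w x = 0 := by
  have : (evPos w : L1 ℤ A →L[ℂ] A).comp projNeg = 0 := by
    refine L1.ext_single fun n a => ?_
    rw [ContinuousLinearMap.comp_apply, projNeg_single]
    cases n with
    | ofNat n =>
      rw [if_neg (by simp), map_zero, ContinuousLinearMap.zero_apply]
    | negSucc n => simp [evPos_single_negSucc hw]
  rw [← hx]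
  exact congrArg (fun M : L1 ℤ A →L[ℂ] A => M x) this

theorem evNeg_of_projNeg_eq_zero {t : ℂ} (ht : ‖t‖ < 1) {x : L1 ℤ A} (hx : projNeg x = 0) :
    evNeg t x = 0 := by
  have : (evNeg t : L1 ℤ A →L[ℂ] A).comp projNeg = evNeg t := by
    refine L1.ext_single fun n a => ?_
    rw [ContinuousLinearMap.comp_apply, projNeg_single]
    cases n with
    | ofNat n => rw [if_neg (by simp), map_zero]; exact (evNeg_single_natCast ht n a).symm
    | negSucc n => simp
  rw [← this, ContinuousLinearMap.comp_apply, hx, map_zero]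

end Wiener

/-! ### The Wiener algebra of the annulus -/

section Convolution

variable {A : Type*} [NormedRing A] [NormedAlgebra ℂ A] [CompleteSpace A]

/-- The structure constants of the multiplication of Laurent series in weighted coordinates. -/
def lcoef (m n : ℤ) : ℂ := lweight (m + n) / (lweight m * lweight n)

/-- The weight `2 ^ max(n, 0)` is submultiplicative, so Laurent series that are absolutely summable
on `1 ≤ |w| ≤ 2` can be multiplied with a norm estimate. -/
theorem norm_lcoef_le (m n : ℤ) : ‖lcoef m n‖ ≤ 1 := by
  have h : (m + n).toNat ≤ m.toNat + n.toNat := by omega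
  simp only [lcoef, lweight, norm_div, norm_mul, norm_pow, RCLike.norm_ofNat, ← pow_add]
  exact div_le_one_of_le₀ (pow_le_pow_right₀ one_le_two h) (by positivity)

/-- The product of the monomials of degrees `m` and `n`. -/
def monoMul (m n : ℤ) : A →L[ℂ] A →L[ℂ] L1 ℤ A :=
  lcoef m n • ((ContinuousLinearMap.compL ℂ A A (L1 ℤ A)) (L1.single A (m + n))).comp
    (ContinuousLinearMap.mul ℂ A)

theorem monoMul_apply (m n : ℤ) (a b : A) :
    monoMul m n a b = lcoef m n • L1.single A (m + n) (a * b) := rfl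

theorem norm_monoMul_le (m n : ℤ) : ‖(monoMul m n : A →L[ℂ] A →L[ℂ] L1 ℤ A)‖ ≤ 1 := by
  refine ContinuousLinearMap.opNorm_le_bound₂ _ zero_le_one fun a b => ?_
  rw [monoMul_apply, norm_smul, L1.norm_single, one_mul]
  calc ‖lcoef m n‖ * ‖a * b‖ ≤ 1 * (‖a‖ * ‖b‖) :=
        mul_le_mul (norm_lcoef_le m n) (norm_mul_le a b) (norm_nonneg _) zero_le_one
    _ = ‖a‖ * ‖b‖ := one_mul _

variable (A) in
/-- The multiplication of Laurent series. -/
def lmul : L1 ℤ A →L[ℂ] L1 ℤ A →L[ℂ] L1 ℤ A :=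
  L1.lsum₂ (W := L1 ℤ A) monoMul zero_le_one norm_monoMul_le

theorem lmul_single (m n : ℤ) (a b : A) :
    lmul A (L1.single A m a) (L1.single A n b) = lcoef m n • L1.single A (m + n) (a * b) :=
  L1.lsum₂_single (W := L1 ℤ A) zero_le_one norm_monoMul_le m n a b

/-- Both sides are continuous and bilinear; on monomials the identity is `w ^ (m + n) = w ^ m w ^
n`, the weights being absorbed by `lcoef`. -/
theorem evLaurent_lmul {w : ℂ} (h1 : 1 < ‖w‖) (h2 : ‖w‖ < 2) (x y : L1 ℤ A) :
    evLaurent w (lmul A x y) = evLaurent w x * evLaurent w y := by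
  have hw : w ≠ 0 := by
    rintro rfl
    simp at h1
    linarith
  have : (ContinuousLinearMap.compL ℂ (L1 ℤ A) (L1 ℤ A) A (evLaurent w)).comp (lmul A) =
      ((ContinuousLinearMap.mul ℂ A).bilinearComp (evLaurent w) (evLaurent w)) := by
    refine L1.ext_single fun m a => L1.ext_single fun n b => ?_
    simp only [ContinuousLinearMap.comp_apply, ContinuousLinearMap.compL_apply,
      ContinuousLinearMap.bilinearComp_apply, ContinuousLinearMap.mul_apply', lmul_single,
      map_smul, evLaurent_single h1 h2, smul_smul, smul_mul_assoc, mul_smul_comm]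
    have e1 := lweight_ne_zero m
    have e2 := lweight_ne_zero n
    have e3 := lweight_ne_zero (m + n)
    have e : lcoef m n * (w ^ (m + n) / lweight (m + n)) =
        w ^ n / lweight n * (w ^ m / lweight m) := by
      rw [lcoef, zpow_add₀ hw]
      field_simp
    rw [e, mul_smul]
    rfl
  exact congrArg (fun M : L1 ℤ A →L[ℂ] L1 ℤ A →L[ℂ] A => M x y) this

end Convolution


/-! ### Laurent expansion on an annulus -/

section Moments

open scoped BoundedContinuousFunction Real Interval

variable {A : Type*} [NormedAddCommGroup A] [NormedSpace ℂ A]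

/-- The value of a continuous function on `[0, 2π]`, extended to the line. -/
def extendCirc (φ : Set.Icc (0 : ℝ) (2 * π) →ᵇ A) (t : ℝ) : A :=
  φ (Set.projIcc 0 (2 * π) Real.two_pi_pos.le t)

theorem continuous_extendCirc (φ : Set.Icc (0 : ℝ) (2 * π) →ᵇ A) : Continuous (extendCirc φ) :=
  φ.continuous.comp continuous_projIcc

theorem norm_extendCirc_le (φ : Set.Icc (0 : ℝ) (2 * π) →ᵇ A) (t : ℝ) :
    ‖extendCirc φ t‖ ≤ ‖φ‖ :=
  φ.norm_coe_le_norm _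

variable {q : ℝ → ℂ} {r : ℝ}

/-- The moment `φ ↦ (2π)⁻¹ ∫ qⁿ φ`. -/
def moment (q : C(ℝ, ℂ)) (r : ℝ) (hq : ∀ t, ‖q t‖ ≤ r) (n : ℕ) :
    (Set.Icc (0 : ℝ) (2 * π) →ᵇ A) →L[ℂ] A :=
  LinearMap.mkContinuous (E := Set.Icc (0 : ℝ) (2 * π) →ᵇ A)
    { toFun := fun φ => (2 * π : ℂ)⁻¹ • ∫ t in (0 : ℝ)..2 * π, q t ^ n • extendCirc φ t
      map_add' := fun φ ψ => by
        rw [← smul_add, ← intervalIntegral.integral_add]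
        · simp only [← smul_add]
          rfl
        all_goals exact
          (((map_continuous q).pow n).smul (continuous_extendCirc _)).intervalIntegrable _ _
      map_smul' := fun c φ => by
        rw [RingHom.id_apply, smul_comm c]
        refine congrArg _ ?_
        rw [← intervalIntegral.integral_smul]
        exact intervalIntegral.integral_congr fun t _ =>
          smul_comm (q t ^ n) c (extendCirc φ t) } (r ^ n) (fun φ => by
      have h1 : ‖∫ t in (0 : ℝ)..2 * π, q t ^ n • extendCirc φ t‖ ≤ r ^ n * ‖φ‖ * |2 * π - 0| :=
        intervalIntegral.norm_integral_le_of_norm_le_const fun t _ => by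
          rw [norm_smul, norm_pow]
          exact mul_le_mul (pow_le_pow_left₀ (norm_nonneg _) (hq t) n) (norm_extendCirc_le φ t)
            (norm_nonneg _) (pow_nonneg ((norm_nonneg _).trans (hq t)) n)
      rw [sub_zero, abs_of_pos Real.two_pi_pos] at h1
      have h2 : ‖(2 * π : ℂ)⁻¹‖ = (2 * π)⁻¹ := by
        simp [abs_of_pos Real.pi_pos]
      change ‖(2 * π : ℂ)⁻¹ • ∫ t in (0 : ℝ)..2 * π, q t ^ n • extendCirc φ t‖ ≤ _
      rw [norm_smul, h2]
      calc (2 * π)⁻¹ * ‖∫ t in (0 : ℝ)..2 * π, q t ^ n • extendCirc φ t‖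
          ≤ (2 * π)⁻¹ * (r ^ n * ‖φ‖ * (2 * π)) :=
            mul_le_mul_of_nonneg_left h1 (by positivity)
        _ = r ^ n * ‖φ‖ := by field_simp)

theorem moment_apply (q : C(ℝ, ℂ)) (hq : ∀ t, ‖q t‖ ≤ r) (n : ℕ)
    (φ : Set.Icc (0 : ℝ) (2 * π) →ᵇ A) :
    moment q r hq n φ = (2 * π : ℂ)⁻¹ • ∫ t in (0 : ℝ)..2 * π, q t ^ n • extendCirc φ t := rfl

theorem norm_moment_le (q : C(ℝ, ℂ)) (hq : ∀ t, ‖q t‖ ≤ r) (n : ℕ) :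
    ‖(moment q r hq n : (Set.Icc (0 : ℝ) (2 * π) →ᵇ A) →L[ℂ] A)‖ ≤ r ^ n :=
  LinearMap.mkContinuous_norm_le _ (pow_nonneg ((norm_nonneg _).trans (hq 0)) n) _

variable [CompleteSpace A]

/-- Term-by-term integration of the geometric series of `(1 - x q)⁻¹`, dominated by `r ^ n`. With
`q` built from a point of a circle, this expands the Cauchy kernel. -/
theorem hasSum_moment (q : C(ℝ, ℂ)) (hq : ∀ t, ‖q t‖ ≤ r) (hr : r < 1)
    (φ : Set.Icc (0 : ℝ) (2 * π) →ᵇ A) {x : ℂ} (hx : ‖x‖ ≤ 1) :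
    HasSum (fun n => x ^ n • moment q r hq n φ)
      ((2 * π : ℂ)⁻¹ • ∫ t in (0 : ℝ)..2 * π, (1 - x * q t)⁻¹ • extendCirc φ t) := by
  have hr0 : 0 ≤ r := (norm_nonneg _).trans (hq 0)
  have hxq : ∀ t, ‖x * q t‖ ≤ r := fun t => by
    rw [norm_mul]
    exact (mul_le_of_le_one_left (norm_nonneg _) hx).trans (hq t)
  have h := intervalIntegral.hasSum_integral_of_dominated_convergence (a := 0) (b := 2 * π)
    (μ := MeasureTheory.volume)
    (F := fun n t => (x * q t) ^ n • extendCirc φ t)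
    (f := fun t => (1 - x * q t)⁻¹ • extendCirc φ t) (fun n _ => r ^ n * ‖φ‖)
    (fun n => (((continuous_const.mul (map_continuous q)).pow n).smul
      (continuous_extendCirc φ)).aestronglyMeasurable)
    (fun n => Filter.Eventually.of_forall fun t _ => by
      rw [norm_smul, norm_pow]
      exact mul_le_mul (pow_le_pow_left₀ (norm_nonneg _) (hxq t) n) (norm_extendCirc_le φ t)
        (norm_nonneg _) (by positivity))
    (Filter.Eventually.of_forall fun t _ =>
      (summable_geometric_of_lt_one hr0 hr).mul_right _)
    (by simp)
    (Filter.Eventually.of_forall fun t _ =>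
      (hasSum_geometric_of_norm_lt_one ((hxq t).trans_lt hr)).smul_const _)
  refine (h.const_smul ((2 * π : ℂ)⁻¹)).congr_fun fun n => ?_
  rw [moment_apply, smul_comm, ← intervalIntegral.integral_smul]
  simp only [smul_smul, mul_pow]

/-- The series converges in operator norm because of the geometric bound, and this makes the Laurent
series a bounded linear function of the boundary values. -/
theorem hasSum_comp_apply {F W : Type*} [NormedAddCommGroup F] [NormedSpace ℂ F]
    [NormedAddCommGroup W] [NormedSpace ℂ W] [CompleteSpace W] {s : ℕ → A →L[ℂ] W}
    {m : ℕ → F →L[ℂ] A} (hs : ∀ n a, ‖s n a‖ = ‖a‖) (hm : ∀ n, ‖m n‖ ≤ r ^ n) (hr0 : 0 ≤ r)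
    (hr : r < 1) (x : F) :
    HasSum (fun n => s n (m n x)) ((∑' n, (s n).comp (m n)) x) := by
  have h : Summable fun n => (s n).comp (m n) := by
    refine Summable.of_norm_bounded (summable_geometric_of_lt_one hr0 hr) fun n => ?_
    refine ContinuousLinearMap.opNorm_le_bound _ (pow_nonneg hr0 n) fun φ => ?_
    rw [ContinuousLinearMap.comp_apply, hs]
    exact (m n).le_of_opNorm_le (hm n) φ
  exact h.hasSum.mapL (ContinuousLinearMap.apply ℂ W x)

/-- The family of moments, as a Laurent series with the given degrees. -/
def momentSeries (q : C(ℝ, ℂ)) (r : ℝ) (hq : ∀ t, ‖q t‖ ≤ r) (i : ℕ → ℤ) :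
    (Set.Icc (0 : ℝ) (2 * π) →ᵇ A) →L[ℂ] L1 ℤ A :=
  ∑' n, (L1.single A (i n)).comp (moment q r hq n)

theorem hasSum_momentSeries (q : C(ℝ, ℂ)) (hq : ∀ t, ‖q t‖ ≤ r) (hr : r < 1) (i : ℕ → ℤ)
    (φ : Set.Icc (0 : ℝ) (2 * π) →ᵇ A) :
    HasSum (fun n => L1.single A (i n) (moment q r hq n φ)) (momentSeries q r hq i φ) :=
  hasSum_comp_apply (F := Set.Icc (0 : ℝ) (2 * π) →ᵇ A) (W := L1 ℤ A)
    (fun n => L1.norm_single (i n)) (norm_moment_le q hq) ((norm_nonneg _).trans (hq 0)) hr φ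

theorem evLaurent_momentSeries_natCast (q : C(ℝ, ℂ)) (hq : ∀ t, ‖q t‖ ≤ r) (hr : r < 1)
    (φ : Set.Icc (0 : ℝ) (2 * π) →ᵇ A) {w : ℂ} (h1 : 1 < ‖w‖) (h2 : ‖w‖ < 2) :
    evLaurent w (momentSeries q r hq (fun n => (n : ℤ)) φ) =
      (2 * π : ℂ)⁻¹ • ∫ t in (0 : ℝ)..2 * π, (1 - w / 2 * q t)⁻¹ • extendCirc φ t := by
  refine ((hasSum_momentSeries q hq hr _ φ).mapL (evLaurent w)).unique ?_
  refine (hasSum_moment q hq hr φ (norm_half_lt h2).le).congr_fun fun n => ?_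
  rw [evLaurent_single h1 h2]
  simp [lweight, div_pow]

theorem evLaurent_momentSeries_negSucc (q : C(ℝ, ℂ)) (hq : ∀ t, ‖q t‖ ≤ r) (hr : r < 1)
    (φ : Set.Icc (0 : ℝ) (2 * π) →ᵇ A) {w : ℂ} (h1 : 1 < ‖w‖) (h2 : ‖w‖ < 2) :
    evLaurent w (momentSeries q r hq Int.negSucc φ) =
      w⁻¹ • (2 * π : ℂ)⁻¹ • ∫ t in (0 : ℝ)..2 * π, (1 - w⁻¹ * q t)⁻¹ • extendCirc φ t := by
  refine ((hasSum_momentSeries q hq hr _ φ).mapL (evLaurent w)).unique ?_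
  refine ((hasSum_moment q hq hr φ (norm_inv_lt h1).le).const_smul w⁻¹).congr_fun fun n => ?_
  rw [evLaurent_single h1 h2, smul_smul, ← pow_succ']
  simp [lweight, zpow_negSucc]

end Moments

/-! ### Cauchy's formula and Laurent coefficients on an annulus -/

section Annulus

open scoped BoundedContinuousFunction Real Interval

variable {A : Type*} [NormedAddCommGroup A] [NormedSpace ℂ A] [CompleteSpace A]

/-- The divided difference of `f` at `w` is holomorphic on the annulus even at `w`, so it has equal
integrals over both circles. Splitting off `f w` leaves the integrals of `(z - w)⁻¹`, which are
`2πi` on the outer circle and `0` on the inner one. -/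
theorem cauchy_annulus {f : ℂ → A} {r R : ℝ} (hr : 0 < r)
    (hf : ∀ z, r ≤ ‖z‖ → ‖z‖ ≤ R → DifferentiableAt ℂ f z) {w : ℂ} (h1 : r < ‖w‖) (h2 : ‖w‖ < R) :
    (∮ z in C(0, R), (z - w)⁻¹ • f z) - (∮ z in C(0, r), (z - w)⁻¹ • f z) =
      (2 * π * Complex.I : ℂ) • f w := by
  have hrR : r < R := h1.trans h2
  have hw := hf w h1.le h2.le
  have key := Complex.circleIntegral_eq_of_differentiable_on_annulus_off_countable (c := 0)
    (f := dslope f w) hr hrR.le (Set.countable_singleton w)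
    (fun z hz => by
      have hz1 : ‖z‖ ≤ R := by simpa using hz.1
      have hz2 : r ≤ ‖z‖ := by simpa using hz.2
      by_cases hzw : z = w
      · rw [hzw]
        exact (continuousAt_dslope_same.2 hw).continuousWithinAt
      · exact ((differentiableAt_dslope_of_ne hzw).2
          (hf z hz2 hz1)).continuousAt.continuousWithinAt)
    (fun z hz => by
      have hz1 : ‖z‖ < R := by simpa using hz.1.1
      have hz2 : r < ‖z‖ := by simpa using hz.1.2
      exact (differentiableAt_dslope_of_ne hz.2).2 (hf z hz2.le hz1.le))
  have hne : ∀ {ρ : ℝ} {z : ℂ}, 0 ≤ ρ → ρ ≠ ‖w‖ → z ∈ Metric.sphere (0 : ℂ) ρ → z ≠ w := by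
    rintro ρ z h0 h hz rfl
    exact h (by simpa using (mem_sphere_zero_iff_norm.1 hz).symm)
  have split : ∀ {ρ : ℝ}, 0 ≤ ρ → ρ ≠ ‖w‖ → r ≤ ρ → ρ ≤ R → (∮ z in C(0, ρ), dslope f w z) =
      (∮ z in C(0, ρ), (z - w)⁻¹ • f z) - (∮ z in C(0, ρ), (z - w)⁻¹) • f w := by
    intro ρ h0 h hr hR
    have c1 : ContinuousOn (fun z : ℂ => (z - w)⁻¹) (Metric.sphere 0 ρ) := fun z hz =>
      ((continuousAt_id.sub continuousAt_const).inv₀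
        (sub_ne_zero.2 (hne h0 h hz))).continuousWithinAt
    have c2 : ContinuousOn f (Metric.sphere 0 ρ) := fun z hz => by
      have hz' : ‖z‖ = ρ := by simpa using hz
      exact (hf z (hz' ▸ hr) (hz' ▸ hR)).continuousAt.continuousWithinAt
    have e := circleIntegral.integral_sub (f := fun z => (z - w)⁻¹ • f z)
      (g := fun z => (z - w)⁻¹ • f w) ((c1.smul c2).circleIntegrable h0)
      ((c1.smul continuousOn_const).circleIntegrable h0)
    rw [← circleIntegral.integral_smul_const, ← e]
    refine circleIntegral.integral_congr h0 fun z hz => ?_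
    simp only [dslope_of_ne f (hne h0 h hz), slope_def_module, smul_sub]
  rw [split (hr.le.trans hrR.le) h2.ne' hrR.le le_rfl, split hr.le h1.ne le_rfl hrR.le] at key
  have e1 : (∮ z in C(0, R), (z - w)⁻¹) = 2 * π * Complex.I :=
    circleIntegral.integral_sub_inv_of_mem_ball (by simpa using h2)
  have e2 : (∮ z in C(0, r), (z - w)⁻¹) = 0 := by
    refine Complex.circleIntegral_eq_zero_of_differentiable_on_off_countable hr.le
      Set.countable_empty (fun z hz => ?_) fun z hz => ?_
    · have hz1 : ‖z‖ ≤ r := by simpa using hz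
      refine ((continuousAt_id.sub continuousAt_const).inv₀ (sub_ne_zero.2 ?_)).continuousWithinAt
      rintro rfl
      exact absurd hz1 (not_le.2 h1)
    · have hz1 : ‖z‖ < r := by simpa using hz.1
      refine (differentiableAt_id.sub_const w).inv (sub_ne_zero.2 ?_)
      rintro rfl
      exact absurd hz1.le (not_le.2 h1)
  rw [e1, e2, zero_smul, sub_zero] at key
  rw [← key]
  abel

variable {E : Type*} [NormedAddCommGroup E] [NormedSpace ℝ E]

/-- The coefficient function on the circle of radius `R`, traversed by `[0, 2π]`. -/
def circSlice (R : ℝ) (g : E × ℂ → A) (y : E) : Set.Icc (0 : ℝ) (2 * π) →ᵇ A :=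
  slice (2 * π) (fun p : E × ℝ => g (p.1, circleMap 0 R p.2)) y

theorem contDiffAt_circSlice {R : ℝ} {g : E × ℂ → A} {y : E}
    (h : ∀ w : ℂ, ‖w‖ = |R| → ContDiffAt ℝ ∞ g (y, w)) : ContDiffAt ℝ ∞ (circSlice R g) y := by
  refine contDiffAt_slice (P := E) (A := A) (G := fun p : E × ℝ => g (p.1, circleMap 0 R p.2))
    fun t _ => ?_
  refine ContDiffAt.comp (f := fun p : E × ℝ => (p.1, circleMap 0 R p.2)) (y, t)
    (h _ (by simp)) (contDiffAt_fst.prodMk ?_)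
  exact ((contDiff_circleMap 0 R).comp (contDiff_snd (E := E) (F := ℝ))).contDiffAt

theorem extendCirc_circSlice {R : ℝ} {g : E × ℂ → A} {y : E}
    (h : ∀ w : ℂ, ‖w‖ = |R| → ContinuousAt g (y, w)) {t : ℝ} (ht : t ∈ Set.Icc 0 (2 * π)) :
    extendCirc (circSlice R g y) t = g (y, circleMap 0 R t) := by
  rw [extendCirc, Set.projIcc_of_mem _ ht]
  refine slice_apply (G := fun p : E × ℝ => g (p.1, circleMap 0 R p.2)) (fun t _ => ?_) _
  refine ContinuousAt.comp (f := fun p : E × ℝ => (p.1, circleMap 0 R p.2)) (x := (y, t))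
    (h _ (by simp)) ?_
  have := continuous_circleMap 0 R
  fun_prop

/-- The Laurent expansion of `g (y, ·)` on the annulus `1/2 < |w| < 3`. -/
def laurent (g : E × ℂ → A) (y : E) : L1 ℤ A :=
  -- The factor `2` produces the weight `2 ^ n` of the `n`-th coordinate; since `|2 / z| = 2 / 3` on
  -- the outer circle, the weighted coefficients remain summable.
  momentSeries ⟨fun t => 2 * (circleMap 0 3 t)⁻¹,
      continuous_const.mul ((continuous_circleMap 0 3).inv₀ fun t => circleMap_ne_center (by simp))⟩
      (2 / 3) (fun t => by simp [div_eq_mul_inv]) (fun n => (n : ℤ)) (circSlice 3 g y) +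
    -- The coefficient of degree `-1 - n` is the mean of `z ^ (n + 1) g` over the inner circle,
    -- hence the `n`-th moment of `z g`.
    momentSeries ⟨circleMap 0 (1 / 2), continuous_circleMap 0 (1 / 2)⟩ (1 / 2)
      (fun t => by simp) Int.negSucc (circSlice (1 / 2) (fun p => p.2 • g p) y)

theorem contDiffAt_laurent {g : E × ℂ → A} {y : E}
    (h : ∀ w : ℂ, 1 / 2 ≤ ‖w‖ → ‖w‖ ≤ 3 → ContDiffAt ℝ ∞ g (y, w)) :
    ContDiffAt ℝ ∞ (laurent g) y := by
  refine ContDiffAt.add ?_ ?_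
  · exact ((momentSeries _ _ _ _).restrictScalars ℝ).contDiff.contDiffAt.comp y
      (contDiffAt_circSlice fun w hw => h w (by rw [hw]; norm_num) (by rw [hw]; norm_num))
  · exact ((momentSeries _ _ _ _).restrictScalars ℝ).contDiff.contDiffAt.comp y
      (contDiffAt_circSlice fun w hw =>
        contDiffAt_snd.smul (h w (by rw [hw]; norm_num) (by rw [hw]; norm_num)))

/-- The moments sum up to Cauchy integrals over the circles of radius `3` and `1/2`, which
`cauchy_annulus` combines. -/
theorem evLaurent_laurent {g : E × ℂ → A} {y : E}
    (h : ∀ w : ℂ, 1 / 2 ≤ ‖w‖ → ‖w‖ ≤ 3 → ContinuousAt g (y, w))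
    (h' : ∀ w : ℂ, 1 / 2 ≤ ‖w‖ → ‖w‖ ≤ 3 → DifferentiableAt ℂ (fun z => g (y, z)) w)
    {w : ℂ} (h1 : 1 < ‖w‖) (h2 : ‖w‖ < 2) : evLaurent w (laurent g y) = g (y, w) := by
  have key := cauchy_annulus (f := fun z => g (y, z)) (r := 1 / 2) (R := 3) (by norm_num) h'
    (w := w) (by linarith) (by linarith)
  have hw : w ≠ 0 := by
    rintro rfl
    simp at h1
    linarith
  rw [laurent, map_add, evLaurent_momentSeries_natCast _ _ (by norm_num) _ h1 h2,
    evLaurent_momentSeries_negSucc _ _ (by norm_num) _ h1 h2]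
  -- With `dz = i z dt`, the kernel `(1 - w / z)⁻¹ dt` is `i⁻¹ (z - w)⁻¹ dz`.
  have e1 : (∫ t in (0 : ℝ)..2 * π, (1 - w / 2 * (2 * (circleMap 0 3 t)⁻¹))⁻¹ •
      extendCirc (circSlice 3 g y) t) = Complex.I⁻¹ • ∮ z in C(0, 3), (z - w)⁻¹ • g (y, z) := by
    rw [circleIntegral, ← intervalIntegral.integral_smul]
    refine intervalIntegral.integral_congr fun t ht => ?_
    rw [Set.uIcc_of_le Real.two_pi_pos.le] at ht
    have hne : circleMap 0 3 t ≠ 0 := circleMap_ne_center (by norm_num)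
    have hne2 : circleMap 0 3 t - w ≠ 0 := by
      refine sub_ne_zero.2 ?_
      rintro rfl
      simp at h2
      linarith
    simp only [deriv_circleMap]
    rw [extendCirc_circSlice (fun w hw => h w (by rw [hw]; norm_num) (by rw [hw]; norm_num)) ht,
      smul_smul, smul_smul]
    congr 1
    have : 1 - w / 2 * (2 * (circleMap 0 3 t)⁻¹) = (circleMap 0 3 t - w) / circleMap 0 3 t := by
      field_simp
    rw [this]
    field_simp
  -- On the inner circle `w⁻¹ (1 - z / w)⁻¹ = -(z - w)⁻¹`, which accounts for the sign.
  have e2 : (w⁻¹ • ∫ t in (0 : ℝ)..2 * π, (1 - w⁻¹ * circleMap 0 (1 / 2) t)⁻¹ •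
      extendCirc (circSlice (1 / 2) (fun p => p.2 • g p) y) t) =
      -(Complex.I⁻¹ • ∮ z in C(0, 1 / 2), (z - w)⁻¹ • g (y, z)) := by
    rw [circleIntegral, ← intervalIntegral.integral_smul, ← intervalIntegral.integral_smul,
      ← intervalIntegral.integral_neg]
    refine intervalIntegral.integral_congr fun t ht => ?_
    rw [Set.uIcc_of_le Real.two_pi_pos.le] at ht
    have hne2 : circleMap 0 (1 / 2) t - w ≠ 0 := by
      refine sub_ne_zero.2 ?_
      rintro rfl
      simp at h1
      linarith
    simp only [deriv_circleMap]
    rw [extendCirc_circSlice (R := 1 / 2) (g := fun p => p.2 • g p) (fun w hw => continuousAt_snd.smul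
      (h w (by rw [hw]; norm_num) (by rw [hw]; norm_num))) ht]
    simp only [smul_smul]
    rw [← neg_smul]
    congr 1
    have : 1 - w⁻¹ * circleMap 0 (1 / 2) t = -(circleMap 0 (1 / 2) t - w) / w := by
      field_simp
      ring
    rw [this]
    field_simp
  rw [smul_comm w⁻¹]
  simp only [ContinuousMap.coe_mk]
  rw [e1, e2, ← smul_add, ← sub_eq_add_neg, ← smul_sub, key, smul_smul, smul_smul]
  have : (2 * π : ℂ)⁻¹ * Complex.I⁻¹ * (2 * π * Complex.I) = 1 := by
    have hpi : (π : ℂ) ≠ 0 := by exact_mod_cast Real.pi_ne_zero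
    field_simp
  rw [this, one_smul]

end Annulus

/-! ### Factorization of matrix functions on an annulus -/

section Factorization

variable {A : Type*} [NormedRing A] [NormedAlgebra ℂ A] [CompleteSpace A]
  {E : Type*} [NormedAddCommGroup E] [NormedSpace ℝ E]

theorem eventually_forall_annulus {y₀ : E} {Q : E × ℂ → Prop}
    (h : ∀ w : ℂ, 1 / 2 ≤ ‖w‖ → ‖w‖ ≤ 3 → ∀ᶠ q in 𝓝 (y₀, w), Q q) :
    ∀ᶠ y in 𝓝 y₀, ∀ w : ℂ, 1 / 2 ≤ ‖w‖ → ‖w‖ ≤ 3 → Q (y, w) := by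
  have hK : IsCompact (Metric.closedBall (0 : ℂ) 3 ∩ {w | 1 / 2 ≤ ‖w‖}) :=
    (isCompact_closedBall 0 3).inter_right (isClosed_le continuous_const continuous_norm)
  have := hK.eventually_forall_of_forall_eventually (x₀ := y₀) (P := fun y w => Q (y, w))
    fun w hw => h w hw.2 (by simpa using hw.1)
  exact this.mono fun y hy w h1 h2 => hy w ⟨by simpa using h2, h1⟩

theorem laurent_eq_zero {g : E × ℂ → A} {y : E}
    (hc : ∀ w : ℂ, 1 / 2 ≤ ‖w‖ → ‖w‖ ≤ 3 → ContinuousAt g (y, w))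
    (h : ∀ w : ℂ, 1 / 2 ≤ ‖w‖ → ‖w‖ ≤ 3 → g (y, w) = 0) : laurent g y = 0 := by
  have key : ∀ (R : ℝ) (f : E × ℂ → A), (∀ w : ℂ, ‖w‖ = |R| → ContinuousAt f (y, w)) →
      (∀ w : ℂ, ‖w‖ = |R| → f (y, w) = 0) → circSlice R f y = 0 := by
    intro R f hc hf
    ext t
    have h1 := extendCirc_circSlice hc t.2
    rw [extendCirc, Set.projIcc_val, hf _ (by simp)] at h1
    exact h1
  rw [laurent, key 3 g (fun w hw => hc w (by rw [hw]; norm_num) (by rw [hw]; norm_num))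
    (fun w hw => h w (by rw [hw]; norm_num) (by rw [hw]; norm_num)),
    key (1 / 2) (fun p => p.2 • g p)
      (fun w hw => continuousAt_snd.smul (hc w (by rw [hw]; norm_num) (by rw [hw]; norm_num)))
      (fun w hw => by rw [h w (by rw [hw]; norm_num) (by rw [hw]; norm_num), smul_zero]),
    map_zero, map_zero, add_zero]

variable (A) in
/-- The Toeplitz operator `a ↦ (k ↦ P₋ (a k))`. -/
def toeplitz : L1 ℤ A →L[ℂ] L1 ℤ A →L[ℂ] L1 ℤ A :=
  (ContinuousLinearMap.compL ℂ (L1 ℤ A) (L1 ℤ A) (L1 ℤ A) projNeg).comp (lmul A)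

theorem toeplitz_apply (a k : L1 ℤ A) : toeplitz A a k = projNeg (lmul A a k) := rfl

/-- The solution of `P₋ (a + k + a k) = 0` of negative degrees. -/
def negFactor (a : L1 ℤ A) : L1 ℤ A := neumann (toeplitz A) (-projNeg a) a

theorem negFactor_zero : negFactor (0 : L1 ℤ A) = 0 := by
  rw [negFactor, neumann_zero, map_zero, neg_zero]

theorem projNeg_negFactor {a : L1 ℤ A} (ha : ‖toeplitz A a‖ < 1) :
    projNeg (negFactor a) = negFactor a := by
  have h := eq_sub_of_add_eq (neumann_add ha (-projNeg a))
  have h' : negFactor a = -projNeg a - projNeg (lmul A a (negFactor a)) := h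
  rw [h', map_sub, map_neg, projNeg_projNeg, projNeg_projNeg]

/-- Writing `g = 1 + a` and `k` for the negative factor, this says that `g (1 + k) - 1` has no terms
of negative degree. -/
theorem projNeg_posFactor {a : L1 ℤ A} (ha : ‖toeplitz A a‖ < 1) :
    projNeg (negFactor a + a + lmul A a (negFactor a)) = 0 := by
  have h : negFactor a + projNeg (lmul A a (negFactor a)) = -projNeg a :=
    neumann_add ha (-projNeg a)
  rw [map_add, map_add, projNeg_negFactor ha, add_right_comm, h, neg_add_cancel]

theorem contDiffAt_negFactor {a : L1 ℤ A} (ha : ‖toeplitz A a‖ < 1) :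
    ContDiffAt ℂ ∞ negFactor a :=
  ContDiffAt.comp (f := fun a : L1 ℤ A => (-projNeg a, a)) a (contDiffAt_neumann ha)
    ((projNeg.contDiff.contDiffAt.neg).prodMk contDiffAt_id)

theorem contDiffAt_posFactor {a : L1 ℤ A} (ha : ‖toeplitz A a‖ < 1) :
    ContDiffAt ℂ ∞ (fun a : L1 ℤ A => negFactor a + a + lmul A a (negFactor a)) a :=
  ((contDiffAt_negFactor ha).add contDiffAt_id).add
    (((lmul A).contDiff.contDiffAt).clm_apply (contDiffAt_negFactor ha))

theorem smoothHolAt_clm_apply {F : Type*} [NormedAddCommGroup F] [NormedSpace ℂ F]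
    {ev : ℂ → F →L[ℂ] A} {k : E → F} {y : E} {w : ℂ}
    (hev : ∀ᶠ w' in 𝓝 w, ContDiffAt ℂ ∞ ev w') (hk : ∀ᶠ y' in 𝓝 y, ContDiffAt ℝ ∞ k y') :
    SmoothHolAt (fun p : E × ℂ => 1 + ev p.2 (k p.1)) (y, w) := by
  filter_upwards [hk.prod_nhds hev] with p hp
  constructor
  · have h1 : ContDiffAt ℝ ∞ (fun q : (F →L[ℂ] A) × F => q.1 q.2) (ev p.2, k p.1) :=
      (isBoundedBilinearMap_apply (𝕜 := ℂ) (E := F) (F := A)).contDiff.contDiffAt.restrict_scalars ℝ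
    have h2 : ContDiffAt ℝ ∞ (fun p : E × ℂ => (ev p.2, k p.1)) p :=
      ((hp.2.restrict_scalars ℝ).comp p contDiffAt_snd).prodMk (hp.1.comp p contDiffAt_fst)
    exact contDiffAt_const.add (ContDiffAt.comp (f := fun p : E × ℂ => (ev p.2, k p.1)) p h1 h2)
  · exact ((hp.2.differentiableAt (by simp)).clm_apply (differentiableAt_const _)).const_add 1

/-- A family of holomorphic functions on an annulus, equal to `1` at the base point, is the
quotient of two families of holomorphic functions on the two sides of the annulus. -/
theorem exists_factorization {g : E × ℂ → A} {y₀ : E}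
    (hg : ∀ w : ℂ, 1 / 2 ≤ ‖w‖ → ‖w‖ ≤ 3 → SmoothHolAt g (y₀, w))
    (hg1 : ∀ w : ℂ, 1 / 2 ≤ ‖w‖ → ‖w‖ ≤ 3 → g (y₀, w) = 1) :
    ∃ hm hp : E × ℂ → A,
      (∀ t : ℂ, ‖t‖ < 1 → SmoothHolAt hm (y₀, t) ∧ hm (y₀, t) = 1) ∧
      (∀ w : ℂ, ‖w‖ < 2 → SmoothHolAt hp (y₀, w) ∧ hp (y₀, w) = 1) ∧
      ∀ᶠ y in 𝓝 y₀, ∀ w : ℂ, 1 < ‖w‖ → ‖w‖ < 2 → g (y, w) * hm (y, w⁻¹) = hp (y, w) := by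
  -- The series of `g - 1` vanishes at `y₀`, so near `y₀` its Toeplitz operator has norm less than
  -- `1` and the Neumann solution is available.
  set a : E → L1 ℤ A := laurent fun p => g p - 1 with ha
  have hev := eventually_forall_annulus hg
  have ha0 : a y₀ = 0 := laurent_eq_zero
    (fun w h1 h2 => (hg w h1 h2).continuousAt.sub continuousAt_const)
    (fun w h1 h2 => by rw [hg1 w h1 h2, sub_self])
  have hsm : ∀ᶠ y in 𝓝 y₀, ContDiffAt ℝ ∞ a y := hev.mono fun y hy =>
    contDiffAt_laurent fun w h1 h2 => (hy w h1 h2).1.sub contDiffAt_const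
  have hlt : ∀ᶠ y in 𝓝 y₀, ‖toeplitz A (a y)‖ < 1 := by
    have h1 : ContinuousAt (fun y => ‖toeplitz A (a y)‖) y₀ :=
      ((toeplitz A).continuous.continuousAt.comp hsm.self_of_nhds.continuousAt).norm
    exact h1.eventually_lt continuousAt_const (by rw [ha0, map_zero, norm_zero]; exact one_pos)
  -- The factor on the outer side is `1 + k` with `k` of negative degrees, written in the coordinate
  -- `w⁻¹`; the factor on the inner side is `g (1 + k)`, which has only non-negative degrees.
  refine ⟨fun p => 1 + evNeg p.2 (negFactor (a p.1)),
    fun p => 1 + evPos p.2 (negFactor (a p.1) + a p.1 + lmul A (a p.1) (negFactor (a p.1))),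
    fun t ht => ⟨?_, ?_⟩, fun w hw => ⟨?_, ?_⟩, ?_⟩
  · refine smoothHolAt_clm_apply (k := fun y => negFactor (a y)) ?_ ?_
    · exact (continuous_norm.continuousAt.eventually_lt continuousAt_const ht).mono
        fun t ht => contDiffAt_evNeg ht
    · filter_upwards [hsm, hlt] with y h1 h2
      exact ((contDiffAt_negFactor h2).restrict_scalars ℝ).comp y h1
  · simp only [ha0, negFactor_zero, map_zero, add_zero]
  · refine smoothHolAt_clm_apply
      (k := fun y => negFactor (a y) + a y + lmul A (a y) (negFactor (a y))) ?_ ?_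
    · exact (continuous_norm.continuousAt.eventually_lt continuousAt_const hw).mono
        fun w hw => contDiffAt_evPos hw
    · filter_upwards [hsm, hlt] with y h1 h2
      exact ((contDiffAt_posFactor h2).restrict_scalars ℝ).comp y h1
  · simp only [ha0, negFactor_zero, map_zero, add_zero]
  · filter_upwards [hev, hlt] with y h1 h2 w hw1 hw2
    -- On `1 < |w| < 2` both factors are values of Laurent series, and evaluation there is
    -- multiplicative.
    have e1 : evLaurent w (a y) = g (y, w) - 1 := evLaurent_laurent
      (fun w h h' => (h1 w h h').1.continuousAt.sub continuousAt_const)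
      (fun w h h' => (h1 w h h').2.sub_const 1) hw1 hw2
    have e2 : evLaurent w (negFactor (a y)) = evNeg w⁻¹ (negFactor (a y)) := by
      rw [evLaurent, _root_.add_apply, evPos_of_projNeg_eq hw2 (projNeg_negFactor h2), zero_add]
    have e3 := evNeg_of_projNeg_eq_zero (norm_inv_lt hw1) (projNeg_posFactor h2)
    have e4 : evPos w (negFactor (a y) + a y + lmul A (a y) (negFactor (a y))) =
        evLaurent w (negFactor (a y) + a y + lmul A (a y) (negFactor (a y))) := by
      rw [evLaurent, _root_.add_apply, e3, add_zero]
    rw [e4, map_add, map_add, evLaurent_lmul hw1 hw2, e1, e2]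
    noncomm_ring

end Factorization

/-! ### Uniqueness of isomorphisms -/

section Rigidity

/-- Used for the rigidity of morphisms and for the existence of fixed sections: the set where `P`
holds and its complement are both open. -/
theorem forall_of_locally_constant {X : Type*} [TopologicalSpace X] [ConnectedSpace X]
    {P : X → Prop} (h : ∀ y₀, ∃ N ∈ 𝓝 y₀, ∀ y ∈ N, ∀ y' ∈ N, P y → P y') {x : X} (hx : P x)
    (y : X) : P y := by
  have h1 : IsClopen {y | P y} := by
    constructor
    · rw [← isOpen_compl_iff, isOpen_iff_mem_nhds]
      intro y hy
      obtain ⟨N, hN, hP⟩ := h y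
      exact Filter.mem_of_superset hN fun y' hy' hp =>
        hy (hP y' hy' y (mem_of_mem_nhds hN) hp)
    · rw [isOpen_iff_mem_nhds]
      intro y hy
      obtain ⟨N, hN, hP⟩ := h y
      exact Filter.mem_of_superset hN fun y' hy' => hP y (mem_of_mem_nhds hN) y' hy' hy
  have := h1.eq_univ ⟨x, hx⟩
  exact (this ▸ Set.mem_univ y : y ∈ {y | P y})

section Ode

variable {A : Type*} [NormedRing A] [NormedAlgebra ℂ A] [CompleteSpace A] {E : Type*} [NormedAddCommGroup E]
  [NormedSpace ℝ E]

/-- A parallel section of the adjoint bundle which is trivial at one point is trivial. -/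
theorem eq_one_of_commutator_eq {U : Set E} (hU : Convex ℝ U) {a : E → E →L[ℝ] A}
    (ha : ContinuousOn a U) {G : E → A} (hG : ∀ e ∈ U, DifferentiableAt ℝ G e)
    (hD : ∀ e ∈ U, ∀ v, fderiv ℝ G e v = G e * a e v - a e v * G e) {e e' : E} (he : e ∈ U)
    (he' : e' ∈ U) (h1 : G e = 1) : G e' = 1 := by
  set γ : ℝ → E := fun t => e + t • (e' - e) with hγ
  have hmem : ∀ t ∈ Set.Icc (0 : ℝ) 1, γ t ∈ U := fun t ht =>
    hU.add_smul_sub_mem he he' ht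
  have hγd : ∀ t, HasDerivAt γ (e' - e) t := fun t => by
    have := ((hasDerivAt_id t).smul_const (e' - e)).const_add e
    rwa [one_smul] at this
  have hγc : Continuous γ := continuous_iff_continuousAt.2 fun t => (hγd t).continuousAt
  -- Along the segment `G` solves the linear equation `k' = k a - a k`, of which the constant `1` is
  -- a solution.
  let M : ℝ → A →L[ℝ] A := fun t =>
    (ContinuousLinearMap.mul ℝ A).flip (a (γ t) (e' - e)) -
      ContinuousLinearMap.mul ℝ A (a (γ t) (e' - e))
  have hac : ContinuousOn (fun t => a (γ t) (e' - e)) (Set.Icc 0 1) :=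
    (ha.comp hγc.continuousOn hmem).clm_apply continuousOn_const
  have hM : ContinuousOn M (Set.Icc 0 1) :=
    ((ContinuousLinearMap.mul ℝ A).flip.continuous.comp_continuousOn hac).sub
      ((ContinuousLinearMap.mul ℝ A).continuous.comp_continuousOn hac)
  have key := linear_ode_unique hM (f := fun t => G (γ t)) (g := fun _ => 1)
    (fun t ht => ?_) (fun t ht => ?_) (by simp [hγ, h1])
  · have := key (Set.right_mem_Icc.2 zero_le_one)
    simpa [hγ] using this
  · have h2 := (hG _ (hmem t ht)).hasFDerivAt.comp_hasDerivAt t (hγd t)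
    rw [hD _ (hmem t ht)] at h2
    exact h2.hasDerivWithinAt
  · have : M t 1 = 0 := by simp [M]
    rw [this]
    exact hasDerivWithinAt_const _ _ _

end Ode

variable {E : Type uE} [NormedAddCommGroup E] [NormedSpace ℂ E]
variable {X : Type uX} [TopologicalSpace X] [ChartedSpace E X] [IsManifold 𝓘(ℝ, E) ∞ X]
variable {B : Type uB} [NormedRing B] [NormedAlgebra ℝ B] [StarRing B] [CStarRing B]
  [StarModule ℝ B] {x : X}

/-- Morphisms of framed twistor torsors, without the condition on the real structures. -/
structure FramedTwistor.IsHom (S T : FramedTwistor E B x) (φ : S.Tot → T.Tot) : Prop where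
  proj : ∀ p, T.proj (φ p) = S.proj p
  act : ∀ p g, φ (S.act p g) = T.act (φ p) g
  reg : ∀ s w, S.IsReg s w → T.IsReg (φ ∘ s) w
  conn : ∀ s y c, c ≠ 0 → S.IsReg s (y, pt c) → T.conn (φ ∘ s) y c = S.conn s y c
  frame : ∀ z, φ (S.frame z) = T.frame z

theorem eventually_reg_slice {T : Torsor (X × P1) (Cx B)ˣ (SmoothHolUnits E)}
    {s : X × P1 → T.Tot} {y : X} {z : P1} (h : T.IsReg s (y, z)) :
    ∀ᶠ y' in 𝓝 y, T.IsReg s (y', z) :=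
  (continuous_id.prodMk continuous_const).continuousAt.eventually (T.reg_nhds _ _ h)

theorem SmoothHolUnits.contMDiffAt {g : X × P1 → (Cx B)ˣ} {y : X} {c : ℂ × ℂ} (hc : c ≠ 0)
    (h : SmoothHolUnits E g (y, pt c)) :
    ContMDiffAt 𝓘(ℝ, E) 𝓘(ℝ, Cx B) ∞ (fun y' => (g (y', pt c)).val) y := by
  have h1 := (h c hc rfl).self_of_nhds.1
  have h2 : ContMDiffAt 𝓘(ℝ, E) (𝓘(ℝ, E).prod 𝓘(ℝ, ℂ × ℂ)) ∞ (fun y' : X => (y', c)) y :=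
    contMDiffAt_id.prodMk contMDiffAt_const
  exact ContMDiffAt.comp (f := fun y' : X => (y', c))
    (g := fun p' : X × (ℂ × ℂ) => (g (p'.1, pt p'.2)).val) y h1 h2

theorem localForm_conn_contDiffAt (T : FramedTwistor E B x) {s : X × P1 → T.Tot} {y : X}
    {c : ℂ × ℂ} (hc : c ≠ 0) (h : T.IsReg s (y, pt c)) :
    ContDiffAt ℝ ∞ (localForm y fun y' => T.conn s y' c) (chartAt E y y) :=
  ContDiffAt.comp (f := fun e : E => (e, c)) (chartAt E y y) (T.conn_smooth s y c hc h)
    (contDiffAt_id.prodMk contDiffAt_const)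

variable [CompleteSpace B]

/-- The two morphisms take a trivialising section over `{y} × ℙ¹` to sections that differ by a
constant; agreement at one point forces this constant to be `1`. -/
theorem FramedTwistor.IsHom.exists_act {S T : FramedTwistor E B x} {φ ψ : S.Tot → T.Tot}
    (hφ : S.IsHom T φ) (hψ : S.IsHom T ψ) {y : X} {z : P1} {p : S.Tot} (hp : S.proj p = (y, z))
    (h : φ p = ψ p) {q : S.Tot} (hq : (S.proj q).1 = y) : φ q = ψ q := by
  obtain ⟨f, hf⟩ := S.fibre_trivial y
  have key : ∀ {χ : S.Tot → T.Tot}, S.IsHom T χ →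
      T.toTorsor.IsFibreSection y fun z => χ (f z) := by
    intro χ hχ z
    obtain ⟨s, h1, h2, h3⟩ := hf z
    exact ⟨χ ∘ s, hχ.reg _ _ h1, congrArg χ h2, h3.mono fun z' hz' => congrArg χ hz'⟩
  obtain ⟨k, hk⟩ := (key hφ).exists_act (key hψ)
  obtain ⟨g, rfl, -⟩ := S.existsUnique_act (f z) p (by rw [hf.proj, hp])
  have e1 := hk z
  have e2 : φ (f z) = ψ (f z) := by
    rw [hφ.act, hψ.act] at h
    have := congrArg (fun r => T.act r g⁻¹) h
    simpa only [← T.act_mul, mul_inv_cancel, T.act_one] using this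
  have e3 : k = 1 := by
    refine (Torsor.act_left_inj (T := T.toTorsor) (p := φ (f z))).1 ?_
    rw [T.act_one, ← e1, e2]
  obtain ⟨g', hg', -⟩ := S.existsUnique_act (f (S.proj q).2) q (by rw [hf.proj, ← hq])
  rw [← hg', hφ.act, hψ.act, hk, e3, T.act_one]

/-- At `(u, v) = (1, 0)` the operator `u d + v dᶜ` is `d`. Both morphisms preserve the connection,
so the function `g` with `ψ = φ g` satisfies `dg = g a - a g` and remains `1` along segments in a
chart. -/
theorem FramedTwistor.IsHom.locally_eq {S T : FramedTwistor E B x} {φ ψ : S.Tot → T.Tot}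
    (hφ : S.IsHom T φ) (hψ : S.IsHom T ψ) {s : X × P1 → S.Tot} {y₀ : X}
    (hs : S.IsReg s (y₀, pt (1, 0))) :
    ∃ N ∈ 𝓝 y₀, ∀ y ∈ N, ∀ y' ∈ N, φ (s (y, pt (1, 0))) = ψ (s (y, pt (1, 0))) →
      φ (s (y', pt (1, 0))) = ψ (s (y', pt (1, 0))) := by
  set c : ℂ × ℂ := (1, 0) with hc
  have hc0 : c ≠ 0 := by simp [hc]
  set g : X × P1 → (Cx B)ˣ := fun w => T.toTorsor.div (φ (s w)) (ψ (s w)) with hg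
  have hproj : ∀ w, T.proj (φ (s w)) = T.proj (ψ (s w)) := fun w => by rw [hφ.proj, hψ.proj]
  have hgs : ψ ∘ s = fun w => T.act ((φ ∘ s) w) (g w) :=
    funext fun w => (Torsor.act_div (hproj w)).symm
  have hreg : ∀ᶠ y in 𝓝 y₀, S.IsReg s (y, pt c) := eventually_reg_slice hs
  have hgr : ∀ y, S.IsReg s (y, pt c) → SmoothHolUnits E g (y, pt c) := fun y hy =>
    Torsor.reg_div (hφ.reg _ _ hy) (hψ.reg _ _ hy)
  have hd : ∀ y, S.IsReg s (y, pt c) → ∀ ξ, dFun (fun y' => (g (y', pt c)).val) y ξ =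
      (g (y, pt c)).val * S.conn s y c ξ - S.conn s y c ξ * (g (y, pt c)).val := by
    intro y hy ξ
    have e1 := T.conn_act _ y c hc0 (hφ.reg _ _ hy) g (hgr y hy) ξ
    rw [← hgs, hφ.conn _ _ _ hc0 hy, hψ.conn _ _ _ hc0 hy] at e1
    simp only [hc, one_smul, zero_smul, add_zero] at e1
    rw [← hc] at e1
    have e2 := congrArg (fun b => (g (y, pt c)).val * b) e1
    simp only [mul_add, ← mul_assoc, Units.mul_inv, one_mul] at e2
    rw [e2]
    abel
  have ha : ContDiffAt ℝ ∞ (localForm y₀ fun y => S.conn s y c) (chartAt E y₀ y₀) :=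
    localForm_conn_contDiffAt S hc0 hs
  have hac : ∀ᶠ e in 𝓝 (chartAt E y₀ y₀), ContinuousAt (localForm y₀ fun y => S.conn s y c) e :=
    ((ha.of_le (m := 1) (by exact_mod_cast le_top)).eventually (by simp)).mono
      fun e he => he.continuousAt
  obtain ⟨r, hr, hball⟩ := Metric.eventually_nhds_iff_ball.1
    (((eventually_symm hreg).and hac).and (eventually_mem_target y₀))
  have hcv := convex_ball (chartAt E y₀ y₀) r
  have hsm : ∀ e ∈ Metric.ball (chartAt E y₀ y₀) r, ContMDiffAt 𝓘(ℝ, E) 𝓘(ℝ, Cx B) ∞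
      (fun y' => (g (y', pt c)).val) ((chartAt E y₀).symm e) := fun e he =>
    SmoothHolUnits.contMDiffAt hc0 (hgr _ (hball e he).1.1)
  refine ⟨(chartAt E y₀).source ∩ chartAt E y₀ ⁻¹' Metric.ball (chartAt E y₀ y₀) r, ?_, ?_⟩
  · exact Filter.inter_mem ((chartAt E y₀).open_source.mem_nhds (mem_chart_source E y₀))
      ((chartAt E y₀).continuousAt (mem_chart_source E y₀) (Metric.ball_mem_nhds _ hr))
  · rintro y ⟨hy1, hy2⟩ y' ⟨hy1', hy2'⟩ heq
    have key := eq_one_of_commutator_eq hcv (a := localForm y₀ fun y => S.conn s y c)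
      (G := fun e => (g ((chartAt E y₀).symm e, pt c)).val)
      (fun e he => (hball e he).1.2.continuousWithinAt)
      (fun e he => ?_) (fun e he v => ?_) hy2 hy2' ?_
    · simp only [(chartAt E y₀).left_inv hy1'] at key
      have h1 : g (y', pt c) = 1 := Units.ext key
      rw [← Torsor.act_div (hproj (y', pt c))]
      change _ = T.act _ (g (y', pt c))
      rw [h1, T.act_one]
    · exact ((contMDiffAt_iff_chart (y₀ := y₀)
        ((chartAt E y₀).map_target (hball e he).2)).1 (hsm e he)).differentiableAt (by simp) |>
          fun h => by rwa [(chartAt E y₀).right_inv (hball e he).2] at h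
    · rw [← localForm_dFun (f := fun y' => (g (y', pt c)).val) (hball e he).2 (hsm e he)]
      exact hd _ (hball e he).1.1 _
    · simp only [(chartAt E y₀).left_inv hy1]
      have : g (y, pt c) = 1 := Torsor.div_eq_of_act_eq (by rw [T.act_one]; exact heq)
      rw [this, Units.val_one]

/-- Morphisms of framed twistor torsors are unique. -/
theorem FramedTwistor.IsHom.eq [ConnectedSpace X] {S T : FramedTwistor E B x}
    {φ ψ : S.Tot → T.Tot} (hφ : S.IsHom T φ) (hψ : S.IsHom T ψ) : φ = ψ := by
  have key : ∀ y, ∀ p, (S.proj p).1 = y → φ p = ψ p := by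
    refine forall_of_locally_constant (fun y₀ => ?_) (x := x) fun p hp => ?_
    · obtain ⟨s, hs⟩ := S.reg_exists (y₀, pt (1, 0))
      obtain ⟨N, hN, h⟩ := hφ.locally_eq hψ hs
      refine ⟨_, Filter.inter_mem hN (eventually_reg_slice hs), fun y hy y' hy' hP p hp => ?_⟩
      exact hφ.exists_act hψ (S.reg_proj _ _ hy'.2)
        (h y hy.1 y' hy'.1 (hP _ (by rw [S.reg_proj _ _ hy.2]))) hp
    · exact hφ.exists_act hψ (S.frame_section.proj (pt (1, 0)))
        (by rw [hφ.frame, hψ.frame]) hp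
  exact funext fun p => key _ p rfl

end Rigidity

/-! ### Local expressions of connections -/

section LocalExpr

variable {E : Type*} [NormedAddCommGroup E] [NormedSpace ℂ E]
  {C : Type*} [NormedAddCommGroup C] [NormedSpace ℂ C]
  {A : Type*} [NormedRing A] [NormedAlgebra ℂ A]

theorem fderiv_slice_eq {G : E × C → A} {e : E} {c : C} (h : DifferentiableAt ℝ G (e, c)) :
    fderiv ℝ (fun e => G (e, c)) e = fderivFst G (e, c) :=
  (h.hasFDerivAt.comp e (hasFDerivAt_prodMk_left e c)).fderiv

theorem SmoothHolAt.contDiffAt_fderivFst {G : E × C → A} {q : E × C} (h : SmoothHolAt G q) :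
    ContDiffAt ℝ ∞ (fderivFst G) q :=
  (h.contDiffAt.fderiv_right (m := ∞) (by simp)).clm_comp contDiffAt_const

/-- The derivative in `c` is complex linear for all nearby `e`; differentiating this in `e` and
exchanging the order of the two derivatives gives complex linearity in `c` of the derivative of
`fderivFst`. -/
theorem SmoothHolAt.differentiableAt_fderivFst {G : E × C → A} {q : E × C} (h : SmoothHolAt G q)
    (ξ : E) : DifferentiableAt ℂ (fun c => fderivFst G (q.1, c) ξ) q.2 := by
  have h1 : DifferentiableAt ℝ (fderiv ℝ G) q :=
    (h.contDiffAt.fderiv_right (m := 1) (by norm_cast)).differentiableAt (by simp)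
  have hs : IsSymmSndFDerivAt ℝ G q := h.contDiffAt.isSymmSndFDerivAt (by
    rw [minSmoothness_of_isRCLikeNormedField]
    exact WithTop.coe_le_coe.2 le_top)
  have h2 : HasFDerivAt (fun c => fderivFst G (q.1, c) ξ)
      (((fderiv ℝ (fderiv ℝ G) q).flip (ξ, 0)).comp (ContinuousLinearMap.inr ℝ E C)) q.2 := by
    have := (h1.hasFDerivAt.comp q.2 (hasFDerivAt_prodMk_right (𝕜 := ℝ) q.1 q.2)).clm_apply
      (hasFDerivAt_const ((ξ, 0) : E × C) q.2)
    refine this.congr_fderiv ?_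
    ext v
    simp
  refine differentiableAt_complex_of_fderiv h2 fun v => ?_
  have h3 : ∀ w : C, HasFDerivAt (fun e => fderiv ℝ G (e, q.2) (0, w))
      (((fderiv ℝ (fderiv ℝ G) q).flip (0, w)).comp (ContinuousLinearMap.inl ℝ E C)) q.1 := by
    intro w
    have := (h1.hasFDerivAt.comp q.1 (hasFDerivAt_prodMk_left (𝕜 := ℝ) q.1 q.2)).clm_apply
      (hasFDerivAt_const ((0, w) : E × C) q.1)
    refine this.congr_fderiv ?_
    ext v
    simp
  have h4 : (fun e => fderiv ℝ G (e, q.2) (0, Complex.I • v)) =ᶠ[𝓝 q.1]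
      fun e => Complex.I • fderiv ℝ G (e, q.2) (0, v) := by
    filter_upwards [SmoothHolAt.eventually_fst h] with e he
    have h5 := ((he.1.differentiableAt (by simp)).hasFDerivAt.comp q.2
      (hasFDerivAt_prodMk_right (𝕜 := ℝ) e q.2)).unique
      (he.2.hasFDerivAt.restrictScalars ℝ)
    have h6 : ∀ w, fderiv ℝ G (e, q.2) (0, w) = fderiv ℂ (fun c => G (e, c)) q.2 w := fun w =>
      congrArg (fun L : C →L[ℝ] A => L w) h5
    rw [h6, h6, map_smul]
  have h7 := ((h3 (Complex.I • v)).congr_of_eventuallyEq h4.symm).unique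
    ((h3 v).const_smul Complex.I)
  have h8 := congrArg (fun L : E →L[ℝ] A => L ξ) h7
  simp only [ContinuousLinearMap.comp_apply, ContinuousLinearMap.flip_apply,
    ContinuousLinearMap.inl_apply, ContinuousLinearMap.inr_apply, _root_.smul_apply] at h8 ⊢
  rw [hs.eq (0, Complex.I • v) (ξ, 0), hs.eq (0, v) (ξ, 0), h8]

theorem differentiableAt_clm_of_forall {F : C → E →L[ℝ] A} {c : C} (h : DifferentiableAt ℝ F c)
    (h' : ∀ ξ, DifferentiableAt ℂ (fun c => F c ξ) c) : DifferentiableAt ℂ F c := by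
  refine differentiableAt_complex_of_fderiv h.hasFDerivAt fun v => ?_
  ext ξ
  have h1 := (h.hasFDerivAt.clm_apply (hasFDerivAt_const ξ c)).unique
    ((h' ξ).hasFDerivAt.restrictScalars ℝ)
  have h2 : ∀ w, fderiv ℝ F c w ξ = fderiv ℂ (fun c => F c ξ) c w := fun w => by
    have := congrArg (fun L : C →L[ℝ] A => L w) h1
    simpa using this
  rw [_root_.smul_apply, h2, h2, map_smul]

theorem contDiffAt_gauge [CompleteSpace A] {G : E × (ℂ × ℂ) → A}
    {a : E × (ℂ × ℂ) → E →L[ℝ] A} {q : E × (ℂ × ℂ)} (hG : SmoothHolAt G q) (hu : IsUnit (G q))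
    (ha : ContDiffAt ℝ ∞ a q) :
    ContDiffAt ℝ ∞ (fun q => gauge (G q) (Ring.inverse (G q)) (a q)
      (twist q.2 (fderivFst G q))) q := by
  have h1 : ContDiffAt ℝ ∞ (fun q => Ring.inverse (G q)) q := (hG.ringInverse hu).contDiffAt
  have h2 : ContDiffAt ℝ ∞ (fun q => twist q.2 (fderivFst G q)) q := by
    have h3 := hG.contDiffAt_fderivFst
    have h4 : ContDiffAt ℝ ∞ (fun q : E × (ℂ × ℂ) => q.2.1) q :=
      (contDiff_fst.comp contDiff_snd).contDiffAt
    have h5 : ContDiffAt ℝ ∞ (fun q : E × (ℂ × ℂ) => q.2.2) q :=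
      (contDiff_snd.comp contDiff_snd).contDiffAt
    exact (h4.smul h3).add (h5.smul (h3.clm_comp contDiffAt_const))
  have h6 : ContDiffAt ℝ ∞ (fun q => ContinuousLinearMap.mulLeftRight ℝ A (Ring.inverse (G q))
      (G q)) q := by
    have h00 : ContDiff ℝ ∞ (fun b : A => ContinuousLinearMap.mulLeftRight ℝ A b) :=
      ContinuousLinearMap.contDiff _
    have h0 : ContDiffAt ℝ ∞ (fun q => ContinuousLinearMap.mulLeftRight ℝ A (Ring.inverse (G q)))
        q := h00.contDiffAt.comp q h1
    exact h0.clm_apply hG.contDiffAt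
  have h7 : ContDiffAt ℝ ∞ (fun q => ContinuousLinearMap.mul ℝ A (Ring.inverse (G q))) q :=
    (ContinuousLinearMap.mul ℝ A).contDiff.contDiffAt.comp q h1
  exact (h6.clm_comp ha).add (h7.clm_comp h2)

end LocalExpr

/-! ### Germs of functions and the form of `Dᶜ` -/

section Germs

variable {E : Type uE} [NormedAddCommGroup E] [NormedSpace ℂ E]
variable {X : Type uX} [TopologicalSpace X] [ChartedSpace E X] [IsManifold 𝓘(ℝ, E) ∞ X]
variable {V : Type*} [NormedAddCommGroup V] [NormedSpace ℝ V]
variable {B : Type uB} [NormedRing B] [NormedAlgebra ℝ B]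

theorem SmoothHolUnits.eventually {g : X × P1 → (Cx B)ˣ} {w : X × P1}
    (h : SmoothHolUnits E g w) : ∀ᶠ w' in 𝓝 w, SmoothHolUnits E g w' := by
  obtain ⟨y, z⟩ := w
  obtain ⟨c, hc, rfl⟩ := exists_pt z
  rw [eventually_nhds_prod_pt hc]
  have h1 := ((smoothHolUnits_iff hc).1 h).eventually
  rw [eventually_chart_prod_iff (mem_chart_source E y)] at h1
  have h2 : ∀ᶠ p : X × (ℂ × ℂ) in 𝓝 (y, c), p.1 ∈ (chartAt E y).source :=
    continuous_fst.continuousAt.eventually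
      ((chartAt E y).open_source.mem_nhds (mem_chart_source E y))
  filter_upwards [h1, h2, eventually_ne_zero hc] with p h3 h4 h5
  exact (smoothHolUnits_iff_chart h5 h4).2 h3

theorem SmoothHolUnits.congr {g g' : X × P1 → (Cx B)ˣ} {w : X × P1}
    (h : SmoothHolUnits E g w) (e : g' =ᶠ[𝓝 w] g) : SmoothHolUnits E g' w := by
  obtain ⟨y, z⟩ := w
  obtain ⟨c, hc, rfl⟩ := exists_pt z
  rw [smoothHolUnits_iff hc] at *
  refine h.congr ?_
  have h1 : ∀ᶠ p : X × (ℂ × ℂ) in 𝓝 (y, c), g' (p.1, pt p.2) = g (p.1, pt p.2) :=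
    (eventually_nhds_prod_pt hc).1 e
  have h2 : ContinuousAt (fun q : E × (ℂ × ℂ) => ((chartAt E y).symm q.1, q.2))
      (chartAt E y y, c) :=
    (ContinuousAt.comp (f := Prod.fst) ((chartAt E y).continuousAt_symm (mem_target_self y))
      continuousAt_fst).prodMk continuousAt_snd
  rw [ContinuousAt, symm_self] at h2
  exact (h2.eventually h1).mono fun q hq => congrArg Units.val hq

theorem dFun_congr {f f' : X → V} {y : X} (h : f =ᶠ[𝓝 y] f') :
    dFun (E := E) f y = dFun f' y :=
  Filter.EventuallyEq.mfderiv_eq h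

theorem dFun_const (v : V) (y : X) : dFun (E := E) (fun _ : X => v) y = 0 :=
  mfderiv_const

theorem dFun_clm {W : Type*} [NormedAddCommGroup W] [NormedSpace ℝ W] (L : V →L[ℝ] W) {f : X → V}
    {y : X} (h : ContMDiffAt 𝓘(ℝ, E) 𝓘(ℝ, V) ∞ f y) (ξ : E) :
    dFun (fun y' => L (f y')) y ξ = L (dFun f y ξ) := by
  have h1 := (L.hasFDerivAt.hasMFDerivAt.comp y (h.mdifferentiableAt (by simp)).hasMFDerivAt).mfderiv
  exact congrArg (fun M : E →L[ℝ] W => M ξ) h1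

theorem dFun_mul {A : Type*} [NormedRing A] [NormedAlgebra ℝ A] {f g : X → A} {y : X}
    (hf : ContMDiffAt 𝓘(ℝ, E) 𝓘(ℝ, A) ∞ f y) (hg : ContMDiffAt 𝓘(ℝ, E) 𝓘(ℝ, A) ∞ g y) (ξ : E) :
    dFun (fun y' => f y' * g y') y ξ = dFun f y ξ * g y + f y * dFun g y ξ := by
  have hfg : ContMDiffAt 𝓘(ℝ, E) 𝓘(ℝ, A) ∞ (fun y' => f y' * g y') y := by
    rw [contMDiffAt_iff_chart (mem_chart_source E y)] at *
    exact hf.mul hg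
  rw [dFun_eq hfg, dFun_eq hf, dFun_eq hg]
  have hf' := ((contMDiffAt_iff_chart (mem_chart_source E y)).1 hf).differentiableAt (by simp)
  have hg' := ((contMDiffAt_iff_chart (mem_chart_source E y)).1 hg).differentiableAt (by simp)
  have := (hf'.hasFDerivAt.mul' hg'.hasFDerivAt).fderiv
  have h2 := congrArg (fun M : E →L[ℝ] A => M ξ) this
  simp only [symm_self] at h2
  refine h2.trans ?_
  simp [add_comm]

section ConnC

variable [StarRing B] [CStarRing B] [StarModule ℝ B]

/-- The two parts combine: `J (a - a^*) / 2 - J (a + a^*) / 2 = -J a^*`. This closed form makes the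
action of `σ` on the connection transparent. -/
theorem connC_apply (a : X → E →L[ℝ] B) (y : X) (ξ : E) :
    connC a y ξ = -star (a y (jmul ξ)) := by
  simp only [connC, Jform, Pi.sub_apply, _root_.sub_apply, ContinuousLinearMap.comp_apply,
    _root_.smul_apply, _root_.add_apply, jmul_apply]
  change (1 / 2 : ℝ) • (a y (Complex.I • ξ) - star (a y (Complex.I • ξ))) -
    (1 / 2 : ℝ) • (a y (Complex.I • ξ) + star (a y (Complex.I • ξ))) = _
  generalize a y (Complex.I • ξ) = p
  generalize star p = q
  module

/-- The adjoint, as a continuous real linear map. -/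
def adjL : B →L[ℝ] B := ((starL' ℝ : B ≃L[ℝ] B) : B →L[ℝ] B)

theorem adjL_apply (b : B) : adjL b = star b := rfl

theorem connC_eq (a : X → E →L[ℝ] B) : connC a = fun y => -(adjL.comp (Jform a y)) := by
  funext y
  ext ξ
  exact connC_apply a y ξ

end ConnC

end Germs

/-! ### Existence of the twistor torsor of a pluriharmonic torsor -/

namespace Torsor

variable {Y : Type uX} [TopologicalSpace Y] {G : Type uB} [Group G] {R : (Y → G) → Y → Prop}
  (T : Torsor Y G R)

/-- A chosen local section near `y`. -/
def someSec (y : Y) : Y → T.Tot := (T.reg_exists y).choose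

theorem isReg_someSec (y : Y) : T.IsReg (T.someSec y) y := (T.reg_exists y).choose_spec

/-- A chosen point of the fibre at `y`. -/
def basePt (y : Y) : T.Tot := T.someSec y y

theorem proj_basePt (y : Y) : T.proj (T.basePt y) = y :=
  T.reg_proj (T.someSec y) y (T.isReg_someSec y)

end Torsor

/-! ### Gauge transformations on the manifold -/

section Gauge

variable {E : Type uE} [NormedAddCommGroup E] [NormedSpace ℂ E]
  {A : Type*} [NormedRing A] [NormedAlgebra ℂ A]

theorem gauge_one (a : E →L[ℝ] A) : gauge 1 1 a 0 = a := by
  ext ξ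
  simp [gauge_apply]

theorem twist_zero (c : ℂ × ℂ) : twist c (0 : E →L[ℝ] A) = 0 := by
  ext ξ
  simp [twist_apply]

/-- The hypothesis `hD` is the product rule for `g h`, in a form that can be checked without naming
the functions being differentiated. -/
theorem gauge_mul (g h : Aˣ) (a : E →L[ℝ] A) (c : ℂ × ℂ) {L M D : E →L[ℝ] A}
    (hD : ∀ ξ, D ξ = L ξ * h.val + g.val * M ξ) :
    gauge (g * h).val (g * h)⁻¹.val a (twist c D) =
      gauge h.val h⁻¹.val (gauge g.val g⁻¹.val a (twist c L)) (twist c M) := by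
  ext ξ
  simp only [gauge_apply, twist_apply, hD, mul_inv_rev, Units.val_mul]
  have e : ∀ x : A, g⁻¹.val * (g.val * x) = x := fun x => by
    rw [← mul_assoc, Units.inv_mul, one_mul]
  simp only [smul_add, mul_add, add_mul, mul_assoc, mul_smul_comm, smul_mul_assoc, e]
  abel

variable {X : Type uX} [TopologicalSpace X] [ChartedSpace E X] [IsManifold 𝓘(ℝ, E) ∞ X]
  [IsManifold 𝓘(ℂ, E) 1 X]

theorem localForm_gauge {k : X → Aˣ} {α : X → E →L[ℝ] A} {y : X} {e : E} (c : ℂ × ℂ)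
    (he : e ∈ (chartAt E y).target)
    (hk : ContMDiffAt 𝓘(ℝ, E) 𝓘(ℝ, A) ∞ (fun y' => (k y').val) ((chartAt E y).symm e)) :
    localForm y (fun y' => gauge (k y').val (k y')⁻¹.val (α y')
        (twist c (dFun (fun y' => (k y').val) y'))) e =
      gauge (k ((chartAt E y).symm e)).val (k ((chartAt E y).symm e))⁻¹.val (localForm y α e)
        (twist c (fderiv ℝ (fun e => (k ((chartAt E y).symm e)).val) e)) := by
  rw [← localForm_dFun (f := fun y' => (k y').val) he hk]
  have h4 := chartD_jmul (E := E) y he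
  ext ξ
  have h5 : chartD y e (jmul ξ) = jmul (chartD y e ξ) :=
    congrArg (fun L : E →L[ℝ] E => L ξ) h4
  simp only [localForm, ContinuousLinearMap.comp_apply, gauge_apply, twist_apply, h5]

theorem curv_localForm {α : X → E →L[ℝ] A} {y : X} (c : ℂ × ℂ)
    (hα : DifferentiableAt ℝ (localForm y α) (chartAt E y y)) (ξ η : E) :
    curv c (localForm y α) (chartAt E y y) ξ η =
      c.1 • dForm α y ξ η + c.2 • dcForm α y ξ η + wedge (α y) (α y) ξ η := by
  rw [dcForm_eq hα, curv, localForm_self]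
  rfl

/-- Flatness is invariant under gauge transformations. -/
theorem flat_gauge [CompleteSpace A] {k : X → Aˣ} {α β : X → E →L[ℝ] A} {y : X} {c : ℂ × ℂ}
    (hk : ∀ᶠ y' in 𝓝 y, ContMDiffAt 𝓘(ℝ, E) 𝓘(ℝ, A) ∞ (fun y' => (k y').val) y')
    (hα : DifferentiableAt ℝ (localForm y α) (chartAt E y y))
    (hβd : DifferentiableAt ℝ (localForm y β) (chartAt E y y))
    (hβ : ∀ᶠ y' in 𝓝 y, β y' = gauge (k y').val (k y')⁻¹.val (α y')
      (twist c (dFun (fun y' => (k y').val) y')))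
    (h : ∀ ξ η, c.1 • dForm α y ξ η + c.2 • dcForm α y ξ η + wedge (α y) (α y) ξ η = 0) (ξ η : E) :
    c.1 • dForm β y ξ η + c.2 • dcForm β y ξ η + wedge (β y) (β y) ξ η = 0 := by
  rw [← curv_localForm c hβd]
  have h1 : localForm y β =ᶠ[𝓝 (chartAt E y y)] fun e =>
      gauge (k ((chartAt E y).symm e)).val (k ((chartAt E y).symm e))⁻¹.val (localForm y α e)
        (twist c (fderiv ℝ (fun e => (k ((chartAt E y).symm e)).val) e)) := by
    filter_upwards [eventually_mem_target y, eventually_symm hk, localForm_congr hβ] with e h2 h3 h4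
    rw [h4, localForm_gauge c h2 h3]
  have h2 : curv c (localForm y β) (chartAt E y y) ξ η = curv c (fun e =>
      gauge (k ((chartAt E y).symm e)).val (k ((chartAt E y).symm e))⁻¹.val (localForm y α e)
        (twist c (fderiv ℝ (fun e => (k ((chartAt E y).symm e)).val) e))) (chartAt E y y) ξ η := by
    rw [curv, curv, h1.fderiv_eq, h1.eq_of_nhds]
  rw [h2, curv_gauge (G := fun e => (k ((chartAt E y).symm e)).val)
    (Gi := fun e => (k ((chartAt E y).symm e))⁻¹.val) (fun e => Units.mul_inv _)
    (fun e => Units.inv_mul _) hα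
    ((contMDiffAt_iff_chart (mem_chart_source E y)).1 hk.self_of_nhds), curv_localForm c hα, h,
    mul_zero, zero_mul]

end Gauge

/-! ### The connection `u D + v Dᶜ` -/

section Pluriharmonic

variable {E : Type uE} [NormedAddCommGroup E] [NormedSpace ℂ E]
variable {X : Type uX} [TopologicalSpace X] [ChartedSpace E X] [IsManifold 𝓘(ℝ, E) ∞ X]
  [IsManifold 𝓘(ℂ, E) 1 X]
variable {B : Type uB} [NormedRing B] [NormedAlgebra ℝ B] [StarRing B] [CStarRing B]
  [StarModule ℝ B] {x : X}

/-- The form `u a + v aᶜ`. -/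
def extForm (a : X → E →L[ℝ] B) (c : ℂ × ℂ) (y : X) : E →L[ℝ] Cx B :=
  c.1 • Cx.ofBaseL.comp (a y) + c.2 • Cx.ofBaseL.comp (connC a y)

theorem extForm_apply (a : X → E →L[ℝ] B) (c : ℂ × ℂ) (y : X) (ξ : E) :
    extForm a c y ξ = c.1 • Cx.ofBase (a y ξ) + c.2 • Cx.ofBase (connC a y ξ) := rfl

theorem differentiableAt_localForm_connC {a : X → E →L[ℝ] B} {y : X}
    (h : DifferentiableAt ℝ (localForm y a) (chartAt E y y)) :
    DifferentiableAt ℝ (localForm y (connC a)) (chartAt E y y) := by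
  rw [connC_eq]
  have h1 := differentiableAt_localForm_J a y h
  have h2 : (fun e => -(adjL (B := B)).comp (localForm y (Jform a) e)) =
      localForm y fun y => -(adjL.comp (Jform a y)) := by
    funext e
    ext1 ξ
    rfl
  rw [← h2]
  exact ((differentiableAt_const _).clm_comp h1).neg

theorem contDiffAt_localForm_connC {a : X → E →L[ℝ] B} {y : X}
    (h : ContDiffAt ℝ ∞ (localForm y a) (chartAt E y y)) :
    ContDiffAt ℝ ∞ (localForm y (connC a)) (chartAt E y y) := by
  have h1 : localForm y (connC a) =ᶠ[𝓝 (chartAt E y y)]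
      fun e => -(adjL (B := B)).comp ((localForm y a e).comp jmul) := by
    filter_upwards [eventually_mem_target y] with e he
    rw [connC_eq, ← localForm_J a y he, localForm, ContinuousLinearMap.neg_comp]
    rfl
  refine ContDiffAt.congr_of_eventuallyEq ?_ h1
  exact (contDiffAt_const.clm_comp (h.clm_comp contDiffAt_const)).neg

theorem contDiffAt_localForm_extForm {a : X → E →L[ℝ] B} {y : X}
    (h : ContDiffAt ℝ ∞ (localForm y a) (chartAt E y y)) (c : ℂ × ℂ) :
    ContDiffAt ℝ ∞ (fun q : E × (ℂ × ℂ) => localForm y (extForm a q.2) q.1)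
      (chartAt E y y, c) := by
  have h1 : (fun q : E × (ℂ × ℂ) => localForm y (extForm a q.2) q.1) = fun q =>
      q.2.1 • (Cx.ofBaseL (B := B)).comp (localForm y a q.1) +
        q.2.2 • (Cx.ofBaseL (B := B)).comp (localForm y (connC a) q.1) := by
    funext q
    ext1 ξ
    rfl
  rw [h1]
  have h2 : ∀ {f : E → E →L[ℝ] B}, ContDiffAt ℝ ∞ f (chartAt E y y) → ContDiffAt ℝ ∞
      (fun q : E × (ℂ × ℂ) => (Cx.ofBaseL (B := B)).comp (f q.1)) (chartAt E y y, c) := fun hf =>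
    contDiffAt_const.clm_comp (ContDiffAt.comp (f := Prod.fst) (chartAt E y y, c) hf contDiffAt_fst)
  exact ((contDiff_fst.comp contDiff_snd).contDiffAt.smul (h2 h)).add
    ((contDiff_snd.comp contDiff_snd).contDiffAt.smul (h2 (contDiffAt_localForm_connC h)))

theorem Cx.ofBase_wedge (α β : E →L[ℝ] B) (ξ η : E) :
    wedge ((Cx.ofBaseL (B := B)).comp α) ((Cx.ofBaseL (B := B)).comp β) ξ η =
      Cx.ofBase (wedge α β ξ η) := by
  ext <;> simp [wedge, Cx.ofBaseL_apply]

/-- The equation `dᶜ aᶜ + aᶜ ∧ aᶜ = 0`. -/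
theorem dcForm_connC {a : X → E →L[ℝ] B} {y : X}
    (hd : DifferentiableAt ℝ (localForm y a) (chartAt E y y))
    (h : ∀ ξ η, dForm a y ξ η + wedge (a y) (a y) ξ η = 0) (ξ η : E) :
    dcForm (connC a) y ξ η + wedge (connC a y) (connC a y) ξ η = 0 := by
  -- Since `J⁻¹ aᶜ = -a^*`, the form `dᶜ aᶜ` at `(ξ, η)` is `-(da)^*` at `(iξ, iη)`, and the claim
  -- is the adjoint of the flatness of `a`.
  have h1 : (fun y' => -Jform (connC a) y') = fun y' => -(adjL.comp (a y')) := by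
    funext y'
    ext ζ
    simp only [Jform, _root_.neg_apply, ContinuousLinearMap.comp_apply, connC_apply, jmul_jmul,
      map_neg, star_neg, neg_neg, adjL_apply]
  have h2 : dcForm (connC a) y ξ η = -star (dForm a y (jmul ξ) (jmul η)) := by
    rw [dcForm, h1, dForm_neg, dForm_comp _ _ _ hd, adjL_apply]
  have h3 : dForm a y (jmul ξ) (jmul η) = -wedge (a y) (a y) (jmul ξ) (jmul η) :=
    eq_neg_of_add_eq_zero_left (h _ _)
  rw [h2, h3]
  simp only [wedge, connC_apply, star_neg, star_sub, star_mul]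
  noncomm_ring

/-- The curvature of `u a + v aᶜ`. -/
theorem curv_extForm {a : X → E →L[ℝ] B} {y : X}
    (hd : DifferentiableAt ℝ (localForm y a) (chartAt E y y)) (c : ℂ × ℂ) (ξ η : E) :
    c.1 • dForm (extForm a c) y ξ η + c.2 • dcForm (extForm a c) y ξ η +
      wedge (extForm a c y) (extForm a c y) ξ η =
      (c.1 * c.1) • Cx.ofBaseL (dForm a y ξ η + wedge (a y) (a y) ξ η) +
        (c.1 * c.2) • Cx.ofBaseL (dForm (connC a) y ξ η + wedge (a y) (connC a y) ξ η +
          (dcForm a y ξ η + wedge (connC a y) (a y) ξ η)) +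
        (c.2 * c.2) • Cx.ofBaseL (dcForm (connC a) y ξ η +
          wedge (connC a y) (connC a y) ξ η) := by

  have hb : ∀ {α : X → E →L[ℝ] B}, DifferentiableAt ℝ (localForm y α) (chartAt E y y) →
      DifferentiableAt ℝ (localForm y fun y' => (Cx.ofBaseL (B := B)).comp (α y'))
        (chartAt E y y) := fun hα =>
    (differentiableAt_const (Cx.ofBaseL (B := B))).clm_comp hα
  have hs : ∀ (l : ℂ) {α : X → E →L[ℝ] Cx B},
      DifferentiableAt ℝ (localForm y α) (chartAt E y y) →
      DifferentiableAt ℝ (localForm y fun y' => l • α y') (chartAt E y y) := fun l α hα =>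
    hα.const_smul l
  have hdc := differentiableAt_localForm_connC hd
  have dJ : ∀ {α : X → E →L[ℝ] B}, DifferentiableAt ℝ (localForm y α) (chartAt E y y) →
      dcForm (fun y' => (Cx.ofBaseL (B := B)).comp (α y')) y ξ η = Cx.ofBaseL (dcForm α y ξ η) := by
    intro α hα
    have h3 : DifferentiableAt ℝ (localForm y fun y' => -Jform α y') (chartAt E y y) := by
      have h4 := (differentiableAt_localForm_J α y hα).neg
      have h5 : localForm y (fun y' => -Jform α y') = -localForm y (Jform α) := by
        funext e
        exact ContinuousLinearMap.neg_comp _ _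
      rwa [h5]
    rw [dcForm, dcForm, ← dForm_comp _ _ _ h3]
    congr 1
    funext y'
    ext1 ζ
    simp [Jform]
  have e1 : dForm (extForm a c) y ξ η = c.1 • Cx.ofBaseL (dForm a y ξ η) +
      c.2 • Cx.ofBaseL (dForm (connC a) y ξ η) := by
    rw [← dForm_comp _ _ _ hd, ← dForm_comp _ _ _ hdc, ← dForm_const_smul c.1 (hb hd),
      ← dForm_const_smul c.2 (hb hdc), ← dForm_add (hs _ (hb hd)) (hs _ (hb hdc))]
    rfl
  have e2 : dcForm (extForm a c) y ξ η = c.1 • Cx.ofBaseL (dcForm a y ξ η) +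
      c.2 • Cx.ofBaseL (dcForm (connC a) y ξ η) := by
    rw [← dJ hd, ← dJ hdc, ← dcForm_const_smul c.1 (hb hd),
      ← dcForm_const_smul c.2 (hb hdc), ← dcForm_add (hs _ (hb hd)) (hs _ (hb hdc))]
    rfl
  have e3 : wedge (extForm a c y) (extForm a c y) ξ η =
      (c.1 * c.1) • Cx.ofBaseL (wedge (a y) (a y) ξ η) +
      (c.1 * c.2) • Cx.ofBaseL (wedge (a y) (connC a y) ξ η + wedge (connC a y) (a y) ξ η) +
      (c.2 * c.2) • Cx.ofBaseL (wedge (connC a y) (connC a y) ξ η) := by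
    simp only [map_add, Cx.ofBaseL_apply, ← Cx.ofBase_wedge]
    simp only [wedge, extForm_apply, ContinuousLinearMap.comp_apply, Cx.ofBaseL_apply, add_mul,
      mul_add, smul_mul_assoc, mul_smul_comm, smul_smul, smul_sub, smul_add, mul_comm c.2 c.1]
    abel
  rw [e1, e2, e3]
  simp only [map_add]
  module

/-- The coefficients of `u²` and `uv` vanish by flatness and pluriharmonicity; that of `v²` vanishes
by `dcForm_connC`, with no further condition. -/
theorem flat_extForm {a : X → E →L[ℝ] B} {y : X}
    (hd : DifferentiableAt ℝ (localForm y a) (chartAt E y y))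
    (h1 : ∀ ξ η, dForm a y ξ η + wedge (a y) (a y) ξ η = 0)
    (h2 : ∀ ξ η, dForm (connC a) y ξ η + wedge (a y) (connC a y) ξ η +
      (dcForm a y ξ η + wedge (connC a y) (a y) ξ η) = 0) (c : ℂ × ℂ) (ξ η : E) :
    c.1 • dForm (extForm a c) y ξ η + c.2 • dcForm (extForm a c) y ξ η +
      wedge (extForm a c y) (extForm a c y) ξ η = 0 := by
  rw [curv_extForm hd, h1, h2, dcForm_connC hd h1]
  simp [Cx.ofBase_zero]

/-- The equations for `a` are coefficients of the flatness of `u a + v aᶜ`. -/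
theorem of_flat_extForm {a : X → E →L[ℝ] B} {y : X}
    (hd : DifferentiableAt ℝ (localForm y a) (chartAt E y y))
    (h : ∀ c : ℂ × ℂ, c ≠ 0 → ∀ ξ η, c.1 • dForm (extForm a c) y ξ η +
      c.2 • dcForm (extForm a c) y ξ η + wedge (extForm a c y) (extForm a c y) ξ η = 0) :
    (∀ ξ η, dForm a y ξ η + wedge (a y) (a y) ξ η = 0) ∧
      ∀ ξ η, dForm (connC a) y ξ η + wedge (a y) (connC a y) ξ η +
        (dcForm a y ξ η + wedge (connC a y) (a y) ξ η) = 0 := by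
  have h1 : ∀ ξ η, dForm a y ξ η + wedge (a y) (a y) ξ η = 0 := by
    intro ξ η
    have e := h (1, 0) (by simp) ξ η
    rw [curv_extForm hd] at e
    apply Cx.ofBase_injective
    simpa [Cx.ofBase_zero] using e
  refine ⟨h1, fun ξ η => ?_⟩
  -- At `(1, 1)` the coefficients of `u²` and `v²` are already known to vanish, and only that of
  -- `uv` is left.
  have e := h (1, 1) (by simp) ξ η
  rw [curv_extForm hd, h1, dcForm_connC hd h1] at e
  apply Cx.ofBase_injective
  simpa [Cx.ofBase_zero] using e

/-- The transformation of `u a + v aᶜ` under a unitary gauge transformation. -/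
theorem extForm_gauge {a a' : X → E →L[ℝ] B} {u : X → unitary B} {y : X}
    (hu : SmoothUnitary E u y)
    (h : ∀ ξ, a' y ξ = star (u y : B) * a y ξ * (u y : B) +
      star (u y : B) * dFun (fun y' => (u y' : B)) y ξ) (c : ℂ × ℂ) :
    extForm a' c y = gauge (unitaryToCx (u y)).val (unitaryToCx (u y))⁻¹.val (extForm a c y)
      (twist c (dFun (fun y' => (unitaryToCx (u y')).val) y)) := by
  have hu' : ContMDiffAt 𝓘(ℝ, E) 𝓘(ℝ, B) ∞ (fun y' => (u y' : B)) y := hu.self_of_nhds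
  have h1 : ∀ ξ, dFun (fun y' => (unitaryToCx (u y')).val) y ξ =
      Cx.ofBase (dFun (fun y' => (u y' : B)) y ξ) := dFun_clm Cx.ofBaseL hu'
  have hst : ContMDiffAt 𝓘(ℝ, E) 𝓘(ℝ, B) ∞ (fun y' => star (u y' : B)) y :=
    ContMDiffAt.comp (I' := 𝓘(ℝ, B)) (g := adjL (B := B)) (f := fun y' => (u y' : B)) y
      (adjL (B := B)).contMDiff.contMDiffAt hu'
  -- Differentiating `u^* u = 1` shows that `u^* du` is anti-self-adjoint; hence the inhomogeneous
  -- term of `aᶜ` is `u^* dᶜu`.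
  have h2 : ∀ ξ : E, star (dFun (fun y' => (u y' : B)) y ξ) * (u y : B) =
      -(star (u y : B) * dFun (fun y' => (u y' : B)) y ξ) := by
    intro ξ
    have e1 := dFun_mul hst hu' ξ
    have e2 : dFun (E := E) (fun y' => star (u y' : B)) y ξ = star (dFun (fun y' => (u y' : B)) y ξ) :=
      dFun_clm adjL hu' ξ
    have e3 : (fun y' => star (u y' : B) * (u y' : B)) = fun _ => 1 :=
      funext fun y' => Unitary.coe_star_mul_self (u y')
    rw [e3, dFun_const, e2] at e1
    exact eq_neg_of_add_eq_zero_left e1.symm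
  ext1 ξ
  rw [gauge_apply, twist_apply, h1, h1, unitaryToCx_inv_val, unitaryToCx_val, extForm_apply,
    extForm_apply, connC_apply, connC_apply, h, h]
  simp only [star_add, star_mul, star_star, mul_assoc]
  rw [h2]
  have e : ∀ p q, Cx.ofBase (p * q) = Cx.ofBase p * Cx.ofBase q := Cx.ofBase_mul (B := B)
  have e' : ∀ p q, Cx.ofBase (p + q) = Cx.ofBase p + Cx.ofBase q := Cx.ofBase_add (B := B)
  have e'' : ∀ p : B, Cx.ofBase (-p) = -Cx.ofBase p := fun p => map_neg (Cx.ofBaseL (B := B)) p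
  simp only [neg_add_rev, neg_neg, e, e', e'', smul_add, mul_add, add_mul, mul_smul_comm,
    smul_mul_assoc, mul_assoc, neg_mul, mul_neg, smul_neg]
  abel

end Pluriharmonic

section Extension

variable {E : Type uE} [NormedAddCommGroup E] [NormedSpace ℂ E]
variable {X : Type uX} [TopologicalSpace X] [ChartedSpace E X] [IsManifold 𝓘(ℝ, E) ∞ X]
  [IsManifold 𝓘(ℂ, E) 1 X]
variable {B : Type uB} [NormedRing B] [NormedAlgebra ℝ B] [CompleteSpace B] [StarRing B]
  [CStarRing B] [StarModule ℝ B] {x : X}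

namespace FramedPluriharmonic

variable (P : FramedPluriharmonic E B x)

/-- The co-ordinate of a point of the torsor, with respect to chosen points of the fibres. -/
def coord (p : P.Tot) : (Cx B)ˣ :=
  unitaryToCx (P.toTorsor.div (P.toTorsor.basePt (P.proj p)) p)

theorem coord_act (p : P.Tot) (u : unitary B) :
    P.coord (P.act p u) = P.coord p * unitaryToCx u := by
  rw [coord, coord, ← map_mul, P.proj_act]
  congr 1
  apply Torsor.div_eq_of_act_eq
  rw [P.act_mul, Torsor.act_div (P.toTorsor.proj_basePt _)]

theorem conjU_coord (p : P.Tot) : Cx.conjU (P.coord p) = P.coord p := conjU_unitaryToCx _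

/-- The co-ordinate of a section of the extension with respect to a section of `U(𝒫)`. -/
def trans (s : X → P.Tot) (S : X × P1 → X × P1 × (Cx B)ˣ) (w : X × P1) : (Cx B)ˣ :=
  (P.coord (s w.1))⁻¹ * (S w).2.2

/-- The base points of the fibres are chosen without any regularity, but they cancel in `trans`.
What remains is the smooth function comparing `s` and `s'`, so smoothness of `trans` does not depend
on `s`. -/
theorem trans_change {s s' : X → P.Tot} {y : X} (hs : P.IsReg s y) (hs' : P.IsReg s' y)
    (S : X × P1 → X × P1 × (Cx B)ˣ) :
    ∀ᶠ y' in 𝓝 y, ∀ z, P.trans s S (y', z) =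
      unitaryToCx (P.toTorsor.div (s y') (s' y')) * P.trans s' S (y', z) := by
  filter_upwards [Torsor.eventually_act_div hs (Torsor.eventually_proj hs')] with y' hy' z
  unfold trans
  have : P.coord (s' y') =
      P.coord (s y') * unitaryToCx (P.toTorsor.div (s y') (s' y')) := by
    rw [← coord_act]
    exact congrArg P.coord hy'
  simp only [this]
  group

/-- The sections of the extension. -/
def ExtReg (S : X × P1 → X × P1 × (Cx B)ˣ) (w : X × P1) : Prop :=
  (∀ᶠ w' in 𝓝 w, ((S w').1, (S w').2.1) = w') ∧
    ∃ s, P.IsReg s w.1 ∧ SmoothHolUnits E (P.trans s S) w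

variable {P}

theorem ExtReg.trans {S : X × P1 → X × P1 × (Cx B)ˣ} {w : X × P1} (h : P.ExtReg S w)
    {s : X → P.Tot} (hs : P.IsReg s w.1) : SmoothHolUnits E (P.trans s S) w := by
  obtain ⟨-, s', hs', h'⟩ := h
  have h1 : SmoothHolUnits E (fun w : X × P1 => unitaryToCx (P.toTorsor.div (s w.1) (s' w.1))) w :=
    smoothHolUnits_unitary_iff.2 (Torsor.reg_div hs hs')
  exact (h1.mul' h').congr
    ((continuous_fst.continuousAt.eventually (trans_change P hs hs' S)).mono fun w hw => hw w.2)

theorem ExtReg.eventually {S : X × P1 → X × P1 × (Cx B)ˣ} {w : X × P1} (h : P.ExtReg S w) :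
    ∀ᶠ w' in 𝓝 w, P.ExtReg S w' := by
  obtain ⟨h1, s, h2, h3⟩ := h
  filter_upwards [h1.eventually_nhds, h3.eventually,
    continuous_fst.continuousAt.eventually (P.reg_nhds s _ h2)] with w' h4 h5 h6
  exact ⟨h4, s, h6, h5⟩

theorem ExtReg.congr {S S' : X × P1 → X × P1 × (Cx B)ˣ} {w : X × P1} (h : P.ExtReg S w)
    (e : S =ᶠ[𝓝 w] S') : P.ExtReg S' w := by
  obtain ⟨h1, s, h2, h3⟩ := h
  refine ⟨?_, s, h2, h3.congr ?_⟩
  · filter_upwards [h1, e] with w' h4 h5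
    rwa [← h5]
  · filter_upwards [e] with w' h4
    rw [FramedPluriharmonic.trans, FramedPluriharmonic.trans, h4]

theorem ExtReg.of_section {s : X → P.Tot} {y : X} (hs : P.IsReg s y) (z : P1) :
    P.ExtReg (fun w => (P.proj (s w.1), w.2, P.coord (s w.1))) (y, z) := by
  refine ⟨?_, s, hs, ?_⟩
  · filter_upwards [continuous_fst.continuousAt.eventually (Torsor.eventually_proj hs)] with w hw
    exact Prod.ext hw rfl
  · refine (smoothHolUnits_const 1 _).congr (.of_forall fun w => ?_)
    exact inv_mul_cancel _

variable (P) in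
/-- The connection form of a section of the extension, computed from a section of `U(𝒫)`. -/
def connWith (s : X → P.Tot) (S : X × P1 → X × P1 × (Cx B)ˣ) (y : X) (c : ℂ × ℂ) :
    E →L[ℝ] Cx B :=
  gauge (P.trans s S (y, pt c)).val (P.trans s S (y, pt c))⁻¹.val (extForm (P.conn s) c y)
    (twist c (dFun (fun y' => (P.trans s S (y', pt c)).val) y))

/-- Changing `s` multiplies `trans` by a unitary function, and by `extForm_gauge` the form `u a + v
aᶜ` changes by the same gauge transformation; the two changes cancel. -/
theorem connWith_eq {s s' : X → P.Tot} {S : X × P1 → X × P1 × (Cx B)ˣ} {y : X} {c : ℂ × ℂ}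
    (hc : c ≠ 0) (hs : P.IsReg s y) (hs' : P.IsReg s' y) (h : P.ExtReg S (y, pt c)) :
    P.connWith s S y c = P.connWith s' S y c := by
  have h1 := trans_change P hs hs' S
  have hu : SmoothUnitary E (fun y' => P.toTorsor.div (s y') (s' y')) y := Torsor.reg_div hs hs'
  have h2 : extForm (P.conn s') c y = _ := extForm_gauge (a := P.conn s) hu (fun ξ => by
    rw [← P.conn_act s y hs _ hu ξ]
    exact congrArg (fun L : E →L[ℝ] B => L ξ)
      (P.conn_congr _ _ y (Torsor.eventually_act_div hs (Torsor.eventually_proj hs')))) c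
  rw [connWith, connWith, h2, h1.self_of_nhds]
  refine gauge_mul _ _ _ c fun ξ => ?_
  rw [dFun_congr (h1.mono fun y' hy' => by rw [hy' (pt c)])]
  exact dFun_mul ((Cx.ofBaseL (B := B)).contMDiff.contMDiffAt.comp y hu.self_of_nhds)
    ((h.trans hs').contMDiffAt hc) ξ

theorem localForm_connWith {s : X → P.Tot} {S : X × P1 → X × P1 × (Cx B)ˣ} {y : X} {c : ℂ × ℂ}
    (hc : c ≠ 0) {e : E} (he : e ∈ (chartAt E y).target)
    (hs : P.IsReg s ((chartAt E y).symm e)) (h : P.ExtReg S ((chartAt E y).symm e, pt c)) :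
    localForm y (fun y' => P.connWith s S y' c) e =
      gauge (P.trans s S ((chartAt E y).symm e, pt c)).val
        (P.trans s S ((chartAt E y).symm e, pt c))⁻¹.val (localForm y (extForm (P.conn s) c) e)
        (twist c (fderiv ℝ (fun e => (P.trans s S ((chartAt E y).symm e, pt c)).val) e)) :=
  localForm_gauge (k := fun y' => P.trans s S (y', pt c)) c he ((h.trans hs).contMDiffAt hc)

theorem eventually_chart_pt {Q : X × P1 → Prop} {y : X} {c : ℂ × ℂ} (hc : c ≠ 0)
    (h : ∀ᶠ w in 𝓝 (y, pt c), Q w) :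
    ∀ᶠ q : E × (ℂ × ℂ) in 𝓝 (chartAt E y y, c), Q ((chartAt E y).symm q.1, pt q.2) := by
  have h2 : ContinuousAt (fun q : E × (ℂ × ℂ) => ((chartAt E y).symm q.1, q.2))
      (chartAt E y y, c) :=
    (ContinuousAt.comp (f := Prod.fst) ((chartAt E y).continuousAt_symm (mem_target_self y))
      continuousAt_fst).prodMk continuousAt_snd
  rw [ContinuousAt, symm_self] at h2
  exact h2.eventually ((eventually_nhds_prod_pt hc).1 h)

theorem contDiffAt_connWith {s : X → P.Tot} {S : X × P1 → X × P1 × (Cx B)ˣ} {y : X} {c : ℂ × ℂ}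
    (hc : c ≠ 0) (hs : P.IsReg s y) (h : P.ExtReg S (y, pt c)) :
    ContDiffAt ℝ ∞ (fun q : E × (ℂ × ℂ) => localForm y (fun y' => P.connWith s S y' q.2) q.1)
      (chartAt E y y, c) := by
  have hG := (smoothHolUnits_iff hc).1 (h.trans hs)
  refine (contDiffAt_gauge hG (Units.isUnit _)
    (contDiffAt_localForm_extForm (P.conn_smooth s y hs) c)).congr_of_eventuallyEq ?_
  filter_upwards [eventually_chart_pt hc h.eventually, hG, eventually_ne_zero hc,
    continuous_fst.continuousAt.eventually (eventually_mem_target y),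
    continuous_fst.continuousAt.eventually (eventually_symm (P.reg_nhds s y hs))]
    with q h1 h2 h3 h4 h5
  rw [localForm_connWith h3 h4 h5 h1, Ring.inverse_unit,
    ← fderiv_slice_eq (h2.1.differentiableAt (by simp))]

theorem differentiableAt_connWith {s : X → P.Tot} {S : X × P1 → X × P1 × (Cx B)ˣ} {y : X}
    {c : ℂ × ℂ} (hc : c ≠ 0) (hs : P.IsReg s y) (h : P.ExtReg S (y, pt c)) :
    DifferentiableAt ℂ (P.connWith s S y) c := by
  have h0 := contDiffAt_connWith hc hs h
  have h1 : ContDiffAt ℝ ∞ (P.connWith s S y) c := by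
    have := ContDiffAt.comp (f := fun c : ℂ × ℂ => (chartAt E y y, c)) c h0
      (contDiffAt_const.prodMk contDiffAt_id)
    refine this.congr_of_eventuallyEq (.of_forall fun c' => ?_)
    exact (localForm_self (fun y' => P.connWith s S y' c') y).symm
  -- Real differentiability as an operator-valued map is known, so holomorphy can be tested on each
  -- tangent vector.
  refine differentiableAt_clm_of_forall (h1.differentiableAt (by simp)) fun ξ => ?_
  have hG := (smoothHolUnits_iff hc).1 (h.trans hs)
  have hG' := hG.differentiableAt
  have hGi := (hG.ringInverse (Units.isUnit _)).differentiableAt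
  have hD : ∀ ζ : E, DifferentiableAt ℂ
      (fun c => dFun (fun y' => (P.trans s S (y', pt c)).val) y ζ) c := by
    intro ζ
    refine (hG.differentiableAt_fderivFst ζ).congr_of_eventuallyEq ?_
    filter_upwards [SmoothHolAt.eventually_snd hG, SmoothHolAt.eventually_snd
      (p := (chartAt E y y, c)) (eventually_chart_pt hc h.eventually),
      SmoothHolAt.eventually_snd (p := (chartAt E y y, c)) (eventually_ne_zero hc)] with c' h2 h3 h4
    simp only [symm_self] at h3
    rw [← fderiv_slice_eq (h2.1.differentiableAt (by simp)),
      dFun_eq ((h3.trans hs).contMDiffAt h4)]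
  simp only [Ring.inverse_unit, symm_self] at hG' hGi
  have h5 : (fun c => P.connWith s S y c ξ) = fun c =>
      (P.trans s S (y, pt c))⁻¹.val * (c.1 • Cx.ofBase (P.conn s y ξ) +
        c.2 • Cx.ofBase (connC (P.conn s) y ξ)) * (P.trans s S (y, pt c)).val +
      (P.trans s S (y, pt c))⁻¹.val *
        (c.1 • dFun (fun y' => (P.trans s S (y', pt c)).val) y ξ +
          c.2 • dFun (fun y' => (P.trans s S (y', pt c)).val) y (jmul ξ)) := rfl
  rw [h5]
  have hu : DifferentiableAt ℂ (fun c : ℂ × ℂ => c.1) c := differentiableAt_fst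
  have hv : DifferentiableAt ℂ (fun c : ℂ × ℂ => c.2) c := differentiableAt_snd
  exact ((hGi.mul ((hu.smul (differentiableAt_const _)).add
    (hv.smul (differentiableAt_const _)))).mul hG').add
    (hGi.mul ((hu.smul (hD ξ)).add (hv.smul (hD _))))

theorem flat_connWith {s : X → P.Tot} {S : X × P1 → X × P1 × (Cx B)ˣ} {y : X} {c : ℂ × ℂ}
    (hc : c ≠ 0) (hs : P.IsReg s y) (h : P.ExtReg S (y, pt c)) (ξ η : E) :
    c.1 • dForm (fun y' => P.connWith s S y' c) y ξ η +
      c.2 • dcForm (fun y' => P.connWith s S y' c) y ξ η +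
      wedge (P.connWith s S y c) (P.connWith s S y c) ξ η = 0 := by
  have hd := (P.conn_smooth s y hs).differentiableAt (by simp)
  have hcd : ∀ {F : E → ℂ × ℂ → E →L[ℝ] Cx B},
      ContDiffAt ℝ ∞ (fun q : E × (ℂ × ℂ) => F q.1 q.2) (chartAt E y y, c) →
      DifferentiableAt ℝ (fun e => F e c) (chartAt E y y) := fun hF =>
    (ContDiffAt.comp (f := fun e : E => (e, c)) (chartAt E y y) hF
      (contDiffAt_id.prodMk contDiffAt_const)).differentiableAt (by simp)
  have h1 : ∀ᶠ y' in 𝓝 y, P.ExtReg S (y', pt c) :=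
    (continuous_id.prodMk continuous_const).continuousAt.eventually h.eventually
  refine flat_gauge (k := fun y' => P.trans s S (y', pt c)) (α := extForm (P.conn s) c)
    (β := fun y' => P.connWith s S y' c) ?_
    (hcd (F := fun e c => localForm y (extForm (P.conn s) c) e)
      (contDiffAt_localForm_extForm (P.conn_smooth s y hs) c))
    (hcd (F := fun e c => localForm y (fun y' => P.connWith s S y' c) e)
      (contDiffAt_connWith hc hs h)) (.of_forall fun y' => rfl)
    (flat_extForm hd (P.flat s y hs) (P.pluriharmonic s y hs) c) ξ η
  filter_upwards [h1, P.reg_nhds s y hs] with y' h2 h3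
  exact (h2.trans h3).contMDiffAt hc

variable (P) in
/-- The connection of the extension. -/
def extConn (S : X × P1 → X × P1 × (Cx B)ˣ) (y : X) (c : ℂ × ℂ) : E →L[ℝ] Cx B :=
  P.connWith (P.toTorsor.someSec y) S y c

theorem extConn_eq {s : X → P.Tot} {S : X × P1 → X × P1 × (Cx B)ˣ} {y : X} {c : ℂ × ℂ}
    (hc : c ≠ 0) (hs : P.IsReg s y) (h : P.ExtReg S (y, pt c)) :
    P.extConn S y c = P.connWith s S y c :=
  connWith_eq hc (P.toTorsor.isReg_someSec y) hs h

/-- `extConn` uses a section that changes with the point; its derivatives are computed from one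
fixed section on a whole neighbourhood. -/
theorem eventually_extConn_eq {s : X → P.Tot} {S : X × P1 → X × P1 × (Cx B)ˣ} {y : X} {c : ℂ × ℂ}
    (hc : c ≠ 0) (hs : P.IsReg s y) (h : P.ExtReg S (y, pt c)) :
    ∀ᶠ p : X × (ℂ × ℂ) in 𝓝 (y, c), P.extConn S p.1 p.2 = P.connWith s S p.1 p.2 := by
  filter_upwards [(eventually_nhds_prod_pt hc).1 h.eventually, eventually_ne_zero hc,
    continuous_fst.continuousAt.eventually (P.reg_nhds s y hs)] with p h1 h2 h3
  exact extConn_eq h2 h3 h1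

end FramedPluriharmonic

end Extension

/-! ### The twistor torsor with its real structure and framing -/

section Extension

variable {E : Type uE} [NormedAddCommGroup E] [NormedSpace ℂ E]
variable {X : Type uX} [TopologicalSpace X] [ChartedSpace E X] [IsManifold 𝓘(ℝ, E) ∞ X]
  [IsManifold 𝓘(ℂ, E) 1 X]
variable {B : Type uB} [NormedRing B] [NormedAlgebra ℝ B] [CompleteSpace B] [StarRing B]
  [CStarRing B] [StarModule ℝ B] {x : X}

namespace FramedPluriharmonic

variable {P : FramedPluriharmonic E B x}

theorem ExtReg.act_iff {S : X × P1 → X × P1 × (Cx B)ˣ} {w : X × P1} (h : P.ExtReg S w)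
    (g : X × P1 → (Cx B)ˣ) :
    P.ExtReg (fun w' => ((S w').1, (S w').2.1, (S w').2.2 * g w')) w ↔ SmoothHolUnits E g w := by
  obtain ⟨h1, s, h2, h3⟩ := h
  have e : ∀ w', P.trans s (fun w' => ((S w').1, (S w').2.1, (S w').2.2 * g w')) w' =
      P.trans s S w' * g w' := fun w' => (mul_assoc _ _ _).symm
  constructor
  · intro h
    have h4 := h3.inv'.mul' (h.trans h2)
    simpa only [e, inv_mul_cancel_left] using h4
  · intro h
    exact ⟨h1, s, h2, (h3.mul' h).congr (.of_forall e)⟩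

theorem extConn_act {S : X × P1 → X × P1 × (Cx B)ˣ} {y : X} {c : ℂ × ℂ} (hc : c ≠ 0)
    (h : P.ExtReg S (y, pt c)) {g : X × P1 → (Cx B)ˣ} (hg : SmoothHolUnits E g (y, pt c)) :
    P.extConn (fun w' => ((S w').1, (S w').2.1, (S w').2.2 * g w')) y c =
      gauge (g (y, pt c)).val (g (y, pt c))⁻¹.val (P.extConn S y c)
        (twist c (dFun (fun y' => (g (y', pt c)).val) y)) := by
  have hs := P.toTorsor.isReg_someSec y
  have e : ∀ w', P.trans (P.toTorsor.someSec y)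
      (fun w' => ((S w').1, (S w').2.1, (S w').2.2 * g w')) w' =
      P.trans (P.toTorsor.someSec y) S w' * g w' := fun w' => (mul_assoc _ _ _).symm
  rw [extConn, extConn, connWith, connWith, e]
  refine gauge_mul _ _ _ c fun ξ => ?_
  simp only [e]
  exact dFun_mul ((h.trans hs).contMDiffAt hc) (hg.contMDiffAt hc) ξ

/-- The real structure of the extension. -/
def extTau (p : X × P1 × (Cx B)ˣ) : X × P1 × (Cx B)ˣ := (p.1, bar p.2.1, Cx.conjU p.2.2)

theorem trans_extTau (s : X → P.Tot) (S : X × P1 → X × P1 × (Cx B)ˣ) (w : X × P1) :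
    P.trans s (fun w' => extTau (S (w'.1, bar w'.2))) w = Cx.conjU (P.trans s S (w.1, bar w.2)) := by
  rw [trans, trans, map_mul, map_inv, conjU_coord]
  rfl

theorem continuousAt_conjBar (w : X × P1) :
    Filter.Tendsto (fun w' : X × P1 => (w'.1, bar w'.2)) (𝓝 (w.1, bar w.2)) (𝓝 w) := by
  have h : Continuous fun w' : X × P1 => (w'.1, bar w'.2) :=
    continuous_fst.prodMk (continuous_bar.comp continuous_snd)
  have := h.tendsto (w.1, bar w.2)
  simpa only [bar_bar] using this

theorem ExtReg.tau {S : X × P1 → X × P1 × (Cx B)ˣ} {w : X × P1} (h : P.ExtReg S w) :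
    P.ExtReg (fun w' => extTau (S (w'.1, bar w'.2))) (w.1, bar w.2) := by
  obtain ⟨h1, s, h2, h3⟩ := h
  refine ⟨?_, s, h2, h3.conj_bar.congr (.of_forall fun w' => trans_extTau s S w')⟩
  filter_upwards [(continuousAt_conjBar w).eventually h1] with w' hw'
  have e1 := congrArg Prod.fst hw'
  have e2 := congrArg Prod.snd hw'
  simp only at e1 e2
  refine Prod.ext e1 ?_
  change bar (S (w'.1, bar w'.2)).2.1 = w'.2
  rw [e2, bar_bar]

theorem extConn_tau {S : X × P1 → X × P1 × (Cx B)ˣ} {y : X} {c : ℂ × ℂ} (hc : c ≠ 0)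
    (h : P.ExtReg S (y, pt c)) (ξ : E) :
    P.extConn (fun w' => extTau (S (w'.1, bar w'.2))) y (cc c) ξ =
      Cx.conj (P.extConn S y c ξ) := by
  have hs := P.toTorsor.isReg_someSec y
  have hb : bar (pt (cc c)) = pt c := by rw [bar_pt (cc_ne hc), cc_cc]
  have h1 : ∀ ζ : E, dFun (fun y' => (Cx.conjU (P.trans (P.toTorsor.someSec y) S (y', pt c))).val)
      y ζ = Cx.conj (dFun (fun y' => (P.trans (P.toTorsor.someSec y) S (y', pt c)).val) y ζ) :=
    dFun_clm Cx.conjL ((h.trans hs).contMDiffAt hc)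
  rw [extConn, extConn, connWith, connWith]
  simp only [trans_extTau, hb, gauge_apply, twist_apply, h1, extForm_apply, map_add, map_mul,
    Cx.conj_smul, Cx.conj_ofBase]
  rfl

variable (P) in
/-- The framed twistor torsor of a framed pluriharmonic torsor. -/
def extension : FramedTwistor E B x where
  -- The total space is a product only as a set; the possibly nontrivial torsor is encoded in the
  -- regular sections `ExtReg`.
  Tot := X × P1 × (Cx B)ˣ
  proj p := (p.1, p.2.1)
  act p g := (p.1, p.2.1, p.2.2 * g)
  act_one p := by simp
  act_mul p g h := by simp [mul_assoc]
  proj_act _ _ := rfl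
  existsUnique_act := by
    rintro ⟨y, z, g⟩ ⟨y', z', g'⟩ h
    obtain ⟨rfl, rfl⟩ := Prod.mk.inj h
    refine ⟨g⁻¹ * g', by simp, ?_⟩
    intro k hk
    have : g * k = g' := congrArg (fun p : X × P1 × (Cx B)ˣ => p.2.2) hk
    rw [← this, inv_mul_cancel_left]
  IsReg := P.ExtReg
  reg_exists := fun ⟨y, z⟩ => ⟨_, ExtReg.of_section (P.toTorsor.isReg_someSec y) z⟩
  reg_proj s y h := h.1.self_of_nhds
  reg_nhds s y h := h.eventually
  reg_congr s s' y h hs := hs.congr h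
  reg_act s y h g := h.act_iff g
  fibre_trivial y :=
    ⟨fun z => (P.proj (P.toTorsor.someSec y y), z, P.coord (P.toTorsor.someSec y y)), fun z =>
      ⟨_, ExtReg.of_section (P.toTorsor.isReg_someSec y) z, rfl, .of_forall fun _ => rfl⟩⟩
  conn := P.extConn
  conn_congr S S' y c hc h := by
    have h1 : ∀ᶠ y' in 𝓝 y, S (y', pt c) = S' (y', pt c) :=
      (continuous_id.prodMk continuous_const).continuousAt.eventually h
    have h2 : ∀ᶠ y' in 𝓝 y, P.trans (P.toTorsor.someSec y) S (y', pt c) =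
        P.trans (P.toTorsor.someSec y) S' (y', pt c) :=
      h1.mono fun y' hy' => by rw [trans, trans, hy']
    rw [extConn, extConn, connWith, connWith, h2.self_of_nhds,
      dFun_congr (h2.mono fun y' hy' => congrArg Units.val hy')]
  conn_smul S y c hc h l hl := by
    ext1 ξ
    simp only [extConn, connWith, pt_smul hc hl, gauge_apply, twist_apply, extForm_apply,
      _root_.smul_apply, Prod.smul_fst, Prod.smul_snd, smul_add, mul_add, add_mul, smul_eq_mul,
      mul_smul, mul_smul_comm, smul_mul_assoc]
  conn_smooth S y c hc h := by
    have hs := P.toTorsor.isReg_someSec y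
    refine (contDiffAt_connWith hc hs h).congr_of_eventuallyEq ?_
    have h1 := eventually_extConn_eq hc hs h
    have h2 : ContinuousAt (fun q : E × (ℂ × ℂ) => ((chartAt E y).symm q.1, q.2))
        (chartAt E y y, c) :=
      (ContinuousAt.comp (f := Prod.fst) ((chartAt E y).continuousAt_symm (mem_target_self y))
        continuousAt_fst).prodMk continuousAt_snd
    rw [ContinuousAt, symm_self] at h2
    filter_upwards [h2.eventually h1] with q hq
    exact congrArg (fun L : E →L[ℝ] Cx B => L.comp (chartD y q.1)) hq
  conn_hol S y c hc h := by
    refine (differentiableAt_connWith hc (P.toTorsor.isReg_someSec y) h).congr_of_eventuallyEq ?_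
    exact .of_forall fun _ => rfl
  conn_act S y c hc h g hg ξ := by
    rw [extConn_act hc h hg, gauge_apply, twist_apply]
  flat S y c hc h ξ η := by
    have hs := P.toTorsor.isReg_someSec y
    have h1 : ∀ᶠ y' in 𝓝 y, P.extConn S y' c = P.connWith (P.toTorsor.someSec y) S y' c :=
      (continuous_id.prodMk continuous_const).continuousAt.eventually
        (eventually_extConn_eq hc hs h)
    rw [dForm_congr h1, dcForm_congr h1]
    exact flat_connWith hc hs h ξ η
  tau := extTau
  proj_tau _ := rfl
  tau_act p g := by
    simp only [extTau, map_mul]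
  tau_tau p := by simp [extTau, bar_bar, Cx.conjU_conjU]
  tau_reg S w h := h.tau
  tau_conn S y c hc h ξ := extConn_tau hc h ξ
  frame z := (P.proj P.frame, z, P.coord P.frame)
  frame_section := by
    have hs := P.toTorsor.isReg_someSec x
    -- Translating a local section by a constant makes it pass through the frame, so that the frame
    -- becomes the restriction of a regular section.
    set u := P.toTorsor.div (P.toTorsor.someSec x x) P.frame
    have hu : P.act (P.toTorsor.someSec x x) u = P.frame :=
      Torsor.act_div (by rw [P.reg_proj _ _ hs, P.proj_frame])
    have hs' : P.IsReg (fun y => P.act (P.toTorsor.someSec x y) u) x :=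
      (P.reg_act _ _ hs _).2 (.of_forall fun _ => contMDiffAt_const)
    intro z
    refine ⟨_, ExtReg.of_section hs' z, ?_, .of_forall fun z' => ?_⟩ <;> simp only [hu]
  tau_frame z := by
    rw [extTau, conjU_coord]

variable (P) in
theorem isTwistorOf_extension : IsTwistorOf P P.extension := by
  refine ⟨fun p z => (P.proj p, z, P.coord p), fun p z => rfl, fun p u z => ?_, fun s y hs z =>
    ExtReg.of_section hs z, fun p z => ?_, fun s y hs c hc ξ => ?_, fun z => rfl⟩
  · change (_, _, _) = (_, _, _)
    rw [P.proj_act, coord_act]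
  · change extTau _ = _
    rw [extTau, conjU_coord]
  · change P.extConn _ y c ξ = _
    rw [extConn_eq hc hs (ExtReg.of_section hs _), connWith]
    have h1 : ∀ w, P.trans s (fun w => (P.proj (s w.1), w.2, P.coord (s w.1))) w = 1 := fun w =>
      inv_mul_cancel _
    simp only [h1, Units.val_one, inv_one, dFun_const, twist_zero, gauge_one]
    rfl

end FramedPluriharmonic

end Extension

/-! ### Uniqueness of the twistor torsor -/

section Uniqueness

variable {E : Type uE} [NormedAddCommGroup E] [NormedSpace ℂ E]
variable {X : Type uX} [TopologicalSpace X] [ChartedSpace E X] [IsManifold 𝓘(ℝ, E) ∞ X]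
  [IsManifold 𝓘(ℂ, E) 1 X]
variable {B : Type uB} [NormedRing B] [NormedAlgebra ℝ B] [CompleteSpace B] [StarRing B]
  [CStarRing B] [StarModule ℝ B] {x : X}

/-- The map `ι` exhibits `T` as the twistor torsor of `P`. -/
structure IsExt (P : FramedPluriharmonic E B x) (T : FramedTwistor E B x)
    (ι : P.Tot → P1 → T.Tot) : Prop where
  proj : ∀ p z, T.proj (ι p z) = (P.proj p, z)
  act : ∀ p u z, ι (P.act p u) z = T.act (ι p z) (unitaryToCx u)
  reg : ∀ s y, P.IsReg s y → ∀ z, T.IsReg (fun w => ι (s w.1) w.2) (y, z)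
  tau : ∀ p z, T.tau (ι p z) = ι p (bar z)
  conn : ∀ s y, P.IsReg s y → ∀ c, c ≠ 0 → ∀ ξ,
      T.conn (fun w => ι (s w.1) w.2) y c ξ =
        c.1 • Cx.ofBase (P.conn s y ξ) + c.2 • Cx.ofBase (connC (P.conn s) y ξ)
  frame : ∀ z, T.frame z = ι P.frame z

theorem isTwistorOf_iff {P : FramedPluriharmonic E B x} {T : FramedTwistor E B x} :
    IsTwistorOf P T ↔ ∃ ι, IsExt P T ι :=
  ⟨fun ⟨ι, h1, h2, h3, h4, h5, h6⟩ => ⟨ι, h1, h2, h3, h4, h5, h6⟩,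
    fun ⟨ι, h1, h2, h3, h4, h5, h6⟩ => ⟨ι, h1, h2, h3, h4, h5, h6⟩⟩

theorem FramedTwistor.IsHom.iso {S T : FramedTwistor E B x} {φ : S.Tot → T.Tot}
    {ψ : T.Tot → S.Tot} (hφ : S.IsHom T φ) (hψ : T.IsHom S ψ)
    (hτ : ∀ p, φ (S.tau p) = T.tau (φ p)) (h1 : ∀ p, ψ (φ p) = p) (h2 : ∀ p, φ (ψ p) = p) :
    S.Iso T := by
  refine ⟨⟨φ, ψ, h1, h2⟩, hφ.proj, hφ.act, fun s w => ⟨hφ.reg s w, fun h => ?_⟩, hφ.conn, hτ,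
    hφ.frame⟩
  have h3 := hψ.reg _ _ h
  have h4 : ψ ∘ φ ∘ s = s := funext fun w => h1 _
  exact h4 ▸ h3

theorem FramedTwistor.Iso.exists_hom {S T : FramedTwistor E B x} (h : S.Iso T) :
    ∃ φ : S.Tot → T.Tot, S.IsHom T φ ∧ ∀ p, φ (S.tau p) = T.tau (φ p) := by
  obtain ⟨φ, h1, h2, h3, h4, h5, h6⟩ := h
  exact ⟨φ, ⟨h1, h2, fun s w => (h3 s w).1, h4, h6⟩, h5⟩

namespace IsExt

variable {P : FramedPluriharmonic E B x} {T T' : FramedTwistor E B x} {ι : P.Tot → P1 → T.Tot}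
  {ι' : P.Tot → P1 → T'.Tot}

theorem exists_act (h : IsExt P T ι) (t : T.Tot) {p : P.Tot} (hp : P.proj p = (T.proj t).1) :
    ∃ g, T.act (ι p (T.proj t).2) g = t :=
  (T.existsUnique_act _ _ (by rw [h.proj, hp])).exists

/-- The comparison map between two extensions. -/
def comparison (ι : P.Tot → P1 → T.Tot) (ι' : P.Tot → P1 → T'.Tot) (t : T.Tot) : T'.Tot :=
  T'.act (ι' (P.toTorsor.basePt (T.proj t).1) (T.proj t).2)
    (T.toTorsor.div (ι (P.toTorsor.basePt (T.proj t).1) (T.proj t).2) t)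

/-- The base point used in the definition does not matter: moving it to `p` introduces the same
unitary factor for `ι` and `ι'`. -/
theorem comparison_act (h : IsExt P T ι) (h' : IsExt P T' ι') (p : P.Tot) (z : P1)
    (g : (Cx B)ˣ) : comparison ι ι' (T.act (ι p z) g) = T'.act (ι' p z) g := by
  have h1 : T.proj (T.act (ι p z) g) = (P.proj p, z) := by rw [T.proj_act, h.proj]
  rw [comparison, h1]
  have h2 := Torsor.act_div (T := P.toTorsor) (P.toTorsor.proj_basePt (P.proj p))
  set u := P.toTorsor.div (P.toTorsor.basePt (P.proj p)) p with hu
  have h3 : T.toTorsor.div (ι (P.toTorsor.basePt (P.proj p)) z) (T.act (ι p z) g) =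
      unitaryToCx u * g := by
    apply Torsor.div_eq_of_act_eq
    rw [T.act_mul, ← h.act, h2]
  change T'.act (ι' (P.toTorsor.basePt (P.proj p)) z) _ = _
  rw [h3, T'.act_mul, ← h'.act, h2]

theorem comparison_ι (h : IsExt P T ι) (h' : IsExt P T' ι') (p : P.Tot) (z : P1) :
    comparison ι ι' (ι p z) = ι' p z := by
  have := comparison_act h h' p z 1
  rwa [T.act_one, T'.act_one] at this

theorem comparison_comparison (h : IsExt P T ι) (h' : IsExt P T' ι') (t : T.Tot) :
    comparison ι' ι (comparison ι ι' t) = t := by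
  obtain ⟨g, hg⟩ := h.exists_act t (P.toTorsor.proj_basePt _)
  rw [← hg, comparison_act h h', comparison_act h' h]

theorem comparison_tau (h : IsExt P T ι) (h' : IsExt P T' ι') (t : T.Tot) :
    comparison ι ι' (T.tau t) = T'.tau (comparison ι ι' t) := by
  obtain ⟨g, hg⟩ := h.exists_act t (P.toTorsor.proj_basePt _)
  rw [← hg, comparison_act h h', T.tau_act, h.tau, comparison_act h h', T'.tau_act, h'.tau]

/-- Every section of `T` is locally `ι(s) g` with `s` a section of `U(𝒫)`; on such sections
regularity and connection are given by the same formulas in `T` and `T'`. -/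
theorem isHom_comparison (h : IsExt P T ι) (h' : IsExt P T' ι') :
    T.IsHom T' (comparison ι ι') := by
  have hact : ∀ t g, comparison ι ι' (T.act t g) = T'.act (comparison ι ι' t) g := by
    intro t g
    obtain ⟨k, hk⟩ := h.exists_act t (P.toTorsor.proj_basePt _)
    rw [← hk, ← T.act_mul, comparison_act h h', comparison_act h h', T'.act_mul]
  have key : ∀ (s : X → P.Tot) (g : X × P1 → (Cx B)ˣ),
      (fun w : X × P1 => comparison ι ι' (T.act (ι (s w.1) w.2) (g w))) =
        fun w => T'.act (ι' (s w.1) w.2) (g w) :=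
    fun s g => funext fun w => comparison_act h h' _ _ _
  have hrep : ∀ S w, T.IsReg S w → ∃ s g, P.IsReg s w.1 ∧ SmoothHolUnits E g w ∧
      S =ᶠ[𝓝 w] fun w => T.act (ι (s w.1) w.2) (g w) := by
    intro S w hS
    have hs := P.toTorsor.isReg_someSec w.1
    have hs' := h.reg _ _ hs w.2
    exact ⟨P.toTorsor.someSec w.1, _, hs, Torsor.reg_div hs' hS,
      Torsor.eventually_act_div hs' (Torsor.eventually_proj hS)⟩
  refine ⟨fun t => ?_, hact, fun S w hS => ?_, fun S y c hc hS => ?_, fun z => ?_⟩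
  · obtain ⟨g, hg⟩ := h.exists_act t (P.toTorsor.proj_basePt _)
    rw [← hg, comparison_act h h', T.proj_act, T'.proj_act, h.proj, h'.proj]
  · obtain ⟨s, g, hs, hg, e⟩ := hrep S w hS
    refine T'.reg_congr _ _ _ (e.fun_comp (comparison ι ι')).symm ?_
    change T'.IsReg (fun w => comparison ι ι' (T.act (ι (s w.1) w.2) (g w))) w
    rw [key, T'.reg_act _ _ (h'.reg s _ hs _)]
    exact hg
  · obtain ⟨s, g, hs, hg, e⟩ := hrep S _ hS
    rw [T'.conn_congr _ _ y c hc (e.fun_comp (comparison ι ι')), T.conn_congr _ _ y c hc e]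
    change T'.conn (fun w => comparison ι ι' (T.act (ι (s w.1) w.2) (g w))) y c = _
    rw [key]
    ext1 ξ
    rw [T'.conn_act _ y c hc (h'.reg s _ hs _) g hg, T.conn_act _ y c hc (h.reg s _ hs _) g hg,
      h.conn s y hs c hc, h'.conn s y hs c hc]
  · rw [h.frame, h'.frame, comparison_ι h h']

/-- The twistor torsor of a pluriharmonic torsor is unique. -/
theorem iso (h : IsExt P T ι) (h' : IsExt P T' ι') : T.Iso T' :=
  (isHom_comparison h h').iso (isHom_comparison h' h) (comparison_tau h h')
    (comparison_comparison h h') (comparison_comparison h' h)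

/-- The twistor torsor of a pluriharmonic torsor is `σ`-invariant. -/
theorem sigma (h : IsExt P T ι) : IsExt P T.sigma fun p z => ι p (rot z) where
  proj p z := by
    change rotY (T.proj _) = _
    rw [h.proj, rotY, rot_rot]
  act p u z := by
    change _ = T.act _ (Cx.cartan _)
    rw [h.act, cartan_unitaryToCx]
  reg s y hs z := by
    change T.IsReg ((fun w : X × P1 => ι (s w.1) (rot w.2)) ∘ rotY) (rotY (y, z))
    have : (fun w : X × P1 => ι (s w.1) (rot w.2)) ∘ rotY = fun w => ι (s w.1) w.2 :=
      funext fun w => by simp [rotY, rot_rot]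
    rw [this]
    exact h.reg s y hs _
  tau p z := by
    change T.tau _ = _
    rw [h.tau, rot_bar]
  conn s y hs c hc ξ := by
    change sigmaForm (T.conn ((fun w : X × P1 => ι (s w.1) (rot w.2)) ∘ rotY) y (rotL c)) ξ = _
    have : (fun w : X × P1 => ι (s w.1) (rot w.2)) ∘ rotY = fun w => ι (s w.1) w.2 :=
      funext fun w => by simp [rotY, rot_rot]
    -- `sigmaForm` takes `a` to `aᶜ` and `aᶜ` to `-a`, so it takes `v a - u aᶜ` to `u a + v aᶜ`.
    rw [this, sigmaForm_apply, h.conn s y hs _ (rotL_ne hc), connC_apply, connC_apply, jmul_jmul,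
      map_neg, star_neg, neg_neg]
    ext <;> simp [rotL_apply, add_comm]
  frame z := h.frame (rot z)

theorem comp_iso {φ : T.Tot → T'.Tot} (h : IsExt P T ι) (hφ : T.IsHom T' φ)
    (hτ : ∀ p, φ (T.tau p) = T'.tau (φ p)) : IsExt P T' fun p z => φ (ι p z) where
  proj p z := by rw [hφ.proj, h.proj]
  act p u z := by rw [h.act, hφ.act]
  reg s y hs z := hφ.reg _ _ (h.reg s y hs z)
  tau p z := by rw [← hτ, h.tau]
  conn s y hs c hc ξ := by
    rw [← h.conn s y hs c hc, ← hφ.conn _ _ _ hc (h.reg s y hs _)]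
    rfl
  frame z := by rw [← h.frame, hφ.frame]

theorem of_iso {Q : FramedPluriharmonic E B x} (h : IsExt P T ι) (e : Q.Iso P) :
    IsTwistorOf Q T := by
  obtain ⟨φ, h1, h2, h3, h4, h5⟩ := e
  refine isTwistorOf_iff.2 ⟨fun q z => ι (φ q) z, ⟨fun q z => ?_, fun q u z => ?_,
    fun s y hs z => h.reg (φ ∘ s) y ((h3 s y).1 hs) z, fun q z => h.tau _ _,
    fun s y hs c hc ξ => ?_, fun z => ?_⟩⟩
  · rw [h.proj, h1]
  · rw [h2, h.act]
  · rw [connC_apply, ← h4 s y hs, ← connC_apply, ← h.conn (φ ∘ s) y ((h3 s y).1 hs) c hc]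
    rfl
  · rw [h5, h.frame]

theorem isFibreSection (h : IsExt P T ι) (p : P.Tot) :
    T.toTorsor.IsFibreSection (P.proj p) (ι p) := by
  have hs := P.toTorsor.isReg_someSec (P.proj p)
  set u := P.toTorsor.div (P.toTorsor.someSec (P.proj p) (P.proj p)) p
  have hu : P.act (P.toTorsor.someSec (P.proj p) (P.proj p)) u = p :=
    Torsor.act_div (by rw [P.reg_proj _ _ hs])
  have hs' : P.IsReg (fun y => P.act (P.toTorsor.someSec (P.proj p) y) u) (P.proj p) :=
    (P.reg_act _ _ hs _).2 (.of_forall fun _ => contMDiffAt_const)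
  intro z
  refine ⟨_, h.reg _ _ hs' z, ?_, .of_forall fun z' => ?_⟩ <;> simp only [hu]

theorem injective (h : IsExt P T ι) {p q : P.Tot} {z : P1} (e : ι p z = ι q z) : p = q := by
  have h1 : P.proj p = P.proj q := by
    have := congrArg (fun t => (T.proj t).1) e
    simpa only [h.proj] using this
  obtain ⟨u, hu, -⟩ := P.existsUnique_act p q h1
  rw [← hu, h.act] at e
  have h2 : unitaryToCx u = 1 :=
    (Torsor.act_left_inj (T := T.toTorsor) (p := ι p z)).1 (by rw [T.act_one]; exact e.symm)
  have h3 : u = 1 := unitaryToCx_injective (h2.trans (map_one _).symm)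
  rw [← hu, h3, P.act_one]

variable [ConnectedSpace X] {Q : FramedPluriharmonic E B x} {κ : Q.Tot → P1 → T.Tot}

/-- By rigidity both reductions induce the same morphism `T → σT`. Comparing its values, and those
of `τ`, on sections `ι p` and `κ q` over the same line shows that the constant relating them is
fixed by conjugation and by `Cτ`, hence is unitary and can be absorbed in `q`. -/
theorem exists_eq (h : IsExt P T ι) (k : IsExt Q T κ) (p : P.Tot) :
    ∃ q, Q.proj q = P.proj p ∧ ∀ z, κ q z = ι p z := by
  have hφ := (isHom_comparison h h.sigma).eq (isHom_comparison k k.sigma)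
  set q := Q.toTorsor.basePt (P.proj p)
  have hq : Q.proj q = P.proj p := Q.toTorsor.proj_basePt _
  obtain ⟨g, hg⟩ := (h.isFibreSection p).exists_act (hq ▸ k.isFibreSection q)
  have h1 : Cx.conjU g = g := by
    have h2 := hg (bar (pt (1, 0)))
    rw [← k.tau, hg, T.tau_act, h.tau] at h2
    exact Torsor.act_left_inj.1 h2
  have h2 : Cx.cartan g = g := by
    have e1 := congrFun hφ (κ q (pt (1, 0)))
    rw [comparison_ι k k.sigma, hg, comparison_act h h.sigma, hg] at e1
    exact Torsor.act_left_inj.1 (show T.act _ _ = T.act _ _ from e1)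
  obtain ⟨u, hu⟩ := exists_unitary_of_fixed h1 h2
  refine ⟨Q.act q u⁻¹, by rw [Q.proj_act, hq], fun z => ?_⟩
  rw [k.act, hg, ← T.act_mul, map_inv, hu, mul_inv_cancel, T.act_one]

/-- A pluriharmonic torsor is determined by its twistor torsor. -/
theorem iso_of_isExt (h : IsExt P T ι) (k : IsExt Q T κ) : P.Iso Q := by
  choose φ hφ1 hφ2 using h.exists_eq k
  choose ψ hψ1 hψ2 using k.exists_eq h
  have e1 : ∀ p, ψ (φ p) = p := fun p => h.injective (z := pt (1, 0)) (by rw [hψ2, hφ2])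
  have e2 : ∀ q, φ (ψ q) = q := fun q => k.injective (z := pt (1, 0)) (by rw [hφ2, hψ2])
  have key : ∀ {P Q : FramedPluriharmonic E B x} {ι : P.Tot → P1 → T.Tot}
      {κ : Q.Tot → P1 → T.Tot} {φ : P.Tot → Q.Tot}, IsExt P T ι → IsExt Q T κ →
      (∀ p, Q.proj (φ p) = P.proj p) → (∀ p z, κ (φ p) z = ι p z) → ∀ s y, P.IsReg s y →
      Q.IsReg (φ ∘ s) y := by
    intro P Q ι κ φ h k hφ1 hφ2 s y hs
    have hr := Q.toTorsor.isReg_someSec y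
    have hp : ∀ᶠ y' in 𝓝 y, Q.proj ((φ ∘ s) y') = y' :=
      (Torsor.eventually_proj hs).mono fun y' hy' => (hφ1 _).trans hy'
    rw [Torsor.isReg_iff_div hr hp, ← smoothHolUnits_unitary_iff (z := pt (1, 0))]
    refine ((T.reg_act _ _ (k.reg _ _ hr (pt (1, 0))) _).1
      (T.reg_congr _ _ _ ?_ (h.reg s y hs (pt (1, 0)))))
    have h1 := Torsor.eventually_act_div hr hp
    filter_upwards [continuous_fst.continuousAt.eventually h1] with w hw
    rw [← k.act, ← hw, ← hφ2]
    rfl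
  refine ⟨⟨φ, ψ, e1, e2⟩, hφ1, fun p u => ?_, fun s y => ⟨key h k hφ1 hφ2 s y, fun hs => ?_⟩,
    fun s y hs => ?_, ?_⟩
  · refine k.injective (z := pt (1, 0)) ?_
    change κ (φ (P.act p u)) _ = κ (Q.act (φ p) u) _
    rw [hφ2, k.act, hφ2, h.act]
  · have := key k h hψ1 hψ2 _ y hs
    have e : ψ ∘ φ ∘ s = s := funext fun w => e1 _
    exact e ▸ this
  · ext1 ξ
    have h1 := k.conn _ y (key h k hφ1 hφ2 s y hs) (1, 0) (by simp) ξ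
    have h2 := h.conn s y hs (1, 0) (by simp) ξ
    simp only [Function.comp, hφ2] at h1
    rw [h2] at h1
    simp only [one_smul, zero_smul, add_zero] at h1
    exact (Cx.ofBase_injective h1).symm
  · refine k.injective (z := pt (1, 0)) ?_
    change κ (φ P.frame) _ = _
    rw [hφ2, ← h.frame, k.frame]

end IsExt

end Uniqueness

/-! ### Connection forms in a fixed chart -/

/-- Evaluation of real linear maps, as a complex linear map. -/
def evalRL {E : Type*} [NormedAddCommGroup E] [NormedSpace ℝ E] {W : Type*} [NormedAddCommGroup W]
    [NormedSpace ℂ W] (ξ : E) : (E →L[ℝ] W) →L[ℂ] W where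
  toFun L := L ξ
  map_add' _ _ := rfl
  map_smul' _ _ := rfl
  cont := (ContinuousLinearMap.apply ℝ W ξ).continuous

section FixedChart

variable {E : Type uE} [NormedAddCommGroup E] [NormedSpace ℂ E]
variable {X : Type uX} [TopologicalSpace X] [ChartedSpace E X] [IsManifold 𝓘(ℝ, E) ∞ X]
variable {V : Type*} [NormedAddCommGroup V] [NormedSpace ℝ V]

/-- Change of charts for forms. -/
theorem localForm_chart_change (α : X → E →L[ℝ] V) {y₀ y : X} {e : E}
    (he : e ∈ (chartAt E y₀).target) (hy : (chartAt E y₀).symm e ∈ (chartAt E y).source) :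
    localForm y₀ α e = (localForm y α (chartAt E y ((chartAt E y₀).symm e))).comp
      (fderiv ℝ (fun e => chartAt E y ((chartAt E y₀).symm e)) e) := by
  have h1 : ContMDiffAt 𝓘(ℝ, E) 𝓘(ℝ, E) ∞ (fun e => chartAt E y ((chartAt E y₀).symm e)) e :=
    ContMDiffAt.comp (g := chartAt E y) e (contMDiffAt_chart' hy) (contMDiffAt_chart_symm' he)
  have h2 := mfderiv_comp e
    (mdifferentiableAt_chart_symm ((chartAt E y).map_source hy)) (h1.mdifferentiableAt (by simp))
  have h3 : (chartAt E y).symm ∘ (fun e => chartAt E y ((chartAt E y₀).symm e)) =ᶠ[𝓝 e]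
      (chartAt E y₀).symm := by
    filter_upwards [((chartAt E y₀).continuousAt_symm he).eventually
      ((chartAt E y).open_source.mem_nhds hy)] with e' he'
    exact (chartAt E y).left_inv he'
  rw [h3.mfderiv_eq, mfderiv_eq_fderiv] at h2
  unfold localForm chartD
  rw [(chartAt E y).left_inv hy]
  exact congrArg (fun L : E →L[ℝ] E => (α ((chartAt E y₀).symm e)).comp L) h2

variable {B : Type uB} [NormedRing B] [NormedAlgebra ℝ B] [StarRing B] [CStarRing B]
  [StarModule ℝ B] {x : X}

/-- The axioms only speak of the chart centred at each point; a change of charts gives smoothness in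
one fixed chart on a full neighbourhood. -/
theorem FramedTwistor.smoothHolAt_localForm_conn (T : FramedTwistor E B x) {s : X × P1 → T.Tot}
    {y₀ : X} {c₀ : ℂ × ℂ} (hc₀ : c₀ ≠ 0) (h : T.IsReg s (y₀, pt c₀)) :
    SmoothHolAt (fun q : E × (ℂ × ℂ) => localForm y₀ (fun y => T.conn s y q.2) q.1)
      (chartAt E y₀ y₀, c₀) := by
  have h0 := (eventually_nhds_prod_pt hc₀).1 (T.reg_nhds _ _ h)
  have h1 : ∀ᶠ q : X × (ℂ × ℂ) in 𝓝 (y₀, c₀), T.IsReg s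
      ((chartAt E y₀).symm (chartAt E y₀ q.1), pt q.2) ∧ q.2 ≠ 0 ∧
      chartAt E y₀ q.1 ∈ (chartAt E y₀).target := by
    filter_upwards [h0, eventually_ne_zero hc₀, continuous_fst.continuousAt.eventually
      ((chartAt E y₀).open_source.mem_nhds (mem_chart_source E y₀))] with q h1 h2 h3
    refine ⟨?_, h2, (chartAt E y₀).map_source h3⟩
    rwa [(chartAt E y₀).left_inv h3]
  have h2 := (eventually_chart_prod_iff (mem_chart_source E y₀)
    (P := fun q : E × (ℂ × ℂ) => T.IsReg s ((chartAt E y₀).symm q.1, pt q.2) ∧ q.2 ≠ 0 ∧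
      q.1 ∈ (chartAt E y₀).target)).2 h1
  filter_upwards [h2] with q ⟨hq1, hq2, hq3⟩
  constructor
  · set y := (chartAt E y₀).symm q.1 with hy
    have hys : (chartAt E y₀).symm q.1 ∈ (chartAt E y).source := mem_chart_source E y
    have hΦ : ContDiffAt ℝ ∞ (fun e => chartAt E y ((chartAt E y₀).symm e)) q.1 :=
      contMDiffAt_iff_contDiffAt.1
        (ContMDiffAt.comp (g := chartAt E y) q.1 (contMDiffAt_chart' hys)
          (contMDiffAt_chart_symm' hq3))
    have e1 : ContDiffAt ℝ ∞ (fun p : E × (ℂ × ℂ) =>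
        (chartAt E y ((chartAt E y₀).symm p.1), p.2)) q :=
      (ContDiffAt.comp (f := Prod.fst) q hΦ contDiffAt_fst).prodMk contDiffAt_snd
    have e2 := ContDiffAt.comp (f := fun p : E × (ℂ × ℂ) =>
        (chartAt E y ((chartAt E y₀).symm p.1), p.2)) q (T.conn_smooth s y q.2 hq2 hq1) e1
    have e3 : ContDiffAt ℝ ∞ (fun p : E × (ℂ × ℂ) =>
        fderiv ℝ (fun e => chartAt E y ((chartAt E y₀).symm e)) p.1) q :=
      ContDiffAt.comp (f := Prod.fst) q (hΦ.fderiv_right (m := ∞) (by simp)) contDiffAt_fst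
    refine (e2.clm_comp e3).congr_of_eventuallyEq ?_
    filter_upwards [continuous_fst.continuousAt.eventually
      ((chartAt E y₀).open_target.mem_nhds hq3), continuous_fst.continuousAt.eventually
      (((chartAt E y₀).continuousAt_symm hq3).eventually
        ((chartAt E y).open_source.mem_nhds hys))] with p hp1 hp2
    exact localForm_chart_change _ hp1 hp2
  · have h3 := T.conn_hol s _ q.2 hq2 hq1
    refine differentiableAt_clm_of_forall ?_ fun ξ => ?_
    · exact (h3.restrictScalars ℝ).clm_comp (differentiableAt_const _)
    · exact (evalRL (chartD y₀ q.1 ξ)).differentiableAt.comp q.2 h3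

end FixedChart

/-! ### Inversion of `u d + v dᶜ` -/

section EffForm

variable {E : Type*} [NormedAddCommGroup E] [NormedSpace ℂ E]
variable {A : Type*} [NormedRing A] [NormedAlgebra ℂ A]

/-- The inverse of `twist c`, for nondegenerate `c`. -/
def untwist (c : ℂ × ℂ) (L : E →L[ℝ] A) : E →L[ℝ] A :=
  (c.1 ^ 2 + c.2 ^ 2)⁻¹ • (c.1 • L - c.2 • L.comp jmul)

theorem untwist_apply (c : ℂ × ℂ) (L : E →L[ℝ] A) (ξ : E) :
    untwist c L ξ = (c.1 ^ 2 + c.2 ^ 2)⁻¹ • (c.1 • L ξ - c.2 • L (jmul ξ)) := rfl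

/-- On `1`-forms `(u - vJ)(u + vJ) = u² + v²`, because `J² = -1`. Where this is nonzero, a `(u d + v
dᶜ)`-connection is thus an ordinary connection in disguise. -/
theorem untwist_gauge {c : ℂ × ℂ} (hc : c.1 ^ 2 + c.2 ^ 2 ≠ 0) (h hi : A) (a L : E →L[ℝ] A) :
    untwist c (gauge h hi a (twist c L)) = gauge h hi (untwist c a) L := by
  ext ξ
  simp only [untwist_apply, gauge_apply, twist_apply, jmul_jmul, map_neg]
  simp only [smul_add, smul_sub, mul_add, mul_sub, sub_mul, mul_smul_comm, smul_mul_assoc, mul_neg,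
    smul_neg, smul_smul]
  have e : hi * L ξ = ((c.1 ^ 2 + c.2 ^ 2)⁻¹ * (c.1 ^ 2 + c.2 ^ 2)) • (hi * L ξ) := by
    rw [inv_mul_cancel₀ hc, one_smul]
  conv_rhs => rw [e]
  module

/-- Connection forms have degree `1` in `c` and `untwist c` has degree `-1`, so the rescaled
connection depends only on the point of `ℙ¹`. -/
theorem untwist_smul {c : ℂ × ℂ} {l : ℂ} (hl : l ≠ 0) (L : E →L[ℝ] A) :
    untwist (l • c) (l • L) = untwist c L := by
  ext ξ
  simp only [untwist_apply, Prod.smul_fst, Prod.smul_snd, smul_eq_mul, _root_.smul_apply,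
    ← smul_sub, smul_smul]
  have e : ((l * c.1) ^ 2 + (l * c.2) ^ 2)⁻¹ = (l ^ 2)⁻¹ * (c.1 ^ 2 + c.2 ^ 2)⁻¹ := by
    rw [← mul_inv]
    congr 1
    ring
  rw [e, smul_sub, smul_sub, smul_smul, smul_smul, smul_smul, smul_smul]
  congr 2 <;> field_simp

theorem smoothHolAt_untwist {α : E × (ℂ × ℂ) → E →L[ℝ] A} {q : E × (ℂ × ℂ)}
    (h : SmoothHolAt α q) (hq : q.2.1 ^ 2 + q.2.2 ^ 2 ≠ 0) :
    SmoothHolAt (fun q => untwist q.2 (α q)) q := by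
  have hJ : SmoothHolAt (fun q => (α q).comp (jmul (E := E))) q := by
    filter_upwards [h] with p hp
    refine ⟨hp.1.clm_comp contDiffAt_const, differentiableAt_clm_of_forall
      ((hp.2.restrictScalars ℝ).clm_comp (differentiableAt_const _)) fun ξ => ?_⟩
    exact (evalRL (jmul ξ)).differentiableAt.comp p.2 hp.2
  have h1 : SmoothHolAt (fun q : E × (ℂ × ℂ) => q.2.1) q :=
    SmoothHolAt.of_snd (t := Prod.fst) (.of_forall fun _ => contDiffAt_fst)
  have h2 : SmoothHolAt (fun q : E × (ℂ × ℂ) => q.2.2) q :=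
    SmoothHolAt.of_snd (t := Prod.snd) (.of_forall fun _ => contDiffAt_snd)
  have h3 : SmoothHolAt (fun q : E × (ℂ × ℂ) => (q.2.1 ^ 2 + q.2.2 ^ 2)⁻¹) q := by
    refine SmoothHolAt.of_snd (t := fun c : ℂ × ℂ => (c.1 ^ 2 + c.2 ^ 2)⁻¹) ?_
    have : ContinuousAt (fun c : ℂ × ℂ => c.1 ^ 2 + c.2 ^ 2) q.2 := by fun_prop
    filter_upwards [this.eventually_ne hq] with c hc
    exact ((contDiffAt_fst.pow 2).add (contDiffAt_snd.pow 2)).inv hc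
  exact h3.smul ((h1.smul h).sub (h2.smul hJ))

end EffForm

/-! ### Radial parallel transport -/

section Radial

variable {E : Type uE} [NormedAddCommGroup E] [NormedSpace ℂ E]
variable {X : Type uX} [TopologicalSpace X] [ChartedSpace E X] [IsManifold 𝓘(ℝ, E) ∞ X]
variable {B : Type uB} [NormedRing B] [NormedAlgebra ℝ B] [StarRing B] [CStarRing B]
  [StarModule ℝ B] {x : X}

/-- For nondegenerate `c`, the local expression at `y₀` of the connection `(u d + v dᶜ)⁻¹`-rescaled
to an ordinary connection. -/
def FramedTwistor.radialForm (T : FramedTwistor E B x) (s : X × P1 → T.Tot) (y₀ : X) (c : ℂ × ℂ) :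
    E → E →L[ℝ] Cx B :=
  localForm y₀ fun y => untwist c (T.conn s y c)

/-- The segment from the origin `chartAt E y₀ y₀` of a chart to `e`. -/
def ray (y₀ : X) (e : E) (t : ℝ) : E := chartAt E y₀ y₀ + t • (e - chartAt E y₀ y₀)

theorem ray_zero (y₀ : X) (e : E) : ray y₀ e 0 = chartAt E y₀ y₀ := by simp [ray]

theorem ray_one (y₀ : X) (e : E) : ray y₀ e 1 = e := by simp [ray]

theorem hasDerivAt_ray (y₀ : X) (e : E) (t : ℝ) :
    HasDerivAt (ray y₀ e) (e - chartAt E y₀ y₀) t := by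
  have := ((hasDerivAt_id t).smul_const (e - chartAt E y₀ y₀)).const_add (chartAt E y₀ y₀)
  rwa [one_smul] at this

/-- The section `s` along the ray `{(ray t, c)}`, corrected by `k`, is parallel. -/
structure FramedTwistor.IsRadial (T : FramedTwistor E B x) (f : P1 → T.Tot) (y₀ : X) (e : E)
    (c : ℂ × ℂ) (s : X × P1 → T.Tot) (k : ℝ → Cx B) : Prop where
  ne : c.1 ^ 2 + c.2 ^ 2 ≠ 0
  mem : ∀ t ∈ Set.Icc (0 : ℝ) 1, ray y₀ e t ∈ (chartAt E y₀).target
  reg : ∀ t ∈ Set.Icc (0 : ℝ) 1, T.IsReg s ((chartAt E y₀).symm (ray y₀ e t), pt c)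
  start : s (y₀, pt c) = f (pt c)
  cont : ContinuousOn (fun t => T.radialForm s y₀ c (ray y₀ e t)) (Set.Icc 0 1)
  zero : k 0 = 1
  deriv : ∀ t ∈ Set.Icc (0 : ℝ) 1, HasDerivWithinAt k
    (-(T.radialForm s y₀ c (ray y₀ e t) (e - chartAt E y₀ y₀) * k t)) (Set.Icc 0 1) t

theorem ne_zero_of_nondegenerate {c : ℂ × ℂ} (h : c.1 ^ 2 + c.2 ^ 2 ≠ 0) : c ≠ 0 := by
  rintro rfl
  simp at h

variable [CompleteSpace B]

theorem FramedTwistor.radialForm_act (T : FramedTwistor E B x) {s : X × P1 → T.Tot} {y₀ : X}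
    {c : ℂ × ℂ} (hc : c.1 ^ 2 + c.2 ^ 2 ≠ 0) {g : X × P1 → (Cx B)ˣ} {e : E}
    (he : e ∈ (chartAt E y₀).target) (hs : T.IsReg s ((chartAt E y₀).symm e, pt c))
    (hg : SmoothHolUnits E g ((chartAt E y₀).symm e, pt c)) (v : E) :
    T.radialForm (fun w => T.act (s w) (g w)) y₀ c e v =
      ((g ((chartAt E y₀).symm e, pt c))⁻¹ : (Cx B)ˣ).val * T.radialForm s y₀ c e v *
        (g ((chartAt E y₀).symm e, pt c)).val +
      ((g ((chartAt E y₀).symm e, pt c))⁻¹ : (Cx B)ˣ).val *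
        fderiv ℝ (fun e => (g ((chartAt E y₀).symm e, pt c)).val) e v := by
  have hc0 := ne_zero_of_nondegenerate hc
  set y := (chartAt E y₀).symm e with hy
  have h1 : T.conn (fun w => T.act (s w) (g w)) y c =
      gauge (g (y, pt c)).val ((g (y, pt c))⁻¹ : (Cx B)ˣ).val (T.conn s y c)
        (twist c (dFun (fun y' => (g (y', pt c)).val) y)) := by
    ext1 ξ
    exact T.conn_act s y c hc0 hs g hg ξ
  have h2 := localForm_dFun (f := fun y' => (g (y', pt c)).val) he
    (SmoothHolUnits.contMDiffAt hc0 hg)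
  rw [← h2]
  change untwist c (T.conn (fun w => T.act (s w) (g w)) y c) (chartD y₀ e v) = _
  rw [h1, untwist_gauge hc]
  rfl

theorem FramedTwistor.radialForm_congr (T : FramedTwistor E B x) {s s' : X × P1 → T.Tot} {y₀ : X}
    {c : ℂ × ℂ} (hc : c ≠ 0) {e : E}
    (h : s =ᶠ[𝓝 ((chartAt E y₀).symm e, pt c)] s') :
    T.radialForm s y₀ c e = T.radialForm s' y₀ c e := by
  unfold FramedTwistor.radialForm localForm
  beta_reduce
  rw [T.conn_congr _ _ _ _ hc h]

/-- If `s' = s q`, then `k` and `q k'` solve the same linear equation along the ray, with the same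
initial value. The transported point therefore depends neither on the local section nor on the
representative of the point of `ℙ¹`. -/
theorem FramedTwistor.IsRadial.unique {T : FramedTwistor E B x} {f : P1 → T.Tot} {y₀ : X} {e : E}
    {c c' : ℂ × ℂ} {s s' : X × P1 → T.Tot} {k k' : ℝ → Cx B} (h : T.IsRadial f y₀ e c s k)
    (h' : T.IsRadial f y₀ e c' s' k') (hcc : pt c = pt c') {g g' : (Cx B)ˣ} (hg : g.val = k 1)
    (hg' : g'.val = k' 1) :
    T.act (s ((chartAt E y₀).symm e, pt c)) g = T.act (s' ((chartAt E y₀).symm e, pt c)) g' := by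
  have hc := ne_zero_of_nondegenerate h.ne
  have hc' := ne_zero_of_nondegenerate h'.ne
  obtain ⟨l, hl, rfl⟩ := exists_smul_of_pt_eq hc' hc hcc.symm
  set a : ℝ → Cx B := fun t => T.radialForm s y₀ c (ray y₀ e t) (e - chartAt E y₀ y₀) with ha
  set H : X × P1 → (Cx B)ˣ := fun w => T.toTorsor.div (s w) (s' w) with hH
  set q : ℝ → Cx B := fun t => (H ((chartAt E y₀).symm (ray y₀ e t), pt c)).val with hq
  have hreg' : ∀ t ∈ Set.Icc (0 : ℝ) 1,
      T.IsReg s' ((chartAt E y₀).symm (ray y₀ e t), pt c) := fun t ht => by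
    rw [hcc]
    exact h'.reg t ht
  have hHr : ∀ t ∈ Set.Icc (0 : ℝ) 1,
      SmoothHolUnits E H ((chartAt E y₀).symm (ray y₀ e t), pt c) := fun t ht =>
    Torsor.reg_div (h.reg t ht) (hreg' t ht)
  have hrad : ∀ t ∈ Set.Icc (0 : ℝ) 1,
      T.radialForm s' y₀ (l • c) (ray y₀ e t) = T.radialForm s' y₀ c (ray y₀ e t) := by
    intro t ht
    unfold FramedTwistor.radialForm localForm
    beta_reduce
    rw [T.conn_smul _ _ _ hc (hreg' t ht) l hl, untwist_smul hl]
  have hqd : ∀ t ∈ Set.Icc (0 : ℝ) 1, HasDerivWithinAt q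
      (q t * T.radialForm s' y₀ c (ray y₀ e t) (e - chartAt E y₀ y₀) - a t * q t)
      (Set.Icc 0 1) t := by
    intro t ht
    have e1 := T.radialForm_act h.ne (h.mem t ht) (h.reg t ht) (hHr t ht) (e - chartAt E y₀ y₀)
    have e2 : s' =ᶠ[𝓝 ((chartAt E y₀).symm (ray y₀ e t), pt c)] fun w => T.act (s w) (H w) :=
      Torsor.eventually_act_div (h.reg t ht) (Torsor.eventually_proj (hreg' t ht))
    rw [← T.radialForm_congr hc e2] at e1
    have h1 := (contMDiffAt_iff_chart ((chartAt E y₀).map_target (h.mem t ht))).1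
      (SmoothHolUnits.contMDiffAt hc (hHr t ht))
    rw [(chartAt E y₀).right_inv (h.mem t ht)] at h1
    have h2 := ((h1.differentiableAt (by simp)).hasFDerivAt.comp_hasDerivAt t
      (hasDerivAt_ray y₀ e t)).hasDerivWithinAt (s := Set.Icc 0 1)
    refine h2.congr_deriv ?_
    rw [e1, mul_add, ← mul_assoc, ← mul_assoc, ← mul_assoc]
    simp only [hq, Units.mul_inv, one_mul, ha]
    abel
  have hs0 : ∀ t, t = 0 → (chartAt E y₀).symm (ray y₀ e t) = y₀ := by
    rintro t rfl
    rw [ray_zero, symm_self]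
  have hq0 : q 0 = 1 := by
    have : H (y₀, pt c) = 1 := by
      have e1 : s' (y₀, pt c) = s (y₀, pt c) := by
        rw [h.start]
        have := h'.start
        rwa [← hcc] at this
      rw [hH]
      simp only [e1, Torsor.div_self]
    simp only [hq, hs0 0 rfl, this, Units.val_one]
  let M : ℝ → Cx B →L[ℝ] Cx B := fun t => -ContinuousLinearMap.mul ℝ (Cx B) (a t)
  have hM : ContinuousOn M (Set.Icc 0 1) :=
    ((ContinuousLinearMap.mul ℝ (Cx B)).continuous.comp_continuousOn
      (h.cont.clm_apply continuousOn_const)).neg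
  have key := linear_ode_unique hM (f := k) (g := fun t => q t * k' t)
    (fun t ht => h.deriv t ht) (fun t ht => ?_) (by rw [h.zero, h'.zero, hq0, mul_one])
  · have h1 := key (Set.right_mem_Icc.2 zero_le_one)
    simp only [hq, ray_one] at h1
    rw [← hg, ← hg', ← Units.val_mul, Units.val_inj] at h1
    rw [h1, T.act_mul, Torsor.act_div]
    have h2 := T.reg_proj _ _ (h.reg 1 (by simp))
    have h3 := T.reg_proj _ _ (hreg' 1 (by simp))
    rw [ray_one] at h2 h3
    rw [h2, h3]
  · have h1 := h'.deriv t ht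
    rw [hrad t ht] at h1
    refine ((hqd t ht).mul h1).congr_deriv ?_
    change _ = -(a t * (q t * k' t))
    simp only [sub_mul, mul_neg, mul_assoc]
    abel

end Radial

/-! ### Extension of fibre sections away from the degenerate points -/

section RadialSection

variable {E : Type uE} [NormedAddCommGroup E] [NormedSpace ℂ E]
variable {X : Type uX} [TopologicalSpace X] [ChartedSpace E X] [IsManifold 𝓘(ℝ, E) ∞ X]
  [IsManifold 𝓘(ℂ, E) 1 X]
variable {B : Type uB} [NormedRing B] [NormedAlgebra ℝ B] [StarRing B] [CStarRing B]
  [StarModule ℝ B] {x : X}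

theorem FramedTwistor.smoothHolAt_radialForm (T : FramedTwistor E B x) {s : X × P1 → T.Tot}
    {y₀ : X} {c₀ : ℂ × ℂ} (hc₀ : c₀.1 ^ 2 + c₀.2 ^ 2 ≠ 0) (h : T.IsReg s (y₀, pt c₀)) :
    SmoothHolAt (fun q : E × (ℂ × ℂ) => T.radialForm s y₀ q.2 q.1) (chartAt E y₀ y₀, c₀) := by
  refine (smoothHolAt_untwist (T.smoothHolAt_localForm_conn (ne_zero_of_nondegenerate hc₀) h)
    hc₀).congr ?_
  filter_upwards [continuous_fst.continuousAt.eventually (eventually_mem_target y₀)] with q hq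
  ext1 ξ
  have h1 := localForm_J (fun y => T.conn s y q.2) y₀ hq
  have h2 : localForm y₀ (Jform fun y => T.conn s y q.2) q.1 ξ = _ :=
    congrArg (fun L : E →L[ℝ] Cx B => L ξ) h1
  rw [untwist_apply, ← ContinuousLinearMap.comp_apply (localForm _ _ _) jmul, ← h1]
  rfl

/-- Rays do not leave balls around the centre, so conditions that hold on a ball hold along whole
rays. -/
theorem dist_ray_le (y₀ : X) (e : E) (c c₀ : ℂ × ℂ) {t : ℝ} (ht : t ∈ Set.Icc (0 : ℝ) 1) :
    dist (ray y₀ e t, c) (chartAt E y₀ y₀, c₀) ≤ dist (e, c) (chartAt E y₀ y₀, c₀) := by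
  rw [Prod.dist_eq, Prod.dist_eq]
  refine max_le_max ?_ le_rfl
  simp only [ray, dist_eq_norm, add_sub_cancel_left, norm_smul, Real.norm_eq_abs,
    abs_of_nonneg ht.1]
  exact mul_le_of_le_one_left (norm_nonneg _) ht.2

variable [CompleteSpace B]

/-- The coefficient `β` contains the factor `e - e₀` and vanishes at the centre. Near it the
coefficient is small, and `transport` yields solutions that are smooth in `e` and holomorphic in
`c`. -/
theorem FramedTwistor.exists_isRadial (T : FramedTwistor E B x) {f : P1 → T.Tot} {y₀ : X}
    {c₀ : ℂ × ℂ} (hc₀ : c₀.1 ^ 2 + c₀.2 ^ 2 ≠ 0) {s : X × P1 → T.Tot} (hs : T.IsReg s (y₀, pt c₀))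
    (hf : ∀ᶠ c in 𝓝 c₀, s (y₀, pt c) = f (pt c)) :
    ∃ H : E × (ℂ × ℂ) → Cx B, SmoothHolAt H (chartAt E y₀ y₀, c₀) ∧
      H (chartAt E y₀ y₀, c₀) = 1 ∧
      ∀ᶠ q in 𝓝 (chartAt E y₀ y₀, c₀), ∃ k, T.IsRadial f y₀ q.1 q.2 s k ∧ H q = k 1 := by
  set e₀ := chartAt E y₀ y₀ with he₀
  set β : (E × (ℂ × ℂ)) × ℝ → Cx B := fun r =>
    T.radialForm s y₀ r.1.2 (ray y₀ r.1.1 r.2) (r.1.1 - e₀) with hβ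
  have hα := T.smoothHolAt_radialForm hc₀ hs
  have hcont : ∀ t : ℝ, ContinuousAt (fun r : (E × (ℂ × ℂ)) × ℝ => (ray y₀ r.1.1 r.2, r.1.2))
      ((e₀, c₀), t) := fun t => by
    unfold ray
    fun_prop
  have hray : ∀ t, ray y₀ e₀ t = e₀ := fun t => by simp [ray, he₀]
  have hβs : ∀ t ∈ Set.Icc (0 : ℝ) 1, ∀ᶠ r in 𝓝 ((e₀, c₀), t), ContDiffAt ℝ ∞ β r ∧
      DifferentiableAt ℂ (fun c => β ((r.1.1, c), r.2)) r.1.2 := by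
    intro t _
    have h1 := hcont t
    rw [ContinuousAt, hray] at h1
    filter_upwards [h1.eventually hα] with r hr
    constructor
    · have h2 : ContDiffAt ℝ ∞ (fun r : (E × (ℂ × ℂ)) × ℝ => (ray y₀ r.1.1 r.2, r.1.2)) r := by
        unfold ray
        fun_prop
      exact (ContDiffAt.comp (f := fun r : (E × (ℂ × ℂ)) × ℝ => (ray y₀ r.1.1 r.2, r.1.2)) r
        hr.1 h2).clm_apply (by fun_prop)
    · exact (evalRL (r.1.1 - e₀)).differentiableAt.comp r.1.2 hr.2
  have hsl : SmoothHolAt (slice 1 β) (e₀, c₀) := smoothHolAt_slice hβs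
  have hsl0 : slice 1 β (e₀, c₀) = 0 := by
    refine BoundedContinuousFunction.ext fun t => ?_
    rw [slice_apply (fun t ht => (hβs t ht).self_of_nhds.1.continuousAt)]
    simp [hβ]
  have hball : ∀ᶠ a in 𝓝 (slice 1 β (e₀, c₀)), ‖a‖ < 1 := by
    rw [hsl0]
    exact (continuous_norm.tendsto _).eventually (gt_mem_nhds (by simp))
  refine ⟨fun q => transport (slice 1 β q) ⟨1, by simp⟩, ?_, ?_, ?_⟩
  · refine hsl.comp_of_eventually (Φ := fun a => transport a ⟨1, by simp⟩) ?_
    filter_upwards [hball] with a ha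
    exact (BoundedContinuousFunction.evalCLM ℂ (β := Cx B)
      (⟨1, by simp⟩ : Set.Icc (0 : ℝ) 1)).contDiff.contDiffAt.comp a (contDiffAt_transport ha)
  · beta_reduce
    rw [hsl0, transport_zero]
    rfl
  · have hcn : ∀ᶠ q : E × (ℂ × ℂ) in 𝓝 (e₀, c₀), q.2.1 ^ 2 + q.2.2 ^ 2 ≠ 0 := by
      have : ContinuousAt (fun q : E × (ℂ × ℂ) => q.2.1 ^ 2 + q.2.2 ^ 2) (e₀, c₀) := by fun_prop
      exact this.eventually_ne hc₀
    have hreg : ∀ᶠ q : E × (ℂ × ℂ) in 𝓝 (e₀, c₀),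
        T.IsReg s ((chartAt E y₀).symm q.1, pt q.2) := by
      have h2 : ContinuousAt (fun q : E × (ℂ × ℂ) => ((chartAt E y₀).symm q.1, q.2))
          (e₀, c₀) :=
        (ContinuousAt.comp (f := Prod.fst) ((chartAt E y₀).continuousAt_symm (mem_target_self y₀))
          continuousAt_fst).prodMk continuousAt_snd
      rw [ContinuousAt, he₀, symm_self] at h2
      exact h2.eventually
        ((eventually_nhds_prod_pt (ne_zero_of_nondegenerate hc₀)).1 (T.reg_nhds _ _ hs))
    obtain ⟨r, hr, hgood⟩ := Metric.eventually_nhds_iff_ball.1 (hreg.and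
      ((continuous_fst.continuousAt.eventually (eventually_mem_target y₀)).and hα))
    filter_upwards [Metric.ball_mem_nhds _ hr, hcn, continuous_snd.continuousAt.eventually hf,
      hsl.continuousAt.eventually hball, eventually_forall_Icc hβs] with q hq h1 h2 h3 h4
    have hq' : ∀ t ∈ Set.Icc (0 : ℝ) 1, (ray y₀ q.1 t, q.2) ∈ Metric.ball (e₀, c₀) r :=
      fun t ht => (dist_ray_le y₀ q.1 q.2 c₀ ht).trans_lt hq
    have h5 : ∀ t (ht : t ∈ Set.Icc (0 : ℝ) 1), extendIcc (slice 1 β q) t = β (q, t) :=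
      fun t ht => by
        rw [extendIcc_of_mem _ ht]
        exact slice_apply (fun t ht => (h4 t ht).1.continuousAt) ⟨t, ht⟩
    refine ⟨extendIcc (transport (slice 1 β q)), ⟨h1, fun t ht => (hgood _ (hq' t ht)).2.1,
      fun t ht => (hgood _ (hq' t ht)).1, h2, fun t ht => ?_, extendIcc_transport_zero h3,
      fun t ht => ?_⟩, ?_⟩
    · refine ContinuousAt.continuousWithinAt ?_
      have h6 : ContinuousAt (fun t => (ray y₀ q.1 t, q.2)) t := by
        unfold ray
        fun_prop
      exact ContinuousAt.comp (f := fun t => (ray y₀ q.1 t, q.2))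
        (g := fun q : E × (ℂ × ℂ) => T.radialForm s y₀ q.2 q.1) (hgood _ (hq' t ht)).2.2.1.continuousAt h6
    · have := hasDerivWithinAt_transport h3 ht
      rwa [h5 t ht] at this
    · rw [extendIcc_of_mem _ (by simp)]

open Classical in
-- Radial transport is carried out with different local sections near different points of `ℙ¹`. By
-- `IsRadial.unique` the results agree, so one section can be defined pointwise and compared with a
-- smooth holomorphic solution near each point.
theorem FramedTwistor.exists_radial_section (T : FramedTwistor E B x) {f : P1 → T.Tot} {y₀ : X}
    (hf : T.toTorsor.IsFibreSection y₀ f) :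
    ∃ F : X × P1 → T.Tot, ∀ c : ℂ × ℂ, c.1 ^ 2 + c.2 ^ 2 ≠ 0 →
      T.IsReg F (y₀, pt c) ∧ F (y₀, pt c) = f (pt c) := by
  let Q : X × P1 → T.Tot → Prop := fun w p => ∃ c s k, ∃ g : (Cx B)ˣ,
    T.IsRadial f y₀ (chartAt E y₀ w.1) c s k ∧ pt c = w.2 ∧ g.val = k 1 ∧
      p = T.act (s ((chartAt E y₀).symm (chartAt E y₀ w.1), pt c)) g
  have hQ : ∀ w p p', Q w p → Q w p' → p = p' := by
    rintro w _ _ ⟨c, s, k, g, h1, h2, h3, rfl⟩ ⟨c', s', k', g', h1', h2', h3', rfl⟩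
    have := h1.unique h1' (h2.trans h2'.symm) h3 h3'
    rw [this, h2, h2']
  -- Points not reached by any radial solution get an irrelevant value; the regularity claims
  -- concern only germs along `{y₀} × ℙ¹`.
  refine ⟨fun w => if h : ∃ p, Q w p then h.choose else T.frame w.2, fun c hc => ?_⟩
  set F : X × P1 → T.Tot := fun w => if h : ∃ p, Q w p then h.choose else T.frame w.2 with hF
  have hFQ : ∀ w p, Q w p → F w = p := fun w p hp => by
    have h : ∃ p, Q w p := ⟨p, hp⟩
    simp only [hF, dif_pos h]
    exact hQ w _ _ h.choose_spec hp
  have hc0 := ne_zero_of_nondegenerate hc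
  obtain ⟨s, hs1, hs2, hs3⟩ := hf (pt c)
  obtain ⟨H, h1, h2, h3⟩ := T.exists_isRadial hc hs1
    (((eventually_nhds_pt hc0).1 hs3).mono fun _ h => h.symm)
  have hu : ∀ᶠ q in 𝓝 (chartAt E y₀ y₀, c), IsUnit (H q) :=
    h1.continuousAt.eventually (Units.isOpen.mem_nhds (by rw [h2]; exact isUnit_one))
  have hs4 : ∀ᶠ w : X × (ℂ × ℂ) in 𝓝 (y₀, c), w.1 ∈ (chartAt E y₀).source :=
    continuous_fst.continuousAt.eventually
      ((chartAt E y₀).open_source.mem_nhds (mem_chart_source E y₀))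
  have key : ∀ᶠ w : X × (ℂ × ℂ) in 𝓝 (y₀, c), ∃ g : (Cx B)ˣ,
      g.val = H (chartAt E y₀ w.1, w.2) ∧ F (w.1, pt w.2) = T.act (s (w.1, pt w.2)) g := by
    filter_upwards [(eventually_chart_prod_iff (mem_chart_source E y₀)).1 (h3.and hu), hs4]
      with w ⟨⟨k, hk1, hk2⟩, g, hg⟩ hw
    refine ⟨g, hg, hFQ (w.1, pt w.2) _ ⟨w.2, s, k, g, hk1, rfl, hg.trans hk2, ?_⟩⟩
    rw [(chartAt E y₀).left_inv hw]
  constructor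
  · have hproj : ∀ᶠ w in 𝓝 (y₀, pt c), T.proj (F w) = w := by
      rw [eventually_nhds_prod_pt hc0]
      filter_upwards [key, (eventually_nhds_prod_pt hc0).1 (Torsor.eventually_proj hs1)]
        with w ⟨g, _, hg⟩ hw
      rw [hg, T.proj_act, hw]
    rw [Torsor.isReg_iff_div hs1 hproj, smoothHolUnits_iff hc0]
    refine h1.congr ?_
    have key' : ∀ᶠ w : X × (ℂ × ℂ) in 𝓝 (y₀, c),
        (T.toTorsor.div (s ((chartAt E y₀).symm (chartAt E y₀ w.1), pt w.2))
          (F ((chartAt E y₀).symm (chartAt E y₀ w.1), pt w.2))).val =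
            H (chartAt E y₀ w.1, w.2) := by
      filter_upwards [key, hs4] with w ⟨g, hg1, hg2⟩ hw
      rw [(chartAt E y₀).left_inv hw, hg2, Torsor.div_act, hg1]
    exact (eventually_chart_prod_iff (mem_chart_source E y₀)
      (P := fun q : E × (ℂ × ℂ) => (T.toTorsor.div (s ((chartAt E y₀).symm q.1, pt q.2))
          (F ((chartAt E y₀).symm q.1, pt q.2))).val = H q)).2 key'
  · obtain ⟨g, hg1, hg2⟩ := key.self_of_nhds
    rw [h2] at hg1
    rw [hg2, show g = 1 from Units.ext hg1, T.act_one, hs2]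

end RadialSection

/-! ### Extension of fibre sections across the degenerate points -/

section Glue

open Classical in
/-- A unit of a ring, as an element of the group of units. -/
def toUnit {A : Type*} [Monoid A] (a : A) : Aˣ := if h : IsUnit a then h.unit else 1

theorem toUnit_val {A : Type*} [Monoid A] {a : A} (h : IsUnit a) : (toUnit a).val = a := by
  rw [toUnit, dif_pos h]
  rfl

theorem toUnit_one {A : Type*} [Monoid A] : toUnit (1 : A) = 1 := Units.ext (toUnit_val isUnit_one)

variable {E : Type uE} [NormedAddCommGroup E] [NormedSpace ℂ E]
variable {X : Type uX} [TopologicalSpace X] [ChartedSpace E X] [IsManifold 𝓘(ℝ, E) ∞ X]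
variable {B : Type uB} [NormedRing B] [NormedAlgebra ℝ B]

/-- `τ` is a function on `ℙ¹`, which may be defined through chosen representatives, and `t` is its
expression on `ℂ²` near `c`; all regularity is demanded of `t`. -/
theorem eventually_chart_pt' {y₀ : X} {c : ℂ × ℂ} (hc : c ≠ 0) {t : ℂ × ℂ → ℂ} {τ : P1 → ℂ}
    (ht : ContinuousAt t c) (hτ : ∀ᶠ c' in 𝓝 c, τ (pt c') = t c') {P : E × ℂ → Prop}
    (h : ∀ᶠ q in 𝓝 (chartAt E y₀ y₀, t c), P q) :
    ∀ᶠ w : X × P1 in 𝓝 (y₀, pt c), P (chartAt E y₀ w.1, τ w.2) := by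
  rw [eventually_nhds_prod_pt hc]
  have h1 : ContinuousAt (fun w : X × (ℂ × ℂ) => (chartAt E y₀ w.1, t w.2)) (y₀, c) :=
    (ContinuousAt.comp (f := Prod.fst) ((chartAt E y₀).continuousAt (mem_chart_source E y₀))
      continuousAt_fst).prodMk (ContinuousAt.comp (f := Prod.snd) ht continuousAt_snd)
  filter_upwards [h1.eventually h, continuous_snd.continuousAt.eventually hτ] with w h2 h3
  rwa [h3]

variable [CompleteSpace B]

theorem eventually_toUnit_val {y₀ : X} {c : ℂ × ℂ} (hc : c ≠ 0) {t : ℂ × ℂ → ℂ} {τ : P1 → ℂ}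
    (ht : ContinuousAt t c) (hτ : ∀ᶠ c' in 𝓝 c, τ (pt c') = t c') {h : E × ℂ → Cx B}
    (hh : SmoothHolAt h (chartAt E y₀ y₀, t c)) (h1 : h (chartAt E y₀ y₀, t c) = 1) :
    ∀ᶠ w : X × P1 in 𝓝 (y₀, pt c), (toUnit (h (chartAt E y₀ w.1, τ w.2))).val =
      h (chartAt E y₀ w.1, τ w.2) := by
  refine (eventually_chart_pt' hc ht hτ (P := fun q => IsUnit (h q)) ?_).mono
    fun w hw => toUnit_val hw
  exact hh.continuousAt.eventually (Units.isOpen.mem_nhds (by rw [h1]; exact isUnit_one))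

theorem smoothHolUnits_toUnit {y₀ : X} {c : ℂ × ℂ} (hc : c ≠ 0) {t : ℂ × ℂ → ℂ} {τ : P1 → ℂ}
    (ht : ∀ᶠ c' in 𝓝 c, ContDiffAt ℂ ∞ t c') (hτ : ∀ᶠ c' in 𝓝 c, τ (pt c') = t c')
    {h : E × ℂ → Cx B} (hh : SmoothHolAt h (chartAt E y₀ y₀, t c))
    (h1 : h (chartAt E y₀ y₀, t c) = 1) :
    SmoothHolUnits E (fun w => toUnit (h (chartAt E y₀ w.1, τ w.2))) (y₀, pt c) := by
  rw [smoothHolUnits_iff hc]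
  refine (hh.comp_snd ht).congr ?_
  have h2 := (eventually_nhds_prod_pt hc).1
    (eventually_toUnit_val hc ht.self_of_nhds.continuousAt hτ hh h1)
  have h3 : ContinuousAt (fun q : E × (ℂ × ℂ) => ((chartAt E y₀).symm q.1, q.2))
      (chartAt E y₀ y₀, c) :=
    (ContinuousAt.comp (f := Prod.fst) ((chartAt E y₀).continuousAt_symm (mem_target_self y₀))
      continuousAt_fst).prodMk continuousAt_snd
  rw [ContinuousAt, symm_self] at h3
  filter_upwards [h3.eventually h2, continuous_fst.continuousAt.eventually
    (eventually_mem_target y₀), continuous_snd.continuousAt.eventually hτ] with q h4 h5 h6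
  rw [h4, (chartAt E y₀).right_inv h5, h6]

variable [StarRing B] [CStarRing B] [StarModule ℝ B] {x : X}

/-- The section `F` is regular at `(y₀, z)` and restricts to `f` there. -/
def FramedTwistor.Extends (T : FramedTwistor E B x) (f : P1 → T.Tot) (y₀ : X)
    (F : X × P1 → T.Tot) (z : P1) : Prop :=
  T.IsReg F (y₀, z) ∧ F (y₀, z) = f z

/-- The correction is `1` over `y₀`, so the modified section stays regular and still restricts to
`f` there. -/
theorem FramedTwistor.Extends.act {T : FramedTwistor E B x} {f : P1 → T.Tot} {y₀ : X}
    {F F' : X × P1 → T.Tot} {c : ℂ × ℂ} (hF : T.Extends f y₀ F (pt c)) (hc : c ≠ 0)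
    {t : ℂ × ℂ → ℂ} {τ : P1 → ℂ}
    (ht : ∀ᶠ c' in 𝓝 c, ContDiffAt ℂ ∞ t c') (hτ : ∀ᶠ c' in 𝓝 c, τ (pt c') = t c')
    {h : E × ℂ → Cx B} (hh : SmoothHolAt h (chartAt E y₀ y₀, t c))
    (h1 : h (chartAt E y₀ y₀, t c) = 1)
    (hF' : ∀ᶠ w in 𝓝 (y₀, pt c), F' w = T.act (F w) (toUnit (h (chartAt E y₀ w.1, τ w.2)))) :
    T.Extends f y₀ F' (pt c) := by
  refine ⟨T.reg_congr _ _ _ (Filter.EventuallyEq.symm hF')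
    ((T.reg_act _ _ hF.1 _).2 (smoothHolUnits_toUnit hc ht hτ hh h1)), ?_⟩
  rw [hF'.self_of_nhds, hτ.self_of_nhds, h1, toUnit_one, T.act_one, hF.2]

/-- The linear form on `ℂ²` vanishing at the degenerate point attached to `l`, where `l² = -1`. -/
def degForm (l : ℂ) (c : ℂ × ℂ) : ℂ := c.1 + l * c.2

theorem degForm_smul (l m : ℂ) (c : ℂ × ℂ) : degForm l (m • c) = m * degForm l c := by
  simp [degForm]
  ring

theorem contDiff_degForm (l : ℂ) : ContDiff ℂ ∞ (degForm l) := by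
  unfold degForm
  fun_prop

/-- The point `c` with `degForm l c = w` and `degForm (-l) c = 1`. -/
def degPt (l w : ℂ) : ℂ × ℂ := ((w + 1) / 2, -l * (w - 1) / 2)

theorem degForm_degPt {l : ℂ} (hl : l ^ 2 = -1) (w : ℂ) : degForm l (degPt l w) = w := by
  simp only [degForm, degPt]
  linear_combination (-(w - 1) / 2) * hl

theorem degForm_neg_degPt {l : ℂ} (hl : l ^ 2 = -1) (w : ℂ) :
    degForm (-l) (degPt l w) = 1 := by
  simp only [degForm, degPt]
  linear_combination ((w - 1) / 2) * hl

theorem smul_degPt {l : ℂ} (hl : l ^ 2 = -1) {c : ℂ × ℂ} (hc : degForm (-l) c ≠ 0) :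
    degForm (-l) c • degPt l (degForm l c / degForm (-l) c) = c := by
  have h1 : degForm (-l) c * (degForm l c / degForm (-l) c) = degForm l c := by
    field_simp
  ext
  · simp only [degPt, Prod.smul_fst, smul_eq_mul, mul_div_assoc', mul_add, h1, mul_one]
    simp only [degForm]
    ring
  · have h2 : degForm (-l) c * (-l * (degForm l c / degForm (-l) c - 1) / 2) =
      -l * (degForm (-l) c * (degForm l c / degForm (-l) c) - degForm (-l) c) / 2 := by ring
    simp only [degPt, Prod.smul_snd, smul_eq_mul]
    rw [h2, h1]
    simp only [degForm]
    linear_combination (-c.2) * hl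

theorem degPt_ne {l : ℂ} (hl : l ^ 2 = -1) (w : ℂ) : degPt l w ≠ 0 := fun h => by
  have := degForm_neg_degPt hl w
  rw [h] at this
  simp [degForm] at this

theorem pt_degPt {l : ℂ} (hl : l ^ 2 = -1) {c : ℂ × ℂ} (hc : degForm (-l) c ≠ 0) :
    pt (degPt l (degForm l c / degForm (-l) c)) = pt c := by
  conv_rhs => rw [← smul_degPt hl hc]
  rw [pt_smul (degPt_ne hl _) hc]

theorem contDiff_degPt (l : ℂ) : ContDiff ℂ ∞ (degPt l) := by
  unfold degPt
  fun_prop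

theorem degForm_ne_or {l : ℂ} (hl : l ^ 2 = -1) {c : ℂ × ℂ} (hc : c ≠ 0) (h : degForm l c = 0) :
    degForm (-l) c ≠ 0 := by
  intro h'
  apply hc
  simp only [degForm] at h h'
  have h1 : c.1 = 0 := by linear_combination (h + h') / 2
  have h2 : c.2 = 0 := by linear_combination (-l / 2) * (h - h') + c.2 * hl
  exact Prod.ext h1 h2

theorem exists_rep_pt {c : ℂ × ℂ} (hc : c ≠ 0) : ∃ l : ℂ, l ≠ 0 ∧ (pt c).rep = l • c := by
  refine exists_smul_of_pt_eq (pt c).rep_nonzero hc ?_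
  rw [pt_of_ne (pt c).rep_nonzero, Projectivization.mk_rep]

/-- The ratio of the two degenerate forms, as a function on `ℙ¹`. -/
def degRatio (l m : ℂ) (z : P1) : ℂ := m * degForm l z.rep / degForm (-l) z.rep

theorem degRatio_pt (l m : ℂ) {c : ℂ × ℂ} (hc : c ≠ 0) :
    degRatio l m (pt c) = m * degForm l c / degForm (-l) c := by
  obtain ⟨k, hk, h⟩ := exists_rep_pt hc
  rw [degRatio, h, degForm_smul, degForm_smul, mul_left_comm, mul_div_mul_left _ _ hk]

theorem contDiffAt_degRatio (l m : ℂ) {c : ℂ × ℂ} (hc : degForm (-l) c ≠ 0) :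
    ∀ᶠ c' in 𝓝 c, ContDiffAt ℂ ∞ (fun c => m * degForm l c / degForm (-l) c) c' := by
  filter_upwards [(contDiff_degForm (-l)).continuous.continuousAt.eventually_ne hc] with c' hc'
  exact (contDiffAt_const.mul (contDiff_degForm l).contDiffAt).div
    (contDiff_degForm (-l)).contDiffAt hc'

end Glue

/-! ### Gluing across a degenerate point -/

section ExtendFibre

variable {E : Type uE} [NormedAddCommGroup E] [NormedSpace ℂ E]
variable {X : Type uX} [TopologicalSpace X] [ChartedSpace E X] [IsManifold 𝓘(ℝ, E) ∞ X]
variable {B : Type uB} [NormedRing B] [NormedAlgebra ℝ B] [CompleteSpace B] [StarRing B]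
  [CStarRing B] [StarModule ℝ B] {x : X}

theorem continuous_norm_degForm (l : ℂ) : Continuous fun c => ‖degForm l c‖ :=
  (contDiff_degForm l).continuous.norm

open Classical in
-- Let `w` be the ratio of the two degenerate forms. A section `s` regular near `w = 0` and the
-- given section `F` are related by `F = s g` on an annulus, with `g = 1` over `y₀`. The
-- factorization `g hm = hp` gives `F hm = s hp` there, with `hm` holomorphic on the outer side and
-- `hp` on the inner side; the two sides glue.
theorem FramedTwistor.exists_glue (T : FramedTwistor E B x) {f : P1 → T.Tot} {y₀ : X}
    (hf : T.toTorsor.IsFibreSection y₀ f) {l : ℂ} (hl : l ^ 2 = -1) {F : X × P1 → T.Tot}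
    (hF : ∀ᶠ w in 𝓝[≠] (0 : ℂ), T.Extends f y₀ F (pt (degPt l w))) :
    ∃ F' : X × P1 → T.Tot, ∀ c, c ≠ 0 → (degForm l c ≠ 0 → T.Extends f y₀ F (pt c)) →
      T.Extends f y₀ F' (pt c) := by
  have hl' : (-l) ^ 2 = -1 := by rw [neg_sq, hl]
  obtain ⟨s, hs1, hs2, hs3⟩ := hf (pt (degPt l 0))
  have hs : ∀ᶠ w in 𝓝 (0 : ℂ), T.Extends f y₀ s (pt (degPt l w)) := by
    have h1 : ∀ᶠ z in 𝓝 (pt (degPt l 0)), T.Extends f y₀ s z := by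
      filter_upwards [hs3, (continuous_const.prodMk continuous_id).continuousAt.eventually
        (T.reg_nhds _ _ hs1)] with z h1 h2 using ⟨h2, h1.symm⟩
    exact (contDiff_degPt l).continuous.continuousAt.eventually
      ((eventually_nhds_pt (degPt_ne hl 0)).1 h1)
  rw [eventually_nhdsWithin_iff] at hF
  obtain ⟨δ, hδ, hball⟩ := Metric.eventually_nhds_iff.1 (hs.and hF)
  -- With this choice `|w| ≤ 3ε` stays inside the disc of radius `δ`, and rescaling by `ε` gives the
  -- annulus `1/2 ≤ |w| ≤ 3` of the factorization.
  set ε : ℝ := δ / 4 with hε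
  have hε0 : 0 < ε := by positivity
  have hεC : (ε : ℂ) ≠ 0 := by exact_mod_cast hε0.ne'
  have hsw : ∀ w : ℂ, ‖w‖ ≤ 3 * ε → T.Extends f y₀ s (pt (degPt l w)) := fun w hw =>
    (hball (by rw [dist_zero_right]; linarith)).1
  have hFw : ∀ w : ℂ, ‖w‖ ≤ 3 * ε → w ≠ 0 → T.Extends f y₀ F (pt (degPt l w)) := fun w hw h0 =>
    (hball (by rw [dist_zero_right]; linarith)).2 h0
  set g : E × ℂ → Cx B := fun q =>
    (T.toTorsor.div (s ((chartAt E y₀).symm q.1, pt (degPt l (ε * q.2))))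
      (F ((chartAt E y₀).symm q.1, pt (degPt l (ε * q.2))))).val with hg
  have hann : ∀ w : ℂ, 1 / 2 ≤ ‖w‖ → ‖w‖ ≤ 3 → ‖(ε : ℂ) * w‖ ≤ 3 * ε ∧ (ε : ℂ) * w ≠ 0 := by
    intro w h1 h2
    constructor
    · rw [norm_mul, Complex.norm_real, Real.norm_eq_abs, abs_of_pos hε0]
      nlinarith
    · refine mul_ne_zero hεC ?_
      rintro rfl
      norm_num at h1
  obtain ⟨hm, hp, hhm, hhp, hfac⟩ := exists_factorization (g := g) (y₀ := chartAt E y₀ y₀)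
    (fun w h1 h2 => by
      obtain ⟨h3, h4⟩ := hann w h1 h2
      have h5 := (smoothHolUnits_iff (degPt_ne hl _)).1
        (Torsor.reg_div (hsw _ h3).1 (hFw _ h3 h4).1)
      exact SmoothHolAt.comp_snd (t := fun w : ℂ => degPt l (ε * w)) h5 (.of_forall fun w =>
        (contDiff_degPt l).contDiffAt.comp w (contDiffAt_const.mul contDiffAt_id)))
    (fun w h1 h2 => by
      obtain ⟨h3, h4⟩ := hann w h1 h2
      simp only [hg, symm_self, (hsw _ h3).2, (hFw _ h3 h4).2, Torsor.div_self, Units.val_one])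
  -- The cut is made at `|w| = 3ε/2`, inside the annulus `ε < |w| < 2ε` where both expressions
  -- agree. It is written without division, so it makes sense at all points of `ℙ¹`.
  set P : ℂ × ℂ → Prop := fun c => 3 * ε * ‖degForm (-l) c‖ ≤ 2 * ‖degForm l c‖ with hP
  have hPrep : ∀ c, c ≠ 0 → (P (pt c).rep ↔ P c) := by
    intro c hc
    obtain ⟨k, hk, h⟩ := exists_rep_pt hc
    have hk' := norm_pos_iff.2 hk
    simp only [hP, h, degForm_smul, norm_mul]
    rw [mul_left_comm, mul_left_comm 2, mul_le_mul_iff_right₀ hk']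
  set Fm : X × P1 → T.Tot := fun w =>
    T.act (F w) (toUnit (hm (chartAt E y₀ w.1, degRatio (-l) ε w.2))) with hFm
  set Fp : X × P1 → T.Tot := fun w =>
    T.act (s w) (toUnit (hp (chartAt E y₀ w.1, degRatio l (ε⁻¹ : ℂ) w.2))) with hFp
  refine ⟨fun w => if P w.2.rep then Fm w else Fp w, fun c hc h => ?_⟩
  have hne : ∀ᶠ c' : ℂ × ℂ in 𝓝 c, c' ≠ 0 := continuousAt_id.eventually_ne hc
  have hτp : ∀ᶠ c' in 𝓝 c, degRatio l (ε⁻¹ : ℂ) (pt c') =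
      (ε⁻¹ : ℂ) * degForm l c' / degForm (-l) c' := hne.mono fun c' hc' => degRatio_pt _ _ hc'
  have hτm : ∀ᶠ c' in 𝓝 c, degRatio (-l) ε (pt c') = ε * degForm (-l) c' / degForm (-(-l)) c' :=
    hne.mono fun c' hc' => degRatio_pt _ _ hc'
  have hsc : ∀ c', degForm (-l) c' ≠ 0 → ‖degForm l c'‖ ≤ 3 * ε * ‖degForm (-l) c'‖ →
      T.Extends f y₀ s (pt c') := by
    intro c' h0 h1
    rw [← pt_degPt hl h0]
    refine hsw _ ?_
    rwa [norm_div, div_le_iff₀ (norm_pos_iff.2 h0)]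
  have hpc : degForm (-l) c ≠ 0 → ‖degForm l c‖ < 2 * ε * ‖degForm (-l) c‖ →
      ‖(ε⁻¹ : ℂ) * degForm l c / degForm (-l) c‖ < 2 := by
    intro h0 h1
    rw [norm_div, norm_mul, norm_inv, Complex.norm_real, Real.norm_eq_abs, abs_of_pos hε0,
      div_lt_iff₀ (norm_pos_iff.2 h0), inv_mul_lt_iff₀ hε0]
    linarith
  by_cases hPc : P c
  · have h0 : degForm l c ≠ 0 := by
      intro h0
      have h1 := norm_pos_iff.2 (degForm_ne_or hl hc h0)
      simp only [hP, h0, norm_zero, mul_zero] at hPc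
      nlinarith
    have h0' := norm_pos_iff.2 h0
    have h0n : degForm (-(-l)) c ≠ 0 := by rwa [neg_neg]
    have htm : ‖(ε : ℂ) * degForm (-l) c / degForm (-(-l)) c‖ < 1 := by
      rw [norm_div, norm_mul, Complex.norm_real, Real.norm_eq_abs, abs_of_pos hε0,
        div_lt_one (norm_pos_iff.2 h0n), neg_neg]
      simp only [hP] at hPc
      linarith
    have hsm := contDiffAt_degRatio (-l) ε h0n
    refine (h h0).act hc hsm hτm (hhm _ htm).1 (hhm _ htm).2 ?_
    -- Inside the annulus a neighbourhood may meet both sides of the cut, and the factorization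
    -- identifies the two expressions. Further out, the first expression is used on a whole
    -- neighbourhood.
    by_cases hov : ‖degForm l c‖ < 2 * ε * ‖degForm (-l) c‖
    · have h0q : degForm (-l) c ≠ 0 := by
        intro hq
        rw [hq, norm_zero, mul_zero] at hov
        linarith
      have hp2 := hpc h0q hov
      have hsp := contDiffAt_degRatio l (ε⁻¹ : ℂ) h0q
      have ev1 := eventually_toUnit_val hc hsm.self_of_nhds.continuousAt hτm (hhm _ htm).1
        (hhm _ htm).2
      have ev2 := eventually_toUnit_val hc hsp.self_of_nhds.continuousAt hτp (hhp _ hp2).1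
        (hhp _ hp2).2
      have ev3 := Torsor.eventually_proj (h h0).1
      have ev4 := Torsor.eventually_proj (hsc c h0q (by nlinarith [norm_nonneg (degForm (-l) c)])).1
      rw [eventually_nhds_prod_pt hc] at ev1 ev2 ev3 ev4 ⊢
      have ev5 : ∀ᶠ c' in 𝓝 c, ‖degForm l c'‖ < 2 * ε * ‖degForm (-l) c'‖ :=
        (continuous_norm_degForm l).continuousAt.eventually_lt
          ((continuous_norm_degForm (-l)).const_mul _).continuousAt hov
      have ev6 : ∀ᶠ c' in 𝓝 c, ε * ‖degForm (-l) c'‖ < ‖degForm l c'‖ := by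
        refine ((continuous_norm_degForm (-l)).const_mul _).continuousAt.eventually_lt
          (continuous_norm_degForm l).continuousAt ?_
        simp only [hP] at hPc
        linarith
      have ev7 := ((chartAt E y₀).continuousAt (mem_chart_source E y₀)).eventually hfac
      filter_upwards [ev1, ev2, ev3, ev4, continuous_snd.continuousAt.eventually ev5,
        continuous_snd.continuousAt.eventually ev6, continuous_fst.continuousAt.eventually ev7,
        eventually_ne_zero hc, continuous_fst.continuousAt.eventually
          ((chartAt E y₀).open_source.mem_nhds (mem_chart_source E y₀))]
        with w e1 e2 e3 e4 e5 e6 e7 e8 e9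
      change (if _ then _ else _) = Fm (w.1, pt w.2)
      split_ifs
      · rfl
      · have e0 : degForm l w.2 ≠ 0 := by
          intro h0
          rw [h0, norm_zero] at e6
          nlinarith [norm_nonneg (degForm (-l) w.2)]
        have e0' : degForm (-l) w.2 ≠ 0 := by
          intro h0
          rw [h0, norm_zero, mul_zero] at e5
          linarith [norm_nonneg (degForm l w.2)]
        have e10 := norm_pos_iff.2 e0'
        have e11 : ‖(ε⁻¹ : ℂ) * degForm l w.2 / degForm (-l) w.2‖ =
            ε⁻¹ * ‖degForm l w.2‖ / ‖degForm (-l) w.2‖ := by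
          rw [norm_div, norm_mul, norm_inv, Complex.norm_real, Real.norm_eq_abs, abs_of_pos hε0]
        have e12 := e7 ((ε⁻¹ : ℂ) * degForm l w.2 / degForm (-l) w.2)
          (by rw [e11, lt_div_iff₀ e10, lt_inv_mul_iff₀ hε0]; linarith)
          (by rw [e11, div_lt_iff₀ e10, inv_mul_lt_iff₀ hε0]; linarith)
        have e13 : (ε : ℂ) * ((ε⁻¹ : ℂ) * degForm l w.2 / degForm (-l) w.2) =
            degForm l w.2 / degForm (-l) w.2 := by
          field_simp
        have e14 : ((ε⁻¹ : ℂ) * degForm l w.2 / degForm (-l) w.2)⁻¹ =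
            ε * degForm (-l) w.2 / degForm (-(-l)) w.2 := by
          rw [neg_neg]
          field_simp
        simp only [hg, e13, pt_degPt hl e0', (chartAt E y₀).left_inv e9, e14] at e12
        rw [← degRatio_pt _ _ e8, ← degRatio_pt _ _ e8, ← e1, ← e2, ← Units.val_mul,
          Units.val_inj] at e12
        simp only [hFm, hFp]
        rw [← e12, T.act_mul, Torsor.act_div (e4.trans e3.symm)]
    · have ev : ∀ᶠ c' in 𝓝 c, P c' := by
        have : ∀ᶠ c' in 𝓝 c, 3 * ε * ‖degForm (-l) c'‖ < 2 * ‖degForm l c'‖ :=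
          ((continuous_norm_degForm (-l)).const_mul _).continuousAt.eventually_lt
            ((continuous_norm_degForm l).const_mul _).continuousAt (by nlinarith)
        exact this.mono fun c' h => h.le
      rw [eventually_nhds_prod_pt hc]
      filter_upwards [continuous_snd.continuousAt.eventually ev, eventually_ne_zero hc]
        with w h1 h2
      exact if_pos ((hPrep _ h2).2 h1)
  · have hPc' : 2 * ‖degForm l c‖ < 3 * ε * ‖degForm (-l) c‖ := not_le.1 hPc
    have h0q : degForm (-l) c ≠ 0 := by
      intro hq
      rw [hq, norm_zero, mul_zero] at hPc'
      linarith [norm_nonneg (degForm l c)]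
    have h0q' := norm_pos_iff.2 h0q
    have hp2 := hpc h0q (by nlinarith)
    refine (hsc c h0q (by nlinarith)).act hc (contDiffAt_degRatio l (ε⁻¹ : ℂ) h0q) hτp
      (hhp _ hp2).1 (hhp _ hp2).2 ?_
    have ev : ∀ᶠ c' in 𝓝 c, 2 * ‖degForm l c'‖ < 3 * ε * ‖degForm (-l) c'‖ :=
      ((continuous_norm_degForm l).const_mul _).continuousAt.eventually_lt
        ((continuous_norm_degForm (-l)).const_mul _).continuousAt hPc'
    rw [eventually_nhds_prod_pt hc]
    filter_upwards [continuous_snd.continuousAt.eventually ev, eventually_ne_zero hc]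
      with w h1 h2
    exact if_neg fun h => not_le.2 h1 ((hPrep _ h2).1 h)

/-- Sections over one projective line extend to a neighbourhood of it. -/
theorem FramedTwistor.exists_extends [IsManifold 𝓘(ℂ, E) 1 X] (T : FramedTwistor E B x)
    {f : P1 → T.Tot} {y₀ : X} (hf : T.toTorsor.IsFibreSection y₀ f) :
    ∃ S : X × P1 → T.Tot, ∀ z, T.IsReg S (y₀, z) ∧ S (y₀, z) = f z := by
  obtain ⟨F, hF⟩ := T.exists_radial_section hf
  have hI : Complex.I ^ 2 = -1 := Complex.I_sq
  have hI' : (-Complex.I) ^ 2 = -1 := by rw [neg_sq, hI]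
  -- The degenerate locus consists of the zeros of `u + iv` and of `u - iv`; these two points are
  -- crossed one after the other.
  have hsq : ∀ c : ℂ × ℂ, c.1 ^ 2 + c.2 ^ 2 = degForm Complex.I c * degForm (-Complex.I) c := by
    intro c
    simp only [degForm]
    linear_combination c.2 ^ 2 * hI
  obtain ⟨F₁, hF₁⟩ := T.exists_glue hf hI (F := F) (by
    filter_upwards [self_mem_nhdsWithin] with w hw
    refine hF _ ?_
    rw [hsq, degForm_degPt hI, degForm_neg_degPt hI, mul_one]
    exact hw)
  have hF₁' : ∀ c, c ≠ 0 → degForm (-Complex.I) c ≠ 0 → T.Extends f y₀ F₁ (pt c) := by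
    intro c hc h
    refine hF₁ c hc fun h' => hF _ ?_
    rw [hsq]
    exact mul_ne_zero h' h
  obtain ⟨F₂, hF₂⟩ := T.exists_glue hf hI' (F := F₁) (by
    filter_upwards [self_mem_nhdsWithin] with w hw
    refine hF₁' _ (degPt_ne hI' _) ?_
    rw [degForm_degPt hI']
    exact hw)
  refine ⟨F₂, fun z => ?_⟩
  obtain ⟨c, hc, rfl⟩ := exists_pt z
  exact hF₂ c hc (hF₁' c hc)

end ExtendFibre

/-! ### Square roots near the identity -/

section Sqrt

variable {A : Type*} [NormedRing A] [NormedAlgebra ℝ A] [CompleteSpace A]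

/-- Inverse function theorem for squaring, whose derivative at `1` is multiplication by `2`. -/
theorem exists_sqrt : ∃ r : A → A, r 1 = 1 ∧ (∀ᶠ m in 𝓝 (1 : A), ContDiffAt ℝ ∞ r m ∧
    r m * r m = m) ∧ ∀ᶠ c in 𝓝 (1 : A), r (c * c) = c := by
  let e : A ≃L[ℝ] A := ContinuousLinearEquiv.smulLeft (Units.mk0 (2 : ℝ) two_ne_zero)
  have hsm : ContDiffAt ℝ ω (fun c : A => c * c) 1 := contDiffAt_id.mul contDiffAt_id
  have hd : HasFDerivAt (fun c : A => c * c) (e : A →L[ℝ] A) 1 := by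
    refine ((hasFDerivAt_id (𝕜 := ℝ) (1 : A)).mul' (hasFDerivAt_id 1)).congr_fderiv ?_
    ext v
    have : e v = (2 : ℝ) • v := rfl
    simp [this, two_smul]
  have h1 := hsm.to_localInverse hd (by simp)
  have hs : HasStrictFDerivAt (fun c : A => c * c) (e : A →L[ℝ] A) 1 :=
    hsm.hasStrictFDerivAt' hd (by simp)
  have h2 := hs.eventually_right_inverse
  have h3 := hs.eventually_left_inverse
  simp only [mul_one] at h1 h2
  refine ⟨hs.localInverse _ _ _, ?_, ?_, h3⟩
  · have := hs.localInverse_apply_image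
    simpa only [mul_one] using this
  · have h4 : ∀ᶠ m in 𝓝 (1 : A), ContDiffAt ℝ ∞ (hs.localInverse _ _ _) m :=
      (h1.eventually (by simp)).mono fun m hm => hm.of_le le_top
    exact h4.and h2

/-- If `α` fixes `m`, then `α (r m)` is again a square root of `m` close to `1`, and such a root is
unique. Only compatibility with squares is used, so `α` may reverse products. -/
theorem eventually_sqrt_fixed {r : A → A} (h1 : r 1 = 1)
    (h2 : ∀ᶠ m in 𝓝 (1 : A), ContDiffAt ℝ ∞ r m ∧ r m * r m = m)
    (h3 : ∀ᶠ c in 𝓝 (1 : A), r (c * c) = c) {α : A → A} (hα : Continuous α) (hα1 : α 1 = 1)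
    (hα2 : ∀ c, α (c * c) = α c * α c) : ∀ᶠ m in 𝓝 (1 : A), α m = m → α (r m) = r m := by
  have h4 : Filter.Tendsto (fun m => α (r m)) (𝓝 1) (𝓝 1) := by
    have := (hα.tendsto (r 1)).comp h2.self_of_nhds.1.continuousAt.tendsto
    rwa [h1, hα1] at this
  filter_upwards [h4.eventually h3, h2] with m h5 h6 h7
  rw [← h5, ← hα2, h6.2, h7]

end Sqrt

/-! ### Torsors isomorphic to their image under `σ` -/

section SigmaInvariant

variable {E : Type uE} [NormedAddCommGroup E] [NormedSpace ℂ E]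
variable {X : Type uX} [TopologicalSpace X] [ChartedSpace E X] [IsManifold 𝓘(ℝ, E) ∞ X]
  [IsManifold 𝓘(ℂ, E) 1 X]
variable {B : Type uB} [NormedRing B] [NormedAlgebra ℝ B] [CompleteSpace B] [StarRing B]
  [CStarRing B] [StarModule ℝ B] {x : X}

/-- The map `φ` is a morphism from `T` to `σ T`. -/
structure IsSigmaHom (T : FramedTwistor E B x) (φ : T.Tot → T.Tot) : Prop where
  hom : T.IsHom T.sigma φ
  tau : ∀ p, φ (T.tau p) = T.tau (φ p)

namespace IsSigmaHom

variable {T : FramedTwistor E B x} {φ : T.Tot → T.Tot}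

theorem proj (h : IsSigmaHom T φ) (p : T.Tot) : T.proj (φ p) = rotY (T.proj p) := by
  have h1 : rotY (T.proj (φ p)) = T.proj p := h.hom.proj p
  rw [← h1, rotY_rotY]

theorem act (h : IsSigmaHom T φ) (p : T.Tot) (g : (Cx B)ˣ) :
    φ (T.act p g) = T.act (φ p) (Cx.cartan g) := h.hom.act p g

theorem reg (h : IsSigmaHom T φ) {s : X × P1 → T.Tot} {w : X × P1} (hs : T.IsReg s w) :
    T.IsReg (fun w => φ (s (rotY w))) (rotY w) := h.hom.reg s w hs

theorem conn (h : IsSigmaHom T φ) {s : X × P1 → T.Tot} {y : X} {c : ℂ × ℂ} (hc : c ≠ 0)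
    (hs : T.IsReg s (y, pt c)) :
    sigmaForm (T.conn (fun w => φ (s (rotY w))) y (rotL c)) = T.conn s y c :=
  h.hom.conn s y c hc hs

theorem frame (h : IsSigmaHom T φ) (z : P1) : φ (T.frame z) = T.frame (rot z) := h.hom.frame z

theorem sigmaForm_sigmaForm (a : E →L[ℝ] Cx B) : sigmaForm (sigmaForm a) = -a := by
  ext1 ξ
  rw [sigmaForm_apply, sigmaForm_apply, jmul_jmul, map_neg]
  simp only [map_neg, star_neg, neg_neg, Cx.star_conj_invol]
  rfl

theorem rotL_rotL (c : ℂ × ℂ) : rotL (rotL c) = (-1 : ℂ) • c := by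
  ext <;> simp [rotL_apply]

theorem isHom_id (T : FramedTwistor E B x) : T.IsHom T id :=
  ⟨fun _ => rfl, fun _ _ => rfl, fun _ _ h => h, fun _ _ _ _ _ => rfl, fun _ => rfl⟩

theorem reg_comp (h : IsSigmaHom T φ) {s : X × P1 → T.Tot} {w : X × P1} (hs : T.IsReg s w) :
    T.IsReg (fun w => φ (φ (s w))) w := by
  have := h.reg (h.reg hs)
  simpa only [rotY_rotY] using this

/-- The square of `sigmaForm` is `-1` and that of `rotL` is `-1`; since the connection has degree
`1` in `c`, the signs cancel. -/
theorem isHom_comp (h : IsSigmaHom T φ) : T.IsHom T (φ ∘ φ) where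
  proj p := by simp only [Function.comp, h.proj, rotY_rotY]
  act p g := by simp only [Function.comp, h.act, Cx.cartan_cartan]
  reg s w hs := h.reg_comp hs
  conn s y c hc hs := by
    have h1 := h.reg hs
    rw [rotY_pt y hc] at h1
    have h2 := h.conn (rotL_ne hc) h1
    simp only [rotY_rotY] at h2
    rw [← h.conn hc hs, ← h2, sigmaForm_sigmaForm, rotL_rotL,
      T.conn_smul _ _ _ hc (h.reg_comp hs) (-1) (by norm_num)]
    ext1 ξ
    change _ = -((-1 : ℂ) • T.conn (fun w => φ (φ (s w))) y c ξ)
    rw [neg_one_smul, neg_neg]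
    rfl
  frame z := by simp only [Function.comp, h.frame, rot_rot]

/-- `φ ∘ φ` is an endomorphism of the framed torsor, hence the identity by rigidity. -/
theorem involutive [ConnectedSpace X] (h : IsSigmaHom T φ) (p : T.Tot) : φ (φ p) = p :=
  congrFun (h.isHom_comp.eq (isHom_id T)) p

end IsSigmaHom

end SigmaInvariant

/-! ### Normal forms for the two involutions -/

section NormalForm

variable {E : Type uE} [NormedAddCommGroup E] [NormedSpace ℂ E]
variable {X : Type uX} [TopologicalSpace X] [ChartedSpace E X] [IsManifold 𝓘(ℝ, E) ∞ X]
  [IsManifold 𝓘(ℂ, E) 1 X]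

theorem SmoothNear.eventually {V : Type*} [NormedAddCommGroup V] [NormedSpace ℝ V] {f : X → V}
    {y : X} (h : SmoothNear E f y) : ∀ᶠ y' in 𝓝 y, SmoothNear E f y' :=
  eventually_eventually_nhds.2 h

theorem SmoothNear.congr {V : Type*} [NormedAddCommGroup V] [NormedSpace ℝ V] {f g : X → V}
    {y : X} (h : SmoothNear E f y) (e : g =ᶠ[𝓝 y] f) : SmoothNear E g y := by
  filter_upwards [h, e.eventuallyEq_nhds] with y' h1 h2 using h1.congr_of_eventuallyEq h2

theorem SmoothNear.comp_of_eventually {V W : Type*} [NormedAddCommGroup V] [NormedSpace ℝ V]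
    [NormedAddCommGroup W] [NormedSpace ℝ W] {f : X → V} {y : X} (h : SmoothNear E f y) {Φ : V → W}
    (hΦ : ∀ᶠ v in 𝓝 (f y), ContDiffAt ℝ ∞ Φ v) : SmoothNear E (fun y => Φ (f y)) y := by
  filter_upwards [h, h.self_of_nhds.continuousAt.eventually hΦ] with y' h1 h2
  exact h2.comp_contMDiffAt h1

variable {B : Type uB} [NormedRing B] [NormedAlgebra ℝ B] [CompleteSpace B] [StarRing B]
  [CStarRing B] [StarModule ℝ B] {x : X}

/-- A regular family of sections on `{y} × ℙ¹` on which the real structure and `φ` act by the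
constants `a` and `b`. -/
structure IsNormal (T : FramedTwistor E B x) (φ : T.Tot → T.Tot) (S : X × P1 → T.Tot) (y : X)
    (a b : (Cx B)ˣ) : Prop where
  reg : ∀ z, T.IsReg S (y, z)
  tau : ∀ z, T.tau (S (y, bar z)) = T.act (S (y, z)) a
  phi : ∀ z, φ (S (y, rot z)) = T.act (S (y, z)) b

variable {T : FramedTwistor E B x} {φ : T.Tot → T.Tot}

theorem FramedTwistor.reg_tau (T : FramedTwistor E B x) {S : X × P1 → T.Tot} {y : X} {z : P1}
    (h : T.IsReg S (y, bar z)) :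
    T.IsReg (fun w => T.tau (S (w.1, bar w.2))) (y, z) := by
  have := T.tau_reg _ _ h
  simpa only [bar_bar] using this

theorem IsSigmaHom.reg_phi (hφ : IsSigmaHom T φ) {S : X × P1 → T.Tot} {y : X} {z : P1}
    (h : T.IsReg S (y, rot z)) : T.IsReg (fun w => φ (S (w.1, rot w.2))) (y, z) := by
  have := hφ.reg h
  simp only [rotY, rot_rot] at this
  exact this

/-- Applying `τ` or `φ` to a section over `{y} × ℙ¹` gives another such section, so the discrepancy
is constant along `ℙ¹`; reading it off at `(1 : 0)` makes it a smooth function of `y`. -/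
theorem IsSigmaHom.isNormal (hφ : IsSigmaHom T φ) {S : X × P1 → T.Tot} {y : X}
    (h : ∀ z, T.IsReg S (y, z)) :
    IsNormal T φ S y
      (T.toTorsor.div (S (y, pt (1, 0))) (T.tau (S (y, bar (pt (1, 0))))))
      (T.toTorsor.div (S (y, pt (1, 0))) (φ (S (y, rot (pt (1, 0)))))) := by
  obtain ⟨a, ha⟩ := (isFibreSection_of_reg h).exists_act
    (isFibreSection_of_reg (S := fun w => T.tau (S (w.1, bar w.2))) fun z => T.reg_tau (h _))
  obtain ⟨b, hb⟩ := (isFibreSection_of_reg h).exists_act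
    (isFibreSection_of_reg (S := fun w => φ (S (w.1, rot w.2))) fun z => hφ.reg_phi (h _))
  refine ⟨h, ?_, ?_⟩
  · rw [Torsor.div_eq_of_act_eq (ha _).symm]
    exact ha
  · rw [Torsor.div_eq_of_act_eq (hb _).symm]
    exact hb

namespace IsNormal

variable {S : X × P1 → T.Tot} {y : X} {a b : (Cx B)ˣ}

/-- This expresses `τ² = 1`; `mul_cartan` and `comm` express `φ² = 1` and `τφ = φτ`. Together they
say that `(a, b)` is a cocycle of `ℤ/2 × ℤ/2`, which `act` changes by a coboundary. -/
theorem mul_conj (h : IsNormal T φ S y a b) : a * Cx.conjU a = 1 := by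
  refine (Torsor.act_left_inj (T := T.toTorsor) (p := S (y, pt (1, 0)))).1 ?_
  have h1 := h.tau (bar (pt (1, 0)))
  rw [bar_bar] at h1
  have h2 := congrArg T.tau h1
  rw [T.tau_tau, T.tau_act, h.tau, ← T.act_mul] at h2
  rw [T.act_one]
  exact h2.symm

theorem act (h : IsNormal T φ S y a b) (hφ : IsSigmaHom T φ) {c : X → (Cx B)ˣ}
    (hc : SmoothNear E (fun y => (c y).val) y) :
    IsNormal T φ (fun w => T.act (S w) (c w.1)) y ((c y)⁻¹ * a * Cx.conjU (c y))
      ((c y)⁻¹ * b * Cx.cartan (c y)) where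
  reg z := (T.reg_act _ _ (h.reg z) _).2 (smoothHolUnits_fst_iff.2 hc)
  tau z := by
    rw [T.tau_act, h.tau, ← T.act_mul, ← T.act_mul, mul_assoc, mul_inv_cancel_left]
  phi z := by
    rw [hφ.act, h.phi, ← T.act_mul, ← T.act_mul, mul_assoc, mul_inv_cancel_left]

variable [ConnectedSpace X]

theorem mul_cartan (h : IsNormal T φ S y a b) (hφ : IsSigmaHom T φ) : b * Cx.cartan b = 1 := by
  refine (Torsor.act_left_inj (T := T.toTorsor) (p := S (y, pt (1, 0)))).1 ?_
  have h1 := h.phi (rot (pt (1, 0)))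
  rw [rot_rot] at h1
  have h2 := congrArg φ h1
  rw [hφ.involutive, hφ.act, h.phi, ← T.act_mul] at h2
  rw [T.act_one]
  exact h2.symm

theorem comm (h : IsNormal T φ S y a b) (hφ : IsSigmaHom T φ) :
    a * Cx.conjU b = b * Cx.cartan a := by
  refine (Torsor.act_left_inj (T := T.toTorsor) (p := S (y, pt (1, 0)))).1 ?_
  set z := pt (1, 0)
  have h1 := congrArg T.tau (h.phi (bar z))
  rw [T.tau_act, h.tau, ← T.act_mul] at h1
  have h2 := h.tau (rot z)
  rw [← rot_bar] at h2
  rw [← hφ.tau, h2, hφ.act, h.phi, ← T.act_mul] at h1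
  exact h1.symm

end IsNormal

theorem Cx.star_conj_of_mul_cartan {b : (Cx B)ˣ} (h : b * Cx.cartan b = 1) :
    star (Cx.conj b.val) = b.val := by
  rw [← Cx.cartan_inv, ← eq_inv_of_mul_eq_one_left h]

/-- First normalisation: the real structure becomes constant. -/
theorem exists_isNormal_tau (hφ : IsSigmaHom T φ) {S : X × P1 → T.Tot} {y₀ : X}
    {a b : X → (Cx B)ˣ} (h : ∀ᶠ y in 𝓝 y₀, IsNormal T φ S y (a y) (b y))
    (ha : SmoothNear E (fun y => (a y).val) y₀) (hb : SmoothNear E (fun y => (b y).val) y₀) :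
    ∃ S' : X × P1 → T.Tot, ∃ b' : X → (Cx B)ˣ, SmoothNear E (fun y => (b' y).val) y₀ ∧
      ∀ᶠ y in 𝓝 y₀, IsNormal T φ S' y (a y₀) (b' y) := by
  -- Averaging over the group of order two: because `a(y) conj a(y) = 1` at all nearby `y`, this `f`
  -- satisfies `a(y) conj(f) = f a(y₀)`. It is `1` at `y₀`, hence invertible nearby.
  set f : X → Cx B := fun y => (1 / 2 : ℝ) • (1 + (a y).val * ((a y₀)⁻¹ : (Cx B)ˣ).val) with hf
  have hfs : SmoothNear E f y₀ :=
    ha.comp_of_eventually (Φ := fun v => (1 / 2 : ℝ) • (1 + v * ((a y₀)⁻¹ : (Cx B)ˣ).val))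
      (.of_forall fun v => contDiffAt_const.smul
        (contDiffAt_const.add (contDiffAt_id.mul contDiffAt_const)))
  have hf1 : f y₀ = 1 := by
    simp only [hf, Units.mul_inv]
    rw [← two_smul ℝ (1 : Cx B), smul_smul]
    norm_num
  have hu : ∀ᶠ y in 𝓝 y₀, (toUnit (f y)).val = f y := by
    filter_upwards [hfs.self_of_nhds.continuousAt.eventually
      (Units.isOpen.mem_nhds (by rw [hf1]; exact isUnit_one))] with y hy using toUnit_val hy
  have hcs : SmoothNear E (fun y => (toUnit (f y)).val) y₀ := hfs.congr hu
  have hcartan : SmoothNear E (fun y => (Cx.cartan (toUnit (f y))).val) y₀ := by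
    simp only [cartan_val_eq]
    refine hcs.comp_of_eventually (Φ := fun v => Cx.transpose (Ring.inverse v)) ?_
    filter_upwards [Units.isOpen.mem_nhds (toUnit (f y₀)).isUnit] with v ⟨u, hu⟩
    rw [← hu]
    exact ((Cx.transpose (B := B)).restrictScalars ℝ).contDiff.contDiffAt.comp _
      (contDiffAt_ringInverse ℝ u)
  have hinv : SmoothNear E (fun y => ((toUnit (f y))⁻¹ : (Cx B)ˣ).val) y₀ := by
    simp only [← Ring.inverse_unit]
    refine hcs.comp_of_eventually ?_
    filter_upwards [Units.isOpen.mem_nhds (toUnit (f y₀)).isUnit] with v ⟨u, hu⟩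
    rw [← hu]
    exact contDiffAt_ringInverse ℝ u
  refine ⟨fun w => T.act (S w) (toUnit (f w.1)),
    fun y => (toUnit (f y))⁻¹ * b y * Cx.cartan (toUnit (f y)), ?_, ?_⟩
  · filter_upwards [hinv, hb, hcartan] with y h1 h2 h3
    rw [contMDiffAt_iff_chart (mem_chart_source E y)] at *
    exact (h1.mul h2).mul h3
  · have h0 := h.self_of_nhds.mul_conj
    filter_upwards [h, hcs.eventually, hu] with y h1 h2 h3
    have h4 := h1.act hφ h2
    have h5 : (toUnit (f y))⁻¹ * a y * Cx.conjU (toUnit (f y)) = a y₀ := by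
      rw [mul_assoc, inv_mul_eq_iff_eq_mul]
      ext1
      have h6 : (a y).val * Cx.conj (a y).val = 1 := congrArg Units.val h1.mul_conj
      have h7 : Cx.conj ((a y₀)⁻¹ : (Cx B)ˣ).val = (a y₀).val := by
        have : Cx.conjU (a y₀)⁻¹ = a y₀ := by
          rw [map_inv]
          exact inv_eq_of_mul_eq_one_left h0
        exact congrArg Units.val this
      have h8 : Cx.conj (f y) =
          (1 / 2 : ℝ) • (1 + Cx.conj (a y).val * Cx.conj ((a y₀)⁻¹ : (Cx B)ˣ).val) := by
        have : f y = (1 / 2 : ℝ) • (1 + (a y).val * ((a y₀)⁻¹ : (Cx B)ˣ).val) := rfl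
        rw [this, ← Cx.conjL_apply, map_smul, Cx.conjL_apply, map_add, map_one, map_mul]
      simp only [Units.val_mul, Cx.conjU_val, h3, h8, h7]
      rw [hf]
      simp only [mul_smul_comm, smul_mul_assoc, mul_add, add_mul, mul_one, one_mul, mul_assoc,
        Units.inv_mul]
      rw [← mul_assoc, h6, one_mul, add_comm]
    rwa [h5] at h4

/-- Second normalisation: both involutions become constant. -/
theorem exists_isNormal_const [ConnectedSpace X] (hφ : IsSigmaHom T φ) {S : X × P1 → T.Tot}
    {y₀ : X} {a : (Cx B)ˣ} {b : X → (Cx B)ˣ} (h : ∀ᶠ y in 𝓝 y₀, IsNormal T φ S y a (b y))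
    (hb : SmoothNear E (fun y => (b y).val) y₀) :
    ∃ S' : X × P1 → T.Tot, ∀ᶠ y in 𝓝 y₀, IsNormal T φ S' y a (b y₀) := by
  obtain ⟨r, hr1, hr2, hr3⟩ := exists_sqrt (A := Cx B)
  -- The correction is the square root `c` of `m`. It makes `b` constant, provided that `b(y₀) (conj
  -- c)^* b(y₀)⁻¹ = c`, and it leaves `a` unchanged, provided that `a conj(c) a⁻¹ = c`. Both
  -- properties hold for `m` by the cocycle relations and pass to its root.
  set m : X → Cx B := fun y => (b y).val * ((b y₀)⁻¹ : (Cx B)ˣ).val with hm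
  have hm1 : m y₀ = 1 := (b y₀).mul_inv
  have hms : SmoothNear E m y₀ :=
    hb.comp_of_eventually (Φ := fun v => v * ((b y₀)⁻¹ : (Cx B)ˣ).val)
      (.of_forall fun v => contDiffAt_id.mul contDiffAt_const)
  have hmc : Filter.Tendsto m (𝓝 y₀) (𝓝 1) := hm1 ▸ hms.self_of_nhds.continuousAt
  have hfs : SmoothNear E (fun y => r (m y)) y₀ := hms.comp_of_eventually (by
    rw [hm1]
    exact hr2.mono fun v hv => hv.1)
  have hu : ∀ᶠ y in 𝓝 y₀, (toUnit (r (m y))).val = r (m y) := by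
    filter_upwards [hfs.self_of_nhds.continuousAt.eventually
      (Units.isOpen.mem_nhds (by change IsUnit (r (m y₀)); rw [hm1, hr1]; exact isUnit_one))] with y hy using toUnit_val hy
  have hcs : SmoothNear E (fun y => (toUnit (r (m y))).val) y₀ := hfs.congr hu
  have hα := eventually_sqrt_fixed hr1 hr2 hr3
    (α := fun v => a.val * Cx.conj v * (a⁻¹ : (Cx B)ˣ).val)
    ((continuous_const.mul (Cx.conjL (B := B)).continuous).mul continuous_const)
    (by simp) (fun v => by simp [mul_assoc])
  have hβ := eventually_sqrt_fixed hr1 hr2 hr3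
    (α := fun v => (b y₀).val * star (Cx.conj v) * ((b y₀)⁻¹ : (Cx B)ˣ).val)
    ((continuous_const.mul (Cx.transpose (B := B)).continuous).mul continuous_const)
    (by simp) (fun v => by simp [mul_assoc])
  have h0 := h.self_of_nhds
  have hb0 := h0.mul_cartan hφ
  have hc0 := h0.comm hφ
  refine ⟨fun w => T.act (S w) (toUnit (r (m w.1))), ?_⟩
  filter_upwards [h, hcs.eventually, hu, hmc.eventually hα, hmc.eventually hβ,
    hmc.eventually hr2] with y h1 h2 h3 h4 h5 h6
  have h7 := h1.act hφ h2
  set u := toUnit (r (m y)) with hu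
  have huu : u * u = b y * (b y₀)⁻¹ := by
    ext1
    rw [Units.val_mul, h3, h6.2, Units.val_mul]
  have e1 : u⁻¹ * a * Cx.conjU u = a := by
    rw [mul_assoc, inv_mul_eq_iff_eq_mul, ← mul_inv_eq_iff_eq_mul]
    ext1
    simp only [Units.val_mul, Cx.conjU_val, h3]
    refine h4 ?_
    have : a * Cx.conjU (b y * (b y₀)⁻¹) * a⁻¹ = b y * (b y₀)⁻¹ := by
      rw [map_mul, ← mul_assoc, h1.comm hφ, map_inv]
      have : (Cx.conjU (b y₀))⁻¹ = (Cx.cartan a)⁻¹ * (b y₀)⁻¹ * a := by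
        rw [← mul_inv_rev, ← hc0, mul_inv_rev, inv_mul_cancel_right]
      rw [this]
      group
    exact congrArg Units.val this
  have e2 : u⁻¹ * b y * Cx.cartan u = b y₀ := by
    have e3 : b y₀ * (Cx.cartan u)⁻¹ * (b y₀)⁻¹ = u := by
      ext1
      simp only [Units.val_mul, Cx.cartan_inv, h3]
      refine h5 ?_
      have e4 := Cx.star_conj_of_mul_cartan (h1.mul_cartan hφ)
      have e5 : star (Cx.conj ((b y₀)⁻¹ : (Cx B)ˣ).val) = ((b y₀)⁻¹ : (Cx B)ˣ).val := by
        rw [← Cx.cartan_val]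
        exact congrArg Units.val (eq_inv_of_mul_eq_one_right hb0)
      simp only [hm, Cx.star_conj_mul, e4, e5, Units.mul_inv_cancel_left]
    have e6 : Cx.cartan u = (b y₀)⁻¹ * u⁻¹ * b y₀ := by
      have : (Cx.cartan u)⁻¹ = (b y₀)⁻¹ * u * b y₀ := by
        have := congrArg (fun v => (b y₀)⁻¹ * v * b y₀) e3
        simpa [mul_assoc] using this
      rw [← inv_inv (Cx.cartan u), this]
      group
    have e7 : b y = u * u * b y₀ := by rw [huu, inv_mul_cancel_right]
    rw [e6, e7]
    group
  rwa [e1, e2] at h7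

/-- Near any point there are sections on which both involutions act by constants. -/
theorem exists_isNormal [ConnectedSpace X] (hφ : IsSigmaHom T φ) (y₀ : X) :
    ∃ S : X × P1 → T.Tot, ∃ a b, ∀ᶠ y in 𝓝 y₀, IsNormal T φ S y a b := by
  obtain ⟨f, hf⟩ := T.fibre_trivial y₀
  obtain ⟨S, hS⟩ := T.exists_extends hf
  have h1 : ∀ᶠ y in 𝓝 y₀, ∀ z, T.IsReg S (y, z) :=
    eventually_forall_P1 fun z => T.reg_nhds _ _ (hS z).1
  have hsm : ∀ g : X × P1 → (Cx B)ˣ, SmoothHolUnits E g (y₀, pt (1, 0)) →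
      SmoothNear E (fun y => (g (y, pt (1, 0))).val) y₀ := by
    intro g hg
    have h2 : ∀ᶠ y in 𝓝 y₀, SmoothHolUnits E g (y, pt (1, 0)) :=
      (continuous_id.prodMk continuous_const).continuousAt.eventually hg.eventually
    exact h2.mono fun y hy => hy.contMDiffAt (by simp)
  have ha := hsm _ (Torsor.reg_div (hS (pt (1, 0))).1 (T.reg_tau (hS (bar (pt (1, 0)))).1))
  have hb := hsm _ (Torsor.reg_div (hS (pt (1, 0))).1 (hφ.reg_phi (hS (rot (pt (1, 0)))).1))
  obtain ⟨S', b', hb', h2⟩ := exists_isNormal_tau hφ (h1.mono fun y hy => hφ.isNormal hy) ha hb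
  obtain ⟨S'', h3⟩ := exists_isNormal_const hφ h2 hb'
  exact ⟨S'', _, _, h3⟩

end NormalForm

/-! ### Descent to a pluriharmonic torsor -/

section Descent

variable {E : Type uE} [NormedAddCommGroup E] [NormedSpace ℂ E]
variable {X : Type uX} [TopologicalSpace X] [ChartedSpace E X] [IsManifold 𝓘(ℝ, E) ∞ X]
  [IsManifold 𝓘(ℂ, E) 1 X]
variable {B : Type uB} [NormedRing B] [NormedAlgebra ℝ B] [CompleteSpace B] [StarRing B]
  [CStarRing B] [StarModule ℝ B] {x : X}

/-- A section on `{y} × ℙ¹` which is fixed by the real structure and by `φ`. -/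
structure IsFixedSection (T : FramedTwistor E B x) (φ : T.Tot → T.Tot) (y : X) (q : P1 → T.Tot) :
    Prop where
  fib : T.toTorsor.IsFibreSection y q
  tau : ∀ z, T.tau (q z) = q (bar z)
  phi : ∀ z, φ (q z) = q (rot z)

variable {T : FramedTwistor E B x} {φ : T.Tot → T.Tot}

theorem IsFixedSection.act {y : X} {q : P1 → T.Tot} (h : IsFixedSection T φ y q)
    (hφ : IsSigmaHom T φ) (u : unitary B) :
    IsFixedSection T φ y fun z => T.act (q z) (unitaryToCx u) where
  fib := h.fib.act _
  tau z := by rw [T.tau_act, h.tau, conjU_unitaryToCx]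
  phi z := by rw [hφ.act, h.phi, cartan_unitaryToCx]

theorem IsFixedSection.exists_unitary {y : X} {q q' : P1 → T.Tot} (h : IsFixedSection T φ y q)
    (h' : IsFixedSection T φ y q') (hφ : IsSigmaHom T φ) :
    ∃ u : unitary B, ∀ z, q' z = T.act (q z) (unitaryToCx u) := by
  obtain ⟨k, hk⟩ := h.fib.exists_act h'.fib
  have h1 : Cx.conjU k = k := by
    have e := h'.tau (pt (1, 0))
    rw [hk, hk, T.tau_act, h.tau] at e
    exact Torsor.act_left_inj.1 e
  have h2 : Cx.cartan k = k := by
    have e := h'.phi (pt (1, 0))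
    rw [hk, hk, hφ.act, h.phi] at e
    exact Torsor.act_left_inj.1 e
  obtain ⟨u, rfl⟩ := exists_unitary_of_fixed h1 h2
  exact ⟨u, hk⟩

theorem isFixedSection_frame (hφ : IsSigmaHom T φ) : IsFixedSection T φ x T.frame :=
  ⟨T.frame_section, T.tau_frame, hφ.frame⟩

/-- Fixed sections correspond to solutions `g` of equations that involve only the constants `a` and
`b`, not the point `y`. -/
theorem IsNormal.isFixedSection_iff {S : X × P1 → T.Tot} {y : X} {a b : (Cx B)ˣ}
    (h : IsNormal T φ S y a b) (hφ : IsSigmaHom T φ) (g : (Cx B)ˣ) :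
    IsFixedSection T φ y (fun z => T.act (S (y, z)) g) ↔
      a * Cx.conjU g = g ∧ b * Cx.cartan g = g := by
  have e1 : ∀ z, T.tau (T.act (S (y, z)) g) = T.act (S (y, bar z)) (a * Cx.conjU g) := fun z => by
    have := h.tau (bar z)
    rw [bar_bar] at this
    rw [T.tau_act, this, T.act_mul]
  have e2 : ∀ z, φ (T.act (S (y, z)) g) = T.act (S (y, rot z)) (b * Cx.cartan g) := fun z => by
    have := h.phi (rot z)
    rw [rot_rot] at this
    rw [hφ.act, this, T.act_mul]
  constructor
  · intro hq
    have h1 := hq.tau (pt (1, 0))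
    have h2 := hq.phi (pt (1, 0))
    rw [e1] at h1
    rw [e2] at h2
    exact ⟨Torsor.act_left_inj.1 h1, Torsor.act_left_inj.1 h2⟩
  · rintro ⟨h1, h2⟩
    exact ⟨(isFibreSection_of_reg h.reg).act g, fun z => by rw [e1, h1], fun z => by rw [e2, h2]⟩

theorem IsFixedSection.exists_of_isNormal {S : X × P1 → T.Tot} {y : X} {a b : (Cx B)ˣ}
    {q : P1 → T.Tot} (hq : IsFixedSection T φ y q) (h : IsNormal T φ S y a b)
    (hφ : IsSigmaHom T φ) : ∃ g, a * Cx.conjU g = g ∧ b * Cx.cartan g = g := by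
  obtain ⟨g, hg⟩ := (isFibreSection_of_reg h.reg).exists_act hq.fib
  refine ⟨g, (h.isFixedSection_iff hφ g).1 ?_⟩
  rwa [← funext hg]

/-- Near any point the equations for `g` are the same for all `y`, so solvability is locally
constant. The frame is a solution over `x`, and `X` is connected. -/
theorem exists_isFixedSection [ConnectedSpace X] (hφ : IsSigmaHom T φ) (y : X) :
    ∃ q, IsFixedSection T φ y q := by
  refine forall_of_locally_constant (P := fun y => ∃ q, IsFixedSection T φ y q) (fun y₀ => ?_)
    ⟨_, isFixedSection_frame hφ⟩ y
  obtain ⟨S, a, b, h⟩ := exists_isNormal hφ y₀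
  refine ⟨_, h, fun y hy y' hy' ⟨q, hq⟩ => ?_⟩
  obtain ⟨g, hg⟩ := hq.exists_of_isNormal hy hφ
  exact ⟨_, (IsNormal.isFixedSection_iff hy' hφ g).2 hg⟩

/-- A solution `g` at `y₀` solves the equations at all nearby points, so a constant translate of a
normal family is fixed. -/
theorem exists_fixed_family [ConnectedSpace X] (hφ : IsSigmaHom T φ) (y₀ : X) :
    ∃ S : X × P1 → T.Tot, ∀ᶠ y in 𝓝 y₀, (∀ z, T.IsReg S (y, z)) ∧
      IsFixedSection T φ y fun z => S (y, z) := by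
  obtain ⟨S, a, b, h⟩ := exists_isNormal hφ y₀
  obtain ⟨q, hq⟩ := exists_isFixedSection hφ y₀
  obtain ⟨g, hg⟩ := hq.exists_of_isNormal h.self_of_nhds hφ
  refine ⟨fun w => T.act (S w) g, h.mono fun y hy => ⟨fun z => ?_, ?_⟩⟩
  · exact (T.reg_act _ _ (hy.reg z) _).2 (smoothHolUnits_const g _)
  · exact (hy.isFixedSection_iff hφ g).2 hg

/-- The points of the descended torsor. -/
def FixedTot (T : FramedTwistor E B x) (φ : T.Tot → T.Tot) : Type (max uX uB) :=
  {p : X × (P1 → T.Tot) // IsFixedSection T φ p.1 p.2}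

/-- The section of `T` given by a family of fixed sections. -/
def evalSec (s : X → FixedTot T φ) (w : X × P1) : T.Tot := (s w.1).1.2 w.2

theorem tau_evalSec (s : X → FixedTot T φ) :
    (fun w : X × P1 => T.tau (evalSec s (w.1, bar w.2))) = evalSec s := by
  funext w
  rw [evalSec, (s w.1).2.tau, bar_bar]
  rfl

theorem phi_evalSec (s : X → FixedTot T φ) : (fun w => φ (evalSec s (rotY w))) = evalSec s := by
  funext w
  change φ ((s w.1).1.2 (rot w.2)) = _
  rw [(s w.1).2.phi, rot_rot]
  rfl

/-- Regular families of fixed sections. -/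
def FixedReg (s : X → FixedTot T φ) (y : X) : Prop :=
  ∀ᶠ y' in 𝓝 y, (s y').1.1 = y' ∧ ∀ z, T.IsReg (evalSec s) (y', z)

theorem FixedReg.reg {s : X → FixedTot T φ} {y : X} (h : FixedReg s y) (z : P1) :
    T.IsReg (evalSec s) (y, z) := h.self_of_nhds.2 z

theorem FixedReg.congr {s s' : X → FixedTot T φ} {y : X} (h : FixedReg s y)
    (e : s =ᶠ[𝓝 y] s') : FixedReg s' y := by
  filter_upwards [h, e.eventuallyEq_nhds] with y' h1 h2
  refine ⟨by rw [← h2.self_of_nhds]; exact h1.1, fun z => T.reg_congr _ _ _ ?_ (h1.2 z)⟩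
  filter_upwards [continuous_fst.continuousAt.eventually h2] with w hw
  rw [evalSec, evalSec, hw]

/-- The action of the unitary group on fixed sections. -/
def fixedAct (hφ : IsSigmaHom T φ) (p : FixedTot T φ) (u : unitary B) : FixedTot T φ :=
  ⟨(p.1.1, fun z => T.act (p.1.2 z) (unitaryToCx u)), p.2.act hφ u⟩

theorem FixedTot.ext {p q : FixedTot T φ} (h1 : p.1.1 = q.1.1) (h2 : ∀ z, p.1.2 z = q.1.2 z) :
    p = q :=
  Subtype.ext (Prod.ext h1 (funext h2))

/-- The torsor of fixed sections. -/
def fixedTorsor [ConnectedSpace X] (hφ : IsSigmaHom T φ) :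
    Torsor X (unitary B) (SmoothUnitary E) where
  Tot := FixedTot T φ
  proj p := p.1.1
  act := fixedAct hφ
  act_one p := FixedTot.ext rfl fun z => by
    change T.act _ (unitaryToCx 1) = _
    rw [map_one, T.act_one]
  act_mul p u v := FixedTot.ext rfl fun z => by
    change T.act _ (unitaryToCx (u * v)) = T.act (T.act _ _) _
    rw [map_mul, T.act_mul]
  proj_act _ _ := rfl
  existsUnique_act p q h := by
    have hq := q.2
    rw [← h] at hq
    obtain ⟨u, hu⟩ := p.2.exists_unitary hq hφ
    refine ⟨u, FixedTot.ext h fun z => (hu z).symm, fun v hv => ?_⟩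
    have e : T.act (p.1.2 (pt (1, 0))) (unitaryToCx v) = q.1.2 (pt (1, 0)) :=
      congrArg (fun r : FixedTot T φ => r.1.2 (pt (1, 0))) hv
    rw [hu] at e
    exact unitaryToCx_injective (Torsor.act_left_inj.1 e)
  IsReg := FixedReg
  reg_exists y₀ := by
    classical
    obtain ⟨S, hS⟩ := exists_fixed_family hφ y₀
    -- The default value, the frame over `x`, is not seen near `y₀`, where `S` consists of fixed
    -- sections.
    let s : X → FixedTot T φ := fun y =>
      if h : IsFixedSection T φ y fun z => S (y, z) then ⟨(y, fun z => S (y, z)), h⟩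
      else ⟨(x, T.frame), isFixedSection_frame hφ⟩
    have hs : ∀ y, (IsFixedSection T φ y fun z => S (y, z)) → (s y).1.1 = y ∧
        ∀ z, evalSec s (y, z) = S (y, z) := fun y hy => by
      have : s y = ⟨(y, fun z => S (y, z)), hy⟩ := dif_pos hy
      exact ⟨by rw [this], fun z => by rw [evalSec, this]⟩
    refine ⟨s, ?_⟩
    filter_upwards [hS, hS.eventually_nhds] with y h1 h2
    refine ⟨(hs y h1.2).1, fun z => T.reg_congr _ _ _ ?_ (h1.1 z)⟩
    filter_upwards [continuous_fst.continuousAt.eventually h2] with w hw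
    exact ((hs w.1 hw.2).2 w.2).symm
  reg_proj s y h := h.self_of_nhds.1
  reg_nhds s y h := eventually_eventually_nhds.2 h
  reg_congr s s' y e h := h.congr e
  reg_act s y h u := by
    have key : ∀ y', (∀ z, T.IsReg (evalSec s) (y', z)) → ∀ z,
        (T.IsReg (evalSec fun y => fixedAct hφ (s y) (u y)) (y', z) ↔ SmoothUnitary E u y') := by
      intro y' h' z
      rw [← smoothHolUnits_unitary_iff (z := z)]
      exact T.reg_act _ _ (h' z) _
    constructor
    · intro h'
      exact (key y h.self_of_nhds.2 (pt (1, 0))).1 (h'.reg _)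
    · intro h'
      filter_upwards [h, SmoothNear.eventually h'] with y' h1 h2
      exact ⟨h1.1, fun z => (key y' h1.2 z).2 h2⟩

/-- The connection of the descended torsor. -/
def fixedConn (s : X → FixedTot T φ) (y : X) : E →L[ℝ] B :=
  Cx.reL.comp (T.conn (evalSec s) y (1, 0))

/-- Over a whole projective line the form is a global section of `𝒪(1)`, hence linear in `(u, v)`.
-/
theorem FramedTwistor.conn_linear (T : FramedTwistor E B x) {S : X × P1 → T.Tot} {y : X}
    (h : ∀ z, T.IsReg S (y, z)) {c : ℂ × ℂ} (hc : c ≠ 0) :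
    T.conn S y c = c.1 • T.conn S y (1, 0) + c.2 • T.conn S y (0, 1) :=
  homogeneous_one_linear (fun c hc => T.conn_hol S y c hc (h _))
    (fun c hc l hl => T.conn_smul S y c hc (h _) l hl) hc

/-- Conjugation fixes `(1, 0)` and the section is fixed by `τ`, so the coefficient of `u` is real.
-/
theorem ofBase_fixedConn {s : X → FixedTot T φ} {y : X} (h : FixedReg s y) (ξ : E) :
    Cx.ofBase (fixedConn s y ξ) = T.conn (evalSec s) y (1, 0) ξ := by
  have e := T.tau_conn (evalSec s) y (1, 0) (by simp) (h.reg _) ξ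
  rw [tau_evalSec] at e
  have e1 : cc (1, 0) = (1, 0) := by simp [cc]
  rw [e1] at e
  exact (Cx.conj_eq_iff.1 e.symm).symm

/-- Since `rotL` takes `(0, 1)` to `(1, 0)`, invariance under `φ` expresses the coefficient of `v`
as `sigmaForm` of that of `u`, which is the form of `Dᶜ`. -/
theorem conn_evalSec (hφ : IsSigmaHom T φ) {s : X → FixedTot T φ} {y : X} (h : FixedReg s y)
    {c : ℂ × ℂ} (hc : c ≠ 0) : T.conn (evalSec s) y c = extForm (fixedConn s) c y := by
  ext1 ξ
  rw [extForm_apply, T.conn_linear h.self_of_nhds.2 hc, ofBase_fixedConn h]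
  have e := hφ.conn (c := (0, 1)) (by simp) (h.reg _)
  rw [phi_evalSec] at e
  have e1 : rotL (0, 1) = ((1, 0) : ℂ × ℂ) := by simp [rotL_apply]
  have e2 : T.conn (evalSec s) y (0, 1) ξ = Cx.ofBase (connC (fixedConn s) y ξ) := by
    rw [← e, e1, sigmaForm_apply, ← ofBase_fixedConn h, connC_apply, Cx.conj_ofBase]
    ext <;> simp
  rw [← e2]
  rfl

theorem contDiffAt_fixedConn {s : X → FixedTot T φ} {y : X} (h : FixedReg s y) :
    ContDiffAt ℝ ∞ (localForm y (fixedConn s)) (chartAt E y y) := by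
  have e : localForm y (fixedConn s) = fun e => (Cx.reL (B := B)).comp
      (localForm y (fun y' => T.conn (evalSec s) y' (1, 0)) e) := rfl
  rw [e]
  exact contDiffAt_const.clm_comp (localForm_conn_contDiffAt T (by simp) (h.reg _))

theorem fixedConn_congr {s s' : X → FixedTot T φ} {y : X} (e : s =ᶠ[𝓝 y] s') :
    fixedConn s y = fixedConn s' y := by
  have e1 : evalSec s =ᶠ[𝓝 (y, pt (1, 0))] evalSec s' := by
    filter_upwards [continuous_fst.continuousAt.eventually e] with w hw
    rw [evalSec, evalSec, hw]
  rw [fixedConn, fixedConn, T.conn_congr _ _ _ _ (by simp) e1]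

theorem fixedConn_act (hφ : IsSigmaHom T φ) {s : X → FixedTot T φ} {y : X} (h : FixedReg s y)
    {u : X → unitary B} (hu : SmoothUnitary E u y) (ξ : E) :
    fixedConn (fun y' => fixedAct hφ (s y') (u y')) y ξ =
      star (u y : B) * fixedConn s y ξ * (u y : B) +
        star (u y : B) * dFun (fun y' => (u y' : B)) y ξ := by
  have e1 : ∀ ξ : E, dFun (fun y' => (unitaryToCx (u y')).val) y ξ =
      Cx.ofBase (dFun (fun y' => (u y' : B)) y ξ) := dFun_clm Cx.ofBaseL hu.self_of_nhds
  have e2 := T.conn_act (evalSec s) y (1, 0) (by simp) (FixedReg.reg h _)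
    (fun w => unitaryToCx (u w.1)) (smoothHolUnits_unitary_iff.2 hu) ξ
  have e3 := congrArg Cx.re e2
  simp only [unitaryToCx_inv_val, unitaryToCx_val, one_smul, zero_smul, add_zero] at e3
  rw [show dFun (fun y' => Cx.ofBase (u y' : B)) y ξ = _ from e1 ξ] at e3
  refine e3.trans ?_
  simp only [Cx.add_re, Cx.mul_re, Cx.ofBase_re, Cx.ofBase_im, zero_mul, mul_zero, sub_zero]
  rfl

theorem flat_fixedConn (hφ : IsSigmaHom T φ) {s : X → FixedTot T φ} {y : X} (h : FixedReg s y) :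
    (∀ ξ η, dForm (fixedConn s) y ξ η + wedge (fixedConn s y) (fixedConn s y) ξ η = 0) ∧
      ∀ ξ η, dForm (connC (fixedConn s)) y ξ η +
        wedge (fixedConn s y) (connC (fixedConn s) y) ξ η +
        (dcForm (fixedConn s) y ξ η + wedge (connC (fixedConn s) y) (fixedConn s y) ξ η) = 0 := by
  refine of_flat_extForm ((contDiffAt_fixedConn h).differentiableAt (by simp))
    fun c hc ξ η => ?_
  -- The identity with `u a + v aᶜ` is needed on a neighbourhood of `y`, because the curvature
  -- differentiates it.
  have e : (fun y' => T.conn (evalSec s) y' c) =ᶠ[𝓝 y] extForm (fixedConn s) c :=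
    (eventually_eventually_nhds.2 h).mono fun y' hy' => conn_evalSec hφ hy' hc
  rw [← dForm_congr e, ← dcForm_congr e, ← e.self_of_nhds]
  exact T.flat _ _ c hc (h.reg _) ξ η

/-- The framed pluriharmonic torsor of fixed sections. -/
def descent [ConnectedSpace X] (hφ : IsSigmaHom T φ) : FramedPluriharmonic E B x where
  toTorsor := fixedTorsor hφ
  conn := fixedConn
  conn_congr s s' y e := fixedConn_congr e
  conn_smooth s y h := contDiffAt_fixedConn h
  conn_act s y h u hu ξ := fixedConn_act hφ h hu ξ
  flat s y h := (flat_fixedConn hφ h).1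
  pluriharmonic s y h := (flat_fixedConn hφ h).2
  frame := ⟨(x, T.frame), isFixedSection_frame hφ⟩
  proj_frame := rfl

theorem isTwistorOf_descent [ConnectedSpace X] (hφ : IsSigmaHom T φ) :
    IsTwistorOf (descent hφ) T :=
  ⟨fun p z => p.1.2 z, fun p z => p.2.fib.proj z, fun p u z => rfl,
    fun s y h z => FixedReg.reg h z, fun p z => p.2.tau z,
    fun s y h c hc ξ => congrArg (fun L : E →L[ℝ] Cx B => L ξ) (conn_evalSec hφ h hc),
    fun z => rfl⟩

end Descent

/-! ### The bijection -/

section Bijection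

variable {E : Type uE} [NormedAddCommGroup E] [NormedSpace ℂ E]
variable {X : Type uX} [TopologicalSpace X] [ChartedSpace E X] [IsManifold 𝓘(ℝ, E) ∞ X]
  [IsManifold 𝓘(ℂ, E) 1 X]
variable {B : Type uB} [NormedRing B] [NormedAlgebra ℝ B] [CompleteSpace B] [StarRing B]
  [CStarRing B] [StarModule ℝ B] {x : X}

/-- Twistor torsors of `P` are unique up to isomorphism, and the property passes along isomorphisms;
hence the relation `IsTwistorOf` determines a map on isomorphism classes. -/
theorem isTwistorOf_iff_mk_eq {P : FramedPluriharmonic E B x} {T : FramedTwistor E B x} :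
    IsTwistorOf P T ↔ (Quotient.mk _ P.extension : RT E B x) = Quotient.mk _ T := by
  obtain ⟨ι, hι⟩ := isTwistorOf_iff.1 (FramedPluriharmonic.isTwistorOf_extension (P := P))
  refine ⟨fun h => ?_, fun h => ?_⟩
  · obtain ⟨κ, hκ⟩ := isTwistorOf_iff.1 h
    exact Quotient.sound (hι.iso hκ)
  · obtain ⟨φ, hφ, hτ⟩ := FramedTwistor.Iso.exists_hom (Quotient.exact h)
    exact isTwistorOf_iff.2 ⟨_, hι.comp_iso hφ hτ⟩

/-- The map sending a pluriharmonic torsor to its twistor torsor, on isomorphism classes. -/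
def twistorMap : RJ E B x → RT E B x :=
  Quotient.lift (fun P => Quotient.mk _ P.extension) fun P Q e => by
    obtain ⟨ι, hι⟩ := isTwistorOf_iff.1 (FramedPluriharmonic.isTwistorOf_extension (P := Q))
    exact isTwistorOf_iff_mk_eq.1 (hι.of_iso e)

theorem sigma_twistorMap (r : RJ E B x) : sigma (twistorMap r) = twistorMap r := by
  induction r using Quotient.inductionOn with | h P => ?_
  obtain ⟨ι, hι⟩ := isTwistorOf_iff.1 (FramedPluriharmonic.isTwistorOf_extension (P := P))
  exact (Quotient.sound (hι.iso hι.sigma)).symm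

variable [ConnectedSpace X]

theorem twistorMap_injective : Function.Injective (twistorMap (E := E) (B := B) (x := x)) := by
  intro r r' h
  induction r using Quotient.inductionOn with | h P => ?_
  induction r' using Quotient.inductionOn with | h Q => ?_
  obtain ⟨κ, hκ⟩ := isTwistorOf_iff.1 (FramedPluriharmonic.isTwistorOf_extension (P := Q))
  obtain ⟨ι, hι⟩ := isTwistorOf_iff.1 (isTwistorOf_iff_mk_eq.2 h)
  exact Quotient.sound (hι.iso_of_isExt hκ)

theorem exists_twistorMap_eq {t : RT E B x} (h : sigma t = t) : ∃ r, twistorMap r = t := by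
  induction t using Quotient.inductionOn with | h T => ?_
  -- Equality of classes supplies a morphism `T → σT` compatible with the real structures, which is
  -- all that the descent uses.
  obtain ⟨φ, hφ, hτ⟩ := FramedTwistor.Iso.exists_hom (Quotient.exact h.symm)
  exact ⟨Quotient.mk _ (descent ⟨hφ, hτ⟩), isTwistorOf_iff_mk_eq.1 (isTwistorOf_descent ⟨hφ, hτ⟩)⟩

/-- The `σ`-invariant framed twistor torsors are the framed pluriharmonic torsors. -/
def twistorEquiv : RJ E B x ≃ {t : RT E B x // sigma t = t} :=
  Equiv.ofBijective (fun r => ⟨twistorMap r, sigma_twistorMap r⟩)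
    ⟨fun _ _ h => twistorMap_injective (congrArg Subtype.val h),
      fun t => (exists_twistorMap_eq t.2).imp fun _ h => Subtype.ext h⟩

end Bijection

end Twistor

end

theorem mainTheorem12
    {E : Type*} [NormedAddCommGroup E] [NormedSpace ℂ E] [FiniteDimensional ℂ E]
    {X : Type*} [TopologicalSpace X] [T2Space X] [ConnectedSpace X] [ChartedSpace E X]
    [IsManifold 𝓘(ℂ, E) ω X] (x : X)
    (B : Type*) [NormedRing B] [NormedAlgebra ℝ B] [CompleteSpace B] [StarRing B] [CStarRing B]
    [StarModule ℝ B] (hB : ∀ b : B, IsUnit (1 + star b * b)) :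
    ∃ Ψ : Twistor.RJ E B x ≃ {t : Twistor.RT E B x // Twistor.sigma t = t},
      ∀ (P : Twistor.FramedPluriharmonic E B x) (T : Twistor.FramedTwistor E B x),
        Twistor.IsTwistorOf P T ↔ (Ψ (Quotient.mk _ P)).1 = Quotient.mk _ T := by
  have := Twistor.isManifold_real (E := E) (X := X)
  have : IsManifold 𝓘(ℂ, E) 1 X := IsManifold.of_le (n := ω) le_top
  exact ⟨Twistor.twistorEquiv, fun P T => Twistor.isTwistorOf_iff_mk_eq⟩
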